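/- **Point-line problems.** A point-line problem in three views consists of $p$ points and $l$ lines in space, an incidence relation $\mathcal I\subset\{1,\dots,p\}\times\{1,\dots,l\}$, and, for each view $v\in\{1,2,3\}$, sets $\mathcal P_v$, $\mathcal L_v$ of observed points and lines. It is assumed that $\mathcal I$ is realizable by distinct points and distinct lines in $\mathbb R^3$ and contains every incidence it implies, and that a view observing two lines that meet according to $\mathcal I$ observes their common point. It is a *PL1P* if every line is incident to at most one point; a *pin* of a point is a line incident to it. PL1Ps are considered up to renumbering points and lines. Let $\mathcal X$ be the variety of all $(X,L)\in(\mathbb P^3_{\mathbb C})^p\times(\mathbb G_{1,3})^l$ with $X_i\in L_j$ for $(i,j)\in\mathcal I$; let $\mathcal C$ be the variety of camera triples $P_v=[R_v\mid t_v]$, $R_v\in\mathrm{SO}(3,\mathbb C)$, $t_v\in\mathbb C^3$, with $R_1=I$, $t_1=0$ and first coordinate of $t_2$ equal to $1$; let $\mathcal Y$ be the variety of triples of plane arrangements of the observed points and lines satisfying the incidences in $\mathcal I$; and let $\Phi:\mathcal X\times\mathcal C\dashrightarrow\mathcal Y$ be the joint camera map. "Generic" means on a dense Zariski-open subset. The problem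 is *minimal* (resp. *camera-minimal*) if for generic $y\in\mathcal Y$ the fibre $\Phi^{-1}(y)$ is nonempty and is finite (resp. its projection to $\mathcal C$ is finite). The cardinality of this projection for generic $y$ is the *camera-degree*. **Reduction.** Forgetting some points and lines (in space and in the views) yields a smaller PL1P with data $\mathcal X',\mathcal Y',\Phi'$ and projections $\Pi:\mathcal X\times\mathcal C\to\mathcal X'\times\mathcal C$, $\pi:\mathcal Y\to\mathcal Y'$. The PL1P is *reducible* to the smaller one if for each forgotten point at most one of its pins is kept, and for generic $S'=((X',L'),P)\in\mathcal X'\times\mathcal C$ and generic $y\in\pi^{-1}(\Phi'(S'))$ there is $(X,L)\in\mathcal X$ with $\Phi((X,L),P)=y$ and $\Pi((X,L),P)=S'$. It is *reduced* if it is not reducible to a PL1P obtained by forgetting at least one point or line. **Views of features.** In what follows $a,b,c$ are the three views in any order. (A) a point with exactly one pin: $a,b$ see the point, only $c$ sees the pin. (B) a point with exactly one pin: $a,b$ see the point, $a,c$ see the pin. (C$_0$), (C$_1$), (C$_2$) a point with exactly two pins: only $a$ sees the point; $b$ sees the first pin, $c$ the second pin; in addition $a$ sees none, exactly the first, or both of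 the pins, respectively. (In each case nothing else is seen of the point and its pins.) A *terminal* PL1P is a reduced camera-minimal one with no point viewed as in (B), (C$_1$) or (C$_2$). Two PL1Ps are *label-equivalent* if they agree up to relabeling the views. A *swap* changes a point of type (B) by letting $b$ instead of $a$ observe the pin; two PL1Ps are *swap&label-equivalent* if one can be transformed into the other by relabelings of the views and swaps. A *lift* of a PL1P is obtained by any number of the replacements (A)$\mapsto$(B) ($a$, or alternatively $b$, also observes the pin), (C$_0$)$\mapsto$(C$_2$), (C$_1$)$\mapsto$(C$_2$). **Corollary 2.** There is a bijection between the swap&label-equivalence classes of reduced minimal PL1Ps in three views and the label-equivalence classes of terminal camera-minimal PL1Ps in three views, under which the class of $D$ corresponds to the class of $T$ if and only if $D$ is swap&label-equivalent to a lift of $T$. Corresponding problems have a well-defined camera-degree, and their camera-degrees are equal. -/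

import Mathlib

open scoped LinearAlgebra.Projectivization

namespace PointLine

/-! ### Projective points and lines, arrangements, Zariski-generic properties -/

/-- The points of the complex projective space of lines through the origin of `ℂ ^ d`
(so `d = 4` is projective 3-space and `d = 3` is the projective plane). -/
abbrev ProjPoint (d : ℕ) : Type := ℙ ℂ (Fin d → ℂ)

/-- The projective lines of that space: the Grassmannian of planes in `ℂ ^ d`. -/
def ProjLine (d : ℕ) : Type :=
  {W : Submodule ℂ (Fin d → ℂ) // Module.finrank ℂ W = 2}

/-- Incidence of a projective point and a projective line. -/
def OnLine {d : ℕ} (x : ProjPoint d) (ℓ : ProjLine d) : Prop := x.submodule ≤ ℓ.1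

/-- A family of points indexed by `ι` and of lines indexed by `κ`. -/
structure Arrangement (ι κ : Type) (d : ℕ) where
  pt : ι → ProjPoint d
  ln : κ → ProjLine d

/-- Homogeneous coordinates of an arrangement: one vector per point, two vectors per line. -/
abbrev ArrCoord (ι κ : Type) (d : ℕ) : Type := (ι × Fin d) ⊕ (κ × Fin 2 × Fin d)

/-- `a` is a choice of homogeneous coordinates for `A`: its vectors span the points and the lines
of `A` (dimensions force the vectors to be nonzero, and independent in the case of a line). -/
def Arrangement.HasCoords {ι κ : Type} {d : ℕ} (A : Arrangement ι κ d)
    (a : ArrCoord ι κ d → ℂ) : Prop :=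
  (∀ i, (A.pt i).submodule = Submodule.span ℂ {fun k => a (Sum.inl (i, k))}) ∧
  ∀ j, (A.ln j).1 = Submodule.span ℂ (Set.range fun (r : Fin 2) (k : Fin d) => a (Sum.inr (j, r, k)))

/-- `Q` holds for a generic element of `V`, i.e. on a Zariski-open and Zariski-dense subset of `V`.
Here `rep t a` says that the vector `a` is a coordinate vector of `t`; a property holds on a dense
open subset of `V` iff it holds on a dense open subset of the cone of coordinate vectors of
elements of `V`, and every dense open subset contains a dense one of the form `f ≠ 0`.
The first conjunct says that the set `f ≠ 0` is dense. -/
def GenericOn {σ T : Type} (rep : T → (σ → ℂ) → Prop) (V : Set T) (Q : T → Prop) : Prop :=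
  ∃ f : MvPolynomial σ ℂ,
    (∀ g : MvPolynomial σ ℂ,
      (∀ t ∈ V, ∀ a, rep t a → MvPolynomial.eval a f ≠ 0 → MvPolynomial.eval a g = 0) →
      ∀ t ∈ V, ∀ a, rep t a → MvPolynomial.eval a g = 0) ∧
    ∀ t ∈ V, ∀ a, rep t a → MvPolynomial.eval a f ≠ 0 → Q t

/-! ### Cameras -/

/-- Three camera matrices. -/
abbrev Cameras : Type := Fin 3 → Matrix (Fin 3) (Fin 4) ℂ

/-- The left `3 × 3` block of a camera matrix. -/
def rot (M : Matrix (Fin 3) (Fin 4) ℂ) : Matrix (Fin 3) (Fin 3) ℂ :=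
  M.submatrix id Fin.castSucc

/-- The last column of a camera matrix. -/
def trans (M : Matrix (Fin 3) (Fin 4) ℂ) : Fin 3 → ℂ := fun r => M r 3

/-- The (complexified) variety of normalized calibrated camera configurations:
`P v = [R v | t v]` with `R v` in `SO(3)`, `P 0 = [I | 0]`, first coordinate of `t 1` equal to `1`. -/
def camVariety : Set Cameras :=
  {P | (∀ v, rot (P v) * (rot (P v)).transpose = 1 ∧ (rot (P v)).det = 1) ∧
    rot (P 0) = 1 ∧ trans (P 0) = 0 ∧ trans (P 1) 0 = 1}

/-! ### Point-line problems in three views -/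

/-- An arrangement of distinct points and distinct lines in real 3-space that satisfies
the incidences in `inc`. -/
structure Realization {ι κ : Type} (inc : Set (ι × κ)) where
  pt : ι → EuclideanSpace ℝ (Fin 3)
  ln : κ → AffineSubspace ℝ (EuclideanSpace ℝ (Fin 3))
  finrank_ln : ∀ j, Module.finrank ℝ (ln j).direction = 1
  pt_injective : Function.Injective pt
  ln_injective : Function.Injective ln
  incident : ∀ i j, (i, j) ∈ inc → pt i ∈ ln j

/-- A point-line problem in three views, with points indexed by `ι` and lines indexed by `κ`. -/
structure Problem (ι κ : Type) where
  /-- the incidences -/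
  inc : Set (ι × κ)
  /-- the points observed by each view -/
  obsPt : Fin 3 → Set ι
  /-- the lines observed by each view -/
  obsLn : Fin 3 → Set κ
  realizable : Nonempty (Realization inc)
  complete : ∀ i j, (i, j) ∉ inc → ∃ R : Realization inc, R.pt i ∉ R.ln j
  observed : ∀ v i j k, j ≠ k → (i, j) ∈ inc → (i, k) ∈ inc →
    j ∈ obsLn v → k ∈ obsLn v → i ∈ obsPt v

/-- Forgetting points and lines in a real arrangement. -/
def Realization.restrict {ι κ : Type} {inc : Set (ι × κ)} (R : Realization inc)
    (A : Set ι) (B : Set κ) :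
    Realization {q : A × B | ((q.1 : ι), (q.2 : κ)) ∈ inc} where
  pt i := R.pt i
  ln j := R.ln j
  finrank_ln j := R.finrank_ln j
  pt_injective _ _ h := Subtype.ext (R.pt_injective h)
  ln_injective _ _ h := Subtype.ext (R.ln_injective h)
  incident i j h := R.incident i j h

namespace Problem

variable {ι κ : Type}

/-- The variety of point-line arrangements in projective 3-space. -/
def spaceVariety (D : Problem ι κ) : Set (Arrangement ι κ 4) :=
  {A | ∀ i j, (i, j) ∈ D.inc → OnLine (A.pt i) (A.ln j)}

/-- The pairs (view, point) such that the view observes the point. -/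
abbrev ObsPt (D : Problem ι κ) : Type := {q : Fin 3 × ι // q.2 ∈ D.obsPt q.1}

/-- The pairs (view, line) such that the view observes the line. -/
abbrev ObsLn (D : Problem ι κ) : Type := {q : Fin 3 × κ // q.2 ∈ D.obsLn q.1}

/-- A family of points and lines in the three image planes, as observed. -/
abbrev Image (D : Problem ι κ) : Type := Arrangement D.ObsPt D.ObsLn 3

/-- The image variety. -/
def imageVariety (D : Problem ι κ) : Set D.Image :=
  {y | ∀ v i j (hi : i ∈ D.obsPt v) (hj : j ∈ D.obsLn v), (i, j) ∈ D.inc →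
    OnLine (y.pt ⟨(v, i), hi⟩) (y.ln ⟨(v, j), hj⟩)}

/-- `y` is the joint image of the arrangement `A` under the cameras `P`. By dimension count this
forces the rational joint camera map to be defined at `(A, P)`: no observed point is the centre of
a camera observing it, and no observed line passes through the centre of a camera observing it. -/
def IsJointImage (D : Problem ι κ) (A : Arrangement ι κ 4) (P : Cameras) (y : D.Image) : Prop :=
  (∀ q : D.ObsPt, (A.pt q.1.2).submodule.map (P q.1.1).mulVecLin = (y.pt q).submodule) ∧
  ∀ q : D.ObsLn, (A.ln q.1.2).1.map (P q.1.1).mulVecLin = (y.ln q).1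

/-- The fibre of the joint camera map over `y`. -/
def solutions (D : Problem ι κ) (y : D.Image) : Set (Arrangement ι κ 4 × Cameras) :=
  {S | S.1 ∈ D.spaceVariety ∧ S.2 ∈ camVariety ∧ D.IsJointImage S.1 S.2 y}

/-- The camera configurations occurring in the fibre of the joint camera map over `y`. -/
def cameraSolutions (D : Problem ι κ) (y : D.Image) : Set Cameras :=
  Prod.snd '' D.solutions y

/-- `Q` holds for a generic joint image. -/
def GenericImage (D : Problem ι κ) (Q : D.Image → Prop) : Prop :=
  GenericOn Arrangement.HasCoords D.imageVariety Q

/-- The joint camera map is dominant. -/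
def IsDominant (D : Problem ι κ) : Prop :=
  D.GenericImage fun y => (D.solutions y).Nonempty

/-- A problem is minimal if a generic joint image has a nonzero finite number of solutions. -/
def IsMinimal (D : Problem ι κ) : Prop :=
  D.IsDominant ∧ D.GenericImage fun y => (D.solutions y).Finite

/-- A problem is camera-minimal if a generic joint image has a nonzero finite number of
possible camera configurations. -/
def IsCameraMinimal (D : Problem ι κ) : Prop :=
  D.IsDominant ∧ D.GenericImage fun y => (D.cameraSolutions y).Finite

/-- The camera-degree of the problem is `d`. -/
def HasCameraDegree (D : Problem ι κ) (d : ℕ) : Prop :=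
  D.GenericImage fun y => (D.cameraSolutions y).encard = d

/-! ### Reduction -/

/-- The problem obtained by forgetting the points outside `A` and the lines outside `B`. -/
def restrict (D : Problem ι κ) (A : Set ι) (B : Set κ) : Problem A B where
  inc := {q | ((q.1 : ι), (q.2 : κ)) ∈ D.inc}
  obsPt v := {i | (i : ι) ∈ D.obsPt v}
  obsLn v := {j | (j : κ) ∈ D.obsLn v}
  realizable := D.realizable.map fun R => R.restrict A B
  complete i j h := by
    obtain ⟨R, hR⟩ := D.complete i j h
    exact ⟨R.restrict A B, hR⟩
  observed v i j k hjk h1 h2 h3 h4 :=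
    D.observed v i j k (fun h => hjk (Subtype.ext h)) h1 h2 h3 h4

/-- The forgetting map on arrangements in space. -/
def forgetSpace (A : Set ι) (B : Set κ) (X : Arrangement ι κ 4) : Arrangement A B 4 where
  pt i := X.pt i
  ln j := X.ln j

/-- The forgetting map on joint images. -/
def forgetImage (D : Problem ι κ) (A : Set ι) (B : Set κ) (y : D.Image) :
    (D.restrict A B).Image where
  pt q := y.pt ⟨(q.1.1, (q.1.2 : ι)), q.2⟩
  ln q := y.ln ⟨(q.1.1, (q.1.2 : κ)), q.2⟩

/-- Coordinates of a pair consisting of an arrangement in space and three cameras. -/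
def SolutionCoords {ι κ : Type} (S : Arrangement ι κ 4 × Cameras)
    (a : ArrCoord ι κ 4 ⊕ (Fin 3 × Fin 3 × Fin 4) → ℂ) : Prop :=
  S.1.HasCoords (fun k => a (Sum.inl k)) ∧ ∀ v r k, S.2 v r k = a (Sum.inr (v, r, k))

/-- `D` is reducible to the problem that keeps exactly the points in `A` and the lines in `B`:
at most one line through each forgotten point is kept, and a generic solution of the smaller
problem lifts to a solution of `D` for generic input images. -/
def ReducibleTo (D : Problem ι κ) (A : Set ι) (B : Set κ) : Prop :=
  (∀ i ∉ A, ∀ j ∈ B, ∀ k ∈ B, (i, j) ∈ D.inc → (i, k) ∈ D.inc → j = k) ∧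
  GenericOn SolutionCoords ((D.restrict A B).spaceVariety ×ˢ camVariety) fun S =>
    ∀ z : (D.restrict A B).Image, (D.restrict A B).IsJointImage S.1 S.2 z →
      GenericOn Arrangement.HasCoords {y | y ∈ D.imageVariety ∧ D.forgetImage A B y = z} fun y =>
        ∃ X ∈ D.spaceVariety, D.IsJointImage X S.2 y ∧ forgetSpace A B X = S.1

/-- A problem is reduced if it is not reducible to another one. -/
def IsReduced (D : Problem ι κ) : Prop :=
  ∀ A B, D.ReducibleTo A B → A = Set.univ ∧ B = Set.univ

end Problem

/-! ### Problems in which every line contains at most one point -/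

/-- A PL1P in three views: a point-line problem with finitely many (numbered) points and lines
in which each line is incident to at most one point. -/
structure PL1P where
  p : ℕ
  l : ℕ
  prob : Problem (Fin p) (Fin l)
  one : ∀ j i i', (i, j) ∈ prob.inc → (i', j) ∈ prob.inc → i = i'

namespace PL1P

/-- The pins of a point. -/
def pins (D : PL1P) (i : Fin D.p) : Set (Fin D.l) := {j | (i, j) ∈ D.prob.inc}

/-- The views that observe a point. -/
def ptViews (D : PL1P) (i : Fin D.p) : Set (Fin 3) := {v | i ∈ D.prob.obsPt v}

/-- The views that observe a line. -/
def lnViews (D : PL1P) (j : Fin D.l) : Set (Fin 3) := {v | j ∈ D.prob.obsLn v}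

/-- The point `i` has exactly one pin, namely `j`; the point is observed exactly by the views in
`U` and the pin exactly by the views in `V`. -/
def OnePin (D : PL1P) (i : Fin D.p) (j : Fin D.l) (U V : Set (Fin 3)) : Prop :=
  D.pins i = {j} ∧ D.ptViews i = U ∧ D.lnViews j = V

/-- The point `i` has exactly two pins, namely `j` and `k`; the point is observed exactly by the
views in `U`, and the pins exactly by the views in `V` and `W`, respectively. -/
def TwoPins (D : PL1P) (i : Fin D.p) (j k : Fin D.l) (U V W : Set (Fin 3)) : Prop :=
  j ≠ k ∧ D.pins i = {j, k} ∧ D.ptViews i = U ∧ D.lnViews j = V ∧ D.lnViews k = W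

/-- The three views in some order. -/
def ViewOrder (a b c : Fin 3) : Prop := a ≠ b ∧ a ≠ c ∧ b ≠ c

/-- A renumbering of points and lines and a relabeling `τ` of views that respects the incidences
and the observed points (observed lines are not yet compared). -/
structure Matching (D E : PL1P) (τ : Equiv.Perm (Fin 3)) where
  pt : Fin D.p ≃ Fin E.p
  ln : Fin D.l ≃ Fin E.l
  inc_iff : ∀ i j, (i, j) ∈ D.prob.inc ↔ (pt i, ln j) ∈ E.prob.inc
  obsPt_iff : ∀ v i, i ∈ D.prob.obsPt v ↔ pt i ∈ E.prob.obsPt (τ v)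

/-- Two problems are label-equivalent if they are the same up to relabeling the views
(and renumbering the points and the lines). -/
def LabelEquiv (D E : PL1P) : Prop :=
  ∃ (τ : Equiv.Perm (Fin 3)) (M : Matching D E τ),
    ∀ v j, j ∈ D.prob.obsLn v ↔ M.ln j ∈ E.prob.obsLn (τ v)

theorem LabelEquiv.refl (D : PL1P) : LabelEquiv D D :=
  ⟨1, ⟨Equiv.refl _, Equiv.refl _, fun _ _ => Iff.rfl, fun _ _ => Iff.rfl⟩, fun _ _ => Iff.rfl⟩

theorem LabelEquiv.symm {D E : PL1P} (h : LabelEquiv D E) : LabelEquiv E D := by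
  obtain ⟨τ, M, hM⟩ := h
  refine ⟨τ.symm, ⟨M.pt.symm, M.ln.symm, fun i j => ?_, fun v i => ?_⟩, fun v j => ?_⟩
  · simp [M.inc_iff]
  · simp [M.obsPt_iff]
  · simp [hM]

theorem LabelEquiv.trans {D E F : PL1P} (h : LabelEquiv D E) (h' : LabelEquiv E F) :
    LabelEquiv D F := by
  obtain ⟨τ, M, hM⟩ := h
  obtain ⟨τ', M', hM'⟩ := h'
  refine ⟨τ.trans τ', ⟨M.pt.trans M'.pt, M.ln.trans M'.ln, fun i j => ?_, fun v i => ?_⟩,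
    fun v j => ?_⟩
  · simp [M.inc_iff, M'.inc_iff]
  · simp [M.obsPt_iff, M'.obsPt_iff]
  · simp [hM, hM']

/-- Label-equivalence on all PL1Ps in three views. -/
def labelSetoid : Setoid PL1P :=
  ⟨LabelEquiv, LabelEquiv.refl, LabelEquiv.symm, LabelEquiv.trans⟩

/-- `E` arises from `D` by one swap: for a point with one pin such that view `a` observes both the
point and its pin, view `b` only the point and view `c` only the pin, the roles of the views `a`
and `b` are exchanged. Everything else is unchanged (up to renumbering points and lines). -/
def Swap (D E : PL1P) : Prop :=
  ∃ (M : Matching D E 1) (i : Fin D.p) (j : Fin D.l) (a b c : Fin 3), ViewOrder a b c ∧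
    D.OnePin i j {a, b} {a, c} ∧ E.OnePin (M.pt i) (M.ln j) {a, b} {b, c} ∧
    ∀ k, k ≠ j → E.lnViews (M.ln k) = D.lnViews k

/-- Swap-and-label-equivalence on all PL1Ps in three views: one problem can be transformed into
the other by relabeling the views and applying swaps, any number of times. -/
def swapLabelSetoid : Setoid PL1P :=
  Relation.EqvGen.setoid fun D E => LabelEquiv D E ∨ Swap D E

/-- The replacements for a point with one pin: if the views `a` and `b` observe exactly the point
and view `c` exactly the pin, then view `a` additionally observes the pin (as the order of the
views is arbitrary, this includes letting view `b` observe the pin instead). -/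
def LiftOne (D E : PL1P) : Prop :=
  ∃ (M : Matching D E 1) (i : Fin D.p) (j : Fin D.l) (a b c : Fin 3), ViewOrder a b c ∧
    D.OnePin i j {a, b} {c} ∧ E.OnePin (M.pt i) (M.ln j) {a, b} {a, c} ∧
    ∀ k, k ≠ j → E.lnViews (M.ln k) = D.lnViews k

/-- The replacements for a point with two pins, of which view `b` observes the first and view `c`
the second: if view `a` observes the point and none or only the first of its pins, then it is made
to observe both pins. -/
def LiftTwo (D E : PL1P) : Prop :=
  ∃ (M : Matching D E 1) (i : Fin D.p) (j k : Fin D.l) (a b c : Fin 3), ViewOrder a b c ∧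
    (D.TwoPins i j k {a} {b} {c} ∨ D.TwoPins i j k {a} {a, b} {c}) ∧
    E.TwoPins (M.pt i) (M.ln j) (M.ln k) {a} {a, b} {a, c} ∧
    ∀ n, n ≠ j → n ≠ k → E.lnViews (M.ln n) = D.lnViews n

/-- `E` arises from `D` by finitely many of these replacements. -/
def LiftsTo (D E : PL1P) : Prop :=
  Relation.ReflTransGen (fun D E => LiftOne D E ∨ LiftTwo D E) D E

/-- A reduced minimal problem. -/
def IsReducedMinimal (D : PL1P) : Prop := D.prob.IsReduced ∧ D.prob.IsMinimal

/-- A camera-minimal problem is terminal if it is reduced and none of its points is viewed,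
up to permuting the views, in one of the following three ways:
two pins, where view `a` sees the point and the first pin, `b` the first pin, `c` the second pin;
two pins, where view `a` sees the point and both pins, `b` the first pin, `c` the second pin;
one pin, where view `a` sees the point and the pin, `b` only the point, `c` only the pin. -/
def IsTerminal (D : PL1P) : Prop :=
  D.prob.IsCameraMinimal ∧ D.prob.IsReduced ∧
  ∀ a b c, ViewOrder a b c →
    (∀ i j k, ¬ D.TwoPins i j k {a} {a, b} {c}) ∧
    (∀ i j k, ¬ D.TwoPins i j k {a} {a, b} {a, c}) ∧
    ∀ i j, ¬ D.OnePin i j {a, b} {a, c}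

/-- The swap-and-label-equivalence classes of reduced minimal PL1Ps in three views. -/
abbrev ReducedMinimalClass : Type :=
  Quotient (swapLabelSetoid.comap (Subtype.val : {D : PL1P // D.IsReducedMinimal} → PL1P))

/-- The label-equivalence classes of terminal camera-minimal PL1Ps in three views. -/
abbrev TerminalClass : Type :=
  Quotient (labelSetoid.comap (Subtype.val : {T : PL1P // T.IsTerminal} → PL1P))

end PL1P

end PointLine

/-! The bijection forgets redundant observations. An observation of a pin is redundant if exactly
two views see the pin and, of these, only the observing one sees its point. Deleting all redundant
observations gives the core of a problem. Swaps and lifts alter redundant observations only, so they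
preserve the core up to relabeling (`labelEquiv_core_of_swapLabel`, `LiftsTo.labelEquiv_core`).

Combinatorics. Reducedness is equivalent to the explicit condition `Comb` on views
(`isReduced_iff_comb`). A reduction exists when the forgotten features can be reconstructed by
intersecting rays and planes. It is excluded by a polynomial in the image coordinates that vanishes
on all images that lift but not on the whole fibre of the forgetting map. Under `Comb`, redundant
observations are those of the types (B), (C$_1$), (C$_2$), so the core of a reduced minimal problem
is terminal once it is known to be camera-minimal. In a minimal problem no line is seen by exactly
one view, since such a line could move in its back-projected plane. Hence a reduced minimal problem
is recovered from its core by choosing, for every pin left with one view, a further view that sees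
the point. If one view sees the point the choice is forced; if two do, the two choices differ by a
swap. This gives injectivity. Making such choices for a terminal problem gives a lift, hence
surjectivity.

Algebra. A problem and its core have the same camera-degree, because an additional redundant
observation imposes no condition on the cameras: in general position, the plane back-projected from
the old image of the pin and the plane of the new image, which passes through the image of the
point, meet in a line through the point. The main difficulty is to show that for a generic image all
solutions are in general position (`gen_nonDeg`). This is a count of transcendence degrees. Let `N`
be the number of image coordinates and `G` the number of parameters by which space coordinates can
change without changing the image (the gauge). A degenerate solution over a generic image can be
changed by the gauge to have transcendence degree at least `N + G`, although it satisfies an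
algebraic relation over the field of its rotations. Replacing translations and space coordinates by
independent ones, with the same rotations, gives a nondegenerate solution of strictly larger degree.
But its cameras are algebraic over the image, since there are finitely many, and its space
coordinates solve linear equations whose solution space is the gauge, so its degree is at most `N +
G`.

Genericity is tested in an affine chart of the image variety (`genericImage_iff`). Chevalley's
theorem shows that having at least `n` camera configurations either holds or fails generically, so
that degrees exist and can be compared at one generic image. Relabeling the views needs a
renormalization of the cameras, which is defined in general position (`Relabel.isCameraMinimal`). -/

namespace PointLine

open MvPolynomial

/-! ### Polynomial functions -/

section IsPoly

variable {σ τ : Type}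

/-- `F` is a polynomial function. -/
def IsPoly (F : (σ → ℂ) → ℂ) : Prop := ∃ p : MvPolynomial σ ℂ, ∀ x, eval x p = F x

theorem IsPoly.of_eval (p : MvPolynomial σ ℂ) : IsPoly fun x => eval x p := ⟨p, fun _ => rfl⟩

theorem IsPoly.const (c : ℂ) : IsPoly fun _ : σ → ℂ => c := ⟨C c, fun _ => by simp⟩

theorem IsPoly.coord (i : σ) : IsPoly fun x : σ → ℂ => x i := ⟨X i, fun _ => by simp⟩

theorem IsPoly.add {F G : (σ → ℂ) → ℂ} (hF : IsPoly F) (hG : IsPoly G) :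
    IsPoly fun x => F x + G x := by
  obtain ⟨p, hp⟩ := hF
  obtain ⟨q, hq⟩ := hG
  exact ⟨p + q, fun x => by simp [hp, hq]⟩

theorem IsPoly.mul {F G : (σ → ℂ) → ℂ} (hF : IsPoly F) (hG : IsPoly G) :
    IsPoly fun x => F x * G x := by
  obtain ⟨p, hp⟩ := hF
  obtain ⟨q, hq⟩ := hG
  exact ⟨p * q, fun x => by simp [hp, hq]⟩

theorem IsPoly.neg {F : (σ → ℂ) → ℂ} (hF : IsPoly F) : IsPoly fun x => -F x := by
  obtain ⟨p, hp⟩ := hF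
  exact ⟨-p, fun x => by simp [hp]⟩

theorem IsPoly.sub {F G : (σ → ℂ) → ℂ} (hF : IsPoly F) (hG : IsPoly G) :
    IsPoly fun x => F x - G x := by
  simpa [sub_eq_add_neg] using hF.add hG.neg

theorem IsPoly.sum {ι : Type*} (s : Finset ι) {F : ι → (σ → ℂ) → ℂ} (h : ∀ i ∈ s, IsPoly (F i)) :
    IsPoly fun x => ∑ i ∈ s, F i x := by
  classical
  induction s using Finset.induction_on with
  | empty => simpa using IsPoly.const 0
  | insert a s ha ih =>
    simp only [Finset.sum_insert ha]
    exact (h a (by simp)).add (ih fun i hi => h i (by simp [hi]))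

theorem IsPoly.prod {ι : Type*} (s : Finset ι) {F : ι → (σ → ℂ) → ℂ} (h : ∀ i ∈ s, IsPoly (F i)) :
    IsPoly fun x => ∏ i ∈ s, F i x := by
  classical
  induction s using Finset.induction_on with
  | empty => simpa using IsPoly.const 1
  | insert a s ha ih =>
    simp only [Finset.prod_insert ha]
    exact (h a (by simp)).mul (ih fun i hi => h i (by simp [hi]))

theorem IsPoly.comp {F : (σ → ℂ) → ℂ} (hF : IsPoly F) {G : (τ → ℂ) → σ → ℂ}
    (hG : ∀ i, IsPoly fun x => G x i) : IsPoly fun x => F (G x) := by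
  obtain ⟨p, hp⟩ := hF
  choose q hq using hG
  refine ⟨aeval q p, fun x => ?_⟩
  have : (fun i => eval x (q i)) = G x := funext fun i => hq i x
  show _ = F (G x)
  rw [← hp, ← this, ← coe_aeval_eq_eval, ← coe_aeval_eq_eval]
  simp only [RingHom.coe_coe]
  rw [← AlgHom.comp_apply, comp_aeval]

theorem IsPoly.dot {n : ℕ} {u w : (σ → ℂ) → Fin n → ℂ} (hu : ∀ i, IsPoly fun x => u x i)
    (hw : ∀ i, IsPoly fun x => w x i) : IsPoly fun x => u x ⬝ᵥ w x :=
  IsPoly.sum _ fun i _ => (hu i).mul (hw i)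

theorem IsPoly.mulVec {m n : ℕ} {M : (σ → ℂ) → Matrix (Fin m) (Fin n) ℂ} {w : (σ → ℂ) → Fin n → ℂ}
    (hM : ∀ r i, IsPoly fun x => M x r i) (hw : ∀ i, IsPoly fun x => w x i) (r : Fin m) :
    IsPoly fun x => (M x).mulVec (w x) r :=
  IsPoly.dot (hM r) hw

theorem IsPoly.det {n : ℕ} {M : (σ → ℂ) → Matrix (Fin n) (Fin n) ℂ}
    (hM : ∀ r i, IsPoly fun x => M x r i) : IsPoly fun x => (M x).det := by
  simp only [Matrix.det_apply']
  exact IsPoly.sum _ fun τ _ => (IsPoly.const _).mul (IsPoly.prod _ fun i _ => hM _ _)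

theorem IsPoly.cross {u w : (σ → ℂ) → Fin 3 → ℂ} (hu : ∀ i, IsPoly fun x => u x i)
    (hw : ∀ i, IsPoly fun x => w x i) (r : Fin 3) : IsPoly fun x => crossProduct (u x) (w x) r := by
  fin_cases r
  · simpa [cross_apply] using ((hu 1).mul (hw 2)).sub ((hu 2).mul (hw 1))
  · simpa [cross_apply] using ((hu 2).mul (hw 0)).sub ((hu 0).mul (hw 2))
  · simpa [cross_apply] using ((hu 0).mul (hw 1)).sub ((hu 1).mul (hw 0))

/-- A nonzero polynomial function on a line has cofinitely many nonzero values. -/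
theorem IsPoly.exists_polynomial {F : (σ → ℂ) → ℂ} (hF : IsPoly F) (a d : σ → ℂ) :
    ∃ q : Polynomial ℂ, ∀ s : ℂ, q.eval s = F (fun i => a i + s * d i) := by
  obtain ⟨p, hp⟩ := hF
  refine ⟨aeval (fun i => Polynomial.C (a i) + Polynomial.X * Polynomial.C (d i)) p, fun s => ?_⟩
  rw [← hp, ← Polynomial.coe_aeval_eq_eval, ← coe_aeval_eq_eval]
  simp only [RingHom.coe_coe]
  rw [← AlgHom.comp_apply, comp_aeval]
  simp [mul_comm s]

end IsPoly

/-! ### Generic properties of points of an affine space -/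

section Gen

variable {σ ζ : Type}

/-- `Q` holds on a nonempty Zariski-open subset of an affine space. -/
def Gen (Q : (σ → ℂ) → Prop) : Prop :=
  ∃ f : MvPolynomial σ ℂ, f ≠ 0 ∧ ∀ b, eval b f ≠ 0 → Q b

theorem Gen.mono {Q R : (σ → ℂ) → Prop} (hQ : Gen Q) (h : ∀ b, Q b → R b) : Gen R := by
  obtain ⟨f, hf, hQ⟩ := hQ
  exact ⟨f, hf, fun b hb => h b (hQ b hb)⟩

theorem Gen.and {Q R : (σ → ℂ) → Prop} (hQ : Gen Q) (hR : Gen R) : Gen fun b => Q b ∧ R b := by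
  obtain ⟨f, hf, hQ⟩ := hQ
  obtain ⟨g, hg, hR⟩ := hR
  refine ⟨f * g, mul_ne_zero hf hg, fun b hb => ?_⟩
  rw [map_mul] at hb
  exact ⟨hQ b (left_ne_zero_of_mul hb), hR b (right_ne_zero_of_mul hb)⟩

theorem exists_eval_ne_zero {f : MvPolynomial σ ℂ} (hf : f ≠ 0) : ∃ b, eval b f ≠ 0 := by
  by_contra! h
  exact hf (MvPolynomial.funext fun x => by simpa using h x)

theorem Gen.exists {Q : (σ → ℂ) → Prop} (hQ : Gen Q) : ∃ b, Q b := by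
  obtain ⟨f, hf, hQ⟩ := hQ
  obtain ⟨b, hb⟩ := exists_eval_ne_zero hf
  exact ⟨b, hQ b hb⟩

theorem Gen.of_forall {Q : (σ → ℂ) → Prop} (h : ∀ b, Q b) : Gen Q :=
  ⟨1, one_ne_zero, fun b _ => h b⟩

theorem IsPoly.gen {F : (σ → ℂ) → ℂ} (hF : IsPoly F) {b : σ → ℂ} (hb : F b ≠ 0) :
    Gen fun b => F b ≠ 0 := by
  obtain ⟨p, hp⟩ := hF
  refine ⟨p, fun h => hb (by rw [← hp, h, map_zero]), fun b hb => by simpa only [← hp] using hb⟩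

theorem Gen.all {ι : Type*} [Finite ι] {Q : ι → (σ → ℂ) → Prop} (h : ∀ i, Gen (Q i)) :
    Gen fun b => ∀ i, Q i b := by
  cases nonempty_fintype ι
  choose f hf hQ using h
  refine ⟨∏ i, f i, Finset.prod_ne_zero_iff.2 fun i _ => hf i, fun b hb i => hQ i b ?_⟩
  rw [map_prod] at hb
  exact Finset.prod_ne_zero_iff.1 hb i (Finset.mem_univ i)

/-- Countably many nonempty Zariski-open subsets of an affine space have a common point. -/
theorem exists_forall_eval_ne_zero [Finite σ] {S : Set (MvPolynomial σ ℂ)} (hS : S.Countable)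
    (h0 : ∀ f ∈ S, f ≠ 0) : ∃ b, ∀ f ∈ S, eval b f ≠ 0 := by
  -- Baire's theorem in the Euclidean topology. For density, a line from `b` to a point where `f` is
  -- nonzero contains only finitely many zeros of `f`.
  have hd : ∀ f ∈ S, Dense {b : σ → ℂ | eval b f ≠ 0} := by
    intro f hf b
    obtain ⟨c, hc⟩ := exists_eval_ne_zero (h0 f hf)
    obtain ⟨q, hq⟩ := (IsPoly.of_eval f).exists_polynomial b (fun i => c i - b i)
    have hq0 : q ≠ 0 := by
      rintro rfl
      have := hq 1
      simp only [Polynomial.eval_zero, one_mul, add_sub_cancel] at this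
      exact hc this.symm
    have hcont : Continuous fun s : ℂ => (fun i => b i + s * (c i - b i) : σ → ℂ) := by fun_prop
    have h1 : Dense (q.roots.toFinset : Set ℂ)ᶜ :=
      (Finset.finite_toSet _).countable.dense_compl ℝ
    have h2 := mem_closure_image hcont.continuousAt (h1 0)
    simp only [zero_mul, add_zero] at h2
    refine closure_mono ?_ h2
    rintro _ ⟨s, hs, rfl⟩
    simp only [Set.mem_compl_iff, Finset.mem_coe, Multiset.mem_toFinset, Polynomial.mem_roots hq0,
      Polynomial.IsRoot.def, hq] at hs
    exact hs
  have ho : ∀ f ∈ S, IsOpen {b : σ → ℂ | eval b f ≠ 0} := fun f _ =>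
    isOpen_ne_fun (MvPolynomial.continuous_eval f) continuous_const
  obtain ⟨b, hb⟩ := (dense_biInter_of_isOpen ho hS hd).nonempty
  exact ⟨b, fun f hf => (Set.mem_iInter₂.1 hb) f hf⟩

/-- Countably many generic properties hold simultaneously at some point. -/
theorem Gen.exists_forall [Finite σ] {ι : Type*} [Countable ι] {Q : ι → (σ → ℂ) → Prop}
    (h : ∀ i, Gen (Q i)) : ∃ b, ∀ i, Q i b := by
  choose f hf hQ using h
  obtain ⟨b, hb⟩ := exists_forall_eval_ne_zero (Set.countable_range f) (by simpa using hf)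
  exact ⟨b, fun i => hQ i b (hb _ ⟨i, rfl⟩)⟩

/-- A constructible set containing the generic point of an affine space contains a nonempty
Zariski-open set. -/
theorem exists_of_bot_mem {R : Type*} [CommRing R] [IsDomain R] {D : Set (PrimeSpectrum R)}
    (hD : Topology.IsConstructible D) (h : (⊥ : PrimeSpectrum R) ∈ D) :
    ∃ f : R, f ≠ 0 ∧ ∀ x : PrimeSpectrum R, f ∉ x.asIdeal → x ∈ D := by
  obtain ⟨S, rfl⟩ := PrimeSpectrum.exists_constructibleSetData_iff.2 hD
  simp only [PrimeSpectrum.ConstructibleSetData.toSet, Set.mem_iUnion] at h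
  obtain ⟨c, hc, h⟩ := h
  obtain ⟨h1, h2⟩ := h
  simp only [PrimeSpectrum.mem_zeroLocus, Set.singleton_subset_iff, SetLike.mem_coe] at h1 h2
  refine ⟨c.f, fun h => h2 (by simp [h]), fun x hx => ?_⟩
  simp only [PrimeSpectrum.ConstructibleSetData.toSet, Set.mem_iUnion]
  refine ⟨c, hc, ?_, ?_⟩
  · rw [PrimeSpectrum.mem_zeroLocus]
    intro y hy
    have := h1 hy
    rw [SetLike.mem_coe, PrimeSpectrum.asIdeal_bot, Ideal.mem_bot] at this
    simp [this]
  · simpa [PrimeSpectrum.mem_zeroLocus] using hx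

/-- A nonempty constructible subset of the spectrum of a Jacobson ring has a closed point. -/
theorem exists_isMaximal_mem {R : Type*} [CommRing R] [IsJacobsonRing R]
    {D : Set (PrimeSpectrum R)} (hD : Topology.IsConstructible D) (h : D.Nonempty) :
    ∃ x ∈ D, x.asIdeal.IsMaximal := by
  obtain ⟨S, rfl⟩ := PrimeSpectrum.exists_constructibleSetData_iff.2 hD
  obtain ⟨y, h⟩ := h
  simp only [PrimeSpectrum.ConstructibleSetData.toSet, Set.mem_iUnion] at h
  obtain ⟨c, hc, h⟩ := h
  have hl : IsLocallyClosed c.toSet := by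
    rw [PrimeSpectrum.BasicConstructibleSetData.toSet, Set.sdiff_eq]
    exact (PrimeSpectrum.isClosed_zeroLocus _).isLocallyClosed.inter
      (PrimeSpectrum.isClosed_zeroLocus _).isOpen_compl.isLocallyClosed
  obtain ⟨x, hx, hx'⟩ := nonempty_inter_closedPoints ⟨y, h⟩ hl
  refine ⟨x, ?_, (PrimeSpectrum.isClosed_singleton_iff_isMaximal x).1 hx'⟩
  simp only [PrimeSpectrum.ConstructibleSetData.toSet, Set.mem_iUnion]
  exact ⟨c, hc, hx⟩

/-- A constructible property of the points of an affine space. -/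
def Constr (Q : (σ → ℂ) → Prop) : Prop :=
  ∃ D : Set (PrimeSpectrum (MvPolynomial σ ℂ)), Topology.IsConstructible D ∧
    ∀ x, Q x ↔ pointToPoint (k := ℂ) x ∈ D

theorem Constr.not {Q : (σ → ℂ) → Prop} (hQ : Constr Q) : Constr fun x => ¬ Q x := by
  obtain ⟨D, hD, h⟩ := hQ
  exact ⟨Dᶜ, hD.compl, fun x => by simp [h]⟩

theorem Constr.and {Q R : (σ → ℂ) → Prop} (hQ : Constr Q) (hR : Constr R) :
    Constr fun x => Q x ∧ R x := by
  obtain ⟨D, hD, h⟩ := hQ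
  obtain ⟨E, hE, h'⟩ := hR
  exact ⟨D ∩ E, hD.inter hE, fun x => by simp [h, h']⟩

theorem Constr.or {Q R : (σ → ℂ) → Prop} (hQ : Constr Q) (hR : Constr R) :
    Constr fun x => Q x ∨ R x := by
  obtain ⟨D, hD, h⟩ := hQ
  obtain ⟨E, hE, h'⟩ := hR
  exact ⟨D ∪ E, hD.union hE, fun x => by simp [h, h']⟩

theorem Constr.all {ι : Type*} [Finite ι] {Q : ι → (σ → ℂ) → Prop} (hQ : ∀ i, Constr (Q i)) :
    Constr fun x => ∀ i, Q i x := by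
  choose D hD h using hQ
  exact ⟨⋂ i, D i, .iInter hD, fun x => by simp [h]⟩

theorem Constr.ex {ι : Type*} [Finite ι] {Q : ι → (σ → ℂ) → Prop} (hQ : ∀ i, Constr (Q i)) :
    Constr fun x => ∃ i, Q i x := by
  choose D hD h using hQ
  exact ⟨⋃ i, D i, .iUnion hD, fun x => by simp [h]⟩

theorem Constr.const (P : Prop) : Constr fun _ : σ → ℂ => P := by
  by_cases h : P
  · exact ⟨Set.univ, .univ, fun x => by simp [h]⟩
  · exact ⟨∅, .empty, fun x => by simp [h]⟩

theorem IsPoly.constr_ne {F : (σ → ℂ) → ℂ} (hF : IsPoly F) : Constr fun x => F x ≠ 0 := by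
  obtain ⟨p, hp⟩ := hF
  refine ⟨PrimeSpectrum.basicOpen p, PrimeSpectrum.isConstructible_basicOpen, fun x => ?_⟩
  show F x ≠ 0 ↔ p ∉ vanishingIdeal ℂ {x}
  rw [← hp, mem_vanishingIdeal_singleton_iff, ← coe_aeval_eq_eval]
  rfl

theorem IsPoly.constr_eq {F G : (σ → ℂ) → ℂ} (hF : IsPoly F) (hG : IsPoly G) :
    Constr fun x => F x = G x := by
  simpa [sub_eq_zero] using (hF.sub hG).constr_ne.not

theorem Constr.imp {Q R : (σ → ℂ) → Prop} (hQ : Constr Q) (hR : Constr R) :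
    Constr fun x => Q x → R x := by
  simpa only [imp_iff_not_or] using hQ.not.or hR

theorem comap_rename_pointToPoint {τ : Type} (r : σ → τ) (x : τ → ℂ) :
    PrimeSpectrum.comap (rename (R := ℂ) r).toRingHom (pointToPoint (k := ℂ) x) =
      pointToPoint (k := ℂ) (x ∘ r) := by
  ext p
  show rename r p ∈ vanishingIdeal ℂ {x} ↔ p ∈ vanishingIdeal ℂ {x ∘ r}
  simp [aeval_rename]

theorem Constr.comp {τ : Type} {Q : (σ → ℂ) → Prop} (hQ : Constr Q) (r : σ → τ) :
    Constr fun x : τ → ℂ => Q (x ∘ r) := by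
  obtain ⟨D, hD, h⟩ := hQ
  obtain ⟨S, rfl⟩ := PrimeSpectrum.exists_constructibleSetData_iff.2 hD
  refine ⟨(S.map (rename (R := ℂ) r).toRingHom).toSet, PrimeSpectrum.exists_constructibleSetData_iff.1
    ⟨_, rfl⟩, fun x => ?_⟩
  show Q (x ∘ r) ↔ _
  rw [h, PrimeSpectrum.ConstructibleSetData.toSet_map, Set.mem_preimage, comap_rename_pointToPoint]

/-- The projection of a constructible set contains or misses a nonempty Zariski-open set. -/
theorem Constr.gen_or_gen_not [Finite σ] [Finite ζ] {Q : (σ ⊕ ζ → ℂ) → Prop} (hQ : Constr Q) :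
    Gen (fun b : σ → ℂ => ∃ z : ζ → ℂ, Q (Sum.elim b z)) ∨
      Gen (fun b : σ → ℂ => ¬ ∃ z : ζ → ℂ, Q (Sum.elim b z)) := by
  obtain ⟨D, hD, h⟩ := hQ
  set φ : MvPolynomial σ ℂ →+* MvPolynomial (σ ⊕ ζ) ℂ := (rename Sum.inl).toRingHom with hφ
  have hfp : φ.FinitePresentation := by
    have h1 : (algebraMap ℂ (MvPolynomial (σ ⊕ ζ) ℂ)).FinitePresentation :=
      RingHom.finitePresentation_algebraMap.2 inferInstance
    have h2 : (algebraMap ℂ (MvPolynomial σ ℂ)).FiniteType :=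
      RingHom.finiteType_algebraMap.2 inferInstance
    refine RingHom.FinitePresentation.of_comp_finiteType (algebraMap ℂ (MvPolynomial σ ℂ)) ?_ h2
    convert h1 using 1
    ext c
    simp [hφ, algebraMap_eq]
  -- A prime of `D` over the closed point `b` need not come from a complex point. But the part of
  -- `D` over `b` is constructible, so it has a closed point if it is nonempty, and closed points
  -- are complex points by the Nullstellensatz.
  have key : ∀ b : σ → ℂ, (∃ z : ζ → ℂ, Q (Sum.elim b z)) ↔
      pointToPoint (k := ℂ) b ∈ PrimeSpectrum.comap φ '' D := by
    intro b
    constructor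
    · rintro ⟨z, hz⟩
      refine ⟨_, (h _).1 hz, ?_⟩
      rw [hφ, comap_rename_pointToPoint]
      rfl
    · rintro ⟨q, hq, hqb⟩
      have hfib : Topology.IsConstructible (D ∩ PrimeSpectrum.comap φ ⁻¹' {pointToPoint (k := ℂ) b}) := by
        refine hD.inter ?_
        have hcl : IsClosed ({pointToPoint (k := ℂ) b} : Set (PrimeSpectrum (MvPolynomial σ ℂ))) :=
          (PrimeSpectrum.isClosed_singleton_iff_isMaximal _).2
            (inferInstanceAs (vanishingIdeal ℂ {b}).IsMaximal)
        have := (hcl.preimage (PrimeSpectrum.continuous_comap φ)).isOpen_compl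
        rw [← Topology.isConstructible_compl]
        exact (TopologicalSpace.NoetherianSpace.isCompact _).isConstructible this
      obtain ⟨x, ⟨hxD, hxb⟩, hx⟩ := exists_isMaximal_mem hfib ⟨q, hq, hqb⟩
      obtain ⟨y, hy⟩ := isMaximal_iff_eq_vanishingIdeal_singleton.1 hx
      have hxy : x = pointToPoint (k := ℂ) y := PrimeSpectrum.ext hy
      subst hxy
      rw [Set.mem_preimage, hφ, comap_rename_pointToPoint, Set.mem_singleton_iff] at hxb
      have hyb : y ∘ Sum.inl = b := by
        ext i
        have h1 : X i - C (b i) ∈ (pointToPoint (k := ℂ) b).asIdeal := by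
          show _ ∈ vanishingIdeal ℂ {b}
          rw [mem_vanishingIdeal_singleton_iff]; simp
        rw [← hxb] at h1
        replace h1 : X i - C (b i) ∈ vanishingIdeal ℂ {y ∘ Sum.inl} := h1
        rw [mem_vanishingIdeal_singleton_iff] at h1
        simpa [sub_eq_zero] using h1
      refine ⟨y ∘ Sum.inr, (h _).2 ?_⟩
      rwa [← hyb, Sum.elim_comp_inl_inr]
  -- Chevalley's theorem.
  have hE := PrimeSpectrum.isConstructible_comap_image hfp hD
  have tr : ∀ (f : MvPolynomial σ ℂ) (b : σ → ℂ), eval b f ≠ 0 →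
      f ∉ (pointToPoint (k := ℂ) b).asIdeal := by
    intro f b hb
    show f ∉ vanishingIdeal ℂ {b}
    rw [mem_vanishingIdeal_singleton_iff]
    rwa [← coe_aeval_eq_eval] at hb
  -- The generic point lies in the image or in its complement; whichever constructible set contains
  -- it contains a nonempty open set.
  by_cases hbot : (⊥ : PrimeSpectrum (MvPolynomial σ ℂ)) ∈ PrimeSpectrum.comap φ '' D
  · left
    obtain ⟨f, hf, hfx⟩ := exists_of_bot_mem hE hbot
    exact ⟨f, hf, fun b hb => (key b).2 (hfx _ (tr f b hb))⟩
  · right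
    obtain ⟨f, hf, hfx⟩ := exists_of_bot_mem hE.compl hbot
    exact ⟨f, hf, fun b hb hz => hfx _ (tr f b hb) ((key b).1 hz)⟩

end Gen

end PointLine

namespace PointLine

open MvPolynomial

/-! ### Projective points and lines in coordinates -/

section Coordinates

theorem finrank_span_pair {d : ℕ} {u w : Fin d → ℂ} (h : LinearIndependent ℂ ![u, w]) :
    Module.finrank ℂ (Submodule.span ℂ {u, w}) = 2 := by
  have := finrank_span_eq_card h
  rwa [Matrix.range_cons_cons_empty, Fintype.card_fin] at this

theorem linearIndependent_of_finrank_span_pair {d : ℕ} {u w : Fin d → ℂ}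
    (h : Module.finrank ℂ (Submodule.span ℂ {u, w}) = 2) : LinearIndependent ℂ ![u, w] := by
  rw [linearIndependent_iff_card_eq_finrank_span, Matrix.range_cons_cons_empty,
    Fintype.card_fin]
  exact h.symm

/-- The line through two points with independent coordinate vectors. -/
def mkLine {d : ℕ} (u w : Fin d → ℂ) (h : LinearIndependent ℂ ![u, w]) : ProjLine d :=
  ⟨Submodule.span ℂ {u, w}, finrank_span_pair h⟩

theorem ProjLine.exists_span {d : ℕ} (l : ProjLine d) :
    ∃ u w : Fin d → ℂ, LinearIndependent ℂ ![u, w] ∧ l.1 = Submodule.span ℂ {u, w} := by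
  obtain ⟨W, hW⟩ := l
  have b := Module.finBasisOfFinrankEq ℂ W hW
  refine ⟨b 0, b 1, ?_, ?_⟩
  · have h1 := b.linearIndependent.map' W.subtype (Submodule.ker_subtype W)
    have e : W.subtype ∘ b = ![(b 0 : Fin d → ℂ), (b 1 : Fin d → ℂ)] := by
      ext i : 1
      fin_cases i <;> rfl
    exact e ▸ h1
  · have h1 := congrArg (Submodule.map W.subtype) b.span_eq
    rw [Submodule.map_span, Submodule.map_top, Submodule.range_subtype] at h1
    refine h1.symm.trans ?_
    congr 1
    ext z
    simp [Fin.exists_fin_two, eq_comm]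

theorem ProjLine.exists_span_of_mem {d : ℕ} (l : ProjLine d) {u : Fin d → ℂ} (hu : u ≠ 0)
    (h : u ∈ l.1) :
    ∃ w : Fin d → ℂ, LinearIndependent ℂ ![u, w] ∧ l.1 = Submodule.span ℂ {u, w} := by
  obtain ⟨a, b, hab, hl⟩ := l.exists_span
  have hfr := finrank_span_pair hab
  have key : ∃ w ∈ l.1, w ∉ Submodule.span ℂ {u} := by
    by_contra! hc
    have h1 : Module.finrank ℂ l.1 ≤ Module.finrank ℂ (Submodule.span ℂ {u}) :=
      Submodule.finrank_mono hc
    rw [hl, hfr, finrank_span_singleton hu] at h1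
    omega
  obtain ⟨w, hw, hwu⟩ := key
  have hli : LinearIndependent ℂ ![u, w] := by
    rw [LinearIndependent.pair_iff' hu]
    intro c hc
    exact hwu (Submodule.mem_span_singleton.2 ⟨c, hc⟩)
  refine ⟨w, hli, (Submodule.eq_of_le_of_finrank_eq ?_ ?_).symm⟩
  · rw [Submodule.span_le]
    rintro z (rfl | rfl)
    exacts [h, hw]
  · rw [finrank_span_pair hli, l.2]

theorem submodule_mk_le {d : ℕ} {u : Fin d → ℂ} (hu : u ≠ 0) {W : Submodule ℂ (Fin d → ℂ)} :
    (Projectivization.mk ℂ u hu).submodule ≤ W ↔ u ∈ W := by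
  rw [Projectivization.submodule_mk, Submodule.span_singleton_le_iff_mem]

theorem ProjPoint.exists_mk {d : ℕ} (x : ProjPoint d) :
    ∃ u : Fin d → ℂ, u ≠ 0 ∧ x.submodule = Submodule.span ℂ {u} :=
  ⟨x.rep, x.rep_nonzero, x.submodule_eq⟩

theorem span_singleton_ne_zero {d : ℕ} {x : ProjPoint d} {u : Fin d → ℂ}
    (h : x.submodule = Submodule.span ℂ {u}) : u ≠ 0 := by
  rintro rfl
  have := x.finrank_submodule
  rw [h, Submodule.span_zero_singleton, finrank_bot] at this
  exact zero_ne_one this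

theorem span_range_fin_two {d : ℕ} (f : Fin 2 → Fin d → ℂ) :
    Submodule.span ℂ (Set.range f) = Submodule.span ℂ {f 0, f 1} := by
  congr 1
  ext z
  simp [Fin.exists_fin_two, eq_comm]

theorem linearIndependent_pair_iff_minor {d : ℕ} {u w : Fin d → ℂ} :
    LinearIndependent ℂ ![u, w] ↔ ∃ k l, u k * w l - u l * w k ≠ 0 := by
  constructor
  · intro h
    by_contra! hc
    have hu : u ≠ 0 := h.ne_zero 0
    obtain ⟨k, hk⟩ := Function.ne_iff.1 hu
    have h2 := LinearIndependent.pair_iff.1 h (w k) (-u k) (by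
      ext l
      have := hc k l
      simp only [Pi.add_apply, Pi.smul_apply, smul_eq_mul, Pi.zero_apply]
      linear_combination -this)
    exact hk (by simpa using h2.2)
  · rintro ⟨k, l, hkl⟩
    rw [LinearIndependent.pair_iff]
    intro s t hst
    have hk := congrFun hst k
    have hl := congrFun hst l
    simp only [Pi.add_apply, Pi.smul_apply, smul_eq_mul, Pi.zero_apply] at hk hl
    constructor
    · refine (mul_eq_zero.1 (?_ : s * (u k * w l - u l * w k) = 0)).resolve_right hkl
      linear_combination w l * hk - w k * hl
    · refine (mul_eq_zero.1 (?_ : t * (u k * w l - u l * w k) = 0)).resolve_right hkl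
      linear_combination u k * hl - u l * hk

/-- The line of the projective plane with the given dual coordinates. -/
def dualSub (n : Fin 3 → ℂ) : Submodule ℂ (Fin 3 → ℂ) :=
  LinearMap.ker (dotProductBilin ℂ ℂ n)

theorem mem_dualSub {n z : Fin 3 → ℂ} : z ∈ dualSub n ↔ n ⬝ᵥ z = 0 := Iff.rfl

theorem finrank_dualSub {n : Fin 3 → ℂ} (hn : n ≠ 0) : Module.finrank ℂ (dualSub n) = 2 := by
  have h0 : (dotProductBilin ℂ ℂ n : Module.Dual ℂ (Fin 3 → ℂ)) ≠ 0 := by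
    intro h
    apply hn
    ext i
    have := LinearMap.congr_fun h (Pi.single i 1)
    simpa [dotProductBilin] using this
  have := Module.Dual.finrank_ker_add_one_of_ne_zero h0
  rw [Module.finrank_fin_fun] at this
  exact Nat.succ_injective this

def dualLine (n : Fin 3 → ℂ) (hn : n ≠ 0) : ProjLine 3 := ⟨dualSub n, finrank_dualSub hn⟩

theorem span_pair_eq_dualSub {u w n : Fin 3 → ℂ} (h : LinearIndependent ℂ ![u, w]) (hn : n ≠ 0)
    (hu : n ⬝ᵥ u = 0) (hw : n ⬝ᵥ w = 0) : Submodule.span ℂ {u, w} = dualSub n := by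
  refine Submodule.eq_of_le_of_finrank_eq ?_ ?_
  · rw [Submodule.span_le]
    rintro z (rfl | rfl)
    exacts [hu, hw]
  · rw [finrank_span_pair h, finrank_dualSub hn]

theorem cross_ne_zero {u w : Fin 3 → ℂ} (h : LinearIndependent ℂ ![u, w]) :
    crossProduct u w ≠ 0 := crossProduct_ne_zero_iff_linearIndependent.2 h

theorem span_pair_eq_dualSub_cross {u w : Fin 3 → ℂ} (h : LinearIndependent ℂ ![u, w]) :
    Submodule.span ℂ {u, w} = dualSub (crossProduct u w) :=
  span_pair_eq_dualSub h (cross_ne_zero h)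
    (by rw [dotProduct_comm]; exact dot_self_cross u w)
    (by rw [dotProduct_comm]; exact dot_cross_self u w)

theorem dualSub_eq_iff {m n : Fin 3 → ℂ} (hm : m ≠ 0) (hn : n ≠ 0) :
    dualSub m = dualSub n ↔ ∃ c : ℂ, c ≠ 0 ∧ m = c • n := by
  constructor
  · intro h
    obtain ⟨k, hk⟩ := Function.ne_iff.1 hn
    simp only [Pi.zero_apply] at hk
    have key : ∀ l, m l * n k = m k * n l := by
      intro l
      have h1 : (Pi.single l (n k) - Pi.single k (n l) : Fin 3 → ℂ) ∈ dualSub n := by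
        rw [mem_dualSub, dotProduct_sub, dotProduct_single, dotProduct_single]
        ring
      rw [← h, mem_dualSub, dotProduct_sub, dotProduct_single, dotProduct_single] at h1
      linear_combination h1
    have hmn : m = (m k / n k) • n := by
      ext l
      simp only [Pi.smul_apply, smul_eq_mul]
      field_simp
      linear_combination key l
    refine ⟨m k / n k, fun h0 => hm (by rw [hmn, h0, zero_smul]), hmn⟩
  · rintro ⟨c, hc, rfl⟩
    ext z
    simp [mem_dualSub, hc]

/-- A pair of vectors of the plane spans the line with dual coordinates `n`, where `n 0 = 1`. -/
theorem span_pair_eq_dualSub_iff {u w n : Fin 3 → ℂ} (hn : n 0 = 1) :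
    (Submodule.span ℂ {u, w} = dualSub n) ↔
      crossProduct u w 0 ≠ 0 ∧ crossProduct u w = crossProduct u w 0 • n := by
  have hn0 : n ≠ 0 := fun h => by simp [h] at hn
  constructor
  · intro h
    have hli := linearIndependent_of_finrank_span_pair (by rw [h, finrank_dualSub hn0])
    rw [span_pair_eq_dualSub_cross hli, dualSub_eq_iff (cross_ne_zero hli) hn0] at h
    obtain ⟨c, hc, h⟩ := h
    have : crossProduct u w 0 = c := by rw [h]; simp [hn]
    exact ⟨this ▸ hc, by rw [this, ← h]⟩
  · rintro ⟨h0, h⟩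
    have hc : crossProduct u w ≠ 0 := fun h' => h0 (by simp [h'])
    rw [span_pair_eq_dualSub_cross (crossProduct_ne_zero_iff_linearIndependent.1 hc),
      dualSub_eq_iff hc hn0]
    exact ⟨_, h0, h⟩

theorem span_singleton_eq_iff {d : ℕ} {u w : Fin d → ℂ} (hu : u ≠ 0) :
    Submodule.span ℂ {u} = Submodule.span ℂ {w} ↔ ∃ c : ℂ, c ≠ 0 ∧ u = c • w := by
  constructor
  · intro h
    obtain ⟨c, hc⟩ := Submodule.mem_span_singleton.1
      (h ▸ Submodule.mem_span_singleton_self u : u ∈ Submodule.span ℂ {w})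
    exact ⟨c, fun h0 => hu (by rw [← hc, h0, zero_smul]), hc.symm⟩
  · rintro ⟨c, hc, rfl⟩
    exact Submodule.span_singleton_smul_eq hc.isUnit w

theorem map_span_singleton (P : Matrix (Fin 3) (Fin 4) ℂ) (u : Fin 4 → ℂ) :
    (Submodule.span ℂ {u}).map P.mulVecLin = Submodule.span ℂ {P.mulVec u} := by
  rw [Submodule.map_span, Set.image_singleton, Matrix.mulVecLin_apply]

theorem map_span_pair (P : Matrix (Fin 3) (Fin 4) ℂ) (u w : Fin 4 → ℂ) :
    (Submodule.span ℂ {u, w}).map P.mulVecLin = Submodule.span ℂ {P.mulVec u, P.mulVec w} := by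
  rw [Submodule.map_span, Set.image_pair, Matrix.mulVecLin_apply, Matrix.mulVecLin_apply]

/-- A point of the plane in the affine chart. -/
theorem span_singleton_eq_chart_iff {u x : Fin 3 → ℂ} (hx : x 2 = 1) :
    Submodule.span ℂ {u} = Submodule.span ℂ {x} ↔ u 2 ≠ 0 ∧ u = u 2 • x := by
  have hx0 : x ≠ 0 := fun h => by simp [h] at hx
  constructor
  · intro h
    have hu : u ≠ 0 := by
      rintro rfl
      rw [Submodule.span_singleton_eq_bot.2 rfl, eq_comm, Submodule.span_singleton_eq_bot] at h
      exact hx0 h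
    obtain ⟨c, hc, rfl⟩ := (span_singleton_eq_iff hu).1 h
    simp [hx, hc]
  · rintro ⟨h0, h⟩
    exact (span_singleton_eq_iff (fun h' => h0 (by simp [h']))).2 ⟨_, h0, h⟩

end Coordinates

end PointLine

namespace PointLine

open MvPolynomial

/-! ### Arrangements in coordinates -/

section ArrangementCoordinates

variable {ι κ : Type} {d : ℕ}

/-- The coordinate vector of a point. -/
def ptv (a : ArrCoord ι κ d → ℂ) (i : ι) : Fin d → ℂ := fun k => a (Sum.inl (i, k))

/-- The coordinate vectors of a line. -/
def lnv (a : ArrCoord ι κ d → ℂ) (j : κ) (r : Fin 2) : Fin d → ℂ := fun k => a (Sum.inr (j, r, k))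

theorem hasCoords_iff {A : Arrangement ι κ d} {a : ArrCoord ι κ d → ℂ} :
    A.HasCoords a ↔ (∀ i, (A.pt i).submodule = Submodule.span ℂ {ptv a i}) ∧
      ∀ j, (A.ln j).1 = Submodule.span ℂ {lnv a j 0, lnv a j 1} :=
  and_congr Iff.rfl (forall_congr' fun j => by
    rw [show (Set.range fun (r : Fin 2) (k : Fin d) => a (Sum.inr (j, r, k))) =
      Set.range (lnv a j) from rfl, span_range_fin_two])

theorem Arrangement.HasCoords.ptv_ne_zero {A : Arrangement ι κ d} {a : ArrCoord ι κ d → ℂ}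
    (h : A.HasCoords a) (i : ι) : ptv a i ≠ 0 :=
  span_singleton_ne_zero ((hasCoords_iff.1 h).1 i)

theorem Arrangement.HasCoords.linearIndependent {A : Arrangement ι κ d} {a : ArrCoord ι κ d → ℂ}
    (h : A.HasCoords a) (j : κ) : LinearIndependent ℂ ![lnv a j 0, lnv a j 1] :=
  linearIndependent_of_finrank_span_pair (by rw [← (hasCoords_iff.1 h).2 j]; exact (A.ln j).2)

theorem Arrangement.ext' {A B : Arrangement ι κ d}
    (h1 : ∀ i, (A.pt i).submodule = (B.pt i).submodule) (h2 : ∀ j, (A.ln j).1 = (B.ln j).1) :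
    A = B := by
  obtain ⟨p, l⟩ := A
  obtain ⟨p', l'⟩ := B
  congr
  · exact funext fun i => Projectivization.submodule_injective (h1 i)
  · exact funext fun j => Subtype.ext (h2 j)

theorem Arrangement.HasCoords.unique {A B : Arrangement ι κ d} {a : ArrCoord ι κ d → ℂ}
    (h : A.HasCoords a) (h' : B.HasCoords a) : A = B := by
  rw [hasCoords_iff] at h h'
  exact Arrangement.ext' (fun i => by rw [h.1, h'.1]) fun j => by rw [h.2, h'.2]

theorem exists_hasCoords {a : ArrCoord ι κ d → ℂ} (h1 : ∀ i, ptv a i ≠ 0)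
    (h2 : ∀ j, LinearIndependent ℂ ![lnv a j 0, lnv a j 1]) :
    ∃ A : Arrangement ι κ d, A.HasCoords a :=
  ⟨⟨fun i => Projectivization.mk ℂ (ptv a i) (h1 i), fun j => mkLine _ _ (h2 j)⟩,
    hasCoords_iff.2 ⟨fun _ => Projectivization.submodule_mk _ _, fun _ => rfl⟩⟩

theorem exists_coords (A : Arrangement ι κ d) : ∃ a, A.HasCoords a := by
  choose x _ hx using fun i => (A.pt i).exists_mk
  choose u w _ huw using fun j => (A.ln j).exists_span
  exact ⟨Sum.elim (fun q => x q.1 q.2) (fun q => (![u q.1, w q.1] : Fin 2 → Fin d → ℂ) q.2.1 q.2.2),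
    hasCoords_iff.2 ⟨hx, huw⟩⟩

theorem Arrangement.HasCoords.onLine_iff {A : Arrangement ι κ d} {a : ArrCoord ι κ d → ℂ}
    (h : A.HasCoords a) (i : ι) (j : κ) :
    OnLine (A.pt i) (A.ln j) ↔ ptv a i ∈ Submodule.span ℂ {lnv a j 0, lnv a j 1} := by
  rw [hasCoords_iff] at h
  rw [OnLine, h.1, h.2, Submodule.span_singleton_le_iff_mem]

end ArrangementCoordinates

/-! ### Substituting rational functions into a polynomial -/

/-- The factor `E` is a product of denominators and hence harmless where these do not vanish. This
pulls open conditions back along rational maps. -/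
theorem exists_clear_denominators {σ τ : Type} {num den : τ → (σ → ℂ) → ℂ}
    (hnum : ∀ t, IsPoly (num t)) (hden : ∀ t, IsPoly (den t)) (p : MvPolynomial τ ℂ) :
    ∃ F E : (σ → ℂ) → ℂ, IsPoly F ∧ IsPoly E ∧ ∀ a, (∀ t, den t a ≠ 0) →
      E a ≠ 0 ∧ F a = E a * eval (fun t => num t a / den t a) p := by
  induction p using MvPolynomial.induction_on with
  | C c => exact ⟨fun _ => c, fun _ => 1, .const _, .const _, fun a _ => by simp⟩
  | add p q hp hq =>
    obtain ⟨F, E, hF, hE, h⟩ := hp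
    obtain ⟨F', E', hF', hE', h'⟩ := hq
    refine ⟨_, _, (hF.mul hE').add (hF'.mul hE), hE.mul hE', fun a ha => ?_⟩
    obtain ⟨h1, h2⟩ := h a ha
    obtain ⟨h3, h4⟩ := h' a ha
    refine ⟨mul_ne_zero h1 h3, ?_⟩
    rw [h2, h4, map_add]
    ring
  | mul_X p t hp =>
    obtain ⟨F, E, hF, hE, h⟩ := hp
    refine ⟨_, _, hF.mul (hnum t), hE.mul (hden t), fun a ha => ?_⟩
    obtain ⟨h1, h2⟩ := h a ha
    have := ha t
    refine ⟨mul_ne_zero h1 this, ?_⟩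
    rw [h2, map_mul, eval_X]
    field_simp

/-! ### An affine chart of the image variety -/

section Chart

variable {ι κ : Type}

/-- The index type of the affine coordinates of a joint image (not all of them are used). -/
abbrev Param (ι κ : Type) : Type := (Fin 3 × ι × Fin 2) ⊕ (Fin 3 × κ × Fin 2)

/-- The image of a point in an affine chart. -/
def imgVec (b : Param ι κ → ℂ) (v : Fin 3) (i : ι) : Fin 3 → ℂ :=
  ![b (Sum.inl (v, i, 0)), b (Sum.inl (v, i, 1)), 1]

theorem imgVec_ne_zero (b : Param ι κ → ℂ) (v : Fin 3) (i : ι) : imgVec b v i ≠ 0 :=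
  fun h => one_ne_zero (congrFun h 2)

/-- Every line is incident to at most one point. -/
def Problem.OneInc (D : Problem ι κ) : Prop := ∀ j i i', (i, j) ∈ D.inc → (i', j) ∈ D.inc → i = i'

open Classical in
/-- Normalized dual coordinates of the image of a line. -/
noncomputable def lnVec (D : Problem ι κ) (b : Param ι κ → ℂ) (v : Fin 3) (j : κ) : Fin 3 → ℂ :=
  ![1, b (Sum.inr (v, j, 0)),
    if h : ∃ i, i ∈ D.obsPt v ∧ (i, j) ∈ D.inc then
      -(b (Sum.inl (v, h.choose, 0)) + b (Sum.inr (v, j, 0)) * b (Sum.inl (v, h.choose, 1)))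
    else b (Sum.inr (v, j, 1))]

variable (D : Problem ι κ)

@[simp] theorem lnVec_zero (b : Param ι κ → ℂ) (v : Fin 3) (j : κ) : lnVec D b v j 0 = 1 := rfl

@[simp] theorem lnVec_one (b : Param ι κ → ℂ) (v : Fin 3) (j : κ) :
    lnVec D b v j 1 = b (Sum.inr (v, j, 0)) := rfl

theorem lnVec_ne_zero (b : Param ι κ → ℂ) (v : Fin 3) (j : κ) : lnVec D b v j ≠ 0 :=
  fun h => one_ne_zero (congrFun h 0)

variable {D} in
-- An observed point on the line determines the third dual coordinate from the other coordinates.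
-- This makes the chart of the image variety a full affine space. As the incident point is unique,
-- the choice in the definition is immaterial.
theorem lnVec_two_of_inc (hD : D.OneInc) (b : Param ι κ → ℂ) {v : Fin 3} {i : ι} {j : κ}
    (hi : i ∈ D.obsPt v) (hij : (i, j) ∈ D.inc) :
    lnVec D b v j 2 = -(b (Sum.inl (v, i, 0)) + b (Sum.inr (v, j, 0)) * b (Sum.inl (v, i, 1))) := by
  have h : ∃ i, i ∈ D.obsPt v ∧ (i, j) ∈ D.inc := ⟨i, hi, hij⟩
  have hc : h.choose = i := hD j _ _ h.choose_spec.2 hij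
  simp only [lnVec, Matrix.cons_val]
  rw [dif_pos h, hc]

variable {D} in
theorem lnVec_two_of_not {v : Fin 3} {j : κ} (h : ¬ ∃ i, i ∈ D.obsPt v ∧ (i, j) ∈ D.inc)
    (b : Param ι κ → ℂ) : lnVec D b v j 2 = b (Sum.inr (v, j, 1)) := by
  simp only [lnVec, Matrix.cons_val]
  rw [dif_neg h]

variable {D} in
theorem lnVec_dot_imgVec (hD : D.OneInc) (b : Param ι κ → ℂ) {v : Fin 3} {i : ι} {j : κ}
    (hi : i ∈ D.obsPt v) (hij : (i, j) ∈ D.inc) : lnVec D b v j ⬝ᵥ imgVec b v i = 0 := by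
  rw [Matrix.vec3_dotProduct, lnVec_two_of_inc hD b hi hij]
  simp [imgVec]

theorem isPoly_lnVec (v : Fin 3) (j : κ) (k : Fin 3) : IsPoly fun b => lnVec D b v j k := by
  fin_cases k
  · exact .const 1
  · exact .coord _
  · by_cases h : ∃ i, i ∈ D.obsPt v ∧ (i, j) ∈ D.inc
    · simp only [lnVec, dif_pos h]
      exact ((IsPoly.coord _).add ((IsPoly.coord _).mul (.coord _))).neg
    · simp only [lnVec, dif_neg h]
      exact .coord _

theorem isPoly_imgVec (v : Fin 3) (i : ι) (k : Fin 3) :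
    IsPoly fun b : Param ι κ → ℂ => imgVec b v i k := by
  fin_cases k
  · exact .coord _
  · exact .coord _
  · exact .const 1

/-- The joint image with the given affine coordinates. -/
noncomputable def chart (b : Param ι κ → ℂ) : D.Image where
  pt q := Projectivization.mk ℂ (imgVec b q.1.1 q.1.2) (imgVec_ne_zero _ _ _)
  ln q := dualLine (lnVec D b q.1.1 q.1.2) (lnVec_ne_zero _ _ _ _)

variable {D}

theorem chart_mem (hD : D.OneInc) (b : Param ι κ → ℂ) : chart D b ∈ D.imageVariety := by
  intro v i j hi hj hij
  show (Projectivization.mk ℂ _ _).submodule ≤ dualSub _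
  rw [submodule_mk_le]
  exact lnVec_dot_imgVec hD b hi hij

variable (D) in
/-- Coordinates of `chart D b`, where the scaling is prescribed by `a`. -/
noncomputable def scaled (a : ArrCoord D.ObsPt D.ObsLn 3 → ℂ) (b : Param ι κ → ℂ) :
    ArrCoord D.ObsPt D.ObsLn 3 → ℂ
  | .inl (q, k) => ptv a q 2 * imgVec b q.1.1 q.1.2 k
  | .inr (q, r, k) => ![-(lnVec D b q.1.1 q.1.2 1 * lnv a q r 1 +
      lnVec D b q.1.1 q.1.2 2 * lnv a q r 2), lnv a q r 1, lnv a q r 2] k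

theorem isPoly_scaled (a : ArrCoord D.ObsPt D.ObsLn 3 → ℂ) (k : ArrCoord D.ObsPt D.ObsLn 3) :
    IsPoly fun b => scaled D a b k := by
  rcases k with ⟨q, k⟩ | ⟨q, r, k⟩
  · exact (IsPoly.const _).mul (isPoly_imgVec _ _ _)
  · fin_cases k
    · exact (((isPoly_lnVec D _ _ 1).mul (.const _)).add
        ((isPoly_lnVec D _ _ 2).mul (.const _))).neg
    · exact .const _
    · exact .const _

/-- The coordinates `a` belong to the affine chart. -/
def InChart (a : ArrCoord D.ObsPt D.ObsLn 3 → ℂ) : Prop :=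
  (∀ q, ptv a q 2 ≠ 0) ∧ ∀ q, crossProduct (lnv a q 0) (lnv a q 1) 0 ≠ 0

theorem hasCoords_scaled {a : ArrCoord D.ObsPt D.ObsLn 3 → ℂ} (ha : InChart a)
    (b : Param ι κ → ℂ) : (chart D b).HasCoords (scaled D a b) := by
  refine hasCoords_iff.2 ⟨fun q => ?_, fun q => ?_⟩
  · show (Projectivization.mk ℂ _ _).submodule = _
    rw [Projectivization.submodule_mk]
    have : ptv (scaled D a b) q = ptv a q 2 • imgVec b q.1.1 q.1.2 := rfl
    rw [this, Submodule.span_singleton_smul_eq (ha.1 q).isUnit]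
  · symm
    show _ = dualSub _
    have hli : LinearIndependent ℂ ![lnv (scaled D a b) q 0, lnv (scaled D a b) q 1] := by
      rw [linearIndependent_pair_iff_minor]
      refine ⟨1, 2, ?_⟩
      have := ha.2 q
      simpa [cross_apply, lnv, scaled] using this
    refine span_pair_eq_dualSub hli (lnVec_ne_zero _ _ _ _) ?_ ?_ <;>
    · rw [Matrix.vec3_dotProduct]
      simp [lnv, scaled]

variable (D) in
/-- The affine coordinates on which `chart D` depends. -/
def Used : Param ι κ → Prop
  | .inl (v, i, _) => i ∈ D.obsPt v
  | .inr (v, j, k) => j ∈ D.obsLn v ∧ ¬ (k = 1 ∧ ∃ i, i ∈ D.obsPt v ∧ (i, j) ∈ D.inc)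

variable (D) in
open Classical in
/-- Numerators of the affine coordinates of a joint image; unused coordinates are those of `b`. -/
noncomputable def chartNum (b : Param ι κ → ℂ) :
    Param ι κ → (ArrCoord D.ObsPt D.ObsLn 3 → ℂ) → ℂ
  | .inl (v, i, k), a => if h : i ∈ D.obsPt v then ptv a ⟨(v, i), h⟩ k.castSucc
      else b (.inl (v, i, k))
  | .inr (v, j, k), a => if h : Used D (.inr (v, j, k)) then
      crossProduct (lnv a ⟨(v, j), h.1⟩ 0) (lnv a ⟨(v, j), h.1⟩ 1) k.succ else b (.inr (v, j, k))

variable (D) in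
open Classical in
/-- Denominators of the affine coordinates of a joint image. -/
noncomputable def chartDen : Param ι κ → (ArrCoord D.ObsPt D.ObsLn 3 → ℂ) → ℂ
  | .inl (v, i, _), a => if h : i ∈ D.obsPt v then ptv a ⟨(v, i), h⟩ 2 else 1
  | .inr (v, j, k), a => if h : Used D (.inr (v, j, k)) then
      crossProduct (lnv a ⟨(v, j), h.1⟩ 0) (lnv a ⟨(v, j), h.1⟩ 1) 0 else 1

theorem used_zero {v : Fin 3} {j : κ} (h : j ∈ D.obsLn v) : Used D (.inr (v, j, 0)) :=
  ⟨h, fun h => zero_ne_one h.1⟩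

theorem isPoly_ptv {ι κ : Type} {d : ℕ} (i : ι) (k : Fin d) :
    IsPoly fun a : ArrCoord ι κ d → ℂ => ptv a i k := .coord _

theorem isPoly_lnv {ι κ : Type} {d : ℕ} (j : κ) (r : Fin 2) (k : Fin d) :
    IsPoly fun a : ArrCoord ι κ d → ℂ => lnv a j r k := .coord _

theorem isPoly_chartNum (b : Param ι κ → ℂ) (t : Param ι κ) : IsPoly fun a => chartNum D b t a := by
  rcases t with ⟨v, i, k⟩ | ⟨v, j, k⟩
  · by_cases h : i ∈ D.obsPt v
    · simp only [chartNum, dif_pos h]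
      exact isPoly_ptv _ _
    · simp only [chartNum, dif_neg h]
      exact .const _
  · by_cases h : Used D (.inr (v, j, k))
    · simp only [chartNum, dif_pos h]
      exact .cross (fun _ => isPoly_lnv _ _ _) (fun _ => isPoly_lnv _ _ _) _
    · simp only [chartNum, dif_neg h]
      exact .const _

theorem isPoly_chartDen (t : Param ι κ) : IsPoly fun a => chartDen D t a := by
  rcases t with ⟨v, i, k⟩ | ⟨v, j, k⟩
  · by_cases h : i ∈ D.obsPt v
    · simp only [chartDen, dif_pos h]
      exact isPoly_ptv _ _
    · simp only [chartDen, dif_neg h]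
      exact .const _
  · by_cases h : Used D (.inr (v, j, k))
    · simp only [chartDen, dif_pos h]
      exact .cross (fun _ => isPoly_lnv _ _ _) (fun _ => isPoly_lnv _ _ _) _
    · simp only [chartDen, dif_neg h]
      exact .const _

theorem inChart_iff (a : ArrCoord D.ObsPt D.ObsLn 3 → ℂ) :
    InChart a ↔ ∀ t, chartDen D t a ≠ 0 := by
  constructor
  · rintro ⟨h1, h2⟩ (⟨v, i, k⟩ | ⟨v, j, k⟩)
    · by_cases h : i ∈ D.obsPt v
      · simpa only [chartDen, dif_pos h] using h1 _
      · simp only [chartDen, dif_neg h, ne_eq, one_ne_zero, not_false_eq_true]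
    · by_cases h : Used D (.inr (v, j, k))
      · simpa only [chartDen, dif_pos h] using h2 _
      · simp only [chartDen, dif_neg h, ne_eq, one_ne_zero, not_false_eq_true]
  · intro h
    constructor
    · rintro ⟨⟨v, i⟩, hi⟩
      simpa only [chartDen, dif_pos hi] using h (.inl (v, i, 0))
    · rintro ⟨⟨v, j⟩, hj⟩
      simpa only [chartDen, dif_pos (used_zero hj)] using h (.inr (v, j, 0))

/-- Homogeneous coordinates in the chart are recovered from their scaling and their affine
coordinates. A polynomial in homogeneous coordinates thereby becomes, for a fixed scaling, a
polynomial in affine ones. -/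
theorem scaled_chart_coords (hD : D.OneInc) {y : D.Image} (hy : y ∈ D.imageVariety)
    {a : ArrCoord D.ObsPt D.ObsLn 3 → ℂ} (hya : y.HasCoords a) (ha : InChart a)
    (b : Param ι κ → ℂ) :
    scaled D a (fun t => chartNum D b t a / chartDen D t a) = a := by
  set c : Param ι κ → ℂ := fun t => chartNum D b t a / chartDen D t a with hc
  have hpt : ∀ q : D.ObsPt, ptv a q = ptv a q 2 • imgVec c q.1.1 q.1.2 := by
    rintro ⟨⟨v, i⟩, hi⟩
    have h0 := ha.1 ⟨(v, i), hi⟩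
    ext k
    fin_cases k
    · simp only [imgVec, hc, chartNum, chartDen, dif_pos hi, Pi.smul_apply, smul_eq_mul]
      simp [mul_div_cancel₀ _ h0]
    · simp only [imgVec, hc, chartNum, chartDen, dif_pos hi, Pi.smul_apply, smul_eq_mul]
      simp [mul_div_cancel₀ _ h0]
    · simp [imgVec]
  have hln : ∀ q : D.ObsLn, crossProduct (lnv a q 0) (lnv a q 1) =
      crossProduct (lnv a q 0) (lnv a q 1) 0 • lnVec D c q.1.1 q.1.2 := by
    rintro ⟨⟨v, j⟩, hj⟩
    have h0 := ha.2 ⟨(v, j), hj⟩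
    have h1 : c (.inr (v, j, 0)) = crossProduct (lnv a ⟨(v, j), hj⟩ 0) (lnv a ⟨(v, j), hj⟩ 1) 1 /
        crossProduct (lnv a ⟨(v, j), hj⟩ 0) (lnv a ⟨(v, j), hj⟩ 1) 0 := by
      simp only [hc, chartNum, chartDen, dif_pos (used_zero hj)]
      rfl
    ext k
    fin_cases k
    · simp
    · simp only [Fin.mk_one, Pi.smul_apply, smul_eq_mul, lnVec_one, h1]
      rw [mul_div_cancel₀ _ h0]
    · show _ = _ * lnVec D c v j 2
      by_cases h : ∃ i, i ∈ D.obsPt v ∧ (i, j) ∈ D.inc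
      · obtain ⟨i, hi, hij⟩ := h
        have h3 := (hya.onLine_iff _ _).1 (hy v i j hi hj hij)
        rw [span_pair_eq_dualSub_cross (hya.linearIndependent _), mem_dualSub, hpt,
          dotProduct_smul, smul_eq_zero, or_iff_right (ha.1 _), Matrix.vec3_dotProduct] at h3
        rw [lnVec_two_of_inc hD c hi hij, h1]
        simp only [imgVec, Matrix.cons_val] at h3
        field_simp
        simp only [Fin.reduceFinMk]
        linear_combination h3
      · have hu : Used D (.inr (v, j, 1)) := ⟨hj, fun h' => h h'.2⟩
        rw [lnVec_two_of_not h]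
        simp only [hc, chartNum, chartDen, dif_pos hu]
        rw [mul_div_cancel₀ _ h0]
        rfl
  funext k
  rcases k with ⟨q, k⟩ | ⟨q, r, k⟩
  · exact (congrFun (hpt q) k).symm
  · have h0 := ha.2 q
    have h1 : crossProduct (lnv a q 0) (lnv a q 1) ⬝ᵥ lnv a q r = 0 := by
      rw [dotProduct_comm]
      rcases Fin.exists_fin_two.1 ⟨r, rfl⟩ with h | h <;> rw [← h]
      · exact dot_self_cross _ _
      · exact dot_cross_self _ _
    rw [hln, smul_dotProduct, smul_eq_zero, or_iff_right h0, Matrix.vec3_dotProduct,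
      lnVec_zero, one_mul] at h1
    fin_cases k
    · show -(_ + _) = lnv a q r 0
      linear_combination -h1
    · rfl
    · rfl

theorem eq_chart (hD : D.OneInc) {y : D.Image} (hy : y ∈ D.imageVariety)
    {a : ArrCoord D.ObsPt D.ObsLn 3 → ℂ} (hya : y.HasCoords a) (ha : InChart a)
    (b : Param ι κ → ℂ) : y = chart D (fun t => chartNum D b t a / chartDen D t a) := by
  have h := hasCoords_scaled ha (fun t => chartNum D b t a / chartDen D t a)
  rw [scaled_chart_coords hD hy hya ha b] at h
  exact hya.unique h

end Chart

end PointLine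

namespace PointLine

open MvPolynomial

/-! ### Generic joint images and the affine chart -/

section Dense

variable {σ T : Type}

/-- The set `F ≠ 0` is dense in `V`. -/
def DenseOn (rep : T → (σ → ℂ) → Prop) (V : Set T) (F : (σ → ℂ) → ℂ) : Prop :=
  ∀ G : (σ → ℂ) → ℂ, IsPoly G → (∀ t ∈ V, ∀ a, rep t a → F a ≠ 0 → G a = 0) →
    ∀ t ∈ V, ∀ a, rep t a → G a = 0

theorem genericOn_iff {rep : T → (σ → ℂ) → Prop} {V : Set T} {Q : T → Prop} :
    GenericOn rep V Q ↔ ∃ F, IsPoly F ∧ DenseOn rep V F ∧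
      ∀ t ∈ V, ∀ a, rep t a → F a ≠ 0 → Q t := by
  constructor
  · rintro ⟨f, hf, hQ⟩
    refine ⟨_, .of_eval f, ?_, hQ⟩
    rintro G ⟨g, hg⟩ h t ht a ha
    rw [← hg]
    exact hf g (fun t ht a ha h' => by rw [hg]; exact h t ht a ha h') t ht a ha
  · rintro ⟨F, ⟨f, hf⟩, hd, hQ⟩
    refine ⟨f, fun g h t ht a ha => ?_, fun t ht a ha h => hQ t ht a ha (by rwa [← hf])⟩
    exact hd _ (.of_eval g) (fun t ht a ha h' => h t ht a ha (by rwa [hf])) t ht a ha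

/-- A set is dense if every point is joined to it by a line segment. -/
theorem DenseOn.of_segment {rep : T → (σ → ℂ) → Prop} {V : Set T} {F : (σ → ℂ) → ℂ} (hF : IsPoly F)
    (h : ∀ t ∈ V, ∀ a, rep t a → ∃ a', F a' ≠ 0 ∧ ∃ q : Polynomial ℂ, q ≠ 0 ∧
      ∀ s, q.eval s ≠ 0 → ∃ t' ∈ V, rep t' fun i => a i + s * (a' i - a i)) : DenseOn rep V F := by
  intro G hG hz t ht a ha
  obtain ⟨a', ha', q, hq, hs⟩ := h t ht a ha
  obtain ⟨g, hg⟩ := hG.exists_polynomial a fun i => a' i - a i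
  obtain ⟨f, hf⟩ := hF.exists_polynomial a fun i => a' i - a i
  have hf0 : f ≠ 0 := by
    rintro rfl
    have := hf 1
    simp only [Polynomial.eval_zero, one_mul, add_sub_cancel] at this
    exact ha' this.symm
  -- The restriction of `G` to the segment vanishes off the zeros of `f` and `q`, hence everywhere;
  -- the given point is the value at `0`.
  have hprod : g * (f * q) = 0 := by
    refine Polynomial.funext fun s => ?_
    rw [Polynomial.eval_mul, Polynomial.eval_mul, Polynomial.eval_zero]
    by_cases h1 : q.eval s = 0
    · simp [h1]
    by_cases h2 : f.eval s = 0
    · simp [h2]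
    obtain ⟨t', ht', hr⟩ := hs s h1
    rw [hg, hz t' ht' _ hr (by rwa [← hf]), zero_mul]
  have hg0 : g = 0 := (mul_eq_zero.1 hprod).resolve_right (mul_ne_zero hf0 hq)
  have := hg 0
  simp only [hg0, Polynomial.eval_zero, zero_mul, add_zero] at this
  exact this.symm

theorem DenseOn.exists_ne {rep : T → (σ → ℂ) → Prop} {V : Set T} {F G : (σ → ℂ) → ℂ}
    (hF : DenseOn rep V F) (hG : IsPoly G) {t : T} (ht : t ∈ V) {a : σ → ℂ} (ha : rep t a)
    (h : G a ≠ 0) : ∃ t ∈ V, ∃ a, rep t a ∧ F a ≠ 0 ∧ G a ≠ 0 := by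
  by_contra! hc
  exact h (hF G hG (fun t ht a ha h' => hc t ht a ha h') t ht a ha)

end Dense

section ChartDense

variable {ι κ : Type} {D : Problem ι κ}

theorem det_one_add_smul_polynomial {n : ℕ} {M : Matrix (Fin n) (Fin n) ℂ} (hM : M.det ≠ 0) :
    ∃ q : Polynomial ℂ, q ≠ 0 ∧ ∀ s, q.eval s = (1 + s • (M - 1)).det := by
  have hP : IsPoly (fun z : Fin n × Fin n → ℂ => (Matrix.of fun i j => z (i, j)).det) :=
    .det fun r i => .coord (r, i)
  obtain ⟨q, hq⟩ := hP.exists_polynomial (fun p => (1 : Matrix (Fin n) (Fin n) ℂ) p.1 p.2)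
    (fun p => (M - 1) p.1 p.2)
  have h2 : ∀ s, q.eval s = (1 + s • (M - 1)).det := hq
  refine ⟨q, ?_, h2⟩
  rintro rfl
  have := h2 1
  rw [one_smul, add_sub_cancel, Polynomial.eval_zero] at this
  exact hM this.symm

theorem linearIndependent_mulVec {n : ℕ} {M : Matrix (Fin n) (Fin n) ℂ} (hM : M.det ≠ 0)
    {u w : Fin n → ℂ} (h : LinearIndependent ℂ ![u, w]) :
    LinearIndependent ℂ ![M.mulVec u, M.mulVec w] := by
  have hinj : LinearMap.ker M.mulVecLin = ⊥ :=
    LinearMap.ker_eq_bot.2 (Matrix.mulVec_injective_iff_isUnit.2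
      ((Matrix.isUnit_iff_isUnit_det M).2 hM.isUnit))
  have h1 := h.map' M.mulVecLin hinj
  have e : M.mulVecLin ∘ ![u, w] = ![M.mulVec u, M.mulVec w] := by
    ext i : 1
    fin_cases i <;> rfl
  rwa [e] at h1

theorem mulVec_ne_zero {n : ℕ} {M : Matrix (Fin n) (Fin n) ℂ} (hM : M.det ≠ 0)
    {u : Fin n → ℂ} (h : u ≠ 0) : M.mulVec u ≠ 0 := fun h0 =>
  h (Matrix.eq_zero_of_mulVec_eq_zero hM h0)

theorem mulVec_mem_span_pair {m n : ℕ} (M : Matrix (Fin m) (Fin n) ℂ) {x u w : Fin n → ℂ}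
    (h : x ∈ Submodule.span ℂ {u, w}) : M.mulVec x ∈ Submodule.span ℂ {M.mulVec u, M.mulVec w} := by
  obtain ⟨a, b, rfl⟩ := Submodule.mem_span_pair.1 h
  rw [Matrix.mulVec_add, Matrix.mulVec_smul, Matrix.mulVec_smul]
  exact Submodule.mem_span_pair.2 ⟨a, b, rfl⟩

/-- Some matrix maps finitely many given points and lines into the affine chart. -/
theorem exists_matrix_inChart [Finite ι] [Finite κ] (a : ArrCoord D.ObsPt D.ObsLn 3 → ℂ)
    (h1 : ∀ q, ptv a q ≠ 0) (h2 : ∀ q, LinearIndependent ℂ ![lnv a q 0, lnv a q 1]) :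
    ∃ M : Matrix (Fin 3) (Fin 3) ℂ, M.det ≠ 0 ∧ (∀ q, M.mulVec (ptv a q) 2 ≠ 0) ∧
      ∀ q, crossProduct (M.mulVec (lnv a q 0)) (M.mulVec (lnv a q 1)) 0 ≠ 0 := by
  let mat : (Fin 3 × Fin 3 → ℂ) → Matrix (Fin 3) (Fin 3) ℂ := fun z => Matrix.of fun i j => z (i, j)
  have hmat : ∀ r i, IsPoly fun z => mat z r i := fun r i => .coord (r, i)
  have g0 : Gen fun z => (mat z).det ≠ 0 := by
    refine (IsPoly.det hmat).gen (b := fun p => (1 : Matrix (Fin 3) (Fin 3) ℂ) p.1 p.2) ?_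
    show (1 : Matrix (Fin 3) (Fin 3) ℂ).det ≠ 0
    simp
  have g1 : Gen fun z => ∀ q, (mat z).mulVec (ptv a q) 2 ≠ 0 := by
    refine Gen.all fun q => ?_
    obtain ⟨k, hk⟩ := Function.ne_iff.1 (h1 q)
    refine (IsPoly.mulVec (w := fun _ => ptv a q) hmat (fun _ => .const _) 2).gen
      (b := fun p => if p = (2, k) then 1 else 0) ?_
    simpa [mat, Matrix.mulVec, dotProduct] using hk
  have g2 : Gen fun z => ∀ q, crossProduct ((mat z).mulVec (lnv a q 0))
      ((mat z).mulVec (lnv a q 1)) 0 ≠ 0 := by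
    refine Gen.all fun q => ?_
    -- The witness matrix has rows `1` and `2` that pick the coordinates `k` and `l`, so the entry
    -- of the cross product is the nonzero minor.
    obtain ⟨k, l, hkl⟩ := linearIndependent_pair_iff_minor.1 (h2 q)
    refine (IsPoly.cross (IsPoly.mulVec (w := fun _ => lnv a q 0) hmat fun _ => .const _)
      (IsPoly.mulVec (w := fun _ => lnv a q 1) hmat fun _ => .const _) 0).gen
      (b := fun p => if p = (1, k) then 1 else if p = (2, l) then 1 else 0) ?_
    have e1 : ∀ u : Fin 3 → ℂ, (mat fun p => if p = (1, k) then 1 else if p = (2, l) then 1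
        else 0).mulVec u 1 = u k := fun u => by
      simp [mat, Matrix.mulVec, dotProduct]
    have e2 : ∀ u : Fin 3 → ℂ, (mat fun p => if p = (1, k) then 1 else if p = (2, l) then 1
        else 0).mulVec u 2 = u l := fun u => by
      simp [mat, Matrix.mulVec, dotProduct]
    simp only [cross_apply, Matrix.cons_val_zero, e1, e2]
    exact hkl
  obtain ⟨z, ⟨h0, h1⟩, h2⟩ := ((g0.and g1).and g2).exists
  exact ⟨mat z, h0, h1, h2⟩

variable (D) in
/-- The product of all denominators of the affine chart. -/
noncomputable def chartDenProd [Fintype ι] [Fintype κ] (a : ArrCoord D.ObsPt D.ObsLn 3 → ℂ) : ℂ :=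
  ∏ t, chartDen D t a

theorem isPoly_chartDenProd [Fintype ι] [Fintype κ] : IsPoly fun a => chartDenProd D a :=
  .prod _ fun t _ => isPoly_chartDen t

theorem chartDenProd_ne_zero [Fintype ι] [Fintype κ] {a : ArrCoord D.ObsPt D.ObsLn 3 → ℂ} :
    chartDenProd D a ≠ 0 ↔ InChart a := by
  rw [chartDenProd, Finset.prod_ne_zero_iff, inChart_iff]
  simp

/-- The image under a matrix of an arrangement, in coordinates. -/
def matAct {d : ℕ} (M : Matrix (Fin d) (Fin d) ℂ) {ι' κ' : Type} (a : ArrCoord ι' κ' d → ℂ) :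
    ArrCoord ι' κ' d → ℂ
  | .inl (i, k) => M.mulVec (ptv a i) k
  | .inr (j, r, k) => M.mulVec (lnv a j r) k

theorem add_smul_matAct_sub {d : ℕ} (M : Matrix (Fin d) (Fin d) ℂ) {ι' κ' : Type}
    (a : ArrCoord ι' κ' d → ℂ) (s : ℂ) :
    (fun i => a i + s * (matAct M a i - a i)) = matAct (1 + s • (M - 1)) a := by
  funext k
  rcases k with ⟨i, k⟩ | ⟨j, r, k⟩
  · simp [matAct, Matrix.add_mulVec, Matrix.smul_mulVec, Matrix.sub_mulVec, ptv]
  · simp [matAct, Matrix.add_mulVec, Matrix.smul_mulVec, Matrix.sub_mulVec, lnv]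

/-- Some projective transformation moves all points and lines of an image into the chart. The
segment from the identity to it consists of invertible matrices up to finitely many exceptions, and
these preserve incidences, so the image is joined to the chart inside the variety. -/
theorem denseOn_chart [Fintype ι] [Fintype κ] :
    DenseOn Arrangement.HasCoords D.imageVariety fun a => chartDenProd D a := by
  refine .of_segment isPoly_chartDenProd fun y hy a hya => ?_
  obtain ⟨M, hM, h1, h2⟩ := exists_matrix_inChart a hya.ptv_ne_zero hya.linearIndependent
  obtain ⟨q, hq, hqs⟩ := det_one_add_smul_polynomial hM
  refine ⟨matAct M a, chartDenProd_ne_zero.2 ⟨h1, h2⟩, q, hq, fun s hs => ?_⟩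
  rw [hqs] at hs
  rw [add_smul_matAct_sub]
  obtain ⟨y', hy'⟩ := exists_hasCoords (a := matAct (1 + s • (M - 1)) a)
    (fun i => mulVec_ne_zero hs (hya.ptv_ne_zero i))
    (fun j => linearIndependent_mulVec hs (hya.linearIndependent j))
  refine ⟨y', fun v i j hi hj hij => ?_, hy'⟩
  rw [hy'.onLine_iff]
  exact mulVec_mem_span_pair _ ((hya.onLine_iff _ _).1 (hy v i j hi hj hij))

theorem cross_scaled (a : ArrCoord D.ObsPt D.ObsLn 3 → ℂ) (b : Param ι κ → ℂ) (q : D.ObsLn) :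
    crossProduct (lnv (scaled D a b) q 0) (lnv (scaled D a b) q 1) =
      crossProduct (lnv a q 0) (lnv a q 1) 0 • lnVec D b q.1.1 q.1.2 := by
  ext k
  fin_cases k
  · simp [cross_apply, lnv, scaled]
  · simp [cross_apply, lnv, scaled]
    ring
  · simp [cross_apply, lnv, scaled]
    ring

theorem inChart_scaled {a : ArrCoord D.ObsPt D.ObsLn 3 → ℂ} (ha : InChart a) (b : Param ι κ → ℂ) :
    InChart (scaled D a b) := by
  refine ⟨fun q => ?_, fun q => ?_⟩
  · simpa [ptv, scaled, imgVec] using ha.1 q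
  · rw [cross_scaled]
    simpa using ha.2 q

open Classical in
theorem chartNum_scaled {a : ArrCoord D.ObsPt D.ObsLn 3 → ℂ} (ha : InChart a)
    (b0 b : Param ι κ → ℂ) (t : Param ι κ) :
    chartNum D b0 t (scaled D a b) / chartDen D t (scaled D a b) =
      if Used D t then b t else b0 t := by
  by_cases ht : Used D t
  · rw [if_pos ht]
    have hden := (inChart_iff _).1 (inChart_scaled ha b) t
    rcases t with ⟨v, i, k⟩ | ⟨v, j, k⟩
    · rw [div_eq_iff hden]
      simp only [chartNum, chartDen, dif_pos (show i ∈ D.obsPt v from ht)]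
      fin_cases k <;> simp [ptv, scaled, imgVec, mul_comm]
    · rw [div_eq_iff hden]
      simp only [chartNum, chartDen, dif_pos ht, cross_scaled]
      rcases Fin.exists_fin_two.1 ⟨k, rfl⟩ with rfl | rfl
      · simp [mul_comm]
      · have h : ¬ ∃ i, i ∈ D.obsPt v ∧ (i, j) ∈ D.inc := fun h => ht.2 ⟨rfl, h⟩
        simp [lnVec_two_of_not h, mul_comm]
  · rw [if_neg ht]
    rcases t with ⟨v, i, k⟩ | ⟨v, j, k⟩
    · simp only [chartNum, chartDen, dif_neg (show ¬ i ∈ D.obsPt v from ht), div_one]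
    · simp only [chartNum, chartDen, dif_neg ht, div_one]

open Classical in
/-- Genericity of a property of joint images can be tested in the affine chart. -/
theorem genericImage_iff [Finite ι] [Finite κ] (hD : D.OneInc) {Q : D.Image → Prop} :
    D.GenericImage Q ↔ Gen fun b => Q (chart D b) := by
  cases nonempty_fintype ι
  cases nonempty_fintype κ
  rw [Problem.GenericImage, genericOn_iff]
  constructor
  · rintro ⟨F, hF, hd, hQ⟩
    -- Any coordinates in the chart serve here: they show that the dense set `F ≠ 0` meets the
    -- chart.
    let a0 : ArrCoord D.ObsPt D.ObsLn 3 → ℂ := fun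
      | .inl _ => 1
      | .inr (_, r, k) => if k = r.succ then 1 else 0
    have ha0 : InChart a0 := ⟨fun q => by simp [ptv, a0], fun q => by
      simp [cross_apply, lnv, a0]⟩
    obtain ⟨y, hy, a, hya, hFa, hden⟩ := hd.exists_ne isPoly_chartDenProd
      (chart_mem hD 0) (hasCoords_scaled ha0 0) (chartDenProd_ne_zero.2 (by
        refine ⟨fun q => ?_, fun q => ?_⟩
        · simp [ptv, scaled, a0, imgVec]
        · simp [cross_apply, lnv, scaled, a0]))
    rw [chartDenProd_ne_zero] at hden
    -- For the fixed scaling `a` this polynomial is nonzero at the affine coordinates of `y`.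
    have hP : IsPoly fun b => F (scaled D a b) := hF.comp fun k => isPoly_scaled a k
    refine (hP.gen (b := fun t => chartNum D 0 t a / chartDen D t a) ?_).mono fun b hb =>
      hQ _ (chart_mem hD b) _ (hasCoords_scaled hden b) hb
    rwa [scaled_chart_coords hD hy hya hden 0]
  · rintro ⟨f, hf, hQ⟩
    obtain ⟨b0, hb0⟩ := exists_eval_ne_zero hf
    -- The polynomial `f` may involve affine coordinates that the chart does not use. These are
    -- frozen at their values in `b0`, where `f` does not vanish.
    obtain ⟨F, E, hF, hE, h⟩ := exists_clear_denominators (isPoly_chartNum (D := D) b0)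
      isPoly_chartDen f
    refine ⟨_, hF.mul isPoly_chartDenProd, fun G hG hz y hy a hya => ?_, fun y hy a hya hFa => ?_⟩
    · refine denseOn_chart G hG (fun y hy a hya ha => ?_) y hy a hya
      rw [chartDenProd_ne_zero] at ha
      let m : (Param ι κ → ℂ) → Param ι κ → ℂ := fun b t => if Used D t then b t else b0 t
      have hm : ∀ b t, chartNum D b0 t (scaled D a b) / chartDen D t (scaled D a b) = m b t :=
        fun b t => chartNum_scaled ha b0 b t
      have hP : IsPoly fun b => G (scaled D a b) := hG.comp fun k => isPoly_scaled a k
      have hfm : IsPoly fun b => eval (m b) f := (IsPoly.of_eval f).comp fun t => by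
        by_cases h : Used D t
        · simpa only [m, if_pos h] using .coord t
        · simpa only [m, if_neg h] using .const _
      have hm0 : m b0 = b0 := by
        funext t
        simp [m]
      have hall : ∀ b, G (scaled D a b) = 0 := by
        by_contra! hc
        obtain ⟨b1, hb1⟩ := hc
        obtain ⟨b, h1, h2⟩ := ((hP.gen hb1).and (hfm.gen (b := b0) (by rwa [hm0]))).exists
        refine h1 (hz _ (chart_mem hD b) _ (hasCoords_scaled ha b) (mul_ne_zero ?_ ?_))
        · obtain ⟨h3, h4⟩ := h (scaled D a b) ((inChart_iff _).1 (inChart_scaled ha b))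
          rw [h4, funext (hm b)]
          exact mul_ne_zero h3 h2
        · exact chartDenProd_ne_zero.2 (inChart_scaled ha b)
      have := hall fun t => chartNum D b0 t a / chartDen D t a
      rwa [scaled_chart_coords hD hy hya ha b0] at this
    · obtain ⟨h1, h2⟩ := mul_ne_zero_iff.1 hFa
      rw [chartDenProd_ne_zero] at h2
      obtain ⟨h3, h4⟩ := h a ((inChart_iff a).1 h2)
      rw [eq_chart hD hy hya h2 b0]
      refine hQ _ fun h0 => h1 ?_
      rw [h4, h0, mul_zero]

end ChartDense

end PointLine

namespace PointLine

open MvPolynomial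

/-! ### Camera centres -/

section Cameras

/-- The centre of a camera. -/
def center (M : Matrix (Fin 3) (Fin 4) ℂ) : Fin 4 → ℂ :=
  Fin.snoc (-((rot M).transpose.mulVec (trans M))) 1

@[simp] theorem center_three (M : Matrix (Fin 3) (Fin 4) ℂ) : center M 3 = 1 := rfl

theorem center_castSucc (M : Matrix (Fin 3) (Fin 4) ℂ) (k : Fin 3) :
    center M k.castSucc = -((rot M).transpose.mulVec (trans M)) k :=
  Fin.snoc_castSucc (α := fun _ => ℂ) 1 (-((rot M).transpose.mulVec (trans M))) k

theorem mulVec_eq_rot_add (M : Matrix (Fin 3) (Fin 4) ℂ) (z : Fin 4 → ℂ) :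
    M.mulVec z = (rot M).mulVec (fun k => z k.castSucc) + z 3 • trans M := by
  ext r
  rw [Matrix.mulVec, dotProduct, Fin.sum_univ_castSucc]
  simp only [Pi.add_apply, Pi.smul_apply, smul_eq_mul, Matrix.mulVec, dotProduct, rot, trans,
    Matrix.submatrix_apply, id]
  rw [mul_comm (z 3)]
  rfl

theorem mulVec_center {M : Matrix (Fin 3) (Fin 4) ℂ} (h : rot M * (rot M).transpose = 1) :
    M.mulVec (center M) = 0 := by
  rw [mulVec_eq_rot_add]
  have : (fun k : Fin 3 => center M k.castSucc) = -((rot M).transpose.mulVec (trans M)) :=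
    funext fun k => center_castSucc M k
  rw [this, Matrix.mulVec_neg, Matrix.mulVec_mulVec, h]
  simp

theorem eq_smul_center {M : Matrix (Fin 3) (Fin 4) ℂ} (h : rot M * (rot M).transpose = 1)
    {z : Fin 4 → ℂ} (hz : M.mulVec z = 0) : z = z 3 • center M := by
  have h' : (rot M).transpose * rot M = 1 := mul_eq_one_comm.1 h
  have h1 : (fun k : Fin 3 => z k.castSucc) = z 3 • -((rot M).transpose.mulVec (trans M)) := by
    rw [mulVec_eq_rot_add] at hz
    have := congrArg ((rot M).transpose.mulVec) hz
    rw [Matrix.mulVec_add, Matrix.mulVec_mulVec, h', Matrix.mulVec_smul, Matrix.mulVec_zero,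
      Matrix.one_mulVec] at this
    rw [smul_neg]
    exact eq_neg_of_add_eq_zero_left this
  ext k
  refine Fin.lastCases ?_ (fun k => ?_) k
  · simp [show Fin.last 3 = 3 from rfl]
  · rw [Pi.smul_apply, center_castSucc]
    exact congrFun h1 k

/-- The determinant of four vectors. -/
def quad (a b c d : Fin 4 → ℂ) : ℂ := (Matrix.of ![a, b, c, d]).det

theorem quad_ne_zero_iff {a b c d : Fin 4 → ℂ} :
    quad a b c d ≠ 0 ↔ LinearIndependent ℂ ![a, b, c, d] := by
  have h := Matrix.linearIndependent_rows_iff_isUnit (A := Matrix.of ![a, b, c, d])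
  rw [Matrix.isUnit_iff_isUnit_det, isUnit_iff_ne_zero] at h
  exact h.symm

theorem exists_coeffs_of_quad {a b c d : Fin 4 → ℂ} (h : quad a b c d ≠ 0) (z : Fin 4 → ℂ) :
    ∃ α β γ δ : ℂ, z = α • a + β • b + γ • c + δ • d := by
  have hli := quad_ne_zero_iff.1 h
  have hs := hli.span_eq_top_of_card_eq_finrank (by simp)
  have hz : z ∈ Submodule.span ℂ (Set.range ![a, b, c, d]) := by rw [hs]; trivial
  obtain ⟨f, hf⟩ := (Submodule.mem_span_range_iff_exists_fun ℂ).1 hz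
  refine ⟨f 0, f 1, f 2, f 3, ?_⟩
  rw [← hf, Fin.sum_univ_four]
  rfl

theorem coeffs_eq_zero_of_quad {a b c d : Fin 4 → ℂ} (h : quad a b c d ≠ 0) {α β γ δ : ℂ}
    (hz : α • a + β • b + γ • c + δ • d = 0) : α = 0 ∧ β = 0 ∧ γ = 0 ∧ δ = 0 := by
  have hli := quad_ne_zero_iff.1 h
  have := Fintype.linearIndependent_iff.1 hli ![α, β, γ, δ] (by
    rw [Fin.sum_univ_four]
    exact hz)
  exact ⟨this 0, this 1, this 2, this 3⟩

theorem isPoly_quad {σ : Type} {a b c d : (σ → ℂ) → Fin 4 → ℂ} (ha : ∀ i, IsPoly fun x => a x i)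
    (hb : ∀ i, IsPoly fun x => b x i) (hc : ∀ i, IsPoly fun x => c x i)
    (hd : ∀ i, IsPoly fun x => d x i) : IsPoly fun x => quad (a x) (b x) (c x) (d x) := by
  refine IsPoly.det fun r i => ?_
  fin_cases r
  exacts [ha i, hb i, hc i, hd i]

theorem isPoly_center {σ : Type} {M : (σ → ℂ) → Matrix (Fin 3) (Fin 4) ℂ}
    (hM : ∀ r k, IsPoly fun x => M x r k) (k : Fin 4) : IsPoly fun x => center (M x) k := by
  refine Fin.lastCases ?_ (fun k => ?_) k
  · simpa only [show Fin.last 3 = 3 from rfl, center_three] using IsPoly.const 1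
  · simp only [center_castSucc]
    exact (IsPoly.mulVec (M := fun x => (rot (M x)).transpose) (w := fun x => trans (M x))
      (fun r i => hM i r.castSucc) (fun i => hM i 3) k).neg

theorem rot_mul_transpose {P : Cameras} (hP : P ∈ camVariety) (v : Fin 3) :
    rot (P v) * (rot (P v)).transpose = 1 := (hP.1 v).1

end Cameras

/-! ### Solutions in coordinates -/

section Solutions

variable {ι κ : Type}

/-- The vectors that describe an arrangement in space: one for every point, and two for every line,
where the first one is shared with the incident point if there is one. -/
abbrev Slot (ι κ : Type) : Type := (ι ⊕ κ) ⊕ κ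

open Classical in
/-- The slot of the first vector of a line. -/
noncomputable def base (D : Problem ι κ) (j : κ) : ι ⊕ κ :=
  if h : ∃ i, (i, j) ∈ D.inc then Sum.inl h.choose else Sum.inr j

theorem base_of_inc {D : Problem ι κ} (hD : D.OneInc) {i : ι} {j : κ} (h : (i, j) ∈ D.inc) :
    base D j = Sum.inl i := by
  have h' : ∃ i, (i, j) ∈ D.inc := ⟨i, h⟩
  rw [base, dif_pos h', hD j _ _ h'.choose_spec h]

theorem base_of_free {D : Problem ι κ} {j : κ} (h : ¬ ∃ i, (i, j) ∈ D.inc) :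
    base D j = Sum.inr j := dif_neg h

/-- The first vector of a line. -/
noncomputable def fst (D : Problem ι κ) (e : Slot ι κ → Fin 4 → ℂ) (j : κ) : Fin 4 → ℂ :=
  e (.inl (base D j))

/-- The second vector of a line. -/
def snd (e : Slot ι κ → Fin 4 → ℂ) (j : κ) : Fin 4 → ℂ := e (.inr j)

/-- The vector of a point. -/
def pnt (e : Slot ι κ → Fin 4 → ℂ) (i : ι) : Fin 4 → ℂ := e (.inl (.inl i))

theorem fst_of_inc {D : Problem ι κ} (hD : D.OneInc) (e : Slot ι κ → Fin 4 → ℂ) {i : ι} {j : κ}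
    (h : (i, j) ∈ D.inc) : fst D e j = pnt e i := by rw [fst, base_of_inc hD h, pnt]

/-- The cameras `P` and the space arrangement with coordinates `e` are a solution for the joint
image with affine coordinates `b`. -/
structure Sol (D : Problem ι κ) (b : Param ι κ → ℂ) (P : Cameras) (e : Slot ι κ → Fin 4 → ℂ) :
    Prop where
  cam : P ∈ camVariety
  pnt_ne : ∀ i, ∃ k, pnt e i k ≠ 0
  indep : ∀ j, ∃ k l, fst D e j k * snd e j l - fst D e j l * snd e j k ≠ 0
  pt : ∀ v i, i ∈ D.obsPt v → (P v).mulVec (pnt e i) 2 ≠ 0 ∧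
    ∀ k, (P v).mulVec (pnt e i) k = (P v).mulVec (pnt e i) 2 * imgVec b v i k
  ln : ∀ v j, j ∈ D.obsLn v →
    crossProduct ((P v).mulVec (fst D e j)) ((P v).mulVec (snd e j)) 0 ≠ 0 ∧
    ∀ k, crossProduct ((P v).mulVec (fst D e j)) ((P v).mulVec (snd e j)) k =
      crossProduct ((P v).mulVec (fst D e j)) ((P v).mulVec (snd e j)) 0 * lnVec D b v j k

/-- The arrangement `A` has coordinates `e`. -/
def Rep (D : Problem ι κ) (A : Arrangement ι κ 4) (e : Slot ι κ → Fin 4 → ℂ) : Prop :=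
  (∀ i, (A.pt i).submodule = Submodule.span ℂ {pnt e i}) ∧
    ∀ j, (A.ln j).1 = Submodule.span ℂ {fst D e j, snd e j}

/-- The first spanning vector of a line with an incident point is taken to be the vector of this
point. Incidences are then built into the coordinates, and the slots are free parameters. -/
theorem exists_rep {D : Problem ι κ} (hD : D.OneInc) {A : Arrangement ι κ 4}
    (hA : A ∈ D.spaceVariety) : ∃ e, Rep D A e := by
  choose x hx0 hx using fun i => (A.pt i).exists_mk
  have h1 : ∀ j, ∃ uw : (Fin 4 → ℂ) × (Fin 4 → ℂ), (A.ln j).1 = Submodule.span ℂ {uw.1, uw.2} ∧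
      ∀ i, (i, j) ∈ D.inc → uw.1 = x i := by
    intro j
    by_cases h : ∃ i, (i, j) ∈ D.inc
    · obtain ⟨i, hij⟩ := h
      have hmem : x i ∈ (A.ln j).1 := by
        have := hA i j hij
        rw [OnLine, hx, Submodule.span_singleton_le_iff_mem] at this
        exact this
      obtain ⟨w, -, hw⟩ := (A.ln j).exists_span_of_mem (hx0 i) hmem
      exact ⟨(x i, w), hw, fun i' hi' => by rw [hD j _ _ hij hi']⟩
    · obtain ⟨u, w, -, hw⟩ := (A.ln j).exists_span
      exact ⟨(u, w), hw, fun i hi => absurd ⟨i, hi⟩ h⟩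
  choose uw huw hinc using h1
  let e : Slot ι κ → Fin 4 → ℂ := Sum.elim (Sum.elim x fun j => (uw j).1) fun j => (uw j).2
  refine ⟨e, hx, fun j => ?_⟩
  rw [huw]
  by_cases h : ∃ i, (i, j) ∈ D.inc
  · obtain ⟨i, hij⟩ := h
    rw [fst_of_inc hD e hij, hinc j i hij]
    rfl
  · rw [fst, base_of_free h]
    rfl

theorem Sol.exists_rep {D : Problem ι κ} {b : Param ι κ → ℂ} {P : Cameras}
    {e : Slot ι κ → Fin 4 → ℂ} (h : Sol D b P e) : ∃ A, Rep D A e :=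
  ⟨⟨fun i => Projectivization.mk ℂ (pnt e i) (Function.ne_iff.2 (h.pnt_ne i)),
    fun j => mkLine _ _ (linearIndependent_pair_iff_minor.2 (h.indep j))⟩,
    fun _ => Projectivization.submodule_mk _ _, fun _ => rfl⟩

theorem Rep.mem_spaceVariety {D : Problem ι κ} (hD : D.OneInc) {A : Arrangement ι κ 4}
    {e : Slot ι κ → Fin 4 → ℂ} (h : Rep D A e) : A ∈ D.spaceVariety := by
  intro i j hij
  rw [OnLine, h.1, h.2, fst_of_inc hD e hij, Submodule.span_singleton_le_iff_mem]
  exact Submodule.subset_span (by simp)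

theorem Rep.sol_iff {D : Problem ι κ} (hD : D.OneInc) {A : Arrangement ι κ 4}
    {e : Slot ι κ → Fin 4 → ℂ} (h : Rep D A e) {b : Param ι κ → ℂ} {P : Cameras} :
    Sol D b P e ↔ (A, P) ∈ D.solutions (chart D b) := by
  have key : D.IsJointImage A P (chart D b) ↔
      (∀ v i, i ∈ D.obsPt v → (P v).mulVec (pnt e i) 2 ≠ 0 ∧
        ∀ k, (P v).mulVec (pnt e i) k = (P v).mulVec (pnt e i) 2 * imgVec b v i k) ∧
      ∀ v j, j ∈ D.obsLn v →
        crossProduct ((P v).mulVec (fst D e j)) ((P v).mulVec (snd e j)) 0 ≠ 0 ∧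
        ∀ k, crossProduct ((P v).mulVec (fst D e j)) ((P v).mulVec (snd e j)) k =
          crossProduct ((P v).mulVec (fst D e j)) ((P v).mulVec (snd e j)) 0 * lnVec D b v j k := by
    have e1 : ∀ v i (hi : i ∈ D.obsPt v), ((A.pt i).submodule.map (P v).mulVecLin =
        ((chart D b).pt ⟨(v, i), hi⟩).submodule) ↔ (P v).mulVec (pnt e i) 2 ≠ 0 ∧
        ∀ k, (P v).mulVec (pnt e i) k = (P v).mulVec (pnt e i) 2 * imgVec b v i k := by
      intro v i hi
      rw [h.1, map_span_singleton, chart, Projectivization.submodule_mk,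
        span_singleton_eq_chart_iff rfl, funext_iff]
      rfl
    have e2 : ∀ v j (hj : j ∈ D.obsLn v), ((A.ln j).1.map (P v).mulVecLin =
        ((chart D b).ln ⟨(v, j), hj⟩).1) ↔
        crossProduct ((P v).mulVec (fst D e j)) ((P v).mulVec (snd e j)) 0 ≠ 0 ∧
        ∀ k, crossProduct ((P v).mulVec (fst D e j)) ((P v).mulVec (snd e j)) k =
          crossProduct ((P v).mulVec (fst D e j)) ((P v).mulVec (snd e j)) 0 * lnVec D b v j k := by
      intro v j hj
      rw [h.2, map_span_pair]
      show _ = dualSub (lnVec D b v j) ↔ _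
      rw [span_pair_eq_dualSub_iff rfl, funext_iff]
      rfl
    constructor
    · rintro ⟨h1, h2⟩
      exact ⟨fun v i hi => (e1 v i hi).1 (h1 ⟨(v, i), hi⟩), fun v j hj => (e2 v j hj).1 (h2 ⟨(v, j), hj⟩)⟩
    · rintro ⟨h1, h2⟩
      exact ⟨fun q => (e1 _ _ q.2).2 (h1 _ _ q.2), fun q => (e2 _ _ q.2).2 (h2 _ _ q.2)⟩
  constructor
  · intro hs
    exact ⟨h.mem_spaceVariety hD, hs.cam, key.2 ⟨hs.pt, hs.ln⟩⟩
  · rintro ⟨-, hP, hj⟩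
    obtain ⟨h1, h2⟩ := key.1 hj
    exact ⟨hP, fun i => Function.ne_iff.1 (span_singleton_ne_zero (h.1 i)),
      fun j => linearIndependent_pair_iff_minor.1
        (linearIndependent_of_finrank_span_pair (by rw [← h.2 j]; exact (A.ln j).2)), h1, h2⟩

theorem mem_cameraSolutions_chart {D : Problem ι κ} (hD : D.OneInc) {b : Param ι κ → ℂ}
    {P : Cameras} : P ∈ D.cameraSolutions (chart D b) ↔ ∃ e, Sol D b P e := by
  constructor
  · rintro ⟨⟨A, P⟩, hA, rfl⟩
    obtain ⟨e, he⟩ := PointLine.exists_rep hD hA.1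
    exact ⟨e, (he.sol_iff hD).2 hA⟩
  · rintro ⟨e, he⟩
    obtain ⟨A, hA⟩ := he.exists_rep
    exact ⟨(A, P), (hA.sol_iff hD).1 he, rfl⟩

/-- The cameras and the arrangement are in general position. -/
structure NonDeg (D : Problem ι κ) (P : Cameras) (e : Slot ι κ → Fin 4 → ℂ) : Prop where
  cam : ∀ v v', v ≠ v' → (P v').mulVec (center (P v)) 0 ≠ 0
  pt : ∀ v v', v ≠ v' → ∀ i, ∃ r : Fin 4,
    quad (pnt e i) (center (P v)) (center (P v')) (Pi.single r 1) ≠ 0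
  ln : ∀ v v', v ≠ v' → ∀ j, j ∈ D.obsLn v →
    quad (fst D e j) (snd e j) (center (P v)) (center (P v')) ≠ 0

/-- The index type of the coordinates of the cameras and the arrangement. -/
abbrev SolVar (ι κ : Type) : Type := (Fin 3 × Fin 3 × Fin 4) ⊕ (Slot ι κ × Fin 4)

def camOf (z : SolVar ι κ → ℂ) : Cameras := fun v => Matrix.of fun r k => z (.inl (v, r, k))

def vecOf (z : SolVar ι κ → ℂ) : Slot ι κ → Fin 4 → ℂ := fun s k => z (.inr (s, k))

theorem exists_camOf_vecOf (P : Cameras) (e : Slot ι κ → Fin 4 → ℂ) :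
    ∃ z : SolVar ι κ → ℂ, camOf z = P ∧ vecOf z = e :=
  ⟨Sum.elim (fun q => P q.1 q.2.1 q.2.2) (fun q => e q.1 q.2), rfl, rfl⟩

section Constructible

variable {σ : Type} {P : (σ → ℂ) → Cameras} {e : (σ → ℂ) → Slot ι κ → Fin 4 → ℂ}
  {b : (σ → ℂ) → Param ι κ → ℂ}

theorem constr_camVariety (hP : ∀ v r k, IsPoly fun x => P x v r k) :
    Constr fun x => P x ∈ camVariety := by
  have hr : ∀ v r k, IsPoly fun x => rot (P x v) r k := fun v r k => hP v r k.castSucc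
  have h : (fun x => P x ∈ camVariety) = fun x =>
      (∀ v, (∀ r k, ∑ i, rot (P x v) r i * rot (P x v) k i = (1 : Matrix (Fin 3) (Fin 3) ℂ) r k) ∧
        (rot (P x v)).det = 1) ∧
      (∀ r k, rot (P x 0) r k = (1 : Matrix (Fin 3) (Fin 3) ℂ) r k) ∧ (∀ r, P x 0 r 3 = 0) ∧
        P x 1 0 3 = 1 := by
    funext x
    simp only [camVariety, Set.mem_ofPred_eq, ← Matrix.ext_iff, funext_iff]
    rfl
  rw [h]
  refine .and (.all fun v => .and (.all fun r => .all fun k => ?_) ?_)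
    (.and (.all fun r => .all fun k => ?_) (.and (.all fun r => ?_) ?_))
  · exact IsPoly.constr_eq (.sum _ fun i _ => (hr v r i).mul (hr v k i)) (.const _)
  · exact IsPoly.constr_eq (.det (hr v)) (.const _)
  · exact IsPoly.constr_eq (hr _ _ _) (.const _)
  · exact IsPoly.constr_eq (hP _ _ _) (.const _)
  · exact IsPoly.constr_eq (hP _ _ _) (.const _)

theorem constr_sol [Finite ι] [Finite κ] (D : Problem ι κ) (hP : ∀ v r k, IsPoly fun x => P x v r k)
    (he : ∀ s k, IsPoly fun x => e x s k) (hb : ∀ t, IsPoly fun x => b x t) :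
    Constr fun x => Sol D (b x) (P x) (e x) := by
  have h : (fun x => Sol D (b x) (P x) (e x)) = fun x => P x ∈ camVariety ∧
      (∀ i, ∃ k, pnt (e x) i k ≠ 0) ∧
      (∀ j, ∃ k l, fst D (e x) j k * snd (e x) j l - fst D (e x) j l * snd (e x) j k ≠ 0) ∧
      (∀ v i, i ∈ D.obsPt v → (P x v).mulVec (pnt (e x) i) 2 ≠ 0 ∧
        ∀ k, (P x v).mulVec (pnt (e x) i) k = (P x v).mulVec (pnt (e x) i) 2 * imgVec (b x) v i k) ∧
      (∀ v j, j ∈ D.obsLn v →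
        crossProduct ((P x v).mulVec (fst D (e x) j)) ((P x v).mulVec (snd (e x) j)) 0 ≠ 0 ∧
        ∀ k, crossProduct ((P x v).mulVec (fst D (e x) j)) ((P x v).mulVec (snd (e x) j)) k =
          crossProduct ((P x v).mulVec (fst D (e x) j)) ((P x v).mulVec (snd (e x) j)) 0 *
            lnVec D (b x) v j k) := by
    funext x
    exact propext ⟨fun h => ⟨h.cam, h.pnt_ne, h.indep, h.pt, h.ln⟩, fun h =>
      ⟨h.1, h.2.1, h.2.2.1, h.2.2.2.1, h.2.2.2.2⟩⟩
  rw [h]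
  have hx : ∀ v i r, IsPoly fun x => (P x v).mulVec (pnt (e x) i) r :=
    fun v i r => IsPoly.mulVec (M := fun x => P x v) (w := fun x => pnt (e x) i) (hP v)
      (fun k => he (.inl (.inl i)) k) r
  have hc : ∀ v j r, IsPoly fun x =>
      crossProduct ((P x v).mulVec (fst D (e x) j)) ((P x v).mulVec (snd (e x) j)) r :=
    fun v j r => IsPoly.cross (u := fun x => (P x v).mulVec (fst D (e x) j))
      (w := fun x => (P x v).mulVec (snd (e x) j))
      (fun i => IsPoly.mulVec (M := fun x => P x v) (w := fun x => fst D (e x) j) (hP v)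
        (fun k => he (.inl (base D j)) k) i)
      (fun i => IsPoly.mulVec (M := fun x => P x v) (w := fun x => snd (e x) j) (hP v)
        (fun k => he (.inr j) k) i) r
  have hf : ∀ j k, IsPoly fun x => fst D (e x) j k := fun j k => he _ k
  have hs : ∀ j k, IsPoly fun x => snd (e x) j k := fun j k => he _ k
  have hp : ∀ i k, IsPoly fun x => pnt (e x) i k := fun i k => he _ k
  have c1 : Constr fun x => ∀ i, ∃ k, pnt (e x) i k ≠ 0 :=
    .all fun i => .ex fun k => (hp i k).constr_ne
  have c2 : Constr fun x => ∀ j, ∃ k l,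
      fst D (e x) j k * snd (e x) j l - fst D (e x) j l * snd (e x) j k ≠ 0 :=
    .all fun j => .ex fun k => .ex fun l =>
      (((hf j k).mul (hs j l)).sub ((hf j l).mul (hs j k))).constr_ne
  have c3 : ∀ v i k, Constr fun x =>
      (P x v).mulVec (pnt (e x) i) k = (P x v).mulVec (pnt (e x) i) 2 * imgVec (b x) v i k :=
    fun v i k => (hx v i k).constr_eq ((hx v i 2).mul ((isPoly_imgVec v i k).comp hb))
  have c4 : ∀ v j k, Constr fun x =>
      crossProduct ((P x v).mulVec (fst D (e x) j)) ((P x v).mulVec (snd (e x) j)) k =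
        crossProduct ((P x v).mulVec (fst D (e x) j)) ((P x v).mulVec (snd (e x) j)) 0 *
          lnVec D (b x) v j k :=
    fun v j k => (hc v j k).constr_eq ((hc v j 0).mul ((isPoly_lnVec D v j k).comp hb))
  exact .and (constr_camVariety hP) (.and c1 (.and c2 (.and
    (.all fun v => .all fun i => .imp (.const _) (.and (hx v i 2).constr_ne (.all (c3 v i))))
    (.all fun v => .all fun j => .imp (.const _) (.and (hc v j 0).constr_ne (.all (c4 v j)))))))

theorem constr_nonDeg [Finite ι] [Finite κ] (D : Problem ι κ)
    (hP : ∀ v r k, IsPoly fun x => P x v r k) (he : ∀ s k, IsPoly fun x => e x s k) :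
    Constr fun x => NonDeg D (P x) (e x) := by
  have h : (fun x => NonDeg D (P x) (e x)) = fun x =>
      (∀ v v', v ≠ v' → (P x v').mulVec (center (P x v)) 0 ≠ 0) ∧
      (∀ v v', v ≠ v' → ∀ i, ∃ r : Fin 4,
        quad (pnt (e x) i) (center (P x v)) (center (P x v')) (Pi.single r 1) ≠ 0) ∧
      (∀ v v', v ≠ v' → ∀ j, j ∈ D.obsLn v →
        quad (fst D (e x) j) (snd (e x) j) (center (P x v)) (center (P x v')) ≠ 0) := by
    funext x
    exact propext ⟨fun h => ⟨h.cam, h.pt, h.ln⟩, fun h => ⟨h.1, h.2.1, h.2.2⟩⟩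
  rw [h]
  have hc : ∀ v k, IsPoly fun x => center (P x v) k := fun v => isPoly_center (hP v)
  refine .and (.all fun v => .all fun v' => .imp (.const _) ?_)
    (.and (.all fun v => .all fun v' => .imp (.const _) (.all fun i => .ex fun r => ?_))
      (.all fun v => .all fun v' => .imp (.const _) (.all fun j => .imp (.const _) ?_)))
  · exact (IsPoly.mulVec (M := fun x => P x v') (w := fun x => center (P x v)) (hP v')
      (hc v) 0).constr_ne
  · exact (isPoly_quad (a := fun x => pnt (e x) i) (b := fun x => center (P x v))
      (c := fun x => center (P x v')) (d := fun _ => Pi.single r 1) (fun k => he (.inl (.inl i)) k)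
      (hc v) (hc v') fun k => .const _).constr_ne
  · exact (isPoly_quad (a := fun x => fst D (e x) j) (b := fun x => snd (e x) j)
      (c := fun x => center (P x v)) (d := fun x => center (P x v'))
      (fun k => he (.inl (base D j)) k) (fun k => he (.inr j) k) (hc v) (hc v')).constr_ne

end Constructible

end Solutions

end PointLine

namespace PointLine

open MvPolynomial

/-! ### Algebraic closures and transcendence degrees inside `ℂ` -/

section AlgebraicClosure

variable (k : Type) [CommRing k] [Algebra k ℂ] [FaithfulSMul k ℂ]

/-- The elements of `ℂ` that are algebraic over the ring generated by `S` over `k`. -/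
def acl (S : Set ℂ) : Subfield ℂ where
  carrier := {a | IsAlgebraic (Algebra.adjoin k S) a}
  mul_mem' := IsAlgebraic.mul
  one_mem' := isAlgebraic_one
  add_mem' := IsAlgebraic.add
  zero_mem' := isAlgebraic_zero
  neg_mem' := IsAlgebraic.neg
  inv_mem' _ h := IsAlgebraic.inv_iff.2 h

variable {k}

omit [FaithfulSMul k ℂ] in
theorem mem_acl {S : Set ℂ} {a : ℂ} : a ∈ acl k S ↔ IsAlgebraic (Algebra.adjoin k S) a := Iff.rfl

theorem coe_acl (S : Set ℂ) :
    (acl k S : Set ℂ) = (AlgebraicIndependent.matroid k ℂ).closure S := by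
  rw [AlgebraicIndependent.matroid_closure_eq]
  rfl

theorem subset_acl (S : Set ℂ) : S ⊆ acl k S := by
  rw [coe_acl]
  exact Matroid.subset_closure _ S (by simp)

theorem acl_mono {S T : Set ℂ} (h : S ⊆ T) : (acl k S : Set ℂ) ⊆ acl k T := by
  rw [coe_acl, coe_acl]
  exact Matroid.closure_subset_closure _ h

variable (k) in
/-- The transcendence degree of the field generated by `S`. -/
noncomputable def rk (S : Set ℂ) : ℕ∞ := (AlgebraicIndependent.matroid k ℂ).eRk S

theorem rk_mono {S T : Set ℂ} (h : S ⊆ acl k T) : rk k S ≤ rk k T := by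
  rw [coe_acl] at h
  rw [rk, rk, ← Matroid.eRk_closure_eq _ T]
  exact Matroid.eRk_mono _ h

theorem rk_union_le (S T : Set ℂ) : rk k (S ∪ T) ≤ rk k S + T.encard :=
  Matroid.eRk_union_le_eRk_add_encard _ S T

/-- Submodularity of the rank in the matroid of algebraic independence: adjoining `U` raises the
rank over `T` by no more than over the smaller set `S`. -/
theorem rk_submod {S T U : Set ℂ} (h : S ⊆ T) :
    rk k (T ∪ U) + rk k S ≤ rk k T + rk k (S ∪ U) := by
  have h1 := (AlgebraicIndependent.matroid k ℂ).eRk_inter_add_eRk_union_le T (S ∪ U)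
  have h2 : T ∪ (S ∪ U) = T ∪ U := by
    rw [← Set.union_assoc, Set.union_eq_left.2 h]
  rw [h2] at h1
  refine le_trans ?_ h1
  rw [add_comm]
  exact add_le_add_left (Matroid.eRk_mono _ (Set.subset_inter h Set.subset_union_left)) _

theorem rk_lt_top {S : Set ℂ} (h : S.Finite) : rk k S < ⊤ :=
  (Matroid.eRk_le_encard _ S).trans_lt h.encard_lt_top

theorem encard_range_le {σ : Type} [Fintype σ] (y : σ → ℂ) :
    (Set.range y).encard ≤ Fintype.card σ := by
  rw [← Set.image_univ]
  exact (Set.encard_image_le _ _).trans_eq (by simp)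

/-- A transcendence basis of `S` stays algebraically independent together with `y`. -/
theorem rk_union_range_of_indep {σ : Type} [Fintype σ] {S : Set ℂ} {y : σ → ℂ}
    (hy : AlgebraicIndependent (Algebra.adjoin k S) y) :
    rk k S + Fintype.card σ ≤ rk k (S ∪ Set.range y) := by
  obtain ⟨I, hI⟩ := (AlgebraicIndependent.matroid k ℂ).exists_isBasis S (by simp)
  have := (algebraMap k ℂ).domain_nontrivial
  have hind : AlgebraicIndependent k ((↑) : I → ℂ) := AlgebraicIndependent.matroid_indep_iff.1 hI.indep
  have h := hind.sumElim_of_tower (S := Algebra.adjoin k S) (y := y) (by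
    rintro _ ⟨i, rfl⟩
    exact ⟨⟨i, Algebra.subset_adjoin (hI.subset i.2)⟩, rfl⟩) hy
  have hr := AlgebraicIndependent.matroid_indep_iff.2 h.to_subtype_range
  have hsub : Set.range (Sum.elim y ((↑) : I → ℂ)) ⊆ S ∪ Set.range y := by
    rintro _ ⟨i | i, rfl⟩
    exacts [Or.inr ⟨i, rfl⟩, Or.inl (hI.subset i.2)]
  have hle := hr.encard_le_eRk_of_subset hsub
  rw [← Set.image_univ, h.injective.encard_image, Set.encard_univ, ENat.card_sum] at hle
  rw [rk, ← hI.encard_eq_eRk]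
  refine le_trans (le_of_eq ?_) hle
  rw [add_comm, ENat.card_eq_coe_fintype_card]
  rfl

/-- Some entry of `y` is algebraic over `S` and the other entries, so it can be omitted when
counting. -/
theorem rk_union_range_of_not_indep {σ : Type} [Fintype σ] {S : Set ℂ} {y : σ → ℂ}
    (hy : ¬ AlgebraicIndependent (Algebra.adjoin k S) y) :
    rk k (S ∪ Set.range y) + 1 ≤ rk k S + Fintype.card σ := by
  classical
  have h : ∃ i, y i ∈ acl k (S ∪ y '' {i}ᶜ) := by
    by_contra! h
    refine hy (algebraicIndependent_of_finite_type'
      (FaithfulSMul.algebraMap_injective _ _) fun t _ _ i hi halg => h i ?_)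
    have h1 : IsAlgebraic (Algebra.adjoin k (S ∪ y '' t)) (y i) := by
      rw [Algebra.adjoin_union_eq_adjoin_adjoin]
      exact halg
    refine acl_mono (Set.union_subset_union_right S (Set.image_mono fun j hj => ?_)) h1
    rintro rfl
    exact hi hj
  obtain ⟨i, hi⟩ := h
  have h1 : rk k (S ∪ Set.range y) ≤ rk k (S ∪ y '' {i}ᶜ) := by
    refine rk_mono ?_
    rintro a (ha | ⟨j, rfl⟩)
    · exact subset_acl _ (Or.inl ha)
    · by_cases hj : j = i
      · rwa [hj]
      · exact subset_acl _ (Or.inr ⟨j, hj, rfl⟩)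
  have h2 : (y '' {i}ᶜ).encard + 1 ≤ Fintype.card σ := by
    have h3 : (y '' {i}ᶜ).encard ≤ (({i} : Set σ)ᶜ).encard := Set.encard_image_le _ _
    have h4 : (({i} : Set σ)ᶜ).encard + 1 = Fintype.card σ := by
      have h5 := Set.encard_add_encard_compl ({i} : Set σ)
      rw [Set.encard_singleton, Set.encard_univ, ENat.card_eq_coe_fintype_card, add_comm] at h5
      exact h5
    exact (add_le_add_left h3 1).trans_eq h4
  calc rk k (S ∪ Set.range y) + 1 ≤ rk k S + (y '' {i}ᶜ).encard + 1 :=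
        add_le_add_left (h1.trans (rk_union_le _ _)) 1
    _ ≤ _ := by rw [add_assoc]; exact add_le_add_right h2 _

theorem countable_mvPolynomial {R σ : Type} [CommRing R] [Countable R] [Countable σ] :
    Countable (MvPolynomial σ R) := by
  rw [← Cardinal.mk_le_aleph0_iff]
  refine MvPolynomial.cardinalMk_le_max.trans ?_
  simp

/-- A generic property holds at some point with algebraically independent coordinates. -/
theorem Gen.exists_algebraicIndependent {R : Type} [CommRing R] [Algebra R ℂ] [FaithfulSMul R ℂ]
    [Countable R] {σ : Type} [Finite σ] {Q : (σ → ℂ) → Prop} (hQ : Gen Q) :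
    ∃ y, Q y ∧ AlgebraicIndependent R y := by
  obtain ⟨f, hf, h⟩ := hQ
  have : Countable (MvPolynomial σ R) := countable_mvPolynomial
  -- The point has to avoid the zeros of `f` and of all nonzero polynomials over `R`, of which there
  -- are countably many.
  obtain ⟨y, hy⟩ := exists_forall_eval_ne_zero (σ := σ)
    (S := insert f ((MvPolynomial.map (algebraMap R ℂ)) '' {0}ᶜ))
    (((Set.to_countable _).image _).insert f) (by
      rintro _ (rfl | ⟨p, hp, rfl⟩)
      · exact hf
      · exact fun h0 => hp (MvPolynomial.map_injective _ (FaithfulSMul.algebraMap_injective R ℂ)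
          (by rw [h0, map_zero])))
  refine ⟨y, h y (hy f (by simp)), ?_⟩
  rw [algebraicIndependent_iff]
  intro p hp
  by_contra h0
  refine hy _ (Set.mem_insert_of_mem _ ⟨p, h0, rfl⟩) ?_
  rwa [MvPolynomial.eval_map, ← MvPolynomial.aeval_def]

omit [FaithfulSMul k ℂ] in
theorem countable_adjoin [Countable k] {S : Set ℂ} (hS : S.Countable) :
    Countable (Algebra.adjoin k S) := by
  have := hS.to_subtype
  have : Countable (MvPolynomial S k) := countable_mvPolynomial
  rw [Algebra.adjoin_eq_range]
  exact Set.countable_range (aeval ((↑) : S → ℂ))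

/-- A solution of a linear system with coefficients in `L` depends on at most as many parameters
as the dimension of the solution space. -/
theorem exists_parameters {L : Subfield ℂ} {n r : ℕ} {V : Submodule ℂ (Fin n → ℂ)}
    (hV : Module.finrank ℂ V ≤ r) {E : Set (Fin n → ℂ)} (hE : ∀ c ∈ E, ∀ l, c l ∈ L)
    (hEV : ∀ z, (∀ c ∈ E, c ⬝ᵥ z = 0) → z ∈ V) {x : Fin n → ℂ} (hx : ∀ c ∈ E, c ⬝ᵥ x = 0) :
    ∃ s : Set ℂ, s.encard ≤ r ∧ ∀ l, x l ∈ Submodule.span L s := by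
  classical
  let Z : Set (Fin n → ℂ) := {z | (∀ l, z l ∈ L) ∧ ∀ c ∈ E, c ⬝ᵥ z = 0}
  have hxZ : x ∈ Submodule.span ℂ Z := by
    -- Expanding the entries of `x` in a basis of `ℂ` over `L` splits `x` into solutions with
    -- entries in `L`, as the equations have coefficients in `L`.
    let B := Module.Basis.ofVectorSpace L ℂ
    let T : Finset _ := Finset.univ.biUnion fun l => (B.repr (x l)).support
    have hexp : x = ∑ t ∈ T, B t • fun l => ((B.repr (x l) t : L) : ℂ) := by
      ext l
      rw [Finset.sum_apply]
      conv_lhs => rw [← B.linearCombination_repr (x l), Finsupp.linearCombination_apply, Finsupp.sum]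
      refine (Finset.sum_subset (Finset.subset_biUnion_of_mem
        (fun l => (B.repr (x l)).support) (Finset.mem_univ l)) fun t _ ht => ?_).trans ?_
      · rw [Finsupp.notMem_support_iff.1 ht, zero_smul]
      · refine Finset.sum_congr rfl fun t _ => ?_
        rw [Pi.smul_apply, smul_eq_mul, mul_comm]
        rfl
    rw [hexp]
    refine Submodule.sum_mem _ fun t _ => Submodule.smul_mem _ _ (Submodule.subset_span
      ⟨fun l => SetLike.coe_mem _, fun c hc => ?_⟩)
    have h1 : ∑ l, (⟨c l, hE c hc l⟩ : L) • x l = 0 := hx c hc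
    have h2 := congrArg (fun z => ((B.repr z t : L) : ℂ)) h1
    simpa [dotProduct] using h2
  -- A maximal independent set of solutions over `L` lies in `V`, so it has at most `r` elements;
  -- the coefficients of `x` with respect to it are the parameters.
  obtain ⟨I, hIZ, hspan, hI⟩ := exists_linearIndependent ℂ Z
  have hIV : Submodule.span ℂ I ≤ V := Submodule.span_le.2 fun z hz => hEV z (hIZ hz).2
  have := hI.finite
  cases nonempty_fintype I
  have hcard : Fintype.card I ≤ r := by
    have h1 := finrank_span_set_eq_card hI
    rw [Set.toFinset_card] at h1
    rw [← h1]
    exact (Submodule.finrank_mono hIV).trans hV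
  rw [← hspan, ← Subtype.range_coe (s := I), Submodule.mem_span_range_iff_exists_fun] at hxZ
  obtain ⟨f, hf⟩ := hxZ
  refine ⟨Set.range f, (encard_range_le f).trans (by exact_mod_cast hcard), fun l => ?_⟩
  rw [← hf, Finset.sum_apply]
  refine Submodule.sum_mem _ fun i _ => ?_
  have h1 : (f i • (i : Fin n → ℂ)) l = (⟨(i : Fin n → ℂ) l, (hIZ i.2).1 l⟩ : L) • f i := by
    rw [Pi.smul_apply, smul_eq_mul, mul_comm]
    rfl
  rw [h1]
  exact Submodule.smul_mem _ _ (Submodule.subset_span ⟨i, rfl⟩)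

/-- The coefficients of a linear combination of independent vectors over `L` are linear
functions over `L` of the entries. -/
theorem mem_span_of_linearIndependent {L : Subfield ℂ} {n r : ℕ} {d : Fin r → Fin n → ℂ}
    (hd : LinearIndependent ℂ d) (hL : ∀ i l, d i l ∈ L) (s : Fin r → ℂ) (i : Fin r) :
    s i ∈ Submodule.span L (Set.range fun l => ∑ i, s i * d i l) := by
  classical
  let d' : Fin r → Fin n → L := fun i l => ⟨d i l, hL i l⟩
  have hd' : LinearIndependent L d' := by
    rw [Fintype.linearIndependent_iff]
    intro g hg i
    have h1 := Fintype.linearIndependent_iff.1 hd (fun i => (g i : ℂ)) (by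
      ext l
      have h2 := congrArg (fun z : Fin n → L => ((z l : L) : ℂ)) hg
      simpa [d'] using h2) i
    exact Subtype.ext h1
  -- A left inverse over `L` of the combination map reads off the coefficients.
  obtain ⟨G, hG⟩ := (Fintype.linearCombination L d').exists_leftInverse_of_injective
    (LinearMap.ker_eq_bot.2 hd'.fintypeLinearCombination_injective)
  let c : Fin n → L := fun l => G (fun j => if l = j then 1 else 0) i
  have hGd : ∀ j, ∑ l, (c l : ℂ) * d j l = if i = j then 1 else 0 := by
    intro j
    have h1 := congrFun (LinearMap.congr_fun hG (Pi.single j 1)) i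
    rw [LinearMap.comp_apply, Fintype.linearCombination_apply_single, one_smul,
      LinearMap.pi_apply_eq_sum_univ, Finset.sum_apply, LinearMap.id_apply, Pi.single_apply] at h1
    have h2 := congrArg (fun z : L => (z : ℂ)) h1
    simp only [Pi.smul_apply, smul_eq_mul, AddSubmonoidClass.coe_finsetSum] at h2
    rw [show ((if i = j then (1 : L) else 0 : L) : ℂ) = if i = j then 1 else 0 by
      split_ifs <;> rfl] at h2
    rw [← h2]
    exact Finset.sum_congr rfl fun l _ => mul_comm _ _
  have h : s i = ∑ l, c l • ∑ j, s j * d j l := by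
    have h1 : ∀ l, c l • ∑ j, s j * d j l = ∑ j, s j * ((c l : ℂ) * d j l) := by
      intro l
      show (c l : ℂ) * _ = _
      rw [Finset.mul_sum]
      exact Finset.sum_congr rfl fun j _ => by ring
    rw [Finset.sum_congr rfl fun l _ => h1 l, Finset.sum_comm]
    simp only [← Finset.mul_sum, hGd]
    simp
  rw [h]
  exact Submodule.sum_mem _ fun l _ => Submodule.smul_mem _ _ (Submodule.subset_span ⟨l, rfl⟩)

omit [FaithfulSMul k ℂ] in
theorem mem_acl_of_mem_span {S T : Set ℂ} {L : Subfield ℂ} (hL : (L : Set ℂ) ⊆ acl k T)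
    (hS : S ⊆ acl k T) {a : ℂ} (ha : a ∈ Submodule.span L S) : a ∈ acl k T := by
  induction ha using Submodule.span_induction with
  | mem x hx => exact hS hx
  | zero => exact zero_mem _
  | add x y _ _ hx hy => exact add_mem hx hy
  | smul c x _ hx => exact mul_mem (hL c.2) hx

end AlgebraicClosure

end PointLine

namespace PointLine

open MvPolynomial

variable {ι κ : Type}

/-! ### Solutions as solutions of linear systems -/

section Linear

/-- The open conditions on cameras and an arrangement in space: the joint image is defined, and
lies in the affine chart. -/
structure Visible (D : Problem ι κ) (P : Cameras) (e : Slot ι κ → Fin 4 → ℂ) : Prop where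
  pnt_ne : ∀ i, ∃ k, pnt e i k ≠ 0
  indep : ∀ j, ∃ k l, fst D e j k * snd e j l - fst D e j l * snd e j k ≠ 0
  pt : ∀ v i, i ∈ D.obsPt v → (P v).mulVec (pnt e i) 2 ≠ 0
  ln : ∀ v j, j ∈ D.obsLn v →
    crossProduct ((P v).mulVec (fst D e j)) ((P v).mulVec (snd e j)) 0 ≠ 0

/-- The linear equations for an arrangement in space to have the joint image with coordinates
`b`. -/
structure Incident (D : Problem ι κ) (b : Param ι κ → ℂ) (P : Cameras)
    (e : Slot ι κ → Fin 4 → ℂ) : Prop where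
  pt : ∀ v i, i ∈ D.obsPt v →
    ∀ k, (P v).mulVec (pnt e i) k = (P v).mulVec (pnt e i) 2 * imgVec b v i k
  fst : ∀ v j, j ∈ D.obsLn v → lnVec D b v j ⬝ᵥ (P v).mulVec (fst D e j) = 0
  snd : ∀ v j, j ∈ D.obsLn v → lnVec D b v j ⬝ᵥ (P v).mulVec (snd e j) = 0

theorem cross_eq_smul_iff {u w n : Fin 3 → ℂ} (hn : n 0 = 1) (h : crossProduct u w 0 ≠ 0) :
    (∀ k, crossProduct u w k = crossProduct u w 0 * n k) ↔ n ⬝ᵥ u = 0 ∧ n ⬝ᵥ w = 0 := by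
  have hn0 : n ≠ 0 := fun h => by simp [h] at hn
  have hli : LinearIndependent ℂ ![u, w] :=
    crossProduct_ne_zero_iff_linearIndependent.1 fun h0 => h (by rw [h0]; rfl)
  have h1 := span_pair_eq_dualSub_iff (u := u) (w := w) hn
  constructor
  · intro hc
    have h2 := h1.2 ⟨h, funext hc⟩
    exact ⟨mem_dualSub.1 (h2 ▸ Submodule.subset_span (by simp)),
      mem_dualSub.1 (h2 ▸ Submodule.subset_span (by simp))⟩
  · rintro ⟨hu, hw⟩ k
    exact congrFun (h1.1 (span_pair_eq_dualSub hli hn0 hu hw)).2 k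

/-- For given image and cameras, the conditions on the space vectors split into an open one and one
that is linear in each vector. The linear part makes the dimension count possible. -/
theorem sol_iff {D : Problem ι κ} {b : Param ι κ → ℂ} {P : Cameras} {e : Slot ι κ → Fin 4 → ℂ} :
    Sol D b P e ↔ P ∈ camVariety ∧ Visible D P e ∧ Incident D b P e := by
  constructor
  · intro h
    have h1 := fun v j hj => (cross_eq_smul_iff (lnVec_zero D b v j) (h.ln v j hj).1).1
      (h.ln v j hj).2
    exact ⟨h.cam, ⟨h.pnt_ne, h.indep, fun v i hi => (h.pt v i hi).1, fun v j hj => (h.ln v j hj).1⟩,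
      ⟨fun v i hi => (h.pt v i hi).2, fun v j hj => (h1 v j hj).1, fun v j hj => (h1 v j hj).2⟩⟩
  · rintro ⟨h1, h2, h3⟩
    exact ⟨h1, h2.pnt_ne, h2.indep, fun v i hi => ⟨h2.pt v i hi, h3.pt v i hi⟩, fun v j hj =>
      ⟨h2.ln v j hj, (cross_eq_smul_iff (lnVec_zero D b v j) (h2.ln v j hj)).2
        ⟨h3.fst v j hj, h3.snd v j hj⟩⟩⟩

theorem Sol.visible {D : Problem ι κ} {b : Param ι κ → ℂ} {P : Cameras}
    {e : Slot ι κ → Fin 4 → ℂ} (h : Sol D b P e) : Visible D P e := (sol_iff.1 h).2.1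

theorem Sol.incident {D : Problem ι κ} {b : Param ι κ → ℂ} {P : Cameras}
    {e : Slot ι κ → Fin 4 → ℂ} (h : Sol D b P e) : Incident D b P e := (sol_iff.1 h).2.2

/-- Numerators of the affine coordinates of the joint image. -/
noncomputable def imageNum (D : Problem ι κ) (P : Cameras) (e : Slot ι κ → Fin 4 → ℂ) :
    Param ι κ → ℂ
  | .inl (v, i, k) => (P v).mulVec (pnt e i) k.castSucc
  | .inr (v, j, k) => crossProduct ((P v).mulVec (fst D e j)) ((P v).mulVec (snd e j)) k.succ

/-- Denominators of the affine coordinates of the joint image. -/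
noncomputable def imageDen (D : Problem ι κ) (P : Cameras) (e : Slot ι κ → Fin 4 → ℂ) :
    Param ι κ → ℂ
  | .inl (v, i, _) => (P v).mulVec (pnt e i) 2
  | .inr (v, j, _) => crossProduct ((P v).mulVec (fst D e j)) ((P v).mulVec (snd e j)) 0

theorem Visible.imageDen_ne_zero {D : Problem ι κ} {P : Cameras} {e : Slot ι κ → Fin 4 → ℂ}
    (h : Visible D P e) {t : Param ι κ} (ht : Used D t) : imageDen D P e t ≠ 0 := by
  rcases t with ⟨v, i, k⟩ | ⟨v, j, k⟩
  exacts [h.pt v i ht, h.ln v j ht.1]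

theorem Sol.eq_div {D : Problem ι κ} {b : Param ι κ → ℂ} {P : Cameras}
    {e : Slot ι κ → Fin 4 → ℂ} (h : Sol D b P e) {t : Param ι κ} (ht : Used D t) :
    b t = imageNum D P e t / imageDen D P e t := by
  rw [eq_div_iff (h.visible.imageDen_ne_zero ht), mul_comm]
  rcases t with ⟨v, i, k⟩ | ⟨v, j, k⟩
  · have h1 := (h.pt v i ht).2 k.castSucc
    fin_cases k <;> exact h1.symm
  · have h1 := (h.ln v j ht.1).2 k.succ
    fin_cases k
    · exact h1.symm
    · refine Eq.trans ?_ h1.symm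
      rw [imageDen]
      congr 1
      exact (lnVec_two_of_not (fun h => ht.2 ⟨rfl, h⟩) b).symm

theorem Visible.sol {D : Problem ι κ} (hD : D.OneInc) {b : Param ι κ → ℂ} {P : Cameras}
    {e : Slot ι κ → Fin 4 → ℂ} (h : Visible D P e) (hP : P ∈ camVariety)
    (hb : ∀ t, Used D t → b t = imageNum D P e t / imageDen D P e t) : Sol D b P e := by
  have hb' : ∀ t, Used D t → imageNum D P e t = imageDen D P e t * b t := fun t ht => by
    rw [hb t ht, mul_div_cancel₀ _ (h.imageDen_ne_zero ht)]
  have hpt : ∀ v i, i ∈ D.obsPt v → ∀ k, (P v).mulVec (pnt e i) k =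
      (P v).mulVec (pnt e i) 2 * imgVec b v i k := by
    intro v i hi k
    fin_cases k
    · exact hb' (.inl (v, i, 0)) hi
    · exact hb' (.inl (v, i, 1)) hi
    · exact (mul_one _).symm
  refine ⟨hP, h.pnt_ne, h.indep, fun v i hi => ⟨h.pt v i hi, hpt v i hi⟩,
    fun v j hj => ⟨h.ln v j hj, fun k => ?_⟩⟩
  have h1 := hb' (.inr (v, j, 0)) (used_zero hj)
  fin_cases k
  · exact (mul_one _).symm
  · exact h1
  -- With an observed point on the line, the last coordinate is not among the used ones. It follows
  -- because the cross product is orthogonal to the image of the point.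
  · by_cases hi : ∃ i, i ∈ D.obsPt v ∧ (i, j) ∈ D.inc
    · obtain ⟨i, hi, hij⟩ := hi
      have h2 := dot_self_cross ((P v).mulVec (fst D e j)) ((P v).mulVec (snd e j))
      rw [Matrix.vec3_dotProduct, fst_of_inc hD e hij, hpt v i hi 0, hpt v i hi 1,
        ← fst_of_inc hD e hij] at h2
      have h3 : (P v).mulVec (fst D e j) 2 ≠ 0 := by
        rw [fst_of_inc hD e hij]; exact h.pt v i hi
      replace h1 : crossProduct ((P v).mulVec (fst D e j)) ((P v).mulVec (snd e j)) 1 =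
        crossProduct ((P v).mulVec (fst D e j)) ((P v).mulVec (snd e j)) 0 * b (.inr (v, j, 0)) := h1
      show crossProduct ((P v).mulVec (fst D e j)) ((P v).mulVec (snd e j)) 2 =
        crossProduct ((P v).mulVec (fst D e j)) ((P v).mulVec (snd e j)) 0 * lnVec D b v j 2
      rw [lnVec_two_of_inc hD b hi hij]
      simp only [imgVec, Matrix.cons_val_zero, Matrix.cons_val_one] at h2
      rw [h1] at h2
      have h4 : (P v).mulVec (fst D e j) 2 *
          (crossProduct ((P v).mulVec (fst D e j)) ((P v).mulVec (snd e j)) 0 * b (.inl (v, i, 0)) +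
          crossProduct ((P v).mulVec (fst D e j)) ((P v).mulVec (snd e j)) 0 * b (.inr (v, j, 0)) *
            b (.inl (v, i, 1)) +
          crossProduct ((P v).mulVec (fst D e j)) ((P v).mulVec (snd e j)) 2) = 0 := by
        linear_combination h2
      have h5 := (mul_eq_zero.1 h4).resolve_left h3
      linear_combination h5
    · refine (hb' (.inr (v, j, 1)) ⟨hj, fun h => hi h.2⟩).trans ?_
      congr 1
      exact (lnVec_two_of_not hi b).symm

/-- The image of `z` is a combination of the images of the two spanning vectors, and the kernel of
the camera is spanned by its centre. Thus the back-projected plane is the span of the line and the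
centre. -/
theorem exists_of_dot_eq_zero {D : Problem ι κ} {b : Param ι κ → ℂ} {P : Cameras}
    {e : Slot ι κ → Fin 4 → ℂ} (h : Sol D b P e) {v : Fin 3} {j : κ} (hj : j ∈ D.obsLn v)
    {z : Fin 4 → ℂ} (hz : lnVec D b v j ⬝ᵥ (P v).mulVec z = 0) :
    ∃ α β γ : ℂ, z = α • fst D e j + β • snd e j + γ • center (P v) := by
  have hn := h.ln v j hj
  have h1 := (span_pair_eq_dualSub_iff (lnVec_zero D b v j)).2 ⟨hn.1, funext hn.2⟩
  have h2 : (P v).mulVec z ∈ Submodule.span ℂ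
      {(P v).mulVec (fst D e j), (P v).mulVec (snd e j)} := by
    rw [h1]
    exact hz
  obtain ⟨α, β, h3⟩ := Submodule.mem_span_pair.1 h2
  have h4 : (P v).mulVec (z - (α • fst D e j + β • snd e j)) = 0 := by
    rw [Matrix.mulVec_sub, Matrix.mulVec_add, Matrix.mulVec_smul, Matrix.mulVec_smul, h3, sub_self]
  have h5 := eq_smul_center (rot_mul_transpose h.cam v) h4
  exact ⟨α, β, _, by rw [← h5]; abel⟩

theorem exists_of_mulVec_eq_smul {P : Cameras} (hP : P ∈ camVariety) {v : Fin 3} {x z : Fin 4 → ℂ}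
    {c : ℂ} (h : (P v).mulVec z = c • (P v).mulVec x) : ∃ γ : ℂ, z = c • x + γ • center (P v) := by
  have h4 : (P v).mulVec (z - c • x) = 0 := by
    rw [Matrix.mulVec_sub, Matrix.mulVec_smul, h, sub_self]
  exact ⟨_, by rw [← eq_smul_center (rot_mul_transpose hP v) h4]; abel⟩

end Linear

end PointLine

/-! ### Combinatorial conditions on views, and the gauge freedom of solutions -/

namespace PointLine

open MvPolynomial

variable {ι κ : Type}

/-- The conditions on the views of points and lines that characterize reduced problems. -/
structure Comb (D : Problem ι κ) : Prop where
  free : ∀ j, (¬ ∃ i, (i, j) ∈ D.inc) → ∀ v, j ∈ D.obsLn v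
  pin : ∀ i j, (i, j) ∈ D.inc → (∀ v, j ∈ D.obsLn v → i ∈ D.obsPt v) → ∀ v, j ∈ D.obsLn v
  pt : ∀ i, (∃ v v', v ≠ v' ∧ i ∈ D.obsPt v ∧ i ∈ D.obsPt v') ∨
    ∃ a b c, a ≠ b ∧ a ≠ c ∧ b ≠ c ∧ (∀ v, i ∈ D.obsPt v ↔ v = a) ∧
      (∃ j, (i, j) ∈ D.inc ∧ j ∈ D.obsLn b) ∧ (∃ j, (i, j) ∈ D.inc ∧ j ∈ D.obsLn c) ∧
      ∀ j, (i, j) ∈ D.inc → ∃ v, j ∉ D.obsLn v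

theorem Comb.exists_obsLn {D : Problem ι κ} (h : Comb D) (j : κ) : ∃ v, j ∈ D.obsLn v := by
  by_cases hj : ∃ i, (i, j) ∈ D.inc
  · obtain ⟨i, hi⟩ := hj
    by_contra! hc
    exact hc 0 (h.pin i j hi (fun v hv => absurd hv (hc v)) 0)
  · exact ⟨0, h.free j hj 0⟩

/-! ### The change of coordinates of a solution -/

section Gauge

/-- Vectors by which the coordinates of a solution can be changed. -/
def gaugeVecs (D : Problem ι κ) (P : Cameras) (e : Slot ι κ → Fin 4 → ℂ) :
    Slot ι κ → Set (Fin 4 → ℂ)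
  | .inl (.inl i) => {pnt e i}
  | .inl (.inr j) => {z | (∃ i, (i, j) ∈ D.inc) ∨ z = fst D e j ∨ z = snd e j}
  | .inr j => {z | z = fst D e j ∨ z = snd e j ∨
      ∃ v, (∀ v', j ∈ D.obsLn v' ↔ v' = v) ∧ z = center (P v)}

/-- The space of vectors by which the coordinates of a solution can be replaced. -/
def gauge (D : Problem ι κ) (P : Cameras) (e : Slot ι κ → Fin 4 → ℂ) (s : Slot ι κ) :
    Submodule ℂ (Fin 4 → ℂ) := Submodule.span ℂ (gaugeVecs D P e s)

open Classical in
/-- The dimension of `gauge`. -/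
noncomputable def gaugeDim (D : Problem ι κ) : Slot ι κ → ℕ
  | .inl (.inl _) => 1
  | .inl (.inr j) => if ∃ i, (i, j) ∈ D.inc then 4 else 2
  | .inr j => if ∃ v, ∀ v', j ∈ D.obsLn v' ↔ v' = v then 3 else 2

variable {D : Problem ι κ} {P : Cameras} {e : Slot ι κ → Fin 4 → ℂ}

theorem self_mem_gauge (D : Problem ι κ) (P : Cameras) (e : Slot ι κ → Fin 4 → ℂ) (s : Slot ι κ) :
    e s ∈ gauge D P e s := by
  apply Submodule.subset_span
  rcases s with (i | j) | j
  · exact rfl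
  · by_cases h : ∃ i, (i, j) ∈ D.inc
    · exact Or.inl h
    · refine Or.inr (Or.inl ?_)
      rw [fst, base_of_free h]
  · exact Or.inr (Or.inl rfl)

theorem mem_gauge_pnt {i : ι} {z : Fin 4 → ℂ} (h : z ∈ gauge D P e (.inl (.inl i))) :
    ∃ c : ℂ, z = c • pnt e i := by
  obtain ⟨c, hc⟩ := Submodule.mem_span_singleton.1 h
  exact ⟨c, hc.symm⟩

theorem mem_gauge_fst (hD : D.OneInc) {j : κ} {z : Fin 4 → ℂ}
    (h : z ∈ gauge D P e (.inl (base D j))) : ∃ α β : ℂ, z = α • fst D e j + β • snd e j := by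
  by_cases hj : ∃ i, (i, j) ∈ D.inc
  · obtain ⟨i, hi⟩ := hj
    rw [base_of_inc hD hi] at h
    obtain ⟨c, hc⟩ := mem_gauge_pnt h
    exact ⟨c, 0, by rw [hc, fst_of_inc hD e hi]; simp⟩
  · rw [base_of_free hj] at h
    have h1 : gaugeVecs D P e (.inl (.inr j)) ⊆ {fst D e j, snd e j} := by
      rintro z (h | h)
      exacts [absurd h hj, h]
    obtain ⟨α, β, h2⟩ := Submodule.mem_span_pair.1 (Submodule.span_mono h1 h)
    exact ⟨α, β, h2.symm⟩

theorem mem_gauge_snd {j : κ} {v : Fin 3} (hv : j ∈ D.obsLn v) {z : Fin 4 → ℂ}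
    (h : z ∈ gauge D P e (.inr j)) :
    ∃ α β γ : ℂ, z = α • fst D e j + β • snd e j + γ • center (P v) := by
  have h1 : gaugeVecs D P e (.inr j) ⊆ {fst D e j, snd e j, center (P v)} := by
    rintro z (h | h | ⟨v', h, hz⟩)
    · exact Or.inl h
    · exact Or.inr (Or.inl h)
    · rw [← (h v).1 hv] at hz
      exact Or.inr (Or.inr hz)
  obtain ⟨α, β, γ, h2⟩ := Submodule.mem_span_triple.1 (Submodule.span_mono h1 h)
  exact ⟨α, β, γ, h2.symm⟩

/-- Rescaling a point and recombining the vectors of a line do not change images. Adding a multiple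
of a centre changes nothing in that view, and it is allowed only if no other view sees the line. -/
theorem Incident.of_gauge (hD : D.OneInc) {b : Param ι κ → ℂ} (h : Sol D b P e)
    {e' : Slot ι κ → Fin 4 → ℂ} (he : ∀ s, e' s ∈ gauge D P e s) : Incident D b P e' := by
  refine ⟨fun v i hi k => ?_, fun v j hj => ?_, fun v j hj => ?_⟩
  · obtain ⟨c, hc⟩ := mem_gauge_pnt (he (.inl (.inl i)))
    rw [pnt, hc, Matrix.mulVec_smul, Pi.smul_apply, Pi.smul_apply, (h.pt v i hi).2 k]
    exact (mul_assoc _ _ _).symm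
  · obtain ⟨α, β, hz⟩ := mem_gauge_fst hD (he (.inl (base D j)))
    rw [PointLine.fst, hz, Matrix.mulVec_add, Matrix.mulVec_smul, Matrix.mulVec_smul, dotProduct_add,
      dotProduct_smul, dotProduct_smul, h.incident.fst v j hj, h.incident.snd v j hj]
    simp
  · obtain ⟨α, β, γ, hz⟩ := mem_gauge_snd hj (he (.inr j))
    rw [PointLine.snd, hz, Matrix.mulVec_add, Matrix.mulVec_add, Matrix.mulVec_smul, Matrix.mulVec_smul,
      Matrix.mulVec_smul, mulVec_center (rot_mul_transpose h.cam v), dotProduct_add,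
      dotProduct_add, dotProduct_smul, dotProduct_smul, h.incident.fst v j hj,
      h.incident.snd v j hj]
    simp

theorem quad_comb (u w c d : Fin 4 → ℂ) (α β α' β' γ : ℂ) :
    quad (α • u + β • w) (α' • u + β' • w + γ • c) c d = (α * β' - β * α') * quad u w c d := by
  simp [quad, Matrix.det_succ_row_zero, Fin.sum_univ_succ, Fin.succAbove]
  ring

theorem quad_smul (u w c d : Fin 4 → ℂ) (α : ℂ) : quad (α • u) w c d = α * quad u w c d := by
  simp [quad, Matrix.det_succ_row_zero, Fin.sum_univ_succ, Fin.succAbove]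
  ring

/-- The determinants for the changed vectors are multiples of the original ones, so a degenerate
solution stays degenerate under the gauge. For lines this uses that one of the two centres belongs
to a view that sees the line: the added multiple of a centre is a multiple of this one. -/
theorem NonDeg.of_gauge (hD : D.OneInc) {e' : Slot ι κ → Fin 4 → ℂ}
    (he : ∀ s, e' s ∈ gauge D P e s) (h : NonDeg D P e') : NonDeg D P e := by
  refine ⟨h.cam, fun v v' hv i => ?_, fun v v' hv j hj => ?_⟩
  · obtain ⟨r, hr⟩ := h.pt v v' hv i
    obtain ⟨c, hc⟩ := mem_gauge_pnt (he (.inl (.inl i)))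
    refine ⟨r, fun h0 => hr ?_⟩
    rw [pnt, hc, quad_smul, h0, mul_zero]
  · intro h0
    refine h.ln v v' hv j hj ?_
    obtain ⟨α, β, hz⟩ := mem_gauge_fst hD (he (.inl (base D j)))
    obtain ⟨α', β', γ, hz'⟩ := mem_gauge_snd hj (he (.inr j))
    rw [fst, snd, hz, hz', quad_comb, h0, mul_zero]

/-- The coefficient vector of the equation that the image of a vector is on an observed line. -/
noncomputable def lineEq (D : Problem ι κ) (b : Param ι κ → ℂ) (P : Cameras) (v : Fin 3) (j : κ) :
    Fin 4 → ℂ := Matrix.vecMul (lnVec D b v j) (P v)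

/-- The coefficient vectors of the equations that the image of a vector is an observed point. -/
def ptEq (b : Param ι κ → ℂ) (P : Cameras) (v : Fin 3) (i : ι) (k : Fin 3) : Fin 4 → ℂ :=
  fun l => P v k l - imgVec b v i k * P v 2 l

theorem lineEq_dot (b : Param ι κ → ℂ) (v : Fin 3) (j : κ) (z : Fin 4 → ℂ) :
    lineEq D b P v j ⬝ᵥ z = lnVec D b v j ⬝ᵥ (P v).mulVec z :=
  (Matrix.dotProduct_mulVec _ _ _).symm

theorem ptEq_dot (b : Param ι κ → ℂ) (v : Fin 3) (i : ι) (k : Fin 3) (z : Fin 4 → ℂ) :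
    ptEq b P v i k ⬝ᵥ z = (P v).mulVec z k - imgVec b v i k * (P v).mulVec z 2 := by
  simp only [dotProduct, ptEq, Matrix.mulVec, Finset.mul_sum, ← Finset.sum_sub_distrib]
  exact Finset.sum_congr rfl fun l _ => by ring

/-- The linear equations for the vectors of a solution. -/
def system (D : Problem ι κ) (b : Param ι κ → ℂ) (P : Cameras) : Slot ι κ → Set (Fin 4 → ℂ)
  | .inl (.inl i) => {c | (∃ v k, i ∈ D.obsPt v ∧ c = ptEq b P v i k) ∨
      ∃ v j, (i, j) ∈ D.inc ∧ j ∈ D.obsLn v ∧ c = lineEq D b P v j}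
  | .inl (.inr j) => {c | (¬ ∃ i, (i, j) ∈ D.inc) ∧ ∃ v, j ∈ D.obsLn v ∧ c = lineEq D b P v j}
  | .inr j => {c | ∃ v, j ∈ D.obsLn v ∧ c = lineEq D b P v j}

theorem Sol.system_dot (hD : D.OneInc) {b : Param ι κ → ℂ} (h : Sol D b P e) (s : Slot ι κ) :
    ∀ c ∈ system D b P s, c ⬝ᵥ e s = 0 := by
  rcases s with (i | j) | j
  · rintro c (⟨v, k, hi, rfl⟩ | ⟨v, j, hij, hj, rfl⟩)
    · rw [ptEq_dot]
      have := h.incident.pt v i hi k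
      rw [pnt] at this
      rw [this]
      ring
    · rw [lineEq_dot]
      have := h.incident.fst v j hj
      rwa [fst, base_of_inc hD hij] at this
  · rintro c ⟨hf, v, hj, rfl⟩
    rw [lineEq_dot]
    have := h.incident.fst v j hj
    rwa [fst, base_of_free hf] at this
  · rintro c ⟨v, hj, rfl⟩
    rw [lineEq_dot]
    exact h.incident.snd v j hj

theorem mem_span_pair_of_two {u w c d z : Fin 4 → ℂ} (h : quad u w c d ≠ 0)
    (h1 : ∃ α β γ : ℂ, z = α • u + β • w + γ • c) (h2 : ∃ α β γ : ℂ, z = α • u + β • w + γ • d) :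
    ∃ α β : ℂ, z = α • u + β • w := by
  obtain ⟨α, β, γ, h1⟩ := h1
  obtain ⟨α', β', γ', h2⟩ := h2
  have h3 := coeffs_eq_zero_of_quad h (α := α - α') (β := β - β') (γ := γ) (δ := -γ') (by
    have := h1.symm.trans h2
    rw [← sub_eq_zero] at this
    rw [← this]
    module)
  exact ⟨α, β, by rw [h1, h3.2.2.1]; simp⟩

/-- In general position, the linear equations determine the vectors of a solution up to the
obvious changes. -/
theorem NonDeg.mem_gauge (hD : D.OneInc) (hC : Comb D) {b : Param ι κ → ℂ} (h : Sol D b P e)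
    (hn : NonDeg D P e) (s : Slot ι κ) {z : Fin 4 → ℂ} (hz : ∀ c ∈ system D b P s, c ⬝ᵥ z = 0) :
    z ∈ gauge D P e s := by
  have hln : ∀ j v v', v ≠ v' → j ∈ D.obsLn v → j ∈ D.obsLn v' →
      lnVec D b v j ⬝ᵥ (P v).mulVec z = 0 → lnVec D b v' j ⬝ᵥ (P v').mulVec z = 0 →
      ∃ α β : ℂ, z = α • fst D e j + β • snd e j := fun j v v' hv hj hj' h1 h2 =>
    mem_span_pair_of_two (hn.ln v v' hv j hj) (exists_of_dot_eq_zero h hj h1)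
      (exists_of_dot_eq_zero h hj' h2)
  rcases s with (i | j) | j
  · have hpt : ∀ v, i ∈ D.obsPt v → ∃ c γ : ℂ, z = c • pnt e i + γ • center (P v) := by
      intro v hv
      refine ⟨_, exists_of_mulVec_eq_smul h.cam
        (c := (P v).mulVec z 2 / (P v).mulVec (pnt e i) 2) ?_⟩
      ext k
      have h1 := hz _ (Or.inl ⟨v, k, hv, rfl⟩)
      rw [ptEq_dot, sub_eq_zero] at h1
      rw [h1, Pi.smul_apply, (h.pt v i hv).2 k, smul_eq_mul]
      field_simp [(h.pt v i hv).1]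
    refine Submodule.mem_span_singleton.2 ?_
    rcases hC.pt i with ⟨v, v', hv, h1, h2⟩ | ⟨a, b', -, hab, -, -, ha, ⟨j, hij, hj⟩, -, -⟩
    -- The rays from two centres meet only in the point.
    · obtain ⟨c, γ, h3⟩ := hpt v h1
      obtain ⟨c', γ', h4⟩ := hpt v' h2
      obtain ⟨r, hr⟩ := hn.pt v v' hv i
      have h5 := coeffs_eq_zero_of_quad hr (α := c - c') (β := γ) (γ := -γ') (δ := 0) (by
        have := h3.symm.trans h4
        rw [← sub_eq_zero] at this
        rw [← this]
        module)
      exact ⟨c, by rw [h3, h5.2.1]; simp⟩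
    -- The ray from the only view of the point meets the plane that another view back-projects from
    -- a pin only in the point.
    · obtain ⟨c, γ, h3⟩ := hpt a ((ha a).2 rfl)
      have h1 := hz _ (Or.inr ⟨b', j, hij, hj, rfl⟩)
      rw [lineEq_dot] at h1
      obtain ⟨α, β, γ', h4⟩ := exists_of_dot_eq_zero h hj h1
      rw [fst_of_inc hD e hij] at h4
      have hq := hn.ln b' a (Ne.symm hab) j hj
      rw [fst_of_inc hD e hij] at hq
      have h5 := coeffs_eq_zero_of_quad hq (α := α - c) (β := β) (γ := γ') (δ := -γ) (by
        have := h4.symm.trans h3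
        rw [← sub_eq_zero] at this
        rw [← this]
        module)
      exact ⟨c, by rw [h3, neg_eq_zero.1 h5.2.2.2]; simp⟩
  · by_cases hj : ∃ i, (i, j) ∈ D.inc
    · exact Submodule.subset_span (Or.inl hj)
    · have h1 : ∀ v, lnVec D b v j ⬝ᵥ (P v).mulVec z = 0 := fun v => by
        rw [← lineEq_dot]
        exact hz _ ⟨hj, v, hC.free j hj v, rfl⟩
      obtain ⟨α, β, h2⟩ := hln j 0 1 (by decide) (hC.free j hj 0) (hC.free j hj 1) (h1 0) (h1 1)
      rw [h2]
      exact add_mem (Submodule.smul_mem _ _ (Submodule.subset_span (Or.inr (Or.inl rfl))))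
        (Submodule.smul_mem _ _ (Submodule.subset_span (Or.inr (Or.inr rfl))))
  · have h1 : ∀ v, j ∈ D.obsLn v → lnVec D b v j ⬝ᵥ (P v).mulVec z = 0 := fun v hv => by
      rw [← lineEq_dot]
      exact hz _ ⟨v, hv, rfl⟩
    obtain ⟨v, hv⟩ := hC.exists_obsLn j
    -- One view confines the vector to a plane; a second view cuts this down to the line.
    by_cases h2 : ∀ v', j ∈ D.obsLn v' → v' = v
    · obtain ⟨α, β, γ, h3⟩ := exists_of_dot_eq_zero h hv (h1 v hv)
      rw [h3]
      refine add_mem (add_mem (Submodule.smul_mem _ _ (Submodule.subset_span (Or.inl rfl)))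
        (Submodule.smul_mem _ _ (Submodule.subset_span (Or.inr (Or.inl rfl)))))
        (Submodule.smul_mem _ _ (Submodule.subset_span (Or.inr (Or.inr ⟨v, fun v' => ⟨h2 v', ?_⟩, rfl⟩))))
      rintro rfl
      exact hv
    · push Not at h2
      obtain ⟨v', hv', hne⟩ := h2
      obtain ⟨α, β, h3⟩ := hln j v v' (Ne.symm hne) hv hv' (h1 v hv) (h1 v' hv')
      rw [h3]
      exact add_mem (Submodule.smul_mem _ _ (Submodule.subset_span (Or.inl rfl)))
        (Submodule.smul_mem _ _ (Submodule.subset_span (Or.inr (Or.inl rfl))))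

theorem finrank_span_le_of_subset {n r : ℕ} {S : Set (Fin n → ℂ)} (f : Fin r → Fin n → ℂ)
    (h : S ⊆ Set.range f) : Module.finrank ℂ (Submodule.span ℂ S) ≤ r :=
  (Submodule.finrank_mono (Submodule.span_mono h)).trans
    ((finrank_range_le_card f).trans_eq (Fintype.card_fin r))

theorem finrank_gauge_le (D : Problem ι κ) (P : Cameras) (e : Slot ι κ → Fin 4 → ℂ)
    (s : Slot ι κ) : Module.finrank ℂ (gauge D P e s) ≤ gaugeDim D s := by
  rcases s with (i | j) | j
  · rw [gaugeDim]
    refine finrank_span_le_of_subset ![pnt e i] ?_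
    rintro z rfl
    exact ⟨0, rfl⟩
  · by_cases h : ∃ i, (i, j) ∈ D.inc
    · rw [gaugeDim, if_pos h]
      exact (Submodule.finrank_le _).trans_eq (Module.finrank_fin_fun ℂ)
    · rw [gaugeDim, if_neg h]
      refine finrank_span_le_of_subset ![fst D e j, snd e j] ?_
      rintro z (h' | rfl | rfl)
      exacts [absurd h' h, ⟨0, rfl⟩, ⟨1, rfl⟩]
  · by_cases h : ∃ v, ∀ v', j ∈ D.obsLn v' ↔ v' = v
    · rw [gaugeDim, if_pos h]
      obtain ⟨v, hv⟩ := h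
      refine finrank_span_le_of_subset ![fst D e j, snd e j, center (P v)] ?_
      rintro z (rfl | rfl | ⟨v', h', rfl⟩)
      · exact ⟨0, rfl⟩
      · exact ⟨1, rfl⟩
      · rw [(hv v').1 ((h' v').2 rfl)]
        exact ⟨2, rfl⟩
    · rw [gaugeDim, if_neg h]
      refine finrank_span_le_of_subset ![fst D e j, snd e j] ?_
      rintro z (rfl | rfl | ⟨v, h', -⟩)
      exacts [⟨0, rfl⟩, ⟨1, rfl⟩, absurd ⟨v, h'⟩ h]

theorem le_finrank_span {n r : ℕ} {S : Set (Fin n → ℂ)} (f : Fin r → Fin n → ℂ)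
    (hf : LinearIndependent ℂ f) (h : ∀ i, f i ∈ S) :
    r ≤ Module.finrank ℂ (Submodule.span ℂ S) := by
  have h1 := finrank_span_eq_card hf
  rw [Fintype.card_fin] at h1
  rw [← h1]
  exact Submodule.finrank_mono (Submodule.span_mono (by rintro _ ⟨i, rfl⟩; exact h i))

theorem Sol.linearIndependent {b : Param ι κ → ℂ} (h : Sol D b P e) (j : κ) :
    LinearIndependent ℂ ![fst D e j, snd e j] := linearIndependent_pair_iff_minor.2 (h.indep j)

theorem le_finrank_gauge {b : Param ι κ → ℂ} (h : Sol D b P e) (s : Slot ι κ) :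
    gaugeDim D s ≤ Module.finrank ℂ (gauge D P e s) := by
  rcases s with (i | j) | j
  · rw [gaugeDim]
    refine le_finrank_span ![pnt e i] ?_ fun r => ?_
    · rw [linearIndependent_unique_iff]
      exact Function.ne_iff.2 (h.pnt_ne i)
    · rw [Fin.eq_zero r]
      exact rfl
  · by_cases hj : ∃ i, (i, j) ∈ D.inc
    · rw [gaugeDim, if_pos hj]
      have : gauge D P e (.inl (.inr j)) = ⊤ :=
        top_le_iff.1 fun z _ => Submodule.subset_span (Or.inl hj)
      rw [this, finrank_top, Module.finrank_fin_fun]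
    · rw [gaugeDim, if_neg hj]
      refine le_finrank_span _ (h.linearIndependent j) fun r => ?_
      fin_cases r
      exacts [Or.inr (Or.inl rfl), Or.inr (Or.inr rfl)]
  · by_cases hj : ∃ v, ∀ v', j ∈ D.obsLn v' ↔ v' = v
    · rw [gaugeDim, if_pos hj]
      obtain ⟨v, hv⟩ := hj
      refine le_finrank_span ![fst D e j, snd e j, center (P v)] ?_ fun r => ?_
      -- The camera kills its centre and keeps the other two vectors independent; the coefficient of
      -- the centre is then read off from its last coordinate `1`.
      · rw [Fintype.linearIndependent_iff]
        intro g hg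
        rw [Fin.sum_univ_three] at hg
        have hli : LinearIndependent ℂ ![(P v).mulVec (fst D e j), (P v).mulVec (snd e j)] :=
          crossProduct_ne_zero_iff_linearIndependent.1 fun h0 =>
            (h.ln v j ((hv v).2 rfl)).1 (by rw [h0]; rfl)
        have h1 := congrArg ((P v).mulVec) hg
        simp only [Matrix.cons_val_zero, Matrix.cons_val_one, Matrix.cons_val, Matrix.mulVec_add,
          Matrix.mulVec_smul, mulVec_center (rot_mul_transpose h.cam v), smul_zero, add_zero,
          Matrix.mulVec_zero] at h1
        obtain ⟨h2, h3⟩ := LinearIndependent.pair_iff.1 hli _ _ h1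
        rw [h2, h3] at hg
        have h4 : g 2 = 0 := by simpa using congrFun hg 3
        intro r
        fin_cases r
        exacts [h2, h3, h4]
      · fin_cases r
        exacts [Or.inl rfl, Or.inr (Or.inl rfl), Or.inr (Or.inr ⟨v, hv, rfl⟩)]
    · rw [gaugeDim, if_neg hj]
      refine le_finrank_span _ (h.linearIndependent j) fun r => ?_
      fin_cases r
      exacts [Or.inl rfl, Or.inr (Or.inl rfl)]

end Gauge

end PointLine

namespace PointLine

open MvPolynomial

variable {ι κ : Type}

/-! ### The number of camera configurations of a generic fibre -/

section Degree

/-- The cameras of the solutions at `b` of a system of conditions. -/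
def camSet (R : (Param ι κ → ℂ) → Cameras → (Slot ι κ → Fin 4 → ℂ) → Prop) (b : Param ι κ → ℂ) :
    Set Cameras := {P | ∃ e, R b P e}

/-- A system of conditions on image coordinates, cameras and space coordinates is
constructible. -/
def ConstrRel (R : (Param ι κ → ℂ) → Cameras → (Slot ι κ → Fin 4 → ℂ) → Prop) : Prop :=
  Constr fun x : Param ι κ ⊕ SolVar ι κ → ℂ =>
    R (fun t => x (.inl t)) (camOf fun t => x (.inr t)) (vecOf fun t => x (.inr t))

theorem constrRel_sol [Finite ι] [Finite κ] (D : Problem ι κ) :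
    ConstrRel fun b P e => Sol D b P e :=
  constr_sol D (fun _ _ _ => .coord _) (fun _ _ => .coord _) fun _ => .coord _

theorem constrRel_nonDeg [Finite ι] [Finite κ] (D : Problem ι κ) :
    ConstrRel (ι := ι) (κ := κ) fun _ P e => NonDeg D P e :=
  constr_nonDeg D (fun _ _ _ => .coord _) (fun _ _ => .coord _)

variable [Finite ι] [Finite κ] {R : (Param ι κ → ℂ) → Cameras → (Slot ι κ → Fin 4 → ℂ) → Prop}

theorem natCast_le_encard_iff {α : Type*} {S : Set α} {n : ℕ} :
    (n : ℕ∞) ≤ S.encard ↔ ∃ f : Fin n → α, (∀ m, f m ∈ S) ∧ ∀ m m', m ≠ m' → f m ≠ f m' := by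
  constructor
  · intro h
    obtain ⟨t, hts, ht⟩ := Set.exists_subset_encard_eq h
    have hfin : t.Finite := Set.finite_of_encard_eq_coe ht
    have := hfin.to_subtype
    have hc : Nat.card t = n := by
      rw [Nat.card_coe_set_eq, Set.ncard, ht]
      rfl
    let E := Finite.equivFinOfCardEq hc
    exact ⟨fun m => E.symm m, fun m => hts (E.symm m).2, fun m m' hm h =>
      hm (E.symm.injective (Subtype.ext h))⟩
  · rintro ⟨f, hf, hinj⟩
    have h1 : (Set.range f).encard = n := by
      rw [← Set.image_univ, Function.Injective.encard_image
        (fun m m' h => by_contra fun hne => hinj m m' hne h), Set.encard_univ]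
      simp
    rw [← h1]
    exact Set.encard_le_encard (by rintro _ ⟨m, rfl⟩; exact hf m)

/-- Having `n` pairwise distinct camera configurations is the projection of a constructible
condition on `n` copies of the solution coordinates, so Chevalley's theorem gives the dichotomy. -/
theorem ConstrRel.gen_le_encard_or (hR : ConstrRel R) (n : ℕ) :
    Gen (fun b => (n : ℕ∞) ≤ (camSet R b).encard) ∨
      Gen fun b => ¬ (n : ℕ∞) ≤ (camSet R b).encard := by
  have hQ : Constr fun x : Param ι κ ⊕ (Fin n × SolVar ι κ) → ℂ =>
      (∀ m, R (fun t => x (.inl t)) (camOf fun t => x (.inr (m, t))) (vecOf fun t => x (.inr (m, t)))) ∧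
      ∀ m m', m ≠ m' → ∃ q : Fin 3 × Fin 3 × Fin 4, x (.inr (m, .inl q)) ≠ x (.inr (m', .inl q)) := by
    refine .and (.all fun m => ?_) (.all fun m => .all fun m' => .imp (.const _) (.ex fun q => ?_))
    · exact Constr.comp hR (fun t : Param ι κ ⊕ SolVar ι κ =>
        (Sum.map id (fun q => (m, q)) t : Param ι κ ⊕ (Fin n × SolVar ι κ)))
    · simpa [sub_ne_zero] using ((IsPoly.coord _).sub (.coord _)).constr_ne
  have key : ∀ b, (n : ℕ∞) ≤ (camSet R b).encard ↔ ∃ z : Fin n × SolVar ι κ → ℂ,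
      (fun x : Param ι κ ⊕ (Fin n × SolVar ι κ) → ℂ =>
      (∀ m, R (fun t => x (.inl t)) (camOf fun t => x (.inr (m, t))) (vecOf fun t => x (.inr (m, t)))) ∧
      ∀ m m', m ≠ m' → ∃ q : Fin 3 × Fin 3 × Fin 4, x (.inr (m, .inl q)) ≠ x (.inr (m', .inl q)))
        (Sum.elim b z) := by
    intro b
    rw [natCast_le_encard_iff]
    constructor
    · rintro ⟨f, hf, hinj⟩
      choose e he using hf
      choose z hz using fun m => exists_camOf_vecOf (f m) (e m)
      refine ⟨fun q => z q.1 q.2, fun m => ?_, fun m m' hm => ?_⟩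
      · have := he m
        rw [← (hz m).1, ← (hz m).2] at this
        exact this
      · by_contra! hc
        refine hinj m m' hm ?_
        rw [← (hz m).1, ← (hz m').1]
        funext v
        ext r k
        exact hc (v, r, k)
    · rintro ⟨z, hz, hne⟩
      refine ⟨fun m => camOf fun t => z (m, t), fun m => ⟨_, hz m⟩, fun m m' hm h => ?_⟩
      obtain ⟨⟨v, r, k⟩, hq⟩ := hne m m' hm
      exact hq (congrFun (congrFun (congrFun h v) r) k)
  simp only [key]
  exact hQ.gen_or_gen_not

/-- If every bound `n` were generically reached, a point outside countably many hypersurfaces would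
have infinitely many configurations. So some bound fails generically, and the degree is one less
than the least such bound. -/
theorem ConstrRel.exists_degree (hR : ConstrRel R) (hfin : Gen fun b => (camSet R b).Finite) :
    ∃ d : ℕ, Gen fun b => (camSet R b).encard = d := by
  classical
  have h : ∃ n : ℕ, Gen fun b => ¬ (n : ℕ∞) ≤ (camSet R b).encard := by
    by_contra h
    rw [not_exists] at h
    have h1 : ∀ n : ℕ, Gen fun b => (n : ℕ∞) ≤ (camSet R b).encard := fun n =>
      (hR.gen_le_encard_or n).resolve_right (h n)
    obtain ⟨b, hb⟩ := Gen.exists_forall fun n => (h1 n).and hfin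
    obtain ⟨m, hm⟩ := ENat.ne_top_iff_exists.1 ((hb 0).2.encard_lt_top).ne
    have := (hb (m + 1)).1
    rw [← hm] at this
    exact absurd (by exact_mod_cast this) (Nat.not_succ_le_self m)
  have h1 := Nat.find_spec h
  -- The bound `0` always holds, so the least failing bound is positive.
  obtain ⟨d, hd⟩ : ∃ d, Nat.find h = d + 1 := by
    refine Nat.exists_eq_succ_of_ne_zero fun h0 => ?_
    rw [h0] at h1
    obtain ⟨b, hb⟩ := h1.exists
    exact hb (by simp)
  rw [hd] at h1
  have h2 := (hR.gen_le_encard_or d).resolve_right (Nat.find_min h (by omega))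
  refine ⟨d, (h1.and h2).mono fun b hb => le_antisymm ?_ hb.2⟩
  have := lt_of_not_ge hb.1
  push_cast at this
  exact Order.lt_add_one_iff_of_not_isMax (by simp) |>.1 this

/-- A property that holds generically fails at some points only of a curve in general position. -/
theorem finite_not_of_eval_ne_zero {σ : Type} {f : MvPolynomial σ ℂ} {a d : σ → ℂ}
    (h : eval a f ≠ 0) : {s : ℂ | eval (fun i => a i + s * d i) f = 0}.Finite := by
  obtain ⟨q, hq⟩ := (IsPoly.of_eval f).exists_polynomial a d
  have hq0 : q ≠ 0 := by
    rintro rfl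
    have := hq 0
    simp only [Polynomial.eval_zero, zero_mul, add_zero] at this
    exact h this.symm
  refine (Finset.finite_toSet q.roots.toFinset).subset fun s hs => ?_
  rw [Finset.mem_coe, Multiset.mem_toFinset, Polynomial.mem_roots hq0, Polynomial.IsRoot.def, hq]
  exact hs

theorem ConstrRel.exists_relation (hR : ConstrRel R) (hfin : Gen fun b => (camSet R b).Finite)
    (v r : Fin 3) (k : Fin 4) : ∃ h : MvPolynomial (Param ι κ ⊕ Unit) ℂ, h ≠ 0 ∧
      ∀ b P e, R b P e → eval (Sum.elim b fun _ => P v r k) h = 0 := by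
  have hQ : Constr fun x : (Param ι κ ⊕ Unit) ⊕ SolVar ι κ → ℂ =>
      R (fun t => x (.inl (.inl t))) (camOf fun t => x (.inr t)) (vecOf fun t => x (.inr t)) ∧
      x (.inr (.inl (v, r, k))) = x (.inl (.inr ())) := by
    refine .and ?_ (IsPoly.constr_eq (.coord _) (.coord _))
    exact Constr.comp hR (fun t : Param ι κ ⊕ SolVar ι κ =>
      (Sum.map Sum.inl id t : (Param ι κ ⊕ Unit) ⊕ SolVar ι κ))
  rcases hQ.gen_or_gen_not with h | ⟨f, hf, h⟩
  · exfalso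
    obtain ⟨g, hg, hgfin⟩ := hfin
    obtain ⟨f, hf, h⟩ := h
    obtain ⟨bc, hbc⟩ := exists_eval_ne_zero (mul_ne_zero hf
      ((map_ne_zero_iff _ (rename_injective _ (Sum.inl_injective (β := Unit)))).2 hg))
    rw [map_mul, eval_rename] at hbc
    -- The direction moves only the camera entry and fixes the image.
    have h1 := finite_not_of_eval_ne_zero (d := Sum.elim (fun _ => 0) fun _ => 1)
      (left_ne_zero_of_mul hbc)
    have h2 := hgfin _ (right_ne_zero_of_mul hbc)
    have h3 : {s : ℂ | eval (fun i => bc i + s * Sum.elim (fun _ => (0 : ℂ)) (fun _ => 1) i) f = 0}ᶜ ⊆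
        (fun P : Cameras => P v r k - bc (.inr ())) '' camSet R (bc ∘ Sum.inl) := by
      intro s hs
      obtain ⟨z, hz, hzc⟩ := h _ hs
      refine ⟨camOf z, ⟨vecOf z, ?_⟩, ?_⟩
      · have : R (fun t => bc (Sum.inl t)) (camOf z) (vecOf z) := by simpa using hz
        exact this
      · have : z (.inl (v, r, k)) = bc (.inr ()) + s := by simpa using hzc
        simp [camOf, this]
    have h4 : (Set.univ : Set ℂ).Finite := by
      rw [← Set.union_compl_self]
      exact h1.union ((h2.image _).subset h3)
    exact Set.infinite_univ h4
  · refine ⟨f, hf, fun b P e hbe => by_contra fun hne => h _ hne ?_⟩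
    obtain ⟨z, hz, hz'⟩ := exists_camOf_vecOf P e
    refine ⟨z, ?_, ?_⟩
    · have : R b (camOf z) (vecOf z) := by rwa [hz, hz']
      exact this
    · show camOf z v r k = _
      rw [hz]
      rfl

theorem aeval_eq_eval_map {K : Type} [CommRing K] [Algebra K ℂ] {σ : Type} (x : σ → ℂ)
    (p : MvPolynomial σ K) : aeval x p = eval x (MvPolynomial.map (algebraMap K ℂ) p) := by
  rw [eval_map, aeval_def]

/-- The nonzero value at `c₀` certifies that, after substituting `b`, the relation is still a
nonzero polynomial in the last variable. -/
theorem mem_acl_of_relation {K : Type} [CommRing K] [Algebra K ℂ] {σ : Type} {b : σ → ℂ} {c c₀ : ℂ}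
    (p : MvPolynomial (σ ⊕ Unit) K) (h : aeval (Sum.elim b fun _ => c) p = 0)
    (h₀ : aeval (Sum.elim b fun _ => c₀) p ≠ 0) : c ∈ acl K (Set.range b) := by
  let A := Algebra.adjoin K (Set.range b)
  let q : Polynomial A := aeval (Sum.elim
    (fun t => Polynomial.C (⟨b t, Algebra.subset_adjoin ⟨t, rfl⟩⟩ : A)) fun _ => Polynomial.X) p
  have key : ∀ s : ℂ, Polynomial.aeval s q = aeval (Sum.elim b fun _ => s) p := by
    intro s
    have h1 : ((Polynomial.aeval s : Polynomial A →ₐ[A] ℂ).restrictScalars K).comp (aeval (Sum.elim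
        (fun t => Polynomial.C (⟨b t, Algebra.subset_adjoin ⟨t, rfl⟩⟩ : A)) fun _ => Polynomial.X)) =
        (aeval (Sum.elim b fun _ => s) : MvPolynomial (σ ⊕ Unit) K →ₐ[K] ℂ) := by
      apply MvPolynomial.algHom_ext
      rintro (t | t)
      · rw [AlgHom.comp_apply, aeval_X, aeval_X]
        exact Polynomial.aeval_C _ _
      · rw [AlgHom.comp_apply, aeval_X, aeval_X]
        exact Polynomial.aeval_X _
    exact AlgHom.congr_fun h1 p
  rw [mem_acl]
  refine ⟨q, fun hz => h₀ ?_, (key c).trans h⟩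
  rw [← key, hz, map_zero]

/-- If a generic fibre has finitely many camera configurations, then these are algebraic functions
of the image coordinates. -/
theorem ConstrRel.exists_algebraic (hR : ConstrRel R) (hfin : Gen fun b => (camSet R b).Finite) :
    ∃ K : Subalgebra ℤ ℂ, Countable K ∧
      Gen fun b => ∀ P e, R b P e → ∀ v r k, P v r k ∈ acl K (Set.range b) := by
  choose h h0 hR using fun q : Fin 3 × Fin 3 × Fin 4 => hR.exists_relation hfin q.1 q.2.1 q.2.2
  -- The ring generated by the coefficients of the relations is countable, so that points with
  -- algebraically independent coordinates over it exist.
  let S : Set ℂ := ⋃ q, ((h q).coeffs : Set ℂ)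
  have hS : S.Countable := Set.countable_iUnion fun q => Finset.countable_toSet _
  let K := Algebra.adjoin ℤ S
  refine ⟨K, countable_adjoin hS, ?_⟩
  have hK : ∀ q, ∃ p : MvPolynomial (Param ι κ ⊕ Unit) K, MvPolynomial.map (algebraMap K ℂ) p = h q := by
    intro q
    refine mem_range_map_iff_coeffs_subset.2 fun c hc => ?_
    exact ⟨⟨c, Algebra.subset_adjoin (Set.mem_iUnion.2 ⟨q, hc⟩)⟩, rfl⟩
  choose p hp using hK
  choose c hc using fun q => exists_eval_ne_zero (h0 q)
  have hgen : Gen fun b : Param ι κ → ℂ => ∀ q, eval (Sum.elim b fun _ => c q (.inr ())) (h q) ≠ 0 := by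
    refine Gen.all fun q => ?_
    refine IsPoly.gen (b := fun t => c q (.inl t)) ?_ ?_
    · refine (IsPoly.of_eval (h q)).comp fun t => ?_
      rcases t with t | t
      exacts [.coord _, .const _]
    · have : Sum.elim (fun t => c q (.inl t)) (fun _ => c q (.inr ())) = c q := by
        funext t
        rcases t with t | t <;> rfl
      rw [this]
      exact hc q
  refine hgen.mono fun b hb P e hbe v r k => ?_
  refine mem_acl_of_relation (p (v, r, k)) (c₀ := c (v, r, k) (.inr ())) ?_ ?_
  · rw [aeval_eq_eval_map, hp]
    exact hR (v, r, k) b P e hbe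
  · rw [aeval_eq_eval_map, hp]
    exact hb (v, r, k)

end Degree

end PointLine

namespace PointLine

open MvPolynomial

variable {ι κ : Type}

/-! ### Polynomial functions with restricted coefficients -/

section PolyIn

variable {σ : Type} {R : Type} [CommRing R] [Algebra R ℂ]

variable (R) in
/-- `F` is a polynomial function with coefficients in `R`. -/
def PolyIn (F : (σ → ℂ) → ℂ) : Prop := ∃ p : MvPolynomial σ R, ∀ x, aeval x p = F x

theorem PolyIn.const {c : ℂ} (hc : ∃ r : R, algebraMap R ℂ r = c) :
    PolyIn R fun _ : σ → ℂ => c := by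
  obtain ⟨r, rfl⟩ := hc
  exact ⟨C r, fun _ => by simp⟩

theorem PolyIn.coord (i : σ) : PolyIn R fun x : σ → ℂ => x i := ⟨X i, fun _ => by simp⟩

theorem PolyIn.mul {F G : (σ → ℂ) → ℂ} (hF : PolyIn R F) (hG : PolyIn R G) :
    PolyIn R fun x => F x * G x := by
  obtain ⟨p, hp⟩ := hF
  obtain ⟨q, hq⟩ := hG
  exact ⟨p * q, fun x => by simp [hp, hq]⟩

theorem PolyIn.neg {F : (σ → ℂ) → ℂ} (hF : PolyIn R F) : PolyIn R fun x => -F x := by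
  obtain ⟨p, hp⟩ := hF
  exact ⟨-p, fun x => by simp [hp]⟩

theorem PolyIn.sum {α : Type*} (s : Finset α) {F : α → (σ → ℂ) → ℂ}
    (h : ∀ i, PolyIn R (F i)) : PolyIn R fun x => ∑ i ∈ s, F i x := by
  choose p hp using h
  exact ⟨∑ i ∈ s, p i, fun x => by simp [hp]⟩

theorem PolyIn.prod {α : Type*} (s : Finset α) {F : α → (σ → ℂ) → ℂ}
    (h : ∀ i, PolyIn R (F i)) : PolyIn R fun x => ∏ i ∈ s, F i x := by
  choose p hp using h
  exact ⟨∏ i ∈ s, p i, fun x => by simp [hp]⟩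

theorem PolyIn.mulVec {m n : ℕ} {M : (σ → ℂ) → Matrix (Fin m) (Fin n) ℂ} {w : (σ → ℂ) → Fin n → ℂ}
    (hM : ∀ i j, PolyIn R fun x => M x i j) (hw : ∀ j, PolyIn R fun x => w x j) (i : Fin m) :
    PolyIn R fun x => (M x).mulVec (w x) i :=
  PolyIn.sum Finset.univ fun j => (hM i j).mul (hw j)

theorem PolyIn.det {n : ℕ} {M : (σ → ℂ) → Matrix (Fin n) (Fin n) ℂ}
    (hM : ∀ i j, PolyIn R fun x => M x i j) : PolyIn R fun x => (M x).det := by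
  simp only [Matrix.det_apply']
  exact PolyIn.sum _ fun s => (PolyIn.const ⟨((Equiv.Perm.sign s : ℤ) : R), by simp⟩).mul
    (PolyIn.prod _ fun i => hM _ _)

theorem PolyIn.quad {a b c d : (σ → ℂ) → Fin 4 → ℂ} (ha : ∀ i, PolyIn R fun x => a x i)
    (hb : ∀ i, PolyIn R fun x => b x i) (hc : ∀ i, PolyIn R fun x => c x i)
    (hd : ∀ i, PolyIn R fun x => d x i) : PolyIn R fun x => quad (a x) (b x) (c x) (d x) := by
  refine PolyIn.det (M := fun x => Matrix.of ![a x, b x, c x, d x]) fun r i => ?_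
  fin_cases r
  exacts [ha i, hb i, hc i, hd i]

theorem PolyIn.center {M : (σ → ℂ) → Matrix (Fin 3) (Fin 4) ℂ}
    (hM : ∀ r k, PolyIn R fun x => M x r k) (k : Fin 4) : PolyIn R fun x => center (M x) k := by
  refine Fin.lastCases ?_ (fun k => ?_) k
  · simpa only [show Fin.last 3 = 3 from rfl, center_three] using
      PolyIn.const (R := R) ⟨1, map_one _⟩
  · simp only [center_castSucc]
    exact (PolyIn.mulVec (M := fun x => (rot (M x)).transpose) (w := fun x => trans (M x))
      (fun r i => hM i r.castSucc) (fun i => hM i 3) k).neg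

/-- Any complex point where `F` is nonzero shows that the polynomial is nonzero, and then it cannot
vanish at algebraically independent coordinates. -/
theorem PolyIn.ne_zero {F : (σ → ℂ) → ℂ} (hF : PolyIn R F) {y : σ → ℂ}
    (hy : AlgebraicIndependent R y) {y₁ : σ → ℂ} (h : F y₁ ≠ 0) : F y ≠ 0 := by
  obtain ⟨p, hp⟩ := hF
  rw [← hp] at h ⊢
  intro h0
  rw [algebraicIndependent_iff.1 hy p h0, map_zero] at h
  exact h rfl

end PolyIn

/-! ### Cameras with given rotations -/

section CamFam

/-- The camera matrix with rotation `R` and translation `t`. -/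
def mkCam (R : Matrix (Fin 3) (Fin 3) ℂ) (t : Fin 3 → ℂ) : Matrix (Fin 3) (Fin 4) ℂ :=
  Matrix.of fun r => Fin.snoc (α := fun _ => ℂ) (R r) (t r)

@[simp] theorem rot_mkCam (R : Matrix (Fin 3) (Fin 3) ℂ) (t : Fin 3 → ℂ) : rot (mkCam R t) = R := by
  ext r k
  exact Fin.snoc_castSucc (α := fun _ => ℂ) _ _ _

@[simp] theorem trans_mkCam (R : Matrix (Fin 3) (Fin 3) ℂ) (t : Fin 3 → ℂ) :
    trans (mkCam R t) = t := rfl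

theorem mkCam_rot_trans (M : Matrix (Fin 3) (Fin 4) ℂ) : mkCam (rot M) (trans M) = M := by
  ext r k
  refine Fin.lastCases rfl (fun k => ?_) k
  exact Fin.snoc_castSucc (α := fun _ => ℂ) _ _ _

/-- The normalized translation vectors. -/
def transFam (y : Fin 5 → ℂ) : Fin 3 → Fin 3 → ℂ := ![0, ![1, y 0, y 1], ![y 2, y 3, y 4]]

/-- The cameras with the same rotations as `P` and translations given by `y`. -/
def camFam (P : Cameras) (y : Fin 5 → ℂ) : Cameras := fun v => mkCam (rot (P v)) (transFam y v)

theorem camFam_mem {P : Cameras} (hP : P ∈ camVariety) (y : Fin 5 → ℂ) :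
    camFam P y ∈ camVariety := by
  obtain ⟨h1, h2, h3, h4⟩ := hP
  exact ⟨fun v => by simpa only [camFam, rot_mkCam] using h1 v, by simpa only [camFam, rot_mkCam],
    rfl, rfl⟩

theorem exists_camFam_eq {P : Cameras} (hP : P ∈ camVariety) : ∃ y, camFam P y = P := by
  refine ⟨![trans (P 1) 1, trans (P 1) 2, trans (P 2) 0, trans (P 2) 1, trans (P 2) 2], ?_⟩
  funext v
  conv_rhs => rw [← mkCam_rot_trans (P v)]
  rw [camFam]
  congr 1
  fin_cases v
  · exact hP.2.2.1.symm
  · ext r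
    fin_cases r
    · exact hP.2.2.2.symm
    · rfl
    · rfl
  · ext r
    fin_cases r <;> rfl

theorem mulVec_center_eq (M N : Matrix (Fin 3) (Fin 4) ℂ) :
    N.mulVec (center M) =
      trans N - (rot N).mulVec ((rot M).transpose.mulVec (trans M)) := by
  rw [mulVec_eq_rot_add, center_three, one_smul]
  have : (fun k : Fin 3 => center M k.castSucc) = -((rot M).transpose.mulVec (trans M)) :=
    funext fun k => center_castSucc M k
  rw [this, Matrix.mulVec_neg]
  abel

/-- The rotations are kept and only the five translation parameters vary, because these range over
an affine space. One choice of parameters suffices to see that the coordinate is not identically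
zero. -/
theorem exists_camFam_center_ne {P : Cameras} (hP : P ∈ camVariety) {v v' : Fin 3} (hv : v ≠ v') :
    ∃ y, (camFam P y v').mulVec (center (camFam P y v)) 0 ≠ 0 := by
  have hRt : ∀ v, rot (P v) * (rot (P v)).transpose = 1 := fun v => (hP.1 v).1
  have htR : ∀ v, (rot (P v)).transpose * rot (P v) = 1 := fun v => mul_eq_one_comm.1 (hRt v)
  have h0 : rot (P 0) = 1 := hP.2.1
  have key : ∀ y, (camFam P y v').mulVec (center (camFam P y v)) =
      transFam y v' - (rot (P v')).mulVec ((rot (P v)).transpose.mulVec (transFam y v)) := by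
    intro y
    rw [mulVec_center_eq]
    simp [camFam]
  simp only [key]
  have h2 : ∀ t : Fin 3 → ℂ, ∃ y, transFam y 2 = t ∧ transFam y 1 = ![1, 0, 0] := fun t =>
    ⟨![0, 0, t 0, t 1, t 2], by ext r; fin_cases r <;> rfl, rfl⟩
  have hcases : v = 0 ∨ (v = 1 ∧ v' = 0) ∨ (v = 1 ∧ v' = 2) ∨ (v = 2 ∧ v' = 0) ∨
      (v = 2 ∧ v' = 1) := by
    clear key
    revert v v'
    decide
  rcases hcases with rfl | ⟨rfl, rfl⟩ | ⟨rfl, rfl⟩ | ⟨rfl, rfl⟩ | ⟨rfl, rfl⟩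
  · obtain ⟨y, hy, hy'⟩ := h2 ![1, 0, 0]
    refine ⟨y, ?_⟩
    have : transFam y 0 = 0 := rfl
    rw [this, Matrix.mulVec_zero, Matrix.mulVec_zero, sub_zero]
    obtain rfl | rfl : v' = 1 ∨ v' = 2 := by clear key; revert v'; decide
    · rw [hy']; simp
    · rw [hy]; simp
  -- Only the two free entries of the second translation matter here. If the coordinate vanished for
  -- all of them, the first column of the second rotation would be zero, against orthogonality.
  · by_contra! hc
    have e : ∀ y, (rot (P 1)).transpose.mulVec (transFam y 1) 0 =
        rot (P 1) 0 0 + rot (P 1) 1 0 * y 0 + rot (P 1) 2 0 * y 1 := by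
      intro y
      rw [Matrix.mulVec, Matrix.vec3_dotProduct]
      simp [transFam]
    have hc' : ∀ y : Fin 5 → ℂ, rot (P 1) 0 0 + rot (P 1) 1 0 * y 0 + rot (P 1) 2 0 * y 1 = 0 := by
      intro y
      have := hc y
      rw [h0, Matrix.one_mulVec, Pi.sub_apply, e] at this
      have e0 : transFam y 0 0 = 0 := rfl
      rw [e0] at this
      linear_combination -this
    have e0 := hc' 0
    have e1 := hc' ![1, 0, 0, 0, 0]
    have e2 := hc' ![0, 1, 0, 0, 0]
    have e3 := congrFun (congrFun (htR 1) 0) 0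
    rw [Matrix.mul_apply, Fin.sum_univ_three] at e3
    simp at e0 e1 e2 e3
    rw [e0] at e1 e2 e3
    rw [zero_add] at e1 e2
    rw [e1, e2] at e3
    simp at e3
  · obtain ⟨y, hy, hy'⟩ := h2 ((rot (P 2)).mulVec ((rot (P 1)).transpose.mulVec ![1, 0, 0]) + ![1, 0, 0])
    exact ⟨y, by rw [hy, hy', add_sub_cancel_left]; simp⟩
  · obtain ⟨y, hy, hy'⟩ := h2 ((rot (P 2)).mulVec ![1, 0, 0])
    refine ⟨y, ?_⟩
    rw [hy, h0, Matrix.one_mulVec, Matrix.mulVec_mulVec, htR, Matrix.one_mulVec]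
    simp [transFam]
  · obtain ⟨y, hy, hy'⟩ := h2 0
    exact ⟨y, by rw [hy, hy']; simp⟩

theorem exists_quad_ne_zero {c d : Fin 4 → ℂ} (h : LinearIndependent ℂ ![c, d]) :
    ∃ a b, quad a b c d ≠ 0 := by
  obtain ⟨b, hb⟩ := exists_linearIndependent_cons_of_lt_finrank h (by simp)
  obtain ⟨a, ha⟩ := exists_linearIndependent_cons_of_lt_finrank hb (by simp)
  exact ⟨a, b, quad_ne_zero_iff.2 ha⟩

theorem exists_quad_single_ne_zero {a b c d : Fin 4 → ℂ} (h : quad a b c d ≠ 0) :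
    ∃ r : Fin 4, quad a c d (Pi.single r 1) ≠ 0 := by
  by_contra! hc
  refine h ?_
  have : quad a b c d = ∑ r, b r * quad a c d (Pi.single r 1) := by
    simp [quad, Matrix.det_succ_row_zero, Fin.sum_univ_succ, Fin.succAbove, Pi.single_apply]
    ring
  rw [this]
  simp [hc]

theorem linearIndependent_center {P : Cameras} (hP : P ∈ camVariety) {v v' : Fin 3}
    (h : (P v').mulVec (center (P v)) 0 ≠ 0) :
    LinearIndependent ℂ ![center (P v), center (P v')] := by
  rw [LinearIndependent.pair_iff]
  intro s t hst
  have h1 := congrArg (fun z => (P v').mulVec z 0) hst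
  simp only [Matrix.mulVec_add, Matrix.mulVec_smul, mulVec_center (rot_mul_transpose hP v'),
    smul_zero, add_zero, Matrix.mulVec_zero, Pi.smul_apply, smul_eq_mul, Pi.zero_apply] at h1
  have hs := (mul_eq_zero.1 h1).resolve_right h
  rw [hs, zero_smul, zero_add] at hst
  exact ⟨hs, by simpa using congrFun hst 3⟩

/-- Coordinates of translations and arrangements. -/
abbrev FamVar (ι κ : Type) : Type := Fin 5 ⊕ (Slot ι κ × Fin 4)

def famCam (P : Cameras) (y : FamVar ι κ → ℂ) : Cameras := camFam P fun i => y (.inl i)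

def famVec (y : FamVar ι κ → ℂ) : Slot ι κ → Fin 4 → ℂ := fun s k => y (.inr (s, k))

/-- For generic translations and arrangements, a configuration is in general position. -/
theorem nonDeg_of_algebraicIndependent (D : Problem ι κ) {R : Type} [CommRing R] [Algebra R ℂ]
    {P : Cameras} (hP : P ∈ camVariety)
    (hR : ∀ v r k, ∃ c : R, algebraMap R ℂ c = rot (P v) r k) {y : FamVar ι κ → ℂ}
    (hy : AlgebraicIndependent R y) : NonDeg D (famCam P y) (famVec y) := by
  classical
  have hcam : ∀ v r k, PolyIn R fun y : FamVar ι κ → ℂ => famCam P y v r k := by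
    intro v r k
    refine Fin.lastCases ?_ (fun k => ?_) k
    · show PolyIn R fun y : FamVar ι κ → ℂ => transFam (fun i => y (.inl i)) v r
      have h0 : ∃ c : R, algebraMap R ℂ c = 0 := ⟨0, map_zero _⟩
      have h1 : ∃ c : R, algebraMap R ℂ c = 1 := ⟨1, map_one _⟩
      fin_cases v
      · exact .const h0
      · fin_cases r
        exacts [.const h1, .coord _, .coord _]
      · fin_cases r
        exacts [.coord _, .coord _, .coord _]
    · have : (fun y : FamVar ι κ → ℂ => famCam P y v r k.castSucc) = fun _ => rot (P v) r k := by
        funext y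
        exact congrFun (congrFun (rot_mkCam (rot (P v)) (transFam (fun i => y (.inl i)) v)) r) k
      rw [this]
      exact .const (hR v r k)
  have hcen : ∀ v k, PolyIn R fun y : FamVar ι κ → ℂ => center (famCam P y v) k :=
    fun v => PolyIn.center (M := fun y : FamVar ι κ → ℂ => famCam P y v) (hcam v)
  have hq : ∀ v v', v ≠ v' → ∃ t : Fin 5 → ℂ, ∃ a b,
      quad a b (center (camFam P t v)) (center (camFam P t v')) ≠ 0 := by
    intro v v' hv
    obtain ⟨t, ht⟩ := exists_camFam_center_ne hP hv
    exact ⟨t, exists_quad_ne_zero (linearIndependent_center (camFam_mem hP t) ht)⟩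
  refine ⟨fun v v' hv => ?_, fun v v' hv i => ?_, fun v v' hv j _ => ?_⟩
  · obtain ⟨t, ht⟩ := exists_camFam_center_ne hP hv
    exact PolyIn.ne_zero (F := fun y : FamVar ι κ → ℂ =>
      (famCam P y v').mulVec (center (famCam P y v)) 0)
      (.mulVec (M := fun y : FamVar ι κ → ℂ => famCam P y v')
        (w := fun y : FamVar ι κ → ℂ => center (famCam P y v)) (hcam v') (hcen v) 0) hy
      (y₁ := Sum.elim t 0) ht
  · obtain ⟨t, a, b, hab⟩ := hq v v' hv
    obtain ⟨r, hr⟩ := exists_quad_single_ne_zero hab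
    refine ⟨r, PolyIn.ne_zero (F := fun y : FamVar ι κ → ℂ => quad (pnt (famVec y) i)
      (center (famCam P y v)) (center (famCam P y v')) (Pi.single r 1)) ?_ hy
      (y₁ := Sum.elim t fun q => a q.2) hr⟩
    refine .quad (a := fun y : FamVar ι κ → ℂ => pnt (famVec y) i)
      (b := fun y : FamVar ι κ → ℂ => center (famCam P y v))
      (c := fun y : FamVar ι κ → ℂ => center (famCam P y v')) (d := fun _ => Pi.single r 1)
      (fun k => .coord _) (hcen v) (hcen v') fun k => .const ⟨if k = r then 1 else 0, ?_⟩
    rw [Pi.single_apply]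
    split_ifs <;> simp
  -- In the witness all first vectors equal `a` and all second vectors equal `b`.
  · obtain ⟨t, a, b, hab⟩ := hq v v' hv
    exact PolyIn.ne_zero (F := fun y : FamVar ι κ → ℂ => quad (fst D (famVec y) j)
      (snd (famVec y) j) (center (famCam P y v)) (center (famCam P y v')))
      (.quad (a := fun y : FamVar ι κ → ℂ => fst D (famVec y) j)
        (b := fun y : FamVar ι κ → ℂ => snd (famVec y) j)
        (c := fun y : FamVar ι κ → ℂ => center (famCam P y v))
        (d := fun y : FamVar ι κ → ℂ => center (famCam P y v'))
        (fun k => .coord _) (fun k => .coord _) (hcen v) (hcen v')) hy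
      (y₁ := Sum.elim t fun q => Sum.elim a b (q.1.map (fun _ => q.2) fun _ => q.2)) hab

end CamFam

end PointLine

namespace PointLine

open MvPolynomial

variable {ι κ : Type}

/-! ### Membership in subfields -/

section Subfield

variable {L : Subfield ℂ}

theorem mulVec_mem {m n : ℕ} {M : Matrix (Fin m) (Fin n) ℂ} {w : Fin n → ℂ}
    (hM : ∀ i j, M i j ∈ L) (hw : ∀ j, w j ∈ L) (i : Fin m) : M.mulVec w i ∈ L :=
  sum_mem (t := Finset.univ) fun j _ => mul_mem (hM i j) (hw j)

theorem cross_mem {u w : Fin 3 → ℂ} (hu : ∀ i, u i ∈ L) (hw : ∀ i, w i ∈ L) (k : Fin 3) :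
    crossProduct u w k ∈ L := by
  rw [cross_apply]
  fin_cases k <;> exact sub_mem (mul_mem (hu _) (hw _)) (mul_mem (hu _) (hw _))

variable {b : Param ι κ → ℂ}

theorem lnVec_mem (D : Problem ι κ) (hb : ∀ t, b t ∈ L) (v : Fin 3) (j : κ) (k : Fin 3) :
    lnVec D b v j k ∈ L := by
  fin_cases k
  · exact one_mem L
  · exact hb _
  · show lnVec D b v j 2 ∈ L
    simp only [lnVec, Matrix.cons_val]
    split_ifs
    · exact neg_mem (add_mem (hb _) (mul_mem (hb _) (hb _)))
    · exact hb _

theorem imgVec_mem (hb : ∀ t, b t ∈ L) (v : Fin 3) (i : ι) (k : Fin 3) : imgVec b v i k ∈ L := by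
  fin_cases k
  exacts [hb _, hb _, one_mem L]

theorem system_mem (D : Problem ι κ) (hb : ∀ t, b t ∈ L) {P : Cameras}
    (hP : ∀ v r k, P v r k ∈ L) (s : Slot ι κ) : ∀ c ∈ system D b P s, ∀ l, c l ∈ L := by
  have h1 : ∀ v j l, lineEq D b P v j l ∈ L := fun v j l =>
    sum_mem (t := Finset.univ) fun r _ => mul_mem (lnVec_mem D hb v j r) (hP v r l)
  rcases s with (i | j) | j
  · rintro c (⟨v, k, -, rfl⟩ | ⟨v, j, -, -, rfl⟩) l
    exacts [sub_mem (hP _ _ _) (mul_mem (imgVec_mem hb _ _ _) (hP _ _ _)), h1 v j l]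
  · rintro c ⟨-, v, -, rfl⟩ l
    exact h1 v j l
  · rintro c ⟨v, -, rfl⟩ l
    exact h1 v j l

variable {P : Cameras} {e : Slot ι κ → Fin 4 → ℂ}

theorem imageNum_mem (D : Problem ι κ) (hP : ∀ v r k, P v r k ∈ L) (he : ∀ s k, e s k ∈ L)
    (t : Param ι κ) : imageNum D P e t ∈ L := by
  rcases t with ⟨v, i, k⟩ | ⟨v, j, k⟩
  exacts [mulVec_mem (hP v) (he _) _,
    cross_mem (mulVec_mem (hP v) (he _)) (mulVec_mem (hP v) (he _)) _]

theorem imageDen_mem (D : Problem ι κ) (hP : ∀ v r k, P v r k ∈ L) (he : ∀ s k, e s k ∈ L)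
    (t : Param ι κ) : imageDen D P e t ∈ L := by
  rcases t with ⟨v, i, k⟩ | ⟨v, j, k⟩
  exacts [mulVec_mem (hP v) (he _) _,
    cross_mem (mulVec_mem (hP v) (he _)) (mulVec_mem (hP v) (he _)) _]

end Subfield

/-! ### Image coordinates as quotients of polynomials -/

section Generic

variable {σ : Type} {P : (σ → ℂ) → Cameras} {e : (σ → ℂ) → Slot ι κ → Fin 4 → ℂ}

theorem isPoly_imageNum (D : Problem ι κ) (hP : ∀ v r k, IsPoly fun x => P x v r k)
    (he : ∀ s k, IsPoly fun x => e x s k) (t : Param ι κ) :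
    IsPoly fun x => imageNum D (P x) (e x) t := by
  rcases t with ⟨v, i, k⟩ | ⟨v, j, k⟩
  · exact IsPoly.mulVec (M := fun x => P x v) (w := fun x => pnt (e x) i) (hP v)
      (fun k => he (.inl (.inl i)) k) _
  · exact IsPoly.cross (u := fun x => (P x v).mulVec (fst D (e x) j))
      (w := fun x => (P x v).mulVec (snd (e x) j))
      (fun i => IsPoly.mulVec (M := fun x => P x v) (w := fun x => fst D (e x) j) (hP v)
        (fun k => he (.inl (base D j)) k) i)
      (fun i => IsPoly.mulVec (M := fun x => P x v) (w := fun x => snd (e x) j) (hP v)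
        (fun k => he (.inr j) k) i) _

theorem isPoly_imageDen (D : Problem ι κ) (hP : ∀ v r k, IsPoly fun x => P x v r k)
    (he : ∀ s k, IsPoly fun x => e x s k) (t : Param ι κ) :
    IsPoly fun x => imageDen D (P x) (e x) t := by
  rcases t with ⟨v, i, k⟩ | ⟨v, j, k⟩
  · exact IsPoly.mulVec (M := fun x => P x v) (w := fun x => pnt (e x) i) (hP v)
      (fun k => he (.inl (.inl i)) k) _
  · exact IsPoly.cross (u := fun x => (P x v).mulVec (fst D (e x) j))
      (w := fun x => (P x v).mulVec (snd (e x) j))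
      (fun i => IsPoly.mulVec (M := fun x => P x v) (w := fun x => fst D (e x) j) (hP v)
        (fun k => he (.inl (base D j)) k) i)
      (fun i => IsPoly.mulVec (M := fun x => P x v) (w := fun x => snd (e x) j) (hP v)
        (fun k => he (.inr j) k) i) _

theorem gen_visible [Finite ι] [Finite κ] (D : Problem ι κ) (hP : ∀ v r k, IsPoly fun x => P x v r k)
    (he : ∀ s k, IsPoly fun x => e x s k) {x₀ : σ → ℂ} (h : Visible D (P x₀) (e x₀)) :
    Gen fun x => Visible D (P x) (e x) := by
  have h1 : Gen fun x => ∀ i, ∃ k, pnt (e x) i k ≠ 0 := Gen.all fun i => by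
    obtain ⟨k, hk⟩ := h.pnt_ne i
    exact (IsPoly.gen (F := fun x => pnt (e x) i k) (he _ _) hk).mono fun x hx => ⟨k, hx⟩
  have h2 : Gen fun x => ∀ j, ∃ k l,
      fst D (e x) j k * snd (e x) j l - fst D (e x) j l * snd (e x) j k ≠ 0 := Gen.all fun j => by
    obtain ⟨k, l, hkl⟩ := h.indep j
    exact (IsPoly.gen (F := fun x => fst D (e x) j k * snd (e x) j l -
      fst D (e x) j l * snd (e x) j k)
      (((he _ _).mul (he _ _)).sub ((he _ _).mul (he _ _))) hkl).mono fun x hx => ⟨k, l, hx⟩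
  have h3 : Gen fun x => ∀ t, Used D t → imageDen D (P x) (e x) t ≠ 0 := Gen.all fun t => by
    by_cases ht : Used D t
    · exact (IsPoly.gen (isPoly_imageDen D hP he t) (h.imageDen_ne_zero ht)).mono fun x hx _ => hx
    · exact Gen.of_forall fun x hx => absurd hx ht
  exact ((h1.and h2).and h3).mono fun x hx => ⟨hx.1.1, hx.1.2,
    fun v i hi => hx.2 (.inl (v, i, 0)) hi, fun v j hj => hx.2 (.inr (v, j, 0)) (used_zero hj)⟩

end Generic

/-! ### Transcendence degrees of solutions -/

section Rank

variable {k : Type} [CommRing k] [Algebra k ℂ] [FaithfulSMul k ℂ]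

theorem card_le_rk_range {σ : Type} [Fintype σ] {y : σ → ℂ} (hy : AlgebraicIndependent k y) :
    (Fintype.card σ : ℕ∞) ≤ rk k (Set.range y) := by
  have := (algebraMap k ℂ).domain_nontrivial
  have h := (AlgebraicIndependent.matroid_indep_iff.2 hy.to_subtype_range).encard_le_eRk_of_subset
    subset_rfl
  rwa [← Set.image_univ, hy.injective.encard_image, Set.encard_univ,
    ENat.card_eq_coe_fintype_card, Set.image_univ] at h

theorem rk_range_le_card {σ : Type} [Fintype σ] (y : σ → ℂ) :
    rk k (Set.range y) ≤ Fintype.card σ := (Matroid.eRk_le_encard _ _).trans (encard_range_le y)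

/-- The set of entries of a family of vectors. -/
def entries {α : Type} {n : ℕ} (e : α → Fin n → ℂ) : Set ℂ := Set.range fun q : α × Fin n => e q.1 q.2

theorem mem_entries {α : Type} {n : ℕ} (e : α → Fin n → ℂ) (s : α) (l : Fin n) :
    e s l ∈ entries e := ⟨(s, l), rfl⟩

/-- The transcendence degree of a solution in general position. -/
theorem rk_entries_le [Fintype ι] [Fintype κ] {D : Problem ι κ} (hD : D.OneInc) (hC : Comb D)
    {b : Param ι κ → ℂ} {P : Cameras} {e : Slot ι κ → Fin 4 → ℂ} (h : Sol D b P e)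
    (hn : NonDeg D P e) (hP : ∀ v r l, P v r l ∈ acl k (Set.range b)) :
    rk k (Set.range b ∪ entries e) ≤ Fintype.card (Param ι κ) + ∑ s, (gaugeDim D s : ℕ∞) := by
  have hL : ∀ t, b t ∈ acl k (Set.range b) := fun t => subset_acl _ ⟨t, rfl⟩
  -- The cameras are algebraic over `b`, so the linear systems are defined over the algebraic
  -- closure of `b`. Their solution spaces lie in the gauge, whose dimension bounds the number of
  -- parameters.
  choose S hS hSe using fun s => exists_parameters (finrank_gauge_le D P e s)
    (system_mem D hL hP s) (fun z hz => NonDeg.mem_gauge hD hC h hn s hz) (h.system_dot hD s)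
  have h1 : Set.range b ∪ entries e ⊆ acl k (Set.range b ∪ ⋃ s, S s) := by
    rintro _ (h' | ⟨⟨s, l⟩, rfl⟩)
    · exact subset_acl _ (Or.inl h')
    · refine mem_acl_of_mem_span (acl_mono Set.subset_union_left) ?_ (hSe s l)
      exact fun a ha => subset_acl _ (Or.inr (Set.mem_iUnion.2 ⟨s, ha⟩))
  refine (rk_mono h1).trans ((rk_union_le _ _).trans (add_le_add (rk_range_le_card b) ?_))
  exact (Set.encard_iUnion_le_of_fintype _).trans (Finset.sum_le_sum fun s _ => hS s)

/-- A solution can be changed so that its transcendence degree is as large as the number of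
image coordinates and the dimensions of the changes permit. -/
theorem exists_rk_entries_ge [Countable k] [Fintype ι] [Fintype κ] {D : Problem ι κ}
    (hD : D.OneInc) {b : Param ι κ → ℂ} (hb : AlgebraicIndependent k b) {P : Cameras}
    {e : Slot ι κ → Fin 4 → ℂ} (h : Sol D b P e) :
    ∃ e', Sol D b P e' ∧ (∀ s, e' s ∈ gauge D P e s) ∧
      Fintype.card (Param ι κ) + ∑ s, (gaugeDim D s : ℕ∞) ≤ rk k (Set.range b ∪ entries e') := by
  have := (algebraMap k ℂ).domain_nontrivial
  let r : Slot ι κ → ℕ := fun s => Module.finrank ℂ (gauge D P e s)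
  let B : ∀ s, Module.Basis (Fin (r s)) ℂ (gauge D P e s) := fun s => Module.finBasis ℂ _
  let d : ∀ s, Fin (r s) → Fin 4 → ℂ := fun s i => B s i
  have hd : ∀ s, LinearIndependent ℂ (d s) := fun s =>
    (B s).linearIndependent.map' (gauge D P e s).subtype (Submodule.ker_subtype _)
  -- All changes of coordinates, parametrized by coefficients with respect to bases of the gauge
  -- spaces; the original solution is the value at `τ₀`.
  let comb : ((Σ s, Fin (r s)) → ℂ) → Slot ι κ → Fin 4 → ℂ := fun τ s l => ∑ i, τ ⟨s, i⟩ * d s i l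
  have hcomb : ∀ τ s, comb τ s ∈ gauge D P e s := by
    intro τ s
    have : comb τ s = ∑ i, τ ⟨s, i⟩ • d s i := by
      ext l
      simp [comb]
    rw [this]
    exact Submodule.sum_mem _ fun i _ => Submodule.smul_mem _ _ (B s i).2
  let τ₀ : (Σ s, Fin (r s)) → ℂ := fun q => (B q.1).repr ⟨e q.1, self_mem_gauge D P e q.1⟩ q.2
  have hτ₀ : comb τ₀ = e := by
    funext s
    have h1 := congrArg (fun z : gauge D P e s => (z : Fin 4 → ℂ))
      ((B s).sum_repr ⟨e s, self_mem_gauge D P e s⟩)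
    simp only [AddSubmonoidClass.coe_finsetSum, Submodule.coe_smul] at h1
    rw [← h1]
    ext l
    simp [comb, τ₀, d]
  have hvis : Gen fun τ => Visible D P (comb τ) :=
    gen_visible (P := fun _ => P) (e := comb) D (fun _ _ _ => .const _)
      (fun s l => .sum _ fun i _ => (IsPoly.coord _).mul (.const _)) (x₀ := τ₀)
      (by rw [hτ₀]; exact h.visible)
  -- The coefficients `τ` are chosen independent over the entries of the bases too, so that they are
  -- algebraic over `A` and the new vectors.
  let A : Set ℂ := Set.range b ∪ ⋃ s, entries (d s)
  have hA : A.Finite := (Set.finite_range b).union (Set.finite_iUnion fun s => Set.finite_range _)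
  have := countable_adjoin (k := k) hA.countable
  obtain ⟨τ, hτ, hind⟩ := hvis.exists_algebraicIndependent (R := Algebra.adjoin k A)
  refine ⟨comb τ, sol_iff.2 ⟨h.cam, hτ, Incident.of_gauge hD h (hcomb τ)⟩, hcomb τ, ?_⟩
  have h1 := rk_union_range_of_indep hind
  have h2 : rk k (A ∪ Set.range τ) ≤ rk k (A ∪ entries (comb τ)) := by
    refine rk_mono ?_
    rintro _ (ha | ⟨⟨s, i⟩, rfl⟩)
    · exact subset_acl _ (Or.inl ha)
    · have h3 := mem_span_of_linearIndependent (L := acl k A) (hd s) (fun i l => subset_acl _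
        (Or.inr (Set.mem_iUnion.2 ⟨s, mem_entries (d s) i l⟩))) (fun i => τ ⟨s, i⟩) i
      refine mem_acl_of_mem_span (acl_mono Set.subset_union_left) ?_ h3
      rintro _ ⟨l, rfl⟩
      exact subset_acl _ (Or.inr (mem_entries (comb τ) s l))
  -- The entries of the bases may themselves contribute to the rank. Submodularity removes them: the
  -- gain over `A` is at most the gain over `b`.
  have h3 := rk_submod (k := k) (S := Set.range b) (T := A) (U := entries (comb τ))
    Set.subset_union_left
  have h4 := card_le_rk_range hb
  have h5 : (∑ s, (gaugeDim D s : ℕ∞)) ≤ Fintype.card (Σ s, Fin (r s)) := by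
    rw [Fintype.card_sigma]
    push_cast
    refine Finset.sum_le_sum fun s _ => ?_
    rw [Fintype.card_fin]
    exact_mod_cast le_finrank_gauge h s
  have h6 : rk k A ≠ ⊤ := (rk_lt_top hA).ne
  refine (ENat.add_le_add_iff_left h6).1 ?_
  calc rk k A + (Fintype.card (Param ι κ) + ∑ s, (gaugeDim D s : ℕ∞))
      ≤ rk k A + (rk k (Set.range b) + Fintype.card (Σ s, Fin (r s))) :=
        add_le_add_right (add_le_add h4 h5) _
    _ = (rk k A + Fintype.card (Σ s, Fin (r s))) + rk k (Set.range b) := by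
        rw [add_assoc, add_comm (rk k (Set.range b))]
    _ ≤ rk k (A ∪ entries (comb τ)) + rk k (Set.range b) := add_le_add_left (h1.trans h2) _
    _ ≤ _ := h3

end Rank

end PointLine

/-! ### Solutions over a generic image are in general position -/

namespace PointLine

open MvPolynomial

variable {ι κ : Type}

/-- If a generic fibre contains only finitely many camera configurations in general position, then
all points of a generic fibre are in general position. -/
theorem gen_nonDeg [Finite ι] [Finite κ] {D : Problem ι κ} (hD : D.OneInc) (hC : Comb D)
    (hfin : Gen fun b => {P | ∃ e, Sol D b P e ∧ NonDeg D P e}.Finite) :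
    Gen fun b => ∀ P e, Sol D b P e → NonDeg D P e := by
  classical
  cases nonempty_fintype ι
  cases nonempty_fintype κ
  -- Either a generic image has a degenerate solution or a generic image has none; the first case is
  -- refuted.
  rcases ((constrRel_sol D).and (constrRel_nonDeg D).not).gen_or_gen_not with hdeg | hdeg
  swap
  · refine hdeg.mono fun b hb P e h => by_contra fun hn => hb ?_
    obtain ⟨z, rfl, rfl⟩ := exists_camOf_vecOf P e
    exact ⟨z, h, hn⟩
  exfalso
  obtain ⟨K, hK, f, hf, halg⟩ := ConstrRel.exists_algebraic
    (R := fun b P e => Sol D b P e ∧ NonDeg D P e) ((constrRel_sol D).and (constrRel_nonDeg D)) hfin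
  obtain ⟨b, ⟨⟨z, hz, hzn⟩, hfb⟩, hb⟩ :=
    (hdeg.and ⟨f, hf, fun b hb => hb⟩).exists_algebraicIndependent (R := K)
  -- The degenerate solution is changed within its gauge to one of large transcendence degree; it
  -- stays degenerate.
  obtain ⟨e, he, hg, hrk⟩ := exists_rk_entries_ge hD hb hz
  have hen : ¬ NonDeg D (camOf z) e := fun h => hzn (h.of_gauge hD hg)
  simp only [Sum.elim_inr] at he hen
  set P := camOf fun t => z t with hPdef
  clear_value P
  have hcam := he.cam
  obtain ⟨t₀, ht₀⟩ := exists_camFam_eq hcam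
  let y₀ : FamVar ι κ → ℂ := Sum.elim t₀ fun q => e q.1 q.2
  have hy₀ : famCam P y₀ = P := ht₀
  have hy₀' : famVec y₀ = e := rfl
  -- The constants shared by the degenerate solution and the one to be compared with it: the
  -- rotations and the unused image coordinates.
  let A : Set ℂ := (Set.range fun q : Fin 3 × Fin 3 × Fin 3 => rot (P q.1) q.2.1 q.2.2) ∪
    b '' {t | ¬ Used D t}
  have hA : A.Finite := (Set.finite_range _).union ((Set.toFinite _).image _)
  have := countable_adjoin (k := K) hA.countable
  have hR : ∀ v r k, ∃ c : Algebra.adjoin K A, algebraMap _ ℂ c = rot (P v) r k := fun v r k =>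
    ⟨⟨_, Algebra.subset_adjoin (Or.inl ⟨(v, r, k), rfl⟩)⟩, rfl⟩
  -- the degenerate solution satisfies an algebraic relation
  have h1 : rk K (A ∪ Set.range y₀) + 1 ≤ rk K A + Fintype.card (FamVar ι κ) :=
    rk_union_range_of_not_indep fun hind => by
      have := nonDeg_of_algebraicIndependent D hcam hR hind
      rw [hy₀, hy₀'] at this
      exact hen this
  have h2 : rk K (Set.range b ∪ entries e) ≤ rk K (A ∪ Set.range y₀) := by
    have hL : ∀ q, y₀ q ∈ acl K (A ∪ Set.range y₀) := fun q => subset_acl _ (Or.inr ⟨q, rfl⟩)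
    have heL : ∀ s l, e s l ∈ acl K (A ∪ Set.range y₀) := fun s l => hL (.inr (s, l))
    have hPL : ∀ v r k, P v r k ∈ acl K (A ∪ Set.range y₀) := by
      intro v r k
      refine Fin.lastCases ?_ (fun k => ?_) k
      · rw [← hy₀]
        show transFam (fun i => y₀ (.inl i)) v r ∈ _
        fin_cases v
        · exact zero_mem _
        · fin_cases r
          exacts [one_mem _, hL (.inl 0), hL (.inl 1)]
        · fin_cases r
          exacts [hL (.inl 2), hL (.inl 3), hL (.inl 4)]
      · exact subset_acl _ (Or.inl (Or.inl ⟨(v, r, k), rfl⟩))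
    refine rk_mono ?_
    rintro _ (⟨t, rfl⟩ | ⟨⟨s, l⟩, rfl⟩)
    · by_cases ht : Used D t
      · rw [he.eq_div ht]
        exact div_mem (imageNum_mem D hPL heL t) (imageDen_mem D hPL heL t)
      · exact subset_acl _ (Or.inl (Or.inr ⟨t, ht, rfl⟩))
    · exact heL s l
  -- a generic configuration with the same rotations
  have hcamP : ∀ v r k, IsPoly fun y : FamVar ι κ → ℂ => famCam P y v r k := by
    intro v r k
    refine Fin.lastCases ?_ (fun k => ?_) k
    · show IsPoly fun y : FamVar ι κ → ℂ => transFam (fun i => y (.inl i)) v r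
      fin_cases v
      · exact .const 0
      · fin_cases r
        exacts [.const 1, .coord _, .coord _]
      · fin_cases r
        exacts [.coord _, .coord _, .coord _]
    · have : (fun y : FamVar ι κ → ℂ => famCam P y v r k.castSucc) = fun _ => rot (P v) r k := by
        funext y
        exact congrFun (congrFun (rot_mkCam (rot (P v)) (transFam (fun i => y (.inl i)) v)) r) k
      rw [this]
      exact .const _
  have hvecP : ∀ s k, IsPoly fun y : FamVar ι κ → ℂ => famVec y s k := fun s k => .coord _
  -- The joint image as a rational function of translations and space vectors; the unused image
  -- coordinates are kept from `b`.
  let num : Param ι κ → (FamVar ι κ → ℂ) → ℂ := fun t y =>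
    if Used D t then imageNum D (famCam P y) (famVec y) t else b t
  let den : Param ι κ → (FamVar ι κ → ℂ) → ℂ := fun t y =>
    if Used D t then imageDen D (famCam P y) (famVec y) t else 1
  have hnum : ∀ t, IsPoly (num t) := by
    intro t
    by_cases ht : Used D t
    · simp only [num, if_pos ht]
      exact isPoly_imageNum (P := famCam P) (e := famVec) D hcamP hvecP t
    · simp only [num, if_neg ht]
      exact .const _
  have hden : ∀ t, IsPoly (den t) := by
    intro t
    by_cases ht : Used D t
    · simp only [den, if_pos ht]
      exact isPoly_imageDen (P := famCam P) (e := famVec) D hcamP hvecP t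
    · simp only [den, if_neg ht]
      exact .const _
  have hdne : ∀ y, Visible D (famCam P y) (famVec y) → ∀ t, den t y ≠ 0 := by
    intro y hy t
    by_cases ht : Used D t
    · simp only [den, if_pos ht]
      exact hy.imageDen_ne_zero ht
    · simp only [den, if_neg ht]
      exact one_ne_zero
  have hv₀ : Visible D (famCam P y₀) (famVec y₀) := by
    rw [hy₀, hy₀']
    exact he.visible
  have hb₀ : (fun t => num t y₀ / den t y₀) = b := by
    funext t
    by_cases ht : Used D t
    · simp only [num, den, if_pos ht, hy₀, hy₀']
      exact (he.eq_div ht).symm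
    · simp only [num, den, if_neg ht, div_one]
  obtain ⟨F, E, hF, -, hFE⟩ := exists_clear_denominators hnum hden f
  have hF₀ : F y₀ ≠ 0 := by
    obtain ⟨hE, hF⟩ := hFE y₀ (hdne y₀ hv₀)
    rw [hF, hb₀]
    exact mul_ne_zero hE hfb
  -- The conditions hold at `y₀`, hence generically: the configuration is visible, and `f` does not
  -- vanish at its image. So the cameras are algebraic over the new image coordinates, although
  -- these need not be independent.
  obtain ⟨y, ⟨hFy, hvis⟩, hy⟩ := ((hF.gen hF₀).and (gen_visible (P := famCam P) (e := famVec) D hcamP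
    hvecP hv₀)).exists_algebraicIndependent (R := Algebra.adjoin K A)
  let b' : Param ι κ → ℂ := fun t => num t y / den t y
  have hsol : Sol D b' (famCam P y) (famVec y) :=
    hvis.sol hD (camFam_mem hcam _) fun t ht => by simp only [b', num, den, if_pos ht]
  have hnd : NonDeg D (famCam P y) (famVec y) := nonDeg_of_algebraicIndependent D hcam hR hy
  have hfb' : eval b' f ≠ 0 := by
    obtain ⟨hE, hF⟩ := hFE y (hdne y hvis)
    rw [hF] at hFy
    exact right_ne_zero_of_mul hFy
  have hPalg := halg b' hfb' _ _ ⟨hsol, hnd⟩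
  have h3 := rk_union_range_of_indep hy
  have h4 := rk_entries_le hD hC hsol hnd hPalg
  have h5 : rk K (A ∪ Set.range y) ≤ rk K (Set.range b' ∪ entries (famVec y)) := by
    have hPL : ∀ v r k, famCam P y v r k ∈ acl K (Set.range b' ∪ entries (famVec y)) :=
      fun v r k => acl_mono Set.subset_union_left (hPalg v r k)
    refine rk_mono ?_
    rintro _ ((⟨⟨v, r, k⟩, rfl⟩ | ⟨t, ht, rfl⟩) | ⟨t | q, rfl⟩)
    · have h6 := hPL v r k.castSucc
      have h7 : famCam P y v r k.castSucc = rot (P v) r k :=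
        congrFun (congrFun (rot_mkCam (rot (P v)) (transFam (fun i => y (.inl i)) v)) r) k
      rwa [h7] at h6
    · have h6 : b' t = b t := by
        have ht' : ¬ Used D t := ht
        simp only [b', num, den, if_neg ht', div_one]
      rw [← h6]
      exact subset_acl _ (Or.inl ⟨t, rfl⟩)
    · fin_cases t
      exacts [hPL 1 1 3, hPL 1 2 3, hPL 2 0 3, hPL 2 1 3, hPL 2 2 3]
    · exact subset_acl _ (Or.inr ⟨q, rfl⟩)
  have h6 : rk K A ≠ ⊤ := (rk_lt_top hA).ne
  -- The relation costs one degree against the independent configuration, whose degree is bounded by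
  -- the image coordinates and the gauge. The modified degenerate solution already attains this
  -- bound.
  have h7 : rk K (A ∪ Set.range y₀) + 1 ≤ rk K (A ∪ Set.range y₀) :=
    calc _ ≤ rk K A + Fintype.card (FamVar ι κ) := h1
      _ ≤ rk K (A ∪ Set.range y) := h3
      _ ≤ _ := h5.trans (h4.trans (hrk.trans h2))
  have h8 : rk K (A ∪ Set.range y₀) ≠ ⊤ := (rk_lt_top (hA.union (Set.finite_range _))).ne
  obtain ⟨n, hn⟩ := ENat.ne_top_iff_exists.1 h8
  rw [← hn] at h7
  exact absurd (by exact_mod_cast h7) (Nat.not_succ_le_self n)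

end PointLine

namespace PointLine

open MvPolynomial

variable {ι κ : Type}

/-! ### Additional observations of pins -/

/-- `D` arises from `T` by letting one further view observe some pins that are seen by only one
view, where the further view observes the point of the pin and the first one does not. -/
structure Ext (T D : Problem ι κ) : Prop where
  inc : D.inc = T.inc
  obsPt : D.obsPt = T.obsPt
  le : ∀ v j, j ∈ T.obsLn v → j ∈ D.obsLn v
  new : ∀ v j, j ∈ D.obsLn v → j ∉ T.obsLn v → ∃ i c, (i, j) ∈ D.inc ∧ i ∈ D.obsPt v ∧
    v ≠ c ∧ (∀ v', j ∈ T.obsLn v' ↔ v' = c) ∧ ∀ v', j ∈ D.obsLn v' ↔ v' = v ∨ v' = c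

section Ext

variable {T D : Problem ι κ}

theorem Ext.oneInc (h : Ext T D) (hT : T.OneInc) : D.OneInc := by
  intro j i i' hi hi'
  rw [h.inc] at hi hi'
  exact hT j i i' hi hi'

theorem base_congr {D D' : Problem ι κ} (h : D.inc = D'.inc) : base D = base D' := by
  cases D
  cases D'
  cases h
  rfl

theorem Ext.fst_eq (h : Ext T D) (e : Slot ι κ → Fin 4 → ℂ) (j : κ) : fst D e j = fst T e j := by
  rw [fst, fst, base_congr h.inc]

theorem Ext.lnVec_eq (h : Ext T D) (b : Param ι κ → ℂ) (v : Fin 3) (j : κ) :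
    lnVec D b v j = lnVec T b v j := by
  have h1 := h.inc
  have h2 := h.obsPt
  clear h
  cases D
  cases T
  cases h1
  cases h2
  rfl

theorem Sol.of_ext (h : Ext T D) {b : Param ι κ → ℂ} {P : Cameras} {e : Slot ι κ → Fin 4 → ℂ}
    (hs : Sol D b P e) : Sol T b P e := by
  refine ⟨hs.cam, hs.pnt_ne, fun j => ?_, fun v i hi => hs.pt v i ?_, fun v j hj => ?_⟩
  · rw [← h.fst_eq]
    exact hs.indep j
  · rwa [h.obsPt]
  · rw [← h.fst_eq, ← h.lnVec_eq]
    exact hs.ln v j (h.le v j hj)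

/-- Two vectors of image coordinates agree up to lines that are not observed. -/
def AgreeOn (T : Problem ι κ) (b b' : Param ι κ → ℂ) : Prop :=
  (∀ q, b' (.inl q) = b (.inl q)) ∧ ∀ v j k, j ∈ T.obsLn v → b' (.inr (v, j, k)) = b (.inr (v, j, k))

theorem AgreeOn.sol {b b' : Param ι κ → ℂ} (h : AgreeOn T b b') {P : Cameras}
    {e : Slot ι κ → Fin 4 → ℂ} (hs : Sol T b P e) : Sol T b' P e := by
  have h1 : ∀ v i, imgVec b' v i = imgVec b v i := fun v i => by simp only [imgVec, h.1]
  have h2 : ∀ v j, j ∈ T.obsLn v → lnVec T b' v j = lnVec T b v j := fun v j hj => by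
    simp only [lnVec, h.1, h.2 v j _ hj]
  refine ⟨hs.cam, hs.pnt_ne, hs.indep, fun v i hi => ?_, fun v j hj => ?_⟩
  · rw [h1]
    exact hs.pt v i hi
  · rw [h2 v j hj]
    exact hs.ln v j hj

/-- A solution in general position extends to the additional observations. -/
theorem Sol.exists_of_ext (hT : T.OneInc) (h : Ext T D) {b : Param ι κ → ℂ} {P : Cameras}
    {e : Slot ι κ → Fin 4 → ℂ} (hs : Sol T b P e) (hn : NonDeg T P e)
    (hc : ∀ v j c, j ∈ D.obsLn v → j ∉ T.obsLn v → j ∈ T.obsLn c →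
      lnVec D b v j ⬝ᵥ (P v).mulVec (center (P c)) ≠ 0) : ∃ e', Sol D b P e' := by
  have hD := h.oneInc hT
  have hfst : ∀ v j, j ∈ D.obsLn v → lnVec D b v j ⬝ᵥ (P v).mulVec (fst D e j) = 0 := by
    intro v j hj
    by_cases hj' : j ∈ T.obsLn v
    · rw [h.lnVec_eq, h.fst_eq]
      exact hs.incident.fst v j hj'
    · obtain ⟨i, c, hij, hi, -⟩ := h.new v j hj hj'
      have h1 : (P v).mulVec (pnt e i) = (P v).mulVec (pnt e i) 2 • imgVec b v i :=
        funext fun k => hs.incident.pt v i (by rwa [← h.obsPt]) k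
      rw [fst_of_inc hD e hij, h1, dotProduct_smul, lnVec_dot_imgVec hD b hi hij, smul_zero]
  have hw : ∀ j, ∃ w : Fin 4 → ℂ, (∃ k l, fst D e j k * w l - fst D e j l * w k ≠ 0) ∧
      ∀ v, j ∈ D.obsLn v → lnVec D b v j ⬝ᵥ (P v).mulVec w = 0 ∧
      crossProduct ((P v).mulVec (fst D e j)) ((P v).mulVec w) 0 ≠ 0 := by
    intro j
    by_cases hnew : ∃ v, j ∈ D.obsLn v ∧ j ∉ T.obsLn v
    · obtain ⟨v, hv, hvT⟩ := hnew
      obtain ⟨i, c, hij, hi, hvc, hTj, hDj⟩ := h.new v j hv hvT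
      have hcT := (hTj c).2 rfl
      have hφ := hc v j c hv hvT hcT
      -- Moving the second vector along its ray from `c` does not change its image in `c`. This
      -- multiple of the centre puts it into the plane that the new observation back-projects from
      -- `v`; the denominator says that this plane misses the centre of `c`.
      let μ : ℂ := -(lnVec D b v j ⬝ᵥ (P v).mulVec (snd e j)) /
        (lnVec D b v j ⬝ᵥ (P v).mulVec (center (P c)))
      have hPc : (P c).mulVec (snd e j + μ • center (P c)) = (P c).mulVec (snd e j) := by
        rw [Matrix.mulVec_add, Matrix.mulVec_smul, mulVec_center (rot_mul_transpose hs.cam c),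
          smul_zero, add_zero]
      have hcc := (hs.ln c j hcT).1
      rw [← h.fst_eq] at hcc
      refine ⟨snd e j + μ • center (P c), ?_, fun v' hv' => ?_⟩
      · rw [← linearIndependent_pair_iff_minor]
        have hli : LinearIndependent ℂ ![(P c).mulVec (fst D e j),
            (P c).mulVec (snd e j + μ • center (P c))] :=
          crossProduct_ne_zero_iff_linearIndependent.1 fun h0 => by
            rw [hPc] at h0
            exact hcc (by rw [h0]; rfl)
        refine LinearIndependent.of_comp (P c).mulVecLin ?_
        convert hli using 1
        funext r
        fin_cases r <;> rfl
      · rcases (hDj v').1 hv' with rfl | rfl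
        · have hdot : lnVec D b v' j ⬝ᵥ (P v').mulVec (snd e j + μ • center (P c)) = 0 := by
            rw [Matrix.mulVec_add, Matrix.mulVec_smul, dotProduct_add, dotProduct_smul, smul_eq_mul,
              div_mul_cancel₀ _ hφ]
            ring
          refine ⟨hdot, ?_⟩
          -- Since the old line and both centres span the space, the modified line misses the centre
          -- of the new view, so its image there is a line.
          have hq := hn.ln c v' (Ne.symm hvc) j hcT
          have hli : LinearIndependent ℂ ![(P v').mulVec (fst D e j),
              (P v').mulVec (snd e j + μ • center (P c))] := by
            rw [LinearIndependent.pair_iff]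
            intro α β hαβ
            have h1 : (P v').mulVec (α • fst T e j + β • (snd e j + μ • center (P c))) = 0 := by
              rw [← hαβ, ← h.fst_eq, Matrix.mulVec_add, Matrix.mulVec_smul, Matrix.mulVec_smul]
            have h2 := eq_smul_center (rot_mul_transpose hs.cam v') h1
            generalize (α • fst T e j + β • (snd e j + μ • center (P c))) 3 = δ at h2
            have h3 := coeffs_eq_zero_of_quad hq (α := α) (β := β) (γ := β * μ) (δ := -δ) (by
              rw [← sub_eq_zero] at h2
              rw [← h2]
              module)
            exact ⟨h3.1, h3.2.1⟩
          exact ((span_pair_eq_dualSub_iff (lnVec_zero D b v' j)).1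
            (span_pair_eq_dualSub hli (lnVec_ne_zero D b v' j) (hfst v' j hv) hdot)).1
        · rw [hPc]
          refine ⟨?_, hcc⟩
          rw [h.lnVec_eq]
          exact hs.incident.snd v' j hcT
    · push Not at hnew
      refine ⟨snd e j, ?_, fun v hv => ?_⟩
      · rw [h.fst_eq]
        exact hs.indep j
      · rw [h.fst_eq, h.lnVec_eq]
        exact ⟨hs.incident.snd v j (hnew v hv), (hs.ln v j (hnew v hv)).1⟩
  choose w hwi hw using hw
  let e' : Slot ι κ → Fin 4 → ℂ := Sum.elim (fun s => e (.inl s)) w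
  refine ⟨e', sol_iff.2 ⟨hs.cam, ⟨hs.pnt_ne, hwi, fun v i hi => ?_, fun v j hj => (hw j v hj).2⟩,
    ⟨fun v i hi => ?_, hfst, fun v j hj => (hw j v hj).1⟩⟩⟩
  · rw [h.obsPt] at hi
    exact hs.visible.pt v i hi
  · rw [h.obsPt] at hi
    exact hs.incident.pt v i hi

/-- The first derivative with respect to the slope of a new observation is nonzero. -/
theorem exists_lnVec_dot_ne_zero (hT : T.OneInc) (h : Ext T D) {b : Param ι κ → ℂ} {P : Cameras}
    {e : Slot ι κ → Fin 4 → ℂ} (hs : Sol T b P e) (hn : NonDeg T P e) {v c : Fin 3} {j : κ}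
    (hj : j ∈ D.obsLn v) (hjT : j ∉ T.obsLn v) (hc : j ∈ T.obsLn c) :
    ∃ s : ℂ, ∀ b', AgreeOn T b b' → b' (.inr (v, j, 0)) = s →
      lnVec D b' v j ⬝ᵥ (P v).mulVec (center (P c)) ≠ 0 := by
  have hD := h.oneInc hT
  obtain ⟨i, c', hij, hi, hvc, hTj, -⟩ := h.new v j hj hjT
  rw [(hTj c).1 hc]
  set g := (P v).mulVec (center (P c')) with hg
  have e1 : ∀ s b', AgreeOn T b b' → b' (.inr (v, j, 0)) = s → lnVec D b' v j ⬝ᵥ g =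
      (g 0 - b (.inl (v, i, 0)) * g 2) + s * (g 1 - b (.inl (v, i, 1)) * g 2) := by
    intro s b' hb hs'
    rw [Matrix.vec3_dotProduct, lnVec_zero, lnVec_one, lnVec_two_of_inc hD b' hi hij, hs', hb.1, hb.1]
    ring
  -- The expression is affine in the slope `s`. If it vanished at `0` and `1`, the image in `v` of
  -- the centre of `c'` would coincide with that of the point, or be zero; this contradicts general
  -- position.
  by_contra! hcon
  have h0 : g 0 - b (.inl (v, i, 0)) * g 2 = 0 := by
    obtain ⟨b', hb, hs', h1⟩ := hcon 0
    rw [e1 0 b' hb hs'] at h1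
    simpa using h1
  have h1 : g 1 - b (.inl (v, i, 1)) * g 2 = 0 := by
    obtain ⟨b', hb, hs', h1⟩ := hcon 1
    rw [e1 1 b' hb hs', h0] at h1
    simpa using h1
  have hiT : i ∈ T.obsPt v := by rwa [← h.obsPt]
  have h2 : (P v).mulVec (center (P c')) =
      (g 2 / (P v).mulVec (pnt e i) 2) • (P v).mulVec (pnt e i) := by
    ext k
    rw [Pi.smul_apply, (hs.pt v i hiT).2 k, smul_eq_mul, ← mul_assoc,
      div_mul_cancel₀ _ (hs.pt v i hiT).1]
    fin_cases k
    · show g 0 = g 2 * b (.inl (v, i, 0))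
      linear_combination h0
    · show g 1 = g 2 * b (.inl (v, i, 1))
      linear_combination h1
    · exact (mul_one _).symm
  obtain ⟨γ, h3⟩ := exists_of_mulVec_eq_smul hs.cam h2
  obtain ⟨r, hr⟩ := hn.pt c' v (Ne.symm hvc) i
  have h4 := coeffs_eq_zero_of_quad hr (α := g 2 / (P v).mulVec (pnt e i) 2) (β := -1) (γ := γ)
    (δ := 0) (by
      rw [← sub_eq_zero] at h3
      rw [← neg_eq_zero, ← h3]
      module)
  simp at h4

variable [Finite ι] [Finite κ]

/-- Solutions in general position generically extend to additional observations. -/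
theorem gen_le_encard_of_ext (hT : T.OneInc) (h : Ext T D) {n : ℕ}
    (hg : Gen fun b => (n : ℕ∞) ≤ (camSet (fun b P e => Sol T b P e ∧ NonDeg T P e) b).encard) :
    Gen fun b => (n : ℕ∞) ≤ (camSet (fun b P e => Sol D b P e) b).encard := by
  classical
  -- By the dichotomy it is enough to find one image with many configurations in the open set where
  -- there would be too few.
  refine ((constrRel_sol D).gen_le_encard_or n).resolve_right fun hnot => ?_
  obtain ⟨f, hf, hnot⟩ := hnot
  obtain ⟨b, hb, hfb⟩ := (hg.and ⟨f, hf, fun b hb => hb⟩).exists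
  obtain ⟨P, hP, hPne⟩ := natCast_le_encard_iff.1 hb
  choose e he using hP
  -- Only slopes of lines that `T` does not observe are varied, so the solutions of `T` do not
  -- change. Generic slopes suit all `n` chosen solutions at once and stay in the open set `f ≠ 0`.
  let b' : (Fin 3 × κ → ℂ) → Param ι κ → ℂ := fun x t => match t with
    | .inl q => b (.inl q)
    | .inr (v, j, k) => if k = 0 ∧ j ∉ T.obsLn v then x (v, j) else b (.inr (v, j, k))
  have hagree : ∀ x, AgreeOn T b (b' x) := fun x =>
    ⟨fun q => rfl, fun v j k hj => if_neg fun h => h.2 hj⟩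
  have hpoly : ∀ t, IsPoly fun x => b' x t := by
    rintro (q | ⟨v, j, k⟩)
    · exact .const _
    · by_cases hk : k = 0 ∧ j ∉ T.obsLn v
      · simp only [b', if_pos hk]
        exact .coord _
      · simp only [b', if_neg hk]
        exact .const _
  have hgf : Gen fun x => eval (b' x) f ≠ 0 := by
    refine IsPoly.gen (b := fun q => b (.inr (q.1, q.2, 0))) ((IsPoly.of_eval f).comp hpoly) ?_
    convert hfb using 3
    funext t
    rcases t with q | ⟨v, j, k⟩
    · rfl
    · simp only [b']
      split_ifs with hk
      · rw [hk.1]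
      · rfl
  have hgc : Gen fun x => ∀ (m : Fin n) (v : Fin 3) (j : κ) (c : Fin 3), j ∈ D.obsLn v →
      j ∉ T.obsLn v → j ∈ T.obsLn c →
      lnVec D (b' x) v j ⬝ᵥ (P m v).mulVec (center (P m c)) ≠ 0 := by
    refine Gen.all fun m => Gen.all fun v => Gen.all fun j => Gen.all fun c => ?_
    by_cases hj : j ∈ D.obsLn v ∧ j ∉ T.obsLn v ∧ j ∈ T.obsLn c
    · obtain ⟨s, hs⟩ := exists_lnVec_dot_ne_zero hT h (he m).1 (he m).2 hj.1 hj.2.1 hj.2.2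
      refine (IsPoly.gen (F := fun x => lnVec D (b' x) v j ⬝ᵥ (P m v).mulVec (center (P m c)))
        (IsPoly.dot (u := fun x => lnVec D (b' x) v j)
          (w := fun _ => (P m v).mulVec (center (P m c)))
          (fun k => (isPoly_lnVec D v j k).comp hpoly) fun k => .const _)
        (b := fun _ => s) (hs (b' fun _ => s) (hagree fun _ => s)
          (if_pos ⟨rfl, hj.2.1⟩))).mono fun x hx _ _ _ => hx
    · exact Gen.of_forall fun x h1 h2 h3 => absurd ⟨h1, h2, h3⟩ hj
  obtain ⟨x, hx, hxc⟩ := (hgf.and hgc).exists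
  refine hnot _ hx (natCast_le_encard_iff.2 ⟨P, fun m => ?_, hPne⟩)
  exact Sol.exists_of_ext hT h ((hagree x).sol (he m).1) (he m).2 (hxc m)

end Ext

end PointLine

namespace PointLine

open MvPolynomial

variable {ι κ : Type}

/-! ### Minimality and degrees in image coordinates -/

section Coordinates

variable {D : Problem ι κ}

theorem cameraSolutions_chart (hD : D.OneInc) (b : Param ι κ → ℂ) :
    D.cameraSolutions (chart D b) = camSet (fun b P e => Sol D b P e) b :=
  Set.ext fun _ => mem_cameraSolutions_chart hD

theorem Problem.IsMinimal.isCameraMinimal (h : D.IsMinimal) : D.IsCameraMinimal := by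
  obtain ⟨h1, f, hf, h2⟩ := h
  exact ⟨h1, f, hf, fun t ht a ha hfa => (h2 t ht a ha hfa).image _⟩

theorem Gen.finite_of_not_le {R : (Param ι κ → ℂ) → Cameras → (Slot ι κ → Fin 4 → ℂ) → Prop} {n : ℕ}
    (h : Gen fun b => ¬ (n : ℕ∞) ≤ (camSet R b).encard) : Gen fun b => (camSet R b).Finite :=
  h.mono fun _ hb => Set.encard_lt_top_iff.1 ((not_le.1 hb).trans (ENat.natCast_lt_top n))

theorem mem_gauge_snd_of_not_single {D : Problem ι κ} {P : Cameras} {e : Slot ι κ → Fin 4 → ℂ}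
    {j : κ} (hj : ¬ ∃ v, ∀ v', j ∈ D.obsLn v' ↔ v' = v) {z : Fin 4 → ℂ}
    (hz : z ∈ gauge D P e (.inr j)) : z ∈ Submodule.span ℂ {fst D e j, snd e j} := by
  refine Submodule.span_mono ?_ hz
  rintro z (h | h | ⟨v, h, -⟩)
  exacts [Or.inl h, Or.inr h, absurd ⟨v, h⟩ hj]

/-- If no line is seen by exactly one view, the gauge only rescales points and changes the spanning
vectors within each line, so the arrangement is the same. -/
theorem Rep.eq_of_gauge {D : Problem ι κ} (hD : D.OneInc)
    (hj : ∀ j, ¬ ∃ v, ∀ v', j ∈ D.obsLn v' ↔ v' = v) {b : Param ι κ → ℂ} {P : Cameras}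
    {e e' : Slot ι κ → Fin 4 → ℂ} {A A' : Arrangement ι κ 4} (h : Rep D A e) (h' : Rep D A' e')
    (hs' : Sol D b P e') (he : ∀ s, e' s ∈ gauge D P e s) : A = A' := by
  refine Arrangement.ext' (fun i => ?_) fun j => ?_
  · rw [h.1, h'.1, eq_comm, span_singleton_eq_iff (Function.ne_iff.2 (hs'.pnt_ne i))]
    obtain ⟨c, hc⟩ := mem_gauge_pnt (he (.inl (.inl i)))
    refine ⟨c, ?_, hc⟩
    rintro rfl
    obtain ⟨k, hk⟩ := hs'.pnt_ne i
    exact hk (by rw [pnt, hc]; simp)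
  · have h1 : (A'.ln j).1 ≤ (A.ln j).1 := by
      rw [h.2, h'.2, Submodule.span_le]
      rintro z (rfl | rfl)
      · obtain ⟨α, β, hz⟩ := mem_gauge_fst hD (he (.inl (base D j)))
        exact Submodule.mem_span_pair.2 ⟨α, β, hz.symm⟩
      · exact mem_gauge_snd_of_not_single (hj j) (he (.inr j))
    exact (Submodule.eq_of_le_of_finrank_eq h1 ((A'.ln j).2.trans (A.ln j).2.symm)).symm

variable [Finite ι] [Finite κ]

theorem hasCameraDegree_iff (hD : D.OneInc) {d : ℕ} :
    D.HasCameraDegree d ↔ Gen fun b => (camSet (fun b P e => Sol D b P e) b).encard = d := by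
  rw [Problem.HasCameraDegree, genericImage_iff hD]
  simp only [cameraSolutions_chart hD]

theorem isDominant_iff (hD : D.OneInc) :
    D.IsDominant ↔ Gen fun b => (camSet (fun b P e => Sol D b P e) b).Nonempty := by
  rw [Problem.IsDominant, genericImage_iff hD]
  simp only [← cameraSolutions_chart hD, Problem.cameraSolutions, Set.image_nonempty]

theorem isCameraMinimal_iff (hD : D.OneInc) :
    D.IsCameraMinimal ↔ Gen (fun b => (camSet (fun b P e => Sol D b P e) b).Nonempty) ∧
      Gen fun b => (camSet (fun b P e => Sol D b P e) b).Finite := by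
  rw [Problem.IsCameraMinimal, isDominant_iff hD, genericImage_iff hD]
  simp only [cameraSolutions_chart hD]

theorem Problem.IsCameraMinimal.exists_degree (hD : D.OneInc) (h : D.IsCameraMinimal) :
    ∃ d : ℕ, Gen fun b => (camSet (fun b P e => Sol D b P e) b).encard = d :=
  (constrRel_sol D).exists_degree ((isCameraMinimal_iff hD).1 h).2

end Coordinates

/-! ### Additional observations and degrees -/

section Ext

variable [Finite ι] [Finite κ] {T D : Problem ι κ}

/-- Forgetting additional observations preserves camera-minimality and the camera-degree. -/
theorem isCameraMinimal_of_ext (hT : T.OneInc) (h : Ext T D) (hC : Comb T)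
    (hD : D.IsCameraMinimal) :
    T.IsCameraMinimal ∧ ∃ d, D.HasCameraDegree d ∧ T.HasCameraDegree d := by
  have hD1 := h.oneInc hT
  obtain ⟨d, hd⟩ := hD.exists_degree hD1
  have hnd : ConstrRel fun b P e => Sol T b P e ∧ NonDeg T P e :=
    (constrRel_sol T).and (constrRel_nonDeg T)
  -- Nondegenerate solutions of `T` extend to `D`, which bounds the number of their configurations
  -- by `d`. Only this finiteness is needed to exclude degenerate solutions of `T`, so its
  -- camera-minimality need not be known beforehand.
  have h1 := (hnd.gen_le_encard_or (d + 1)).resolve_left fun hg => by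
    obtain ⟨b, hb1, hb2⟩ := ((gen_le_encard_of_ext hT h hg).and hd).exists
    rw [hb2] at hb1
    exact absurd (by exact_mod_cast hb1) (Nat.not_succ_le_self d)
  have h2 := gen_nonDeg hT hC h1.finite_of_not_le
  have hle : ∀ b, camSet (fun b P e => Sol D b P e) b ⊆ camSet (fun b P e => Sol T b P e) b :=
    fun b P ⟨e, he⟩ => ⟨e, he.of_ext h⟩
  have h3 : Gen fun b => (camSet (fun b P e => Sol T b P e) b).encard = d := by
    refine ((h1.and h2).and hd).mono fun b hb => le_antisymm ?_ ?_
    · have : camSet (fun b P e => Sol T b P e) b ⊆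
          camSet (fun b P e => Sol T b P e ∧ NonDeg T P e) b :=
        fun P ⟨e, he⟩ => ⟨e, he, hb.1.2 P e he⟩
      refine (Set.encard_le_encard this).trans (Order.le_of_lt_add_one ?_)
      exact_mod_cast not_le.1 hb.1.1
    · rw [← hb.2]
      exact Set.encard_le_encard (hle b)
  refine ⟨(isCameraMinimal_iff hT).2 ⟨?_, ?_⟩, d, (hasCameraDegree_iff hD1).2 hd,
    (hasCameraDegree_iff hT).2 h3⟩
  · exact ((isCameraMinimal_iff hD1).1 hD).1.mono fun b hb => hb.mono (hle b)
  · exact h3.mono fun b hb => Set.finite_of_encard_eq_coe hb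

/-- Additional observations turn a camera-minimal problem into a minimal one with the same
camera-degree, if every line is observed twice in the end. -/
theorem isMinimal_of_ext (hT : T.OneInc) (h : Ext T D) (hCT : Comb T) (hCD : Comb D)
    (hj : ∀ j, ¬ ∃ v, ∀ v', j ∈ D.obsLn v' ↔ v' = v) (hmin : T.IsCameraMinimal) : D.IsMinimal := by
  have hD := h.oneInc hT
  obtain ⟨d, hd⟩ := hmin.exists_degree hT
  have hfin : Gen fun b => (camSet (fun b P e => Sol T b P e) b).Finite :=
    ((isCameraMinimal_iff hT).1 hmin).2
  have hnd := gen_nonDeg hT hCT (hfin.mono fun b hb => hb.subset fun P ⟨e, he⟩ => ⟨e, he.1⟩)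
  have h1 : Gen fun b => (d : ℕ∞) ≤ (camSet (fun b P e => Sol D b P e) b).encard := by
    refine gen_le_encard_of_ext hT h ((hd.and hnd).mono fun b hb => ?_)
    rw [← hb.1]
    exact Set.encard_le_encard fun P ⟨e, he⟩ => ⟨e, he, hb.2 P e he⟩
  have hle : ∀ b, camSet (fun b P e => Sol D b P e) b ⊆ camSet (fun b P e => Sol T b P e) b :=
    fun b P ⟨e, he⟩ => ⟨e, he.of_ext h⟩
  have hfinD : Gen fun b => (camSet (fun b P e => Sol D b P e) b).Finite :=
    hfin.mono fun b hb => hb.subset (hle b)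
  have hndD := gen_nonDeg hD hCD (hfinD.mono fun b hb => hb.subset fun P ⟨e, he⟩ => ⟨e, he.1⟩)
  refine ⟨(isDominant_iff hD).2 ?_, (genericImage_iff hD).2 ?_⟩
  · refine ((h1.and hd).and ((isCameraMinimal_iff hT).1 hmin).1).mono fun b hb => ?_
    rw [← Set.one_le_encard_iff_nonempty] at hb ⊢
    exact (hb.2.trans_eq hb.1.2).trans hb.1.1
  · refine (hfinD.and hndD).mono fun b hb => ?_
    have hfin' : (Prod.snd '' D.solutions (chart D b)).Finite := by
      have := cameraSolutions_chart hD b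
      rw [Problem.cameraSolutions] at this
      rw [this]
      exact hb.1
    -- The cameras are finite in number and determine the arrangement: two solutions with the same
    -- cameras differ by the gauge.
    refine hfin'.of_finite_image ?_
    rintro ⟨A, P⟩ hA ⟨A', P'⟩ hA' hP
    obtain rfl : P = P' := hP
    obtain ⟨e, he⟩ := exists_rep hD hA.1
    obtain ⟨e', he'⟩ := exists_rep hD hA'.1
    have hs := (he.sol_iff hD).2 hA
    have hs' := (he'.sol_iff hD).2 hA'
    exact Prod.ext (he.eq_of_gauge hD hj he' hs' fun s =>
      (hb.2 P e hs).mem_gauge hD hCD hs s (hs'.system_dot hD s)) rfl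

/-- In a minimal problem no line is observed exactly once. -/
theorem Problem.IsMinimal.not_single {D : Problem ι κ} (hD : D.OneInc) (h : D.IsMinimal) (j : κ) :
    ¬ ∃ v, ∀ v', j ∈ D.obsLn v' ↔ v' = v := by
  classical
  rintro ⟨v, hv⟩
  obtain ⟨b, ⟨P, e, hs⟩, hfin⟩ := (((isDominant_iff hD).1 h.1).and ((genericImage_iff hD).1 h.2)).exists
  -- The line moves in the plane back-projected from its only view, which gives a one-parameter
  -- family of solutions.
  let e' : ℂ → Slot ι κ → Fin 4 → ℂ := fun s => Function.update e (.inr j) (snd e j + s • center (P v))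
  have hjv := (hv v).2 rfl
  have hli : LinearIndependent ℂ ![(P v).mulVec (fst D e j), (P v).mulVec (snd e j)] :=
    crossProduct_ne_zero_iff_linearIndependent.1 fun h0 => (hs.ln v j hjv).1 (by rw [h0]; rfl)
  have hpnt : ∀ s, pnt (e' s) = pnt e := fun s => rfl
  have hfst : ∀ s j', fst D (e' s) j' = fst D e j' := fun s j' => rfl
  have hsnd : ∀ s, snd (e' s) j = snd e j + s • center (P v) := fun s => Function.update_self ..
  have hsnd' : ∀ s j', j' ≠ j → snd (e' s) j' = snd e j' := fun s j' hj' =>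
    Function.update_of_ne (fun h => hj' (Sum.inr_injective h)) ..
  have hPv : ∀ s : ℂ, (P v).mulVec (snd e j + s • center (P v)) = (P v).mulVec (snd e j) := fun s => by
    rw [Matrix.mulVec_add, Matrix.mulVec_smul, mulVec_center (rot_mul_transpose hs.cam v),
      smul_zero, add_zero]
  have hs' : ∀ s, Sol D b P (e' s) := by
    intro s
    refine ⟨hs.cam, hs.pnt_ne, fun j' => ?_, hs.pt, fun v' j' hj' => ?_⟩
    · rw [hfst]
      by_cases hjj : j' = j
      · subst hjj
        rw [hsnd, ← linearIndependent_pair_iff_minor]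
        refine LinearIndependent.of_comp (P v).mulVecLin ?_
        convert hli using 1
        funext r
        fin_cases r
        · rfl
        · exact hPv s
      · rw [hsnd' s j' hjj]
        exact hs.indep j'
    · rw [hfst]
      by_cases hjj : j' = j
      · subst hjj
        obtain rfl := (hv v').1 hj'
        rw [hsnd, hPv]
        exact hs.ln v' j' hj'
      · rw [hsnd' s j' hjj]
        exact hs.ln v' j' hj'
  choose A hA using fun s => (hs' s).exists_rep
  refine Set.infinite_of_injective_forall_mem (f := fun s => (A s, P)) (fun s s' hss => ?_)
    (fun s => ((hA s).sol_iff hD).1 (hs' s)) hfin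
  have h1 : A s = A s' := congrArg Prod.fst hss
  by_contra hne
  have h2 := (hA s).2 j
  rw [h1, (hA s').2 j] at h2
  have h3 : snd (e' s') j ∈ Submodule.span ℂ {fst D (e' s) j, snd (e' s) j} := by
    rw [← h2]
    exact Submodule.subset_span (Or.inr rfl)
  obtain ⟨α, β, h4⟩ := Submodule.mem_span_pair.1 h3
  rw [hfst, hsnd, hsnd] at h4
  have h5 := congrArg ((P v).mulVec) h4
  rw [Matrix.mulVec_add, Matrix.mulVec_smul, Matrix.mulVec_smul, hPv, hPv] at h5
  obtain ⟨h6, h7⟩ := LinearIndependent.pair_iff.1 hli α (β - 1) (by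
    rw [sub_smul, one_smul, ← add_sub_assoc, h5, sub_self])
  rw [h6, sub_eq_zero.1 h7, zero_smul, one_smul, zero_add, add_right_inj] at h4
  have := congrFun h4 3
  simp only [Pi.smul_apply, center_three, smul_eq_mul, mul_one] at this
  exact hne this

end Ext

end PointLine

namespace PointLine

open MvPolynomial

/-! ### Relabeling the views -/

section RelCam

/-- The first coordinate of the second translation vector before normalization. -/
def relScale (σ : Equiv.Perm (Fin 3)) (P : Cameras) : ℂ := (P (σ 1)).mulVec (center (P (σ 0))) 0

/-- The normalized cameras after relabeling the views. -/
noncomputable def relCam (σ : Equiv.Perm (Fin 3)) (P : Cameras) : Cameras := fun v =>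
  mkCam (rot (P (σ v)) * (rot (P (σ 0))).transpose)
    ((relScale σ P)⁻¹ • (P (σ v)).mulVec (center (P (σ 0))))

/-- The change of space coordinates that normalizes the cameras after relabeling the views. -/
def relVec (σ : Equiv.Perm (Fin 3)) (P : Cameras) (z : Fin 4 → ℂ) : Fin 4 → ℂ :=
  Fin.snoc (α := fun _ => ℂ) ((P (σ 0)).mulVec z) (relScale σ P * z 3)

variable {σ : Equiv.Perm (Fin 3)} {P : Cameras}

theorem relVec_castSucc (z : Fin 4 → ℂ) (k : Fin 3) :
    relVec σ P z k.castSucc = (P (σ 0)).mulVec z k := Fin.snoc_castSucc (α := fun _ => ℂ) _ _ _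

theorem relVec_three (z : Fin 4 → ℂ) : relVec σ P z 3 = relScale σ P * z 3 :=
  Fin.snoc_last (α := fun _ => ℂ) _ _

theorem relVec_comb (α β : ℂ) (u w : Fin 4 → ℂ) :
    α • relVec σ P u + β • relVec σ P w = relVec σ P (α • u + β • w) := by
  ext k
  refine Fin.lastCases ?_ (fun k => ?_) k
  · simp only [show Fin.last 3 = 3 from rfl, Pi.add_apply, Pi.smul_apply, relVec_three, smul_eq_mul]
    ring
  · simp only [Pi.add_apply, Pi.smul_apply, relVec_castSucc, smul_eq_mul, Matrix.mulVec_add,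
      Matrix.mulVec_smul]

/-- With `R` and `t` the rotations and translations of `P`, one has `P v c = t v - R v (R 0)ᵀ t 0`
for the centre `c` of view `0`, with indices permuted by `σ`. Adding `z 3` times this to `R v (R 0)ᵀ
(P 0 z)` gives `P v z`; the factor `relScale` cancels. -/
theorem relCam_mulVec (hP : P ∈ camVariety) (hs : relScale σ P ≠ 0) (v : Fin 3) (z : Fin 4 → ℂ) :
    (relCam σ P v).mulVec (relVec σ P z) = (P (σ v)).mulVec z := by
  rw [mulVec_eq_rot_add, relCam, rot_mkCam, trans_mkCam, relVec_three, smul_smul,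
    mul_right_comm, mul_inv_cancel₀ hs, one_mul, mulVec_center_eq]
  have : (fun k : Fin 3 => relVec σ P z k.castSucc) = (P (σ 0)).mulVec z :=
    funext fun k => relVec_castSucc z k
  have h2 : (rot (P (σ 0))).transpose * rot (P (σ 0)) = 1 := mul_eq_one_comm.1 (hP.1 _).1
  rw [this, mulVec_eq_rot_add (P (σ 0)), mulVec_eq_rot_add (P (σ v)) z, Matrix.mulVec_add,
    Matrix.mulVec_mulVec, Matrix.mul_assoc, h2, Matrix.mul_one, Matrix.mulVec_smul,
    Matrix.mulVec_mulVec, smul_sub]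
  abel

theorem relCam_mem (hP : P ∈ camVariety) (hs : relScale σ P ≠ 0) : relCam σ P ∈ camVariety := by
  have h1 : ∀ v, rot (P v) * (rot (P v)).transpose = 1 := fun v => (hP.1 v).1
  have h2 : ∀ v, (rot (P v)).transpose * rot (P v) = 1 := fun v => mul_eq_one_comm.1 (h1 v)
  refine ⟨fun v => ⟨?_, ?_⟩, ?_, ?_, ?_⟩
  · rw [relCam, rot_mkCam, Matrix.transpose_mul, Matrix.transpose_transpose, Matrix.mul_assoc,
      ← Matrix.mul_assoc _ (rot _) (rot _).transpose, h2, Matrix.one_mul, h1]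
  · rw [relCam, rot_mkCam, Matrix.det_mul, Matrix.det_transpose, (hP.1 _).2, (hP.1 _).2, one_mul]
  · rw [relCam, rot_mkCam, h1]
  · rw [relCam, trans_mkCam, mulVec_center (h1 _), smul_zero]
  · rw [relCam, trans_mkCam, Pi.smul_apply, smul_eq_mul]
    exact inv_mul_cancel₀ hs

theorem relVec_ne_zero (hP : P ∈ camVariety) (hs : relScale σ P ≠ 0) {z : Fin 4 → ℂ}
    (h : relVec σ P z = 0) : z = 0 := by
  have h1 : (P (σ 0)).mulVec z = 0 := funext fun k => by
    rw [← relVec_castSucc, h]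
    rfl
  have h2 : z 3 = 0 := by
    have := congrFun h 3
    rw [relVec_three] at this
    exact (mul_eq_zero.1 this).resolve_left hs
  rw [eq_smul_center (rot_mul_transpose hP _) h1, h2, zero_smul]

theorem center_relCam (hP : P ∈ camVariety) (hs : relScale σ P ≠ 0) (v : Fin 3) :
    relVec σ P (center (P (σ v))) = relScale σ P • center (relCam σ P v) := by
  have h1 := relCam_mulVec hP hs v (center (P (σ v)))
  rw [mulVec_center (rot_mul_transpose hP _)] at h1
  rw [eq_smul_center (rot_mul_transpose (relCam_mem hP hs) v) h1, relVec_three, center_three, mul_one]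

/-- As the original cameras are normalized, relabeling back recovers them exactly. Hence
renormalization is injective and preserves the number of configurations. -/
theorem relCam_symm (hP : P ∈ camVariety) (hs : relScale σ P ≠ 0) :
    relCam σ.symm (relCam σ P) = P := by
  have h2 : ∀ v, (rot (P v)).transpose * rot (P v) = 1 := fun v => mul_eq_one_comm.1 (hP.1 v).1
  have hc : center (P 0) = Pi.single 3 1 := by
    ext k
    refine Fin.lastCases rfl (fun k => ?_) k
    rw [center_castSucc, hP.2.2.1, Matrix.mulVec_zero]
    rw [show (3 : Fin 4) = Fin.last 3 from rfl, Pi.single_eq_of_ne (Fin.castSucc_ne_last k)]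
    exact neg_zero
  have h3 : ∀ v, (relCam σ P (σ.symm v)).mulVec (center (relCam σ P (σ.symm 0))) =
      (relScale σ P)⁻¹ • trans (P v) := by
    intro v
    have h4 := center_relCam hP hs (σ.symm 0)
    rw [Equiv.apply_symm_apply] at h4
    have h5 := relCam_mulVec hP hs (σ.symm v) (center (P 0))
    rw [h4, Equiv.apply_symm_apply, Matrix.mulVec_smul, hc] at h5
    rw [eq_inv_smul_iff₀ hs, h5]
    ext r
    simp [trans, Matrix.mulVec_single]
  have h6 : relScale σ.symm (relCam σ P) = (relScale σ P)⁻¹ := by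
    rw [relScale, h3, Pi.smul_apply, hP.2.2.2, smul_eq_mul, mul_one]
  funext v
  conv_lhs => rw [relCam]
  rw [h3, h6, inv_inv, smul_inv_smul₀ hs]
  conv_rhs => rw [← mkCam_rot_trans (P v)]
  congr 1
  rw [relCam, relCam, rot_mkCam, rot_mkCam, Equiv.apply_symm_apply, Equiv.apply_symm_apply,
    Matrix.transpose_mul, Matrix.transpose_transpose, hP.2.1, Matrix.transpose_one, Matrix.mul_one,
    Matrix.mul_assoc, h2, Matrix.mul_one]

end RelCam

theorem Gen.comp_equiv {σ τ : Type} {Q : (σ → ℂ) → Prop} (h : Gen Q) (g : σ ≃ τ) :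
    Gen fun b : τ → ℂ => Q (b ∘ g) := by
  obtain ⟨f, hf, hQ⟩ := h
  refine ⟨rename g f, fun h0 => hf (rename_injective g g.injective (h0.trans (map_zero _).symm)),
    fun b hb => hQ _ ?_⟩
  rwa [eval_rename] at hb

section Relabel

variable {ι κ ι' κ' : Type}

/-- `E` is obtained from `D` by renumbering the points and the lines and relabeling the views. -/
structure Relabel (D : Problem ι κ) (E : Problem ι' κ') (τ : Equiv.Perm (Fin 3)) (p : ι ≃ ι')
    (l : κ ≃ κ') : Prop where
  inc : ∀ i j, (i, j) ∈ D.inc ↔ (p i, l j) ∈ E.inc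
  obsPt : ∀ v i, i ∈ D.obsPt v ↔ p i ∈ E.obsPt (τ v)
  obsLn : ∀ v j, j ∈ D.obsLn v ↔ l j ∈ E.obsLn (τ v)

variable {D : Problem ι κ} {E : Problem ι' κ'} {τ : Equiv.Perm (Fin 3)} {p : ι ≃ ι'} {l : κ ≃ κ'}

theorem Relabel.symm (h : Relabel D E τ p l) : Relabel E D τ.symm p.symm l.symm :=
  ⟨fun i j => by simp [h.inc], fun v i => by simp [h.obsPt], fun v j => by simp [h.obsLn]⟩

theorem Relabel.oneInc (h : Relabel D E τ p l) (hD : D.OneInc) : E.OneInc := by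
  intro j i i' hi hi'
  rw [h.symm.inc] at hi hi'
  exact p.symm.injective (hD _ _ _ hi hi')

/-- The corresponding reindexing of the image coordinates. -/
def relParam (τ : Equiv.Perm (Fin 3)) (p : ι ≃ ι') (l : κ ≃ κ') : Param ι κ ≃ Param ι' κ' :=
  Equiv.sumCongr (Equiv.prodCongr τ (Equiv.prodCongr p (Equiv.refl _)))
    (Equiv.prodCongr τ (Equiv.prodCongr l (Equiv.refl _)))

/-- The corresponding reindexing of the vectors of an arrangement. -/
def relSlot (p : ι ≃ ι') (l : κ ≃ κ') : Slot ι κ ≃ Slot ι' κ' :=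
  Equiv.sumCongr (Equiv.sumCongr p l) l

theorem imgVec_relParam (b : Param ι' κ' → ℂ) (v : Fin 3) (i : ι) :
    imgVec (b ∘ relParam τ p l) v i = imgVec b (τ v) (p i) := rfl

theorem Relabel.lnVec_relParam (hD : D.OneInc) (h : Relabel D E τ p l) (b : Param ι' κ' → ℂ)
    (v : Fin 3) (j : κ) : lnVec D (b ∘ relParam τ p l) v j = lnVec E b (τ v) (l j) := by
  ext k
  fin_cases k
  · rfl
  · rfl
  · show lnVec D _ v j 2 = lnVec E b (τ v) (l j) 2
    by_cases hj : ∃ i, i ∈ D.obsPt v ∧ (i, j) ∈ D.inc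
    · obtain ⟨i, hi, hij⟩ := hj
      rw [lnVec_two_of_inc hD _ hi hij,
        lnVec_two_of_inc (h.oneInc hD) b ((h.obsPt v i).1 hi) ((h.inc i j).1 hij)]
      rfl
    · rw [lnVec_two_of_not hj, lnVec_two_of_not]
      · rfl
      · rintro ⟨i, hi, hij⟩
        refine hj ⟨p.symm i, (h.obsPt _ _).2 ?_, (h.inc _ _).2 ?_⟩ <;> simpa

theorem Relabel.fst_relSlot (hD : D.OneInc) (h : Relabel D E τ p l)
    (e : Slot ι' κ' → Fin 4 → ℂ) (j : κ) : fst E e (l j) = fst D (e ∘ relSlot p l) j := by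
  by_cases hj : ∃ i, (i, j) ∈ D.inc
  · obtain ⟨i, hij⟩ := hj
    rw [fst_of_inc hD _ hij, fst_of_inc (h.oneInc hD) e ((h.inc i j).1 hij)]
    rfl
  · have hj' : ¬ ∃ i, (i, l j) ∈ E.inc := by
      rintro ⟨i, hij⟩
      exact hj ⟨p.symm i, (h.inc _ _).2 (by simpa)⟩
    rw [fst, fst, base_of_free hj, base_of_free hj']
    rfl

theorem Relabel.sol (hD : D.OneInc) (h : Relabel D E τ p l) {b : Param ι' κ' → ℂ} {P : Cameras}
    {e : Slot ι κ → Fin 4 → ℂ} (hs : Sol D (b ∘ relParam τ p l) P e)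
    (hc : relScale τ.symm P ≠ 0) : ∃ e', Sol E b (relCam τ.symm P) e' := by
  let e' : Slot ι' κ' → Fin 4 → ℂ := fun s => relVec τ.symm P (e ((relSlot p l).symm s))
  have hfst : ∀ j, fst E e' (l j) = relVec τ.symm P (fst D e j) := fun j => by
    rw [h.fst_relSlot hD]
    simp [fst, e']
  have hsnd : ∀ j, snd e' (l j) = relVec τ.symm P (snd e j) := fun j => by
    simp [snd, e', relSlot]
  have hpnt : ∀ i, pnt e' (p i) = relVec τ.symm P (pnt e i) := fun i => by
    simp [pnt, e', relSlot]
  have hmul : ∀ v z, (relCam τ.symm P (τ v)).mulVec (relVec τ.symm P z) = (P v).mulVec z := by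
    intro v z
    rw [relCam_mulVec hs.cam hc, Equiv.symm_apply_apply]
  refine ⟨e', relCam_mem hs.cam hc, fun i => ?_, fun j => ?_, fun v i hi => ?_, fun v j hj => ?_⟩
  · obtain ⟨i, rfl⟩ := p.surjective i
    rw [hpnt]
    refine Function.ne_iff.1 fun h0 => ?_
    obtain ⟨k, hk⟩ := hs.pnt_ne i
    exact hk (congrFun (relVec_ne_zero hs.cam hc h0) k)
  · obtain ⟨j, rfl⟩ := l.surjective j
    rw [hfst, hsnd, ← linearIndependent_pair_iff_minor, LinearIndependent.pair_iff]
    intro α β h0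
    rw [relVec_comb] at h0
    exact LinearIndependent.pair_iff.1 (hs.linearIndependent j) α β (relVec_ne_zero hs.cam hc h0)
  · obtain ⟨i, rfl⟩ := p.surjective i
    obtain ⟨v, rfl⟩ := τ.surjective v
    rw [hpnt, hmul, ← imgVec_relParam (p := p) (l := l)]
    exact hs.pt v i ((h.obsPt v i).2 hi)
  · obtain ⟨j, rfl⟩ := l.surjective j
    obtain ⟨v, rfl⟩ := τ.surjective v
    rw [hfst, hsnd, hmul, hmul, ← h.lnVec_relParam hD]
    exact hs.ln v j ((h.obsLn v j).2 hj)

/-- Renormalization divides by `relScale`, whose nonvanishing is part of general position. -/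
theorem Relabel.gen_le_encard (hD : D.OneInc) (h : Relabel D E τ p l) {n : ℕ}
    (hg : Gen fun b => (n : ℕ∞) ≤ (camSet (fun b P e => Sol D b P e ∧ NonDeg D P e) b).encard) :
    Gen fun b => (n : ℕ∞) ≤ (camSet (fun b P e => Sol E b P e) b).encard := by
  refine (hg.comp_equiv (relParam τ p l)).mono fun b hb => ?_
  obtain ⟨P, hP, hne⟩ := natCast_le_encard_iff.1 hb
  choose e he using hP
  have hc : ∀ m, relScale τ.symm (P m) ≠ 0 := fun m =>
    (he m).2.cam _ _ (fun h => zero_ne_one (τ.symm.injective h))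
  refine natCast_le_encard_iff.2 ⟨fun m => relCam τ.symm (P m), fun m => h.sol hD (he m).1 (hc m),
    fun m m' hm heq => hne m m' hm ?_⟩
  rw [← relCam_symm (he m).1.cam (hc m), ← relCam_symm (he m').1.cam (hc m')]
  exact congrArg _ heq

theorem Comb.relabel (h : Relabel D E τ p l) (hC : Comb D) : Comb E := by
  refine ⟨fun j hj v => ?_, fun i j hij hv v => ?_, fun i => ?_⟩
  · rw [h.symm.obsLn]
    refine hC.free _ ?_ _
    rintro ⟨i, hi⟩
    exact hj ⟨p i, by simpa using (h.inc _ _).1 hi⟩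
  · rw [h.symm.obsLn]
    refine hC.pin (p.symm i) _ ((h.symm.inc _ _).1 hij) (fun v' hv' => ?_) _
    rw [h.obsLn, Equiv.apply_symm_apply] at hv'
    rw [h.obsPt, Equiv.apply_symm_apply]
    exact hv _ hv'
  · obtain ⟨i, rfl⟩ := p.surjective i
    have hex : ∀ v, (∃ j, (i, j) ∈ D.inc ∧ j ∈ D.obsLn v) →
        ∃ j, (p i, j) ∈ E.inc ∧ j ∈ E.obsLn (τ v) := fun v ⟨j, h1, h2⟩ =>
      ⟨l j, (h.inc _ _).1 h1, (h.obsLn _ _).1 h2⟩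
    rcases hC.pt i with ⟨v, v', hv, h1, h2⟩ | ⟨a, b, c, hab, hac, hbc, ha, hb, hc, hj⟩
    · exact Or.inl ⟨τ v, τ v', fun h => hv (τ.injective h), (h.obsPt _ _).1 h1, (h.obsPt _ _).1 h2⟩
    · refine Or.inr ⟨τ a, τ b, τ c, fun h => hab (τ.injective h), fun h => hac (τ.injective h),
        fun h => hbc (τ.injective h), fun v => ?_, hex b hb, hex c hc, fun j hij => ?_⟩
      · obtain ⟨v, rfl⟩ := τ.surjective v
        rw [← h.obsPt, ha, τ.injective.eq_iff]
      · obtain ⟨j, rfl⟩ := l.surjective j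
        obtain ⟨v, hv⟩ := hj j ((h.inc _ _).2 hij)
        exact ⟨τ v, fun h' => hv ((h.obsLn _ _).2 h')⟩

variable [Finite ι] [Finite κ] [Finite ι'] [Finite κ']

/-- Camera-minimality and the camera-degree do not depend on the labels of the views. -/
theorem Relabel.isCameraMinimal (hD : D.OneInc) (h : Relabel D E τ p l) (hC : Comb D)
    (hmin : D.IsCameraMinimal) :
    E.IsCameraMinimal ∧ ∃ d, D.HasCameraDegree d ∧ E.HasCameraDegree d := by
  have hE := h.oneInc hD
  obtain ⟨d, hd⟩ := hmin.exists_degree hD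
  have hnd : Gen fun b => ∀ P e, Sol D b P e → NonDeg D P e :=
    gen_nonDeg hD hC (((isCameraMinimal_iff hD).1 hmin).2.mono fun b hb =>
      hb.subset fun P ⟨e, he⟩ => ⟨e, he.1⟩)
  have h1 := h.gen_le_encard hD (n := d) ((hd.and hnd).mono fun b hb => by
    rw [← hb.1]
    exact Set.encard_le_encard fun P ⟨e, he⟩ => ⟨e, he, hb.2 P e he⟩)
  have hndE : ConstrRel fun b P e => Sol E b P e ∧ NonDeg E P e :=
    (constrRel_sol E).and (constrRel_nonDeg E)
  have h2 := (hndE.gen_le_encard_or (d + 1)).resolve_left fun hg => by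
    obtain ⟨b, hb1, hb2⟩ := ((h.symm.gen_le_encard hE hg).and hd).exists
    rw [hb2] at hb1
    exact absurd (by exact_mod_cast hb1) (Nat.not_succ_le_self d)
  have h3 := gen_nonDeg hE (hC.relabel h) h2.finite_of_not_le
  have h4 : Gen fun b => (camSet (fun b P e => Sol E b P e) b).encard = d := by
    refine ((h1.and h2).and h3).mono fun b hb => le_antisymm ?_ hb.1.1
    have : camSet (fun b P e => Sol E b P e) b ⊆
        camSet (fun b P e => Sol E b P e ∧ NonDeg E P e) b :=
      fun P ⟨e, he⟩ => ⟨e, he, hb.2 P e he⟩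
    refine (Set.encard_le_encard this).trans (Order.le_of_lt_add_one ?_)
    exact_mod_cast not_le.1 hb.1.2
  refine ⟨(isCameraMinimal_iff hE).2 ⟨?_, h4.mono fun b hb => Set.finite_of_encard_eq_coe hb⟩,
    d, (hasCameraDegree_iff hD).2 hd, (hasCameraDegree_iff hE).2 h4⟩
  obtain ⟨b, hb1, hb2⟩ := (((isCameraMinimal_iff hD).1 hmin).1.and hd).exists
  refine h4.mono fun b' hb' => ?_
  rw [← Set.one_le_encard_iff_nonempty] at hb1 ⊢
  rwa [hb', ← hb2]

end Relabel

end PointLine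

namespace PointLine

open MvPolynomial

/-! ### Cameras and arrangements in general position -/

/-- A condition that is given by the nonvanishing of a polynomial. -/
def Opn {σ : Type} (Q : (σ → ℂ) → Prop) : Prop := ∃ F, IsPoly F ∧ ∀ x, F x ≠ 0 ↔ Q x

section Opn

variable {σ : Type}

theorem IsPoly.opn {F : (σ → ℂ) → ℂ} (hF : IsPoly F) : Opn fun x => F x ≠ 0 :=
  ⟨F, hF, fun _ => Iff.rfl⟩

theorem Opn.and {Q R : (σ → ℂ) → Prop} (hQ : Opn Q) (hR : Opn R) : Opn fun x => Q x ∧ R x := by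
  obtain ⟨F, hF, h⟩ := hQ
  obtain ⟨G, hG, h'⟩ := hR
  exact ⟨_, hF.mul hG, fun x => by rw [mul_ne_zero_iff, h, h']⟩

theorem Opn.all {ι : Type*} [Finite ι] {Q : ι → (σ → ℂ) → Prop} (h : ∀ i, Opn (Q i)) :
    Opn fun x => ∀ i, Q i x := by
  cases nonempty_fintype ι
  choose F hF h using h
  exact ⟨_, IsPoly.prod Finset.univ fun i _ => hF i, fun x => by simp [Finset.prod_ne_zero_iff, h]⟩

theorem Opn.true : Opn fun _ : σ → ℂ => True := ⟨fun _ => 1, .const _, fun x => by simp⟩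

theorem Opn.imp {P : Prop} {Q : (σ → ℂ) → Prop} (h : P → Opn Q) : Opn fun x => P → Q x := by
  by_cases hP : P
  · simpa [hP] using h hP
  · simpa [hP] using Opn.true

theorem Opn.congr {Q R : (σ → ℂ) → Prop} (hQ : Opn Q) (h : ∀ x, Q x ↔ R x) : Opn R := by
  obtain ⟨F, hF, h'⟩ := hQ
  exact ⟨F, hF, fun x => (h' x).trans (h x)⟩

end Opn

theorem exists_mulVec_eq {n : ℕ} {x : Fin n → ℂ} (hx : x ≠ 0) (p : Fin n → ℂ) :
    ∃ M : Matrix (Fin n) (Fin n) ℂ, M.mulVec x = p := by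
  obtain ⟨k, hk⟩ := Function.ne_iff.1 hx
  refine ⟨Matrix.of fun i j => if j = k then p i / x k else 0, ?_⟩
  ext i
  simp [Matrix.mulVec, dotProduct, div_mul_cancel₀ _ hk]

theorem exists_mulVec_eq_pair {n : ℕ} {u w : Fin n → ℂ} (h : LinearIndependent ℂ ![u, w])
    (p q : Fin n → ℂ) : ∃ M : Matrix (Fin n) (Fin n) ℂ, M.mulVec u = p ∧ M.mulVec w = q := by
  obtain ⟨k, l, hkl⟩ := linearIndependent_pair_iff_minor.1 h
  have hne : k ≠ l := by
    rintro rfl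
    simp at hkl
  have e : ∀ z : Fin n → ℂ, ∀ α β : ℂ, ∑ j, (if j = k then α else if j = l then β else 0) * z j =
      α * z k + β * z l := by
    intro z α β
    have h1 : ∀ j, (if j = k then α else if j = l then β else 0) * z j =
        (if j = k then α * z j else 0) + if j = l then β * z j else 0 := by
      intro j
      by_cases hj : j = k
      · subst hj
        simp [hne]
      · simp [hj]
    simp only [h1, Finset.sum_add_distrib, Finset.sum_ite_eq', Finset.mem_univ, if_true]
  refine ⟨Matrix.of fun i j =>
    if j = k then (p i * w l - q i * u l) / (u k * w l - u l * w k)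
    else if j = l then (q i * u k - p i * w k) / (u k * w l - u l * w k) else 0, ?_, ?_⟩
  · ext i
    simp only [Matrix.mulVec, dotProduct, Matrix.of_apply, e]
    rw [div_mul_eq_mul_div, div_mul_eq_mul_div, ← add_div, div_eq_iff hkl]
    ring
  · ext i
    simp only [Matrix.mulVec, dotProduct, Matrix.of_apply, e]
    rw [div_mul_eq_mul_div, div_mul_eq_mul_div, ← add_div, div_eq_iff hkl]
    ring

/-- The three centres and the arrangement are in general position. -/
structure GenPos {ι κ : Type} (P : Cameras) (a : ArrCoord ι κ 4 → ℂ) : Prop where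
  cam : quad (Pi.single 0 1) (center (P 0)) (center (P 1)) (center (P 2)) ≠ 0
  pt : ∀ i, quad (ptv a i) (center (P 0)) (center (P 1)) (center (P 2)) ≠ 0
  ln : ∀ v v', v ≠ v' → ∀ j, quad (lnv a j 0) (lnv a j 1) (center (P v)) (center (P v')) ≠ 0

/-- The first centre is the origin, so the determinant reduces to a `2 × 2` minor of the other two
centres. If it vanished for all translations, entries of two columns of the second rotation would
vanish so that its determinant would be zero. -/
theorem exists_camFam_centers {P : Cameras} (hP : P ∈ camVariety) : ∃ y,
    quad (Pi.single 0 1) (center (camFam P y 0)) (center (camFam P y 1)) (center (camFam P y 2)) ≠ 0 := by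
  have hRt : ∀ v, rot (P v) * (rot (P v)).transpose = 1 := fun v => (hP.1 v).1
  have htR : ∀ v, (rot (P v)).transpose * rot (P v) = 1 := fun v => mul_eq_one_comm.1 (hRt v)
  have hc : ∀ y v (k : Fin 3), center (camFam P y v) k.castSucc =
      -((rot (P v)).transpose.mulVec (transFam y v)) k := by
    intro y v k
    rw [center_castSucc, camFam, rot_mkCam, trans_mkCam]
  have h1 : ∀ y, quad (Pi.single 0 1) (center (camFam P y 0)) (center (camFam P y 1))
      (center (camFam P y 2)) =
      (rot (P 1)).transpose.mulVec (transFam y 1) 1 * (rot (P 2)).transpose.mulVec (transFam y 2) 2 -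
      (rot (P 1)).transpose.mulVec (transFam y 1) 2 * (rot (P 2)).transpose.mulVec (transFam y 2) 1 := by
    intro y
    have e0 : ∀ k : Fin 3, center (camFam P y 0) k.castSucc = 0 := by
      intro k
      rw [hc, show transFam y 0 = 0 from rfl, Matrix.mulVec_zero]
      exact neg_zero
    have e1 : ∀ v, center (camFam P y v) 1 = -((rot (P v)).transpose.mulVec (transFam y v)) 1 :=
      fun v => hc y v 1
    have e2 : ∀ v, center (camFam P y v) 2 = -((rot (P v)).transpose.mulVec (transFam y v)) 2 :=
      fun v => hc y v 2
    have e01 : center (camFam P y 0) 1 = 0 := e0 1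
    have e02 : center (camFam P y 0) 2 = 0 := e0 2
    simp [quad, Matrix.det_succ_row_zero, Fin.sum_univ_succ, Fin.succAbove, e01, e02, e1, e2]
    ring
  by_contra! hcon
  have h2 : ∀ s t : ℂ, ∀ c : Fin 3 → ℂ,
      (rot (P 1)).transpose.mulVec ![1, s, t] 1 * c 2 -
      (rot (P 1)).transpose.mulVec ![1, s, t] 2 * c 1 = 0 := by
    intro s t c
    have h3 := hcon ![s, t, (rot (P 2)).mulVec c 0, (rot (P 2)).mulVec c 1, (rot (P 2)).mulVec c 2]
    rw [h1] at h3
    have e1 : transFam ![s, t, (rot (P 2)).mulVec c 0, (rot (P 2)).mulVec c 1,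
        (rot (P 2)).mulVec c 2] 1 = ![1, s, t] := rfl
    have e2 : transFam ![s, t, (rot (P 2)).mulVec c 0, (rot (P 2)).mulVec c 1,
        (rot (P 2)).mulVec c 2] 2 = (rot (P 2)).mulVec c := by
      ext r
      fin_cases r <;> rfl
    rw [e1, e2, Matrix.mulVec_mulVec, htR, Matrix.one_mulVec] at h3
    exact h3
  have h4 : ∀ s t : ℂ, ∀ k : Fin 3, k = 1 ∨ k = 2 →
      rot (P 1) 0 k + rot (P 1) 1 k * s + rot (P 1) 2 k * t = 0 := by
    intro s t k hk
    have e : ∀ k, (rot (P 1)).transpose.mulVec ![1, s, t] k =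
        rot (P 1) 0 k + rot (P 1) 1 k * s + rot (P 1) 2 k * t := fun k => by
      rw [Matrix.mulVec, Matrix.vec3_dotProduct]
      simp
    have a1 := h2 s t ![0, 0, 1]
    have a2 := h2 s t ![0, 1, 0]
    rw [e, e] at a1 a2
    rcases hk with rfl | rfl
    · simpa using a1
    · simp at a2
      linear_combination -a2
  have h5 : ∀ k : Fin 3, k = 1 ∨ k = 2 → rot (P 1) 0 k = 0 := fun k hk => by
    simpa using h4 0 0 k hk
  have h6 : (rot (P 1)).det = 0 := by
    have a1 := h5 1 (Or.inl rfl)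
    have a2 := h5 2 (Or.inr rfl)
    have b1 := h4 1 0 1 (Or.inl rfl)
    have b2 := h4 1 0 2 (Or.inr rfl)
    rw [a1] at b1
    rw [a2] at b2
    simp at b1 b2
    rw [Matrix.det_fin_three, a1, a2, b1, b2]
    ring
  rw [(hP.1 1).2] at h6
  exact one_ne_zero h6

section Density

variable {ι κ : Type}

/-- The cameras encoded in the coordinates of a solution. -/
def coordCam (w : ArrCoord ι κ 4 ⊕ (Fin 3 × Fin 3 × Fin 4) → ℂ) : Cameras :=
  fun v => Matrix.of fun r k => w (.inr (v, r, k))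

theorem coordCam_eq {S : Arrangement ι κ 4 × Cameras}
    {w : ArrCoord ι κ 4 ⊕ (Fin 3 × Fin 3 × Fin 4) → ℂ} (h : Problem.SolutionCoords S w) :
    coordCam w = S.2 := funext fun v => Matrix.ext fun r k => (h.2 v r k).symm

theorem isPoly_quad_center {σ : Type} {x : (σ → ℂ) → Fin 4 → ℂ} {P : (σ → ℂ) → Cameras}
    (hx : ∀ k, IsPoly fun z => x z k) (hP : ∀ v r k, IsPoly fun z => P z v r k) :
    IsPoly fun z => quad (x z) (center (P z 0)) (center (P z 1)) (center (P z 2)) :=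
  isPoly_quad (a := x) (b := fun z => center (P z 0)) (c := fun z => center (P z 1))
    (d := fun z => center (P z 2)) hx (isPoly_center (hP 0)) (isPoly_center (hP 1))
    (isPoly_center (hP 2))

theorem isPoly_quad_pair {σ : Type} {x x' : (σ → ℂ) → Fin 4 → ℂ} {P : (σ → ℂ) → Cameras}
    (hx : ∀ k, IsPoly fun z => x z k) (hx' : ∀ k, IsPoly fun z => x' z k)
    (hP : ∀ v r k, IsPoly fun z => P z v r k) (v v' : Fin 3) :
    IsPoly fun z => quad (x z) (x' z) (center (P z v)) (center (P z v')) :=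
  isPoly_quad (a := x) (b := x') (c := fun z => center (P z v)) (d := fun z => center (P z v'))
    hx hx' (isPoly_center (hP v)) (isPoly_center (hP v'))

theorem isPoly_camFam {σ : Type} (P : Cameras) {y : (σ → ℂ) → Fin 5 → ℂ}
    (hy : ∀ i, IsPoly fun z => y z i) (v r : Fin 3) (k : Fin 4) :
    IsPoly fun z => camFam P (y z) v r k := by
  refine Fin.lastCases ?_ (fun k => ?_) k
  · show IsPoly fun z => transFam (y z) v r
    fin_cases v
    · exact .const 0
    · fin_cases r
      exacts [.const 1, hy 0, hy 1]
    · fin_cases r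
      exacts [hy 2, hy 3, hy 4]
  · have : (fun z => camFam P (y z) v r k.castSucc) = fun _ => rot (P v) r k := by
      funext z
      exact congrFun (congrFun (rot_mkCam (rot (P v)) (transFam (y z) v)) r) k
    rw [this]
    exact .const _

variable [Finite ι] [Finite κ]

theorem opn_genPos : Opn fun w : ArrCoord ι κ 4 ⊕ (Fin 3 × Fin 3 × Fin 4) → ℂ =>
    GenPos (coordCam w) fun k => w (.inl k) := by
  have hP : ∀ v r k, IsPoly fun w : ArrCoord ι κ 4 ⊕ (Fin 3 × Fin 3 × Fin 4) → ℂ =>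
    coordCam w v r k := fun v r k => .coord _
  have h1 := (isPoly_quad_center (x := fun _ => Pi.single 0 1) (fun k => .const _) hP).opn
  have h2 := Opn.all fun i : ι => (isPoly_quad_center
    (x := fun w : ArrCoord ι κ 4 ⊕ (Fin 3 × Fin 3 × Fin 4) → ℂ => ptv (fun k => w (.inl k)) i)
    (fun k => .coord _) hP).opn
  have h3 := Opn.all fun v : Fin 3 => Opn.all fun v' : Fin 3 => Opn.imp fun _ : v ≠ v' =>
    Opn.all fun j : κ => (isPoly_quad_pair
      (x := fun w : ArrCoord ι κ 4 ⊕ (Fin 3 × Fin 3 × Fin 4) → ℂ => lnv (fun k => w (.inl k)) j 0)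
      (x' := fun w : ArrCoord ι κ 4 ⊕ (Fin 3 × Fin 3 × Fin 4) → ℂ => lnv (fun k => w (.inl k)) j 1)
      (fun k => .coord _) (fun k => .coord _) hP v v').opn
  exact (h1.and (h2.and h3)).congr fun w =>
    ⟨fun h => ⟨h.1, h.2.1, h.2.2⟩, fun h => ⟨h.1, h.2, h.3⟩⟩

/-- Each condition is open in the pair of a linear map of space and the translations, and has its
own witness; finitely many such conditions hold together. -/
theorem exists_genPos {P : Cameras} (hP : P ∈ camVariety) {a : ArrCoord ι κ 4 → ℂ}
    (h1 : ∀ i, ptv a i ≠ 0) (h2 : ∀ j, LinearIndependent ℂ ![lnv a j 0, lnv a j 1]) :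
    ∃ (M : Matrix (Fin 4) (Fin 4) ℂ) (y : Fin 5 → ℂ), M.det ≠ 0 ∧
      GenPos (camFam P y) (matAct M a) := by
  let mat : ((Fin 4 × Fin 4) ⊕ Fin 5 → ℂ) → Matrix (Fin 4) (Fin 4) ℂ :=
    fun z => Matrix.of fun i j => z (.inl (i, j))
  have hmat : ∀ r i, IsPoly fun z => mat z r i := fun r i => .coord _
  let yy : ((Fin 4 × Fin 4) ⊕ Fin 5 → ℂ) → Fin 5 → ℂ := fun z i => z (.inr i)
  have hcam := isPoly_camFam P (y := yy) fun i => .coord _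
  have hvec : ∀ x : Fin 4 → ℂ, ∀ k, IsPoly fun z => (mat z).mulVec x k := fun x k =>
    IsPoly.mulVec (w := fun _ => x) hmat (fun _ => .const _) k
  have hz : ∀ (M : Matrix (Fin 4) (Fin 4) ℂ) y, ∃ z, mat z = M ∧ yy z = y := fun M y =>
    ⟨Sum.elim (fun q => M q.1 q.2) y, rfl, rfl⟩
  obtain ⟨y₀, hy₀⟩ := exists_camFam_centers hP
  have g0 : Gen fun z => (mat z).det ≠ 0 := by
    obtain ⟨z, hz, -⟩ := hz 1 0
    refine (IsPoly.det hmat).gen (b := z) ?_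
    rw [hz, Matrix.det_one]
    exact one_ne_zero
  have g1 : Gen fun z => quad (Pi.single 0 1) (center (camFam P (yy z) 0))
      (center (camFam P (yy z) 1)) (center (camFam P (yy z) 2)) ≠ 0 := by
    obtain ⟨z, -, hz⟩ := hz 1 y₀
    refine (isPoly_quad_center (x := fun _ => Pi.single 0 1) (fun k => .const _) hcam).gen (b := z) ?_
    rw [hz]
    exact hy₀
  have g2 : Gen fun z => ∀ i, quad ((mat z).mulVec (ptv a i)) (center (camFam P (yy z) 0))
      (center (camFam P (yy z) 1)) (center (camFam P (yy z) 2)) ≠ 0 := by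
    refine Gen.all fun i => ?_
    obtain ⟨M, hM⟩ := exists_mulVec_eq (h1 i) (Pi.single 0 1)
    obtain ⟨z, hz, hz'⟩ := hz M y₀
    refine (isPoly_quad_center (x := fun z => (mat z).mulVec (ptv a i)) (hvec _) hcam).gen (b := z) ?_
    rw [hz, hz', hM]
    exact hy₀
  have g3 : Gen fun z => ∀ v v', v ≠ v' → ∀ j, quad ((mat z).mulVec (lnv a j 0))
      ((mat z).mulVec (lnv a j 1)) (center (camFam P (yy z) v)) (center (camFam P (yy z) v')) ≠ 0 := by
    refine Gen.all fun v => Gen.all fun v' => ?_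
    by_cases hv : v = v'
    · exact Gen.of_forall fun z h => absurd hv h
    refine (Gen.all fun j => ?_).mono fun z hz _ => hz
    obtain ⟨y, hy⟩ := exists_camFam_center_ne hP hv
    obtain ⟨p, q, hpq⟩ := exists_quad_ne_zero (linearIndependent_center (camFam_mem hP y) hy)
    obtain ⟨M, hM, hM'⟩ := exists_mulVec_eq_pair (h2 j) p q
    obtain ⟨z, hz, hz'⟩ := hz M y
    refine (isPoly_quad_pair (x := fun z => (mat z).mulVec (lnv a j 0))
      (x' := fun z => (mat z).mulVec (lnv a j 1)) (hvec _) (hvec _) hcam v v').gen (b := z) ?_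
    rw [hz, hz', hM, hM']
    exact hpq
  obtain ⟨z, hz0, hz1, hz2, hz3⟩ := (g0.and (g1.and (g2.and g3))).exists
  exact ⟨mat z, yy z, hz0, hz1, hz2, hz3⟩

/-- Solutions in general position are dense. -/
theorem denseOn_genPos (T : Problem ι κ) {F : (ArrCoord ι κ 4 ⊕ (Fin 3 × Fin 3 × Fin 4) → ℂ) → ℂ}
    (hF : IsPoly F) (hFG : ∀ w, F w ≠ 0 ↔ GenPos (coordCam w) fun k => w (.inl k)) :
    DenseOn Problem.SolutionCoords (T.spaceVariety ×ˢ camVariety) F := by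
  refine .of_segment hF ?_
  rintro ⟨X, P⟩ ⟨hX, hP⟩ w ⟨hw, hwP⟩
  obtain ⟨M, y, hM, hG⟩ := exists_genPos hP hw.ptv_ne_zero hw.linearIndependent
  obtain ⟨q, hq, hqs⟩ := det_one_add_smul_polynomial hM
  refine ⟨Sum.elim (matAct M fun k => w (.inl k)) fun t => camFam P y t.1 t.2.1 t.2.2,
    (hFG _).2 hG, q, hq, fun s hs => ?_⟩
  rw [hqs] at hs
  obtain ⟨X', hX'⟩ := exists_hasCoords (a := matAct (1 + s • (M - 1)) fun k => w (.inl k))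
    (fun i => mulVec_ne_zero hs (hw.ptv_ne_zero i))
    (fun j => linearIndependent_mulVec hs (hw.linearIndependent j))
  -- On this segment the rotations are constant and the translations vary affinely, so the cameras
  -- stay normalized and calibrated.
  let P' : Cameras := fun v => Matrix.of fun r k => P v r k + s * (camFam P y v r k - P v r k)
  have hrot : ∀ v, rot (P' v) = rot (P v) := by
    intro v
    ext r k
    have := congrFun (congrFun (rot_mkCam (rot (P v)) (transFam y v)) r) k
    show P v r k.castSucc + s * (rot (mkCam (rot (P v)) (transFam y v)) r k - P v r k.castSucc) = _
    rw [this]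
    show P v r k.castSucc + s * (P v r k.castSucc - P v r k.castSucc) = P v r k.castSucc
    ring
  have htr : ∀ v r, trans (P' v) r = trans (P v) r + s * (transFam y v r - trans (P v) r) :=
    fun v r => rfl
  refine ⟨(X', P'), ⟨fun i j hij => ?_, fun v => ?_, ?_, ?_, ?_⟩, ?_, fun v r k => ?_⟩
  · rw [hX'.onLine_iff]
    exact mulVec_mem_span_pair _ ((hw.onLine_iff _ _).1 (hX i j hij))
  · rw [hrot]
    exact hP.1 v
  · rw [hrot]
    exact hP.2.1
  · ext r
    rw [htr, hP.2.2.1]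
    simp [transFam]
  · rw [htr, hP.2.2.2]
    simp [transFam]
  · rw [← add_smul_matAct_sub] at hX'
    exact hX'
  · show P v r k + s * (camFam P y v r k - P v r k) = w (.inr (v, r, k)) + _
    rw [← hwP]
    rfl

end Density

end PointLine

namespace PointLine

open MvPolynomial

/-! ### Projections of points and lines -/

section Projection

variable {P : Cameras}

theorem quad_centers {x : Fin 4 → ℂ} (h : quad x (center (P 0)) (center (P 1)) (center (P 2)) ≠ 0)
    {a b c : Fin 3} (hab : a ≠ b) (hac : a ≠ c) (hbc : b ≠ c) :
    quad x (center (P a)) (center (P b)) (center (P c)) ≠ 0 := by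
  have e1 : ∀ c d e : Fin 4 → ℂ, quad x c d e = -quad x d c e := fun c d e => by
    simp [quad, Matrix.det_succ_row_zero, Fin.sum_univ_succ, Fin.succAbove]
    ring
  have e2 : ∀ c d e : Fin 4 → ℂ, quad x c d e = -quad x c e d := fun c d e => by
    simp [quad, Matrix.det_succ_row_zero, Fin.sum_univ_succ, Fin.succAbove]
    ring
  have hcases : (a = 0 ∧ b = 1 ∧ c = 2) ∨ (a = 0 ∧ b = 2 ∧ c = 1) ∨ (a = 1 ∧ b = 0 ∧ c = 2) ∨
      (a = 1 ∧ b = 2 ∧ c = 0) ∨ (a = 2 ∧ b = 0 ∧ c = 1) ∨ (a = 2 ∧ b = 1 ∧ c = 0) := by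
    clear h e1 e2
    revert a b c
    decide
  rcases hcases with ⟨rfl, rfl, rfl⟩ | ⟨rfl, rfl, rfl⟩ | ⟨rfl, rfl, rfl⟩ | ⟨rfl, rfl, rfl⟩ |
    ⟨rfl, rfl, rfl⟩ | ⟨rfl, rfl, rfl⟩
  · exact h
  · rwa [e2, neg_ne_zero]
  · rwa [e1, neg_ne_zero]
  · rwa [e2, neg_ne_zero, e1, neg_ne_zero]
  · rwa [e1, neg_ne_zero, e2, neg_ne_zero]
  · rwa [e1, neg_ne_zero, e2, neg_ne_zero, e1, neg_ne_zero]

theorem exists_other (a b : Fin 3) (h : a ≠ b) : ∃ c, a ≠ c ∧ b ≠ c := by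
  revert a b
  decide

theorem linearIndependent_mulVec_of_quad {M : Matrix (Fin 3) (Fin 4) ℂ}
    (hM : rot M * (rot M).transpose = 1) {x y z : Fin 4 → ℂ} (h : quad x y z (center M) ≠ 0) :
    LinearIndependent ℂ ![M.mulVec x, M.mulVec y, M.mulVec z] := by
  rw [Fintype.linearIndependent_iff]
  intro g hg
  rw [Fin.sum_univ_three] at hg
  have h1 : M.mulVec (g 0 • x + g 1 • y + g 2 • z) = 0 := by
    rw [Matrix.mulVec_add, Matrix.mulVec_add, Matrix.mulVec_smul, Matrix.mulVec_smul,
      Matrix.mulVec_smul]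
    exact hg
  have h2 := eq_smul_center hM h1
  generalize (g 0 • x + g 1 • y + g 2 • z) 3 = δ at h2
  have h3 := coeffs_eq_zero_of_quad h (α := g 0) (β := g 1) (γ := g 2) (δ := -δ) (by
    rw [h2, neg_smul, add_neg_cancel])
  intro r
  fin_cases r
  exacts [h3.1, h3.2.1, h3.2.2.1]

/-- The triple product of the images of three points. -/
theorem cross_dot_ne_zero {M : Matrix (Fin 3) (Fin 4) ℂ} (hM : rot M * (rot M).transpose = 1)
    {x y z : Fin 4 → ℂ} (h : quad x y z (center M) ≠ 0) :
    crossProduct (M.mulVec x) (M.mulVec y) ⬝ᵥ M.mulVec z ≠ 0 := by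
  have h1 := Matrix.linearIndependent_rows_iff_isUnit
    (A := Matrix.of ![M.mulVec x, M.mulVec y, M.mulVec z])
  rw [Matrix.isUnit_iff_isUnit_det, isUnit_iff_ne_zero] at h1
  have h2 := h1.1 (linearIndependent_mulVec_of_quad hM h)
  rw [dotProduct_comm, ← triple_product_permutation, ← triple_product_permutation,
    triple_product_eq_det]
  exact h2

/-- A vector that is mapped to a given one by a camera. -/
def ray (M : Matrix (Fin 3) (Fin 4) ℂ) (y : Fin 3 → ℂ) : Fin 4 → ℂ :=
  Fin.snoc (α := fun _ => ℂ) ((rot M).transpose.mulVec y) 0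

theorem mulVec_ray {M : Matrix (Fin 3) (Fin 4) ℂ} (hM : rot M * (rot M).transpose = 1)
    (y : Fin 3 → ℂ) : M.mulVec (ray M y) = y := by
  have h1 : (fun k : Fin 3 => ray M y k.castSucc) = (rot M).transpose.mulVec y :=
    funext fun k => Fin.snoc_castSucc (α := fun _ => ℂ) _ _ _
  have h2 : ray M y 3 = 0 := Fin.snoc_last (α := fun _ => ℂ) _ _
  rw [mulVec_eq_rot_add, h1, h2, Matrix.mulVec_mulVec, hM, Matrix.one_mulVec, zero_smul, add_zero]

theorem isPoly_ray {σ : Type} (M : Matrix (Fin 3) (Fin 4) ℂ) {y : (σ → ℂ) → Fin 3 → ℂ}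
    (hy : ∀ k, IsPoly fun x => y x k) (k : Fin 4) : IsPoly fun x => ray M (y x) k := by
  refine Fin.lastCases ?_ (fun k => ?_) k
  · have : (fun x => ray M (y x) (Fin.last 3)) = fun _ => 0 :=
      funext fun x => Fin.snoc_last (α := fun _ => ℂ) _ _
    rw [this]
    exact .const 0
  · have : (fun x => ray M (y x) k.castSucc) = fun x => (rot M).transpose.mulVec (y x) k :=
      funext fun x => Fin.snoc_castSucc (α := fun _ => ℂ) _ _ _
    rw [this]
    exact IsPoly.mulVec (M := fun _ => (rot M).transpose) (w := y) (fun _ _ => .const _) hy k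

theorem exists_add_smul_center {M : Matrix (Fin 3) (Fin 4) ℂ} (hM : rot M * (rot M).transpose = 1)
    {x z : Fin 4 → ℂ} {c : ℂ} (h : M.mulVec z = c • M.mulVec x) :
    ∃ γ : ℂ, z = c • x + γ • center M := by
  have h4 : M.mulVec (z - c • x) = 0 := by
    rw [Matrix.mulVec_sub, Matrix.mulVec_smul, h, sub_self]
  exact ⟨_, by rw [← eq_smul_center hM h4]; abel⟩

theorem map_eq_dualSub {M : Matrix (Fin 3) (Fin 4) ℂ} (hM : rot M * (rot M).transpose = 1)
    {l : ProjLine 4} {n : Fin 3 → ℂ} (hn : n ≠ 0) (hc : center M ∉ l.1)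
    (h : ∀ z ∈ l.1, n ⬝ᵥ M.mulVec z = 0) : l.1.map M.mulVecLin = dualSub n := by
  have hinj : Function.Injective (M.mulVecLin.domRestrict l.1) := by
    rw [← LinearMap.ker_eq_bot, LinearMap.ker_eq_bot']
    rintro ⟨z, hz⟩ h0
    have h1 := eq_smul_center hM (show M.mulVec z = 0 from h0)
    refine Subtype.ext ?_
    show z = 0
    by_cases h3 : z 3 = 0
    · rw [h1, h3, zero_smul]
    · refine absurd ?_ hc
      have : center M = (z 3)⁻¹ • z := by
        conv_rhs => rw [h1]
        rw [Pi.smul_apply, center_three, smul_eq_mul, mul_one, inv_smul_smul₀ h3]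
      rw [this]
      exact l.1.smul_mem _ hz
  refine Submodule.eq_of_le_of_finrank_eq ?_ ?_
  · rintro _ ⟨z, hz, rfl⟩
    exact h z hz
  · rw [finrank_dualSub hn, ← LinearMap.range_domRestrict]
    exact (LinearMap.finrank_range_of_inj hinj).trans l.2

/-- The line that is seen as two given lines by two cameras. -/
theorem exists_line_of_images (hP : P ∈ camVariety) {a b : Fin 3} {n m : Fin 3 → ℂ}
    (hn : n ⬝ᵥ (P a).mulVec (center (P b)) ≠ 0) (hm : m ⬝ᵥ (P b).mulVec (center (P a)) ≠ 0) :
    ∃ l : ProjLine 4, (∀ z, z ∈ l.1 ↔ n ⬝ᵥ (P a).mulVec z = 0 ∧ m ⬝ᵥ (P b).mulVec z = 0) ∧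
      l.1.map (P a).mulVecLin = dualSub n ∧ l.1.map (P b).mulVecLin = dualSub m := by
  have ha := mulVec_center (rot_mul_transpose hP a)
  have hb := mulVec_center (rot_mul_transpose hP b)
  let f : (Fin 4 → ℂ) →ₗ[ℂ] Fin 2 → ℂ := LinearMap.pi
    ![(dotProductBilin ℂ ℂ n).comp (P a).mulVecLin, (dotProductBilin ℂ ℂ m).comp (P b).mulVecLin]
  have hf : ∀ z, f z = ![n ⬝ᵥ (P a).mulVec z, m ⬝ᵥ (P b).mulVec z] := by
    intro z
    ext r
    fin_cases r <;> rfl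
  have hsurj : Function.Surjective f := by
    intro t
    -- Each centre is killed by its own camera, so the two centres make the pair of equations
    -- diagonal.
    refine ⟨(t 0 / (n ⬝ᵥ (P a).mulVec (center (P b)))) • center (P b) +
      (t 1 / (m ⬝ᵥ (P b).mulVec (center (P a)))) • center (P a), ?_⟩
    rw [hf]
    ext r
    simp only [Matrix.mulVec_add, Matrix.mulVec_smul, ha, hb, dotProduct_smul,
      smul_zero, smul_eq_mul, add_zero, zero_add, div_mul_cancel₀ _ hn,
      div_mul_cancel₀ _ hm]
    fin_cases r <;> rfl
  have hrank := LinearMap.finrank_range_add_finrank_ker f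
  rw [LinearMap.range_eq_top.2 hsurj, finrank_top, Module.finrank_fin_fun, Module.finrank_fin_fun]
    at hrank
  have hmem : ∀ z, z ∈ LinearMap.ker f ↔ n ⬝ᵥ (P a).mulVec z = 0 ∧ m ⬝ᵥ (P b).mulVec z = 0 := by
    intro z
    rw [LinearMap.mem_ker, hf, funext_iff, Fin.forall_fin_two]
    rfl
  refine ⟨⟨LinearMap.ker f, by omega⟩, hmem, ?_, ?_⟩
  · refine map_eq_dualSub (rot_mul_transpose hP a) (fun h => hn (by rw [h, zero_dotProduct]))
      (fun h => hm ((hmem _).1 h).2) fun z hz => ((hmem z).1 hz).1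
  · refine map_eq_dualSub (rot_mul_transpose hP b) (fun h => hm (by rw [h, zero_dotProduct]))
      (fun h => hn ((hmem _).1 h).1) fun z hz => ((hmem z).1 hz).2

end Projection

/-! ### Vectors avoiding finitely many hyperplanes -/

section Avoid

theorem exists_dot_ne_zero {ι : Type*} [Finite ι] {n : ℕ} {c : ι → Fin n → ℂ} (h : ∀ i, c i ≠ 0) :
    ∃ w : Fin n → ℂ, ∀ i, w ⬝ᵥ c i ≠ 0 := by
  refine Gen.exists (Gen.all fun i => ?_)
  obtain ⟨k, hk⟩ := Function.ne_iff.1 (h i)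
  refine (IsPoly.dot (u := fun w => w) (w := fun _ => c i) (fun k => .coord _)
    fun k => .const _).gen (b := Pi.single k 1) ?_
  rwa [single_dotProduct, one_mul]

theorem exists_cross_eq {n : Fin 3 → ℂ} (hn : n ≠ 0) :
    ∃ u w, ∃ t : ℂ, t ≠ 0 ∧ crossProduct u w = t • n := by
  obtain ⟨u, w, h, hl⟩ := (dualLine n hn).exists_span
  have h1 : dualSub n = dualSub (crossProduct u w) := by
    rw [← span_pair_eq_dualSub_cross h]
    exact hl
  obtain ⟨t, ht, h2⟩ := (dualSub_eq_iff (cross_ne_zero h) hn).1 h1.symm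
  exact ⟨u, w, t, ht, h2⟩

/-- A line in the plane can be moved such that it avoids finitely many points. -/
theorem exists_cross_dot_ne_zero {ι : Type*} [Finite ι] {c : ι → Fin 3 → ℂ} (h : ∀ i, c i ≠ 0) :
    ∃ u w : Fin 3 → ℂ, ∀ i, crossProduct u w ⬝ᵥ c i ≠ 0 := by
  by_cases hi : IsEmpty ι
  · exact ⟨0, 0, fun i => hi.elim i⟩
  rw [not_isEmpty_iff] at hi
  obtain ⟨i⟩ := hi
  obtain ⟨n, hn⟩ := exists_dot_ne_zero h
  obtain ⟨u, w, t, ht, h1⟩ := exists_cross_eq (n := n) fun h0 => hn i (by rw [h0, zero_dotProduct])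
  refine ⟨u, w, fun i => ?_⟩
  rw [h1, smul_dotProduct, smul_eq_mul]
  exact mul_ne_zero ht (hn i)

theorem cross_dot_eq (p w c : Fin 3 → ℂ) :
    crossProduct p w ⬝ᵥ c = -(w ⬝ᵥ crossProduct p c) := by
  simp_rw [cross_apply, Matrix.vec3_dotProduct]
  dsimp only [Matrix.cons_val]
  ring

/-- The coefficients `α` and `β` are prescribed so that a given pair of vectors with the same
combination `p` can be joined to the new pair by a segment on which the combination stays `p`. -/
theorem exists_cross_dot_ne_zero_of_mem {ι : Type*} [Finite ι] {c : ι → Fin 3 → ℂ} {p : Fin 3 → ℂ}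
    (h : ∀ i, LinearIndependent ℂ ![p, c i]) {α β : ℂ} (hαβ : α ≠ 0 ∨ β ≠ 0) :
    ∃ u w : Fin 3 → ℂ, α • u + β • w = p ∧ ∀ i, crossProduct u w ⬝ᵥ c i ≠ 0 := by
  obtain ⟨w, hw⟩ := exists_dot_ne_zero fun i => cross_ne_zero (h i)
  have key : ∀ i, crossProduct p w ⬝ᵥ c i ≠ 0 := by
    intro i hi
    rw [cross_dot_eq, neg_eq_zero] at hi
    exact hw i hi
  rcases hαβ with hα | hβ
  · refine ⟨α⁻¹ • (p - β • w), w, ?_, fun i => ?_⟩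
    · rw [smul_inv_smul₀ hα, sub_add_cancel]
    · rw [LinearMap.map_smul₂, LinearMap.map_sub₂, LinearMap.map_smul₂, cross_self, smul_zero,
        sub_zero, smul_dotProduct, smul_eq_mul]
      exact mul_ne_zero (inv_ne_zero hα) (key i)
  · refine ⟨w, β⁻¹ • (p - α • w), ?_, fun i => ?_⟩
    · rw [smul_inv_smul₀ hβ, add_sub_cancel]
    · rw [map_smul, map_sub, map_smul, cross_self, smul_zero, sub_zero, ← cross_anticomm,
        smul_neg, neg_dotProduct, smul_dotProduct, smul_eq_mul]
      exact neg_ne_zero.2 (mul_ne_zero (inv_ne_zero hβ) (key i))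

/-- A line through a point of the plane that avoids other points. -/
theorem exists_perp_dot_ne_zero {ι : Type*} [Finite ι] {c : ι → Fin 3 → ℂ} {p : Fin 3 → ℂ}
    (h : ∀ i, LinearIndependent ℂ ![p, c i]) : ∃ n : Fin 3 → ℂ, n ⬝ᵥ p = 0 ∧ ∀ i, n ⬝ᵥ c i ≠ 0 := by
  obtain ⟨u, w, h1, h2⟩ := exists_cross_dot_ne_zero_of_mem h (α := 1) (β := 0) (Or.inl one_ne_zero)
  rw [one_smul, zero_smul, add_zero] at h1
  subst h1
  exact ⟨crossProduct u w, by rw [dotProduct_comm, dot_self_cross], h2⟩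

end Avoid

end PointLine

namespace PointLine

open MvPolynomial

variable {ι κ : Type}

/-! ### Fibres of the forgetting map -/

theorem GenericOn.of_forall {σ T : Type} {rep : T → (σ → ℂ) → Prop} {V : Set T} {Q : T → Prop}
    (h : ∀ t ∈ V, Q t) : GenericOn rep V Q :=
  ⟨1, fun g hg t ht a ha => hg t ht a ha (by simp), fun t ht _ _ _ => h t ht⟩

section Fibre

variable {D : Problem ι κ} {A : Set ι} {B : Set κ} {P : Cameras}

/-- The forgotten lines avoid the images of the centres. -/
def LinesOff (D : Problem ι κ) (B : Set κ) (P : Cameras) (a : ArrCoord D.ObsPt D.ObsLn 3 → ℂ) : Prop :=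
  ∀ q : D.ObsLn, q.1.2 ∉ B → ∀ v' : {v' // v' ≠ q.1.1},
    crossProduct (lnv a q 0) (lnv a q 1) ⬝ᵥ (P q.1.1).mulVec (center (P v')) ≠ 0

/-- The forgotten points avoid given lines. -/
def PointsOff (D : Problem ι κ) (A : Set ι) (ξ : Fin 3 → Fin 3 → Fin 3 → ℂ)
    (a : ArrCoord D.ObsPt D.ObsLn 3 → ℂ) : Prop :=
  ∀ q : D.ObsPt, q.1.2 ∉ A → ∀ v' : {v' // v' ≠ q.1.1}, ptv a q ⬝ᵥ ξ q.1.1 v' ≠ 0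

theorem opn_off [Finite ι] [Finite κ] (D : Problem ι κ) (A : Set ι) (B : Set κ) (P : Cameras)
    (ξ : Fin 3 → Fin 3 → Fin 3 → ℂ) : Opn fun a => LinesOff D B P a ∧ PointsOff D A ξ a := by
  refine .and (.all fun q => .imp fun _ => .all fun v' => ?_)
    (.all fun q => .imp fun _ => .all fun v' => ?_)
  · exact (IsPoly.dot (u := fun a => crossProduct (lnv a q 0) (lnv a q 1))
      (w := fun _ => (P q.1.1).mulVec (center (P v')))
      (IsPoly.cross (isPoly_lnv q 0) (isPoly_lnv q 1)) fun _ => .const _).opn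
  · exact (IsPoly.dot (u := fun a => ptv a q) (w := fun _ => ξ q.1.1 v') (isPoly_ptv q)
      fun _ => .const _).opn

theorem exists_ne_view (v : Fin 3) : ∃ v', v' ≠ v := by
  revert v
  decide

theorem LinesOff.linearIndependent {a : ArrCoord D.ObsPt D.ObsLn 3 → ℂ} (h : LinesOff D B P a)
    {q : D.ObsLn} (hq : q.1.2 ∉ B) : LinearIndependent ℂ ![lnv a q 0, lnv a q 1] := by
  obtain ⟨v', hv'⟩ := exists_ne_view q.1.1
  exact crossProduct_ne_zero_iff_linearIndependent.1 fun h0 => h q hq ⟨v', hv'⟩ (by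
    rw [h0, zero_dotProduct])

theorem PointsOff.ne_zero {ξ : Fin 3 → Fin 3 → Fin 3 → ℂ} {a : ArrCoord D.ObsPt D.ObsLn 3 → ℂ}
    (h : PointsOff D A ξ a) {q : D.ObsPt} (hq : q.1.2 ∉ A) : ptv a q ≠ 0 := fun h0 => by
  obtain ⟨v', hv'⟩ := exists_ne_view q.1.1
  exact h q hq ⟨v', hv'⟩ (by rw [h0, zero_dotProduct])

/-- In a fibre of the forgetting map, an image can be moved along a segment until its forgotten
lines avoid the images of other centres and its forgotten points avoid the lines `ξ`. By `H`, the
only observed incidences involving forgotten features are those of forgotten lines with kept points,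
and these survive along the segment. So liftability need only be shown for such images. -/
theorem genericOn_fibre [Finite ι] [Finite κ] (hD : D.OneInc) {ξ : Fin 3 → Fin 3 → Fin 3 → ℂ}
    (hξ : ∀ v v', v' ≠ v → ξ v v' ≠ 0)
    (hc : ∀ v v', v' ≠ v → (P v).mulVec (center (P v')) ≠ 0) {z : (D.restrict A B).Image}
    (H : ∀ v i j (hi : i ∈ D.obsPt v), j ∈ D.obsLn v → (i, j) ∈ D.inc → i ∉ A ∨ j ∉ B →
      ∃ hA : i ∈ A, j ∉ B ∧ ∀ p, (z.pt ⟨(v, ⟨i, hA⟩), hi⟩).submodule = Submodule.span ℂ {p} →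
        ∀ v', v' ≠ v → LinearIndependent ℂ ![p, (P v).mulVec (center (P v'))])
    {Q : D.Image → Prop}
    (hQ : ∀ y ∈ D.imageVariety, D.forgetImage A B y = z → ∀ a, y.HasCoords a →
      LinesOff D B P a → PointsOff D A ξ a → Q y) :
    GenericOn Arrangement.HasCoords {y | y ∈ D.imageVariety ∧ D.forgetImage A B y = z} Q := by
  classical
  obtain ⟨F, hF, hFO⟩ := opn_off D A B P ξ
  refine genericOn_iff.2 ⟨F, hF, .of_segment hF ?_, fun y hy a ha hFa =>
    hQ y hy.1 hy.2 a ha ((hFO a).1 hFa).1 ((hFO a).1 hFa).2⟩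
  rintro y ⟨hy, hyz⟩ a ha
  have hzpt : ∀ v i (hA : i ∈ A) (hi : i ∈ D.obsPt v),
      (z.pt ⟨(v, ⟨i, hA⟩), hi⟩).submodule = Submodule.span ℂ {ptv a ⟨(v, i), hi⟩} := by
    intro v i hA hi
    rw [← hyz]
    exact (hasCoords_iff.1 ha).1 ⟨(v, i), hi⟩
  have hpt : ∀ q : D.ObsPt, ∃ u : Fin 3 → ℂ, (q.1.2 ∈ A → u = ptv a q) ∧
      (q.1.2 ∉ A → ∀ v' : {v' // v' ≠ q.1.1}, u ⬝ᵥ ξ q.1.1 v' ≠ 0) := by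
    intro q
    by_cases hq : q.1.2 ∈ A
    · exact ⟨ptv a q, fun _ => rfl, fun h => absurd hq h⟩
    · obtain ⟨u, hu⟩ := exists_dot_ne_zero fun v' : {v' // v' ≠ q.1.1} => hξ q.1.1 v' v'.2
      exact ⟨u, fun h => absurd h hq, fun _ => hu⟩
  choose u hu hu' using hpt
  have hln : ∀ q : D.ObsLn, ∃ l : Fin 2 → Fin 3 → ℂ, (q.1.2 ∈ B → l = lnv a q) ∧
      (q.1.2 ∉ B → ∀ v' : {v' // v' ≠ q.1.1},
        crossProduct (l 0) (l 1) ⬝ᵥ (P q.1.1).mulVec (center (P v')) ≠ 0) ∧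
      ∀ i (hi : i ∈ D.obsPt q.1.1), (i, q.1.2) ∈ D.inc → q.1.2 ∉ B → ∃ α β : ℂ,
        α • lnv a q 0 + β • lnv a q 1 = ptv a ⟨(q.1.1, i), hi⟩ ∧
        α • l 0 + β • l 1 = ptv a ⟨(q.1.1, i), hi⟩ := by
    rintro ⟨⟨v, j⟩, hj⟩
    by_cases hq : j ∈ B
    · exact ⟨lnv a ⟨(v, j), hj⟩, fun _ => rfl, fun h => absurd hq h, fun _ _ _ h => absurd hq h⟩
    by_cases hex : ∃ i, i ∈ D.obsPt v ∧ (i, j) ∈ D.inc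
    · obtain ⟨i, hi, hij⟩ := hex
      obtain ⟨hA, -, hli⟩ := H v i j hi hj hij (Or.inr hq)
      have hmem := (ha.onLine_iff _ _).1 (hy v i j hi hj hij)
      obtain ⟨α, β, hαβ⟩ := Submodule.mem_span_pair.1 hmem
      have hne : α ≠ 0 ∨ β ≠ 0 := by
        by_contra! h0
        refine ha.ptv_ne_zero ⟨(v, i), hi⟩ ?_
        rw [← hαβ, h0.1, h0.2]
        simp
      obtain ⟨u', w', h1, h2⟩ := exists_cross_dot_ne_zero_of_mem
        (c := fun v' : {v' // v' ≠ v} => (P v).mulVec (center (P v')))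
        (fun v' => hli _ (hzpt v i hA hi) v' v'.2) hne
      refine ⟨![u', w'], fun h => absurd h hq, fun _ => h2, fun i' hi' hij' _ => ?_⟩
      obtain rfl := hD j _ _ hij hij'
      exact ⟨α, β, hαβ, h1⟩
    · obtain ⟨u', w', h2⟩ := exists_cross_dot_ne_zero fun v' : {v' // v' ≠ v} => hc v v' v'.2
      exact ⟨![u', w'], fun h => absurd h hq, fun _ => h2, fun i hi hij _ => absurd ⟨i, hi, hij⟩ hex⟩
  choose l hl hl' hl'' using hln
  let a' : ArrCoord D.ObsPt D.ObsLn 3 → ℂ :=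
    Sum.elim (fun t => u t.1 t.2) fun t => l t.1 t.2.1 t.2.2
  have hFa' : F a' ≠ 0 := (hFO a').2 ⟨hl', hu'⟩
  obtain ⟨q, hq⟩ := hF.exists_polynomial a fun i => a' i - a i
  refine ⟨a', hFa', q, ?_, fun s hs => ?_⟩
  · rintro rfl
    refine hFa' ?_
    have := hq 1
    simp only [one_mul, add_sub_cancel, Polynomial.eval_zero] at this
    exact this.symm
  rw [hq] at hs
  set b : ArrCoord D.ObsPt D.ObsLn 3 → ℂ := fun i => a i + s * (a' i - a i) with hb
  obtain ⟨hb1, hb2⟩ := (hFO b).1 hs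
  have ept : ∀ q, ptv b q = ptv a q + s • (u q - ptv a q) := fun q => rfl
  have eln : ∀ q r, lnv b q r = lnv a q r + s • (l q r - lnv a q r) := fun q r => rfl
  have ept' : ∀ q : D.ObsPt, q.1.2 ∈ A → ptv b q = ptv a q := fun q hq => by
    rw [ept, hu q hq, sub_self, smul_zero, add_zero]
  have eln' : ∀ q : D.ObsLn, q.1.2 ∈ B → ∀ r, lnv b q r = lnv a q r := fun q hq r => by
    rw [eln, hl q hq, sub_self, smul_zero, add_zero]
  obtain ⟨y', hy'⟩ := exists_hasCoords (a := b)
    (fun q => if hq : q.1.2 ∈ A then by rw [ept' q hq]; exact ha.ptv_ne_zero q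
      else hb2.ne_zero hq)
    (fun q => if hq : q.1.2 ∈ B then by rw [eln' q hq, eln' q hq]; exact ha.linearIndependent q
      else hb1.linearIndependent hq)
  refine ⟨y', ⟨fun v i j hi hj hij => ?_, ?_⟩, hy'⟩
  · rw [hy'.onLine_iff]
    by_cases hAB : i ∉ A ∨ j ∉ B
    · obtain ⟨hA, hB, -⟩ := H v i j hi hj hij hAB
      obtain ⟨α, β, h1, h2⟩ := hl'' ⟨(v, j), hj⟩ i hi hij hB
      -- The same coefficients express the kept point at both ends of the segment.
      refine Submodule.mem_span_pair.2 ⟨α, β, ?_⟩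
      rw [ept' _ hA, eln, eln]
      have : α • (lnv a ⟨(v, j), hj⟩ 0 + s • (l ⟨(v, j), hj⟩ 0 - lnv a ⟨(v, j), hj⟩ 0)) +
          β • (lnv a ⟨(v, j), hj⟩ 1 + s • (l ⟨(v, j), hj⟩ 1 - lnv a ⟨(v, j), hj⟩ 1)) =
          (α • lnv a ⟨(v, j), hj⟩ 0 + β • lnv a ⟨(v, j), hj⟩ 1) +
          s • ((α • l ⟨(v, j), hj⟩ 0 + β • l ⟨(v, j), hj⟩ 1) -
            (α • lnv a ⟨(v, j), hj⟩ 0 + β • lnv a ⟨(v, j), hj⟩ 1)) := by module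
      rw [this, h1, h2, sub_self, smul_zero, add_zero]
    · push Not at hAB
      rw [ept' _ hAB.1, eln' _ hAB.2, eln' _ hAB.2]
      exact (ha.onLine_iff _ _).1 (hy v i j hi hj hij)
  · rw [← hyz]
    refine Arrangement.ext' (fun q => ?_) fun q => ?_
    · show (y'.pt _).submodule = (y.pt _).submodule
      rw [(hasCoords_iff.1 hy').1, (hasCoords_iff.1 ha).1, ept' _ q.1.2.2]
    · show (y'.ln _).1 = (y.ln _).1
      rw [(hasCoords_iff.1 hy').2, (hasCoords_iff.1 ha).2, eln' _ q.1.2.2, eln' _ q.1.2.2]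

end Fibre

/-! ### Reductions -/

section Reduction

variable {D : Problem ι κ} {A : Set ι} {B : Set κ}

theorem exists_lift {X : Arrangement A B 4} {P : Cameras}
    {z : (D.restrict A B).Image} {y : D.Image} (hX : X ∈ (D.restrict A B).spaceVariety)
    (hz : (D.restrict A B).IsJointImage X P z)
    (hyz : D.forgetImage A B y = z) (f : ι → ProjPoint 4) (g : κ → ProjLine 4)
    (hinc : ∀ i j, (i, j) ∈ D.inc → i ∉ A ∨ j ∉ B → ∀ x l,
      (∀ h : i ∈ A, x = X.pt ⟨i, h⟩) → (i ∉ A → x = f i) →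
      (∀ h : j ∈ B, l = X.ln ⟨j, h⟩) → (j ∉ B → l = g j) → OnLine x l)
    (hpt : ∀ v i (h : i ∈ D.obsPt v), i ∉ A →
      (f i).submodule.map (P v).mulVecLin = (y.pt ⟨(v, i), h⟩).submodule)
    (hln : ∀ v j (h : j ∈ D.obsLn v), j ∉ B →
      (g j).1.map (P v).mulVecLin = (y.ln ⟨(v, j), h⟩).1) :
    ∃ X' ∈ D.spaceVariety, D.IsJointImage X' P y ∧ Problem.forgetSpace A B X' = X := by
  classical
  let X' : Arrangement ι κ 4 := ⟨fun i => if h : i ∈ A then X.pt ⟨i, h⟩ else f i,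
    fun j => if h : j ∈ B then X.ln ⟨j, h⟩ else g j⟩
  have h1 : ∀ i (h : i ∈ A), X'.pt i = X.pt ⟨i, h⟩ := fun i h => dif_pos h
  have h2 : ∀ i, i ∉ A → X'.pt i = f i := fun i h => dif_neg h
  have h3 : ∀ j (h : j ∈ B), X'.ln j = X.ln ⟨j, h⟩ := fun i h => dif_pos h
  have h4 : ∀ j, j ∉ B → X'.ln j = g j := fun i h => dif_neg h
  refine ⟨X', fun i j hij => ?_, ⟨?_, ?_⟩, ?_⟩
  · by_cases hAB : i ∉ A ∨ j ∉ B
    · exact hinc i j hij hAB _ _ (h1 i) (h2 i) (h3 j) (h4 j)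
    · push Not at hAB
      rw [h1 i hAB.1, h3 j hAB.2]
      exact hX ⟨i, hAB.1⟩ ⟨j, hAB.2⟩ hij
  · rintro ⟨⟨v, i⟩, hi⟩
    by_cases hA : i ∈ A
    · show (X'.pt i).submodule.map _ = _
      rw [h1 i hA]
      refine (hz.1 ⟨(v, ⟨i, hA⟩), hi⟩).trans ?_
      rw [← hyz]
      rfl
    · show (X'.pt i).submodule.map _ = _
      rw [h2 i hA]
      exact hpt v i hi hA
  · rintro ⟨⟨v, j⟩, hj⟩
    by_cases hB : j ∈ B
    · show (X'.ln j).1.map _ = _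
      rw [h3 j hB]
      refine (hz.2 ⟨(v, ⟨j, hB⟩), hj⟩).trans ?_
      rw [← hyz]
      rfl
    · show (X'.ln j).1.map _ = _
      rw [h4 j hB]
      exact hln v j hj hB
  · refine Arrangement.ext' (fun i => ?_) fun j => ?_
    · show (X'.pt i).submodule = _
      rw [h1 i i.2]
    · show (X'.ln j).1 = _
      rw [h3 j j.2]

/-- The point `x` is off the plane of the three centres, so its image differs from the image of
another centre. -/
theorem linearIndependent_mulVec_center {P : Cameras}
    (hP : P ∈ camVariety) {x : Fin 4 → ℂ}
    (hx : quad x (center (P 0)) (center (P 1)) (center (P 2)) ≠ 0) {v v' : Fin 3} (hv : v' ≠ v) :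
    LinearIndependent ℂ ![(P v).mulVec x, (P v).mulVec (center (P v'))] := by
  obtain ⟨c, hc, hc'⟩ := exists_other v' v hv
  have h := linearIndependent_mulVec_of_quad (rot_mul_transpose hP v)
    (quad_centers hx hc hv (Ne.symm hc'))
  rw [LinearIndependent.pair_iff]
  intro s t hst
  have h1 := Fintype.linearIndependent_iff.1 h ![s, t, 0] (by
    rw [Fin.sum_univ_three]
    simpa using hst)
  exact ⟨h1 0, h1 1⟩

theorem GenPos.mulVec_center_ne {ι' κ' : Type} {P : Cameras} {a : ArrCoord ι' κ' 4 → ℂ}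
    (h : GenPos P a) (hP : P ∈ camVariety) {v v' : Fin 3} (hv : v' ≠ v) :
    (P v).mulVec (center (P v')) ≠ 0 :=
  (linearIndependent_mulVec_center hP h.cam hv).ne_zero 1

/-- A point without pins that are seen by other views only can be forgotten. -/
theorem reducibleTo_point {i : ι} (h1 : ∀ v v', i ∈ D.obsPt v → i ∈ D.obsPt v' → v = v')
    (h2 : ∀ j k, (i, j) ∈ D.inc → (i, k) ∈ D.inc → j = k)
    (h3 : ∀ v j, i ∈ D.obsPt v → (i, j) ∈ D.inc → j ∈ D.obsLn v) :
    D.ReducibleTo {i}ᶜ Set.univ := by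
  refine ⟨fun i' hi' j _ k _ => ?_, .of_forall ?_⟩
  · obtain rfl : i' = i := by simpa using hi'
    exact h2 j k
  rintro ⟨X, P⟩ ⟨hX, hP⟩ z hz
  refine .of_forall ?_
  rintro y ⟨hy, hyz⟩
  have key : ∃ x : ProjPoint 4, (∀ j, (i, j) ∈ D.inc → OnLine x (X.ln ⟨j, trivial⟩)) ∧
      ∀ v (hv : i ∈ D.obsPt v), x.submodule.map (P v).mulVecLin = (y.pt ⟨(v, i), hv⟩).submodule := by
    by_cases hU : ∃ v, i ∈ D.obsPt v
    · obtain ⟨v, hv⟩ := hU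
      obtain ⟨η, hη, hyη⟩ := (y.pt ⟨(v, i), hv⟩).exists_mk
      have hx : ∃ x : Fin 4 → ℂ, (P v).mulVec x = η ∧
          ∀ j, (i, j) ∈ D.inc → x ∈ (X.ln ⟨j, trivial⟩).1 := by
        by_cases hp : ∃ j, (i, j) ∈ D.inc
        · obtain ⟨j, hj⟩ := hp
          have hjv := h3 v j hv hj
          have e1 := hz.2 ⟨(v, ⟨j, trivial⟩), hjv⟩
          have e2 := hy v i j hv hjv hj
          rw [← hyz] at e1
          have e3 : η ∈ (X.ln ⟨j, trivial⟩).1.map (P v).mulVecLin := by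
            refine e1.symm ▸ ?_
            refine e2 ?_
            rw [hyη]
            exact Submodule.mem_span_singleton_self η
          obtain ⟨x, hx, hxη⟩ := e3
          refine ⟨x, hxη, fun k hk => ?_⟩
          obtain rfl := h2 j k hj hk
          exact hx
        · exact ⟨ray (P v) η, mulVec_ray (rot_mul_transpose hP v) η, fun j hj => absurd ⟨j, hj⟩ hp⟩
      obtain ⟨x, hxη, hx⟩ := hx
      have hx0 : x ≠ 0 := by
        rintro rfl
        exact hη (by rw [← hxη, Matrix.mulVec_zero])
      refine ⟨Projectivization.mk ℂ x hx0, fun j hj => (submodule_mk_le hx0).2 (hx j hj),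
        fun v' hv' => ?_⟩
      obtain rfl := h1 v v' hv hv'
      rw [Projectivization.submodule_mk, map_span_singleton, hxη, hyη]
    · by_cases hp : ∃ j, (i, j) ∈ D.inc
      · obtain ⟨j, hj⟩ := hp
        obtain ⟨u, w, huw, hl⟩ := (X.ln ⟨j, trivial⟩).exists_span
        have hu : u ≠ 0 := huw.ne_zero 0
        refine ⟨Projectivization.mk ℂ u hu, fun k hk => ?_, fun v hv => absurd ⟨v, hv⟩ hU⟩
        obtain rfl := h2 j k hj hk
        rw [OnLine, submodule_mk_le, hl]
        exact Submodule.subset_span (Or.inl rfl)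
      · exact ⟨Projectivization.mk ℂ (Pi.single 0 1) (by simp), fun j hj => absurd ⟨j, hj⟩ hp,
          fun v hv => absurd ⟨v, hv⟩ hU⟩
  obtain ⟨x, hx1, hx2⟩ := key
  refine exists_lift hX hz hyz (fun _ => x) (fun j => X.ln ⟨j, trivial⟩)
    (fun i' j hij hor x' l _ h5 h6 _ => ?_) (fun v i' hi' hA => ?_) fun v j hj hB => absurd trivial hB
  · have hi' : i' ∉ ({i}ᶜ : Set ι) := hor.resolve_right fun h => h trivial
    rw [h5 hi', h6 trivial]
    obtain rfl : i' = i := by simpa using hi'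
    exact hx1 j hij
  · obtain rfl : i' = i := by simpa using hA
    exact hx2 v hi'

variable [Finite ι] [Finite κ]

/-- Configurations in general position are dense, so only these have to be lifted. -/
theorem reducibleTo_of_genPos
    (h1 : ∀ i ∉ A, ∀ j ∈ B, ∀ k ∈ B, (i, j) ∈ D.inc → (i, k) ∈ D.inc → j = k)
    (h2 : ∀ X ∈ (D.restrict A B).spaceVariety, ∀ P ∈ camVariety, ∀ a, X.HasCoords a → GenPos P a →
      ∀ z, (D.restrict A B).IsJointImage X P z →
        GenericOn Arrangement.HasCoords {y | y ∈ D.imageVariety ∧ D.forgetImage A B y = z} fun y =>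
          ∃ X' ∈ D.spaceVariety, D.IsJointImage X' P y ∧ Problem.forgetSpace A B X' = X) :
    D.ReducibleTo A B := by
  obtain ⟨F, hF, hFG⟩ := opn_genPos (ι := A) (κ := B)
  refine ⟨h1, genericOn_iff.2 ⟨F, hF, denseOn_genPos _ hF hFG, ?_⟩⟩
  rintro ⟨X, P⟩ ⟨hX, hP⟩ w hw hFw z hz
  have hG : GenPos (coordCam w) fun k => w (.inl k) := (hFG w).1 hFw
  rw [coordCam_eq hw] at hG
  exact h2 X hX P hP _ hw.1 hG z hz

end Reduction

end PointLine

/-! ### Reductions that forget lines -/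

namespace PointLine

open MvPolynomial

variable {ι κ : Type}

section Reduction

variable {D : Problem ι κ} {A : Set ι} {B : Set κ}

theorem LinearIndependent.smul_left {n : ℕ} {u w : Fin n → ℂ} (h : LinearIndependent ℂ ![u, w])
    {t : ℂ} (ht : t ≠ 0) : LinearIndependent ℂ ![t • u, w] := by
  rw [LinearIndependent.pair_iff] at h ⊢
  intro α β h0
  rw [smul_smul] at h0
  obtain ⟨h1, h2⟩ := h _ _ h0
  exact ⟨(mul_eq_zero.1 h1).resolve_right ht, h2⟩

theorem Arrangement.HasCoords.ln_eq_dualSub {ι' κ' : Type} {y : Arrangement ι' κ' 3}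
    {a : ArrCoord ι' κ' 3 → ℂ} (h : y.HasCoords a) (q : κ') :
    (y.ln q).1 = dualSub (crossProduct (lnv a q 0) (lnv a q 1)) := by
  rw [(hasCoords_iff.1 h).2, span_pair_eq_dualSub_cross (h.linearIndependent q)]

/-- The images of a kept point. -/
theorem image_pt_eq {X : Arrangement A B 4} {P : Cameras} {a : ArrCoord A B 4 → ℂ}
    (ha : X.HasCoords a) {z : (D.restrict A B).Image} (hz : (D.restrict A B).IsJointImage X P z)
    {v : Fin 3} {i : ι} (hA : i ∈ A) (hi : i ∈ D.obsPt v) :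
    (z.pt ⟨(v, ⟨i, hA⟩), hi⟩).submodule = Submodule.span ℂ {(P v).mulVec (ptv a ⟨i, hA⟩)} := by
  rw [← map_span_singleton, ← (hasCoords_iff.1 ha).1]
  exact (hz.1 ⟨(v, ⟨i, hA⟩), hi⟩).symm

theorem linearIndependent_image_pt {X : Arrangement A B 4} {P : Cameras} (hP : P ∈ camVariety)
    {a : ArrCoord A B 4 → ℂ} (ha : X.HasCoords a) (hG : GenPos P a) {z : (D.restrict A B).Image}
    (hz : (D.restrict A B).IsJointImage X P z) {v : Fin 3} {i : ι} (hA : i ∈ A)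
    (hi : i ∈ D.obsPt v) {p : Fin 3 → ℂ}
    (hp : (z.pt ⟨(v, ⟨i, hA⟩), hi⟩).submodule = Submodule.span ℂ {p}) {v' : Fin 3} (hv : v' ≠ v) :
    LinearIndependent ℂ ![p, (P v).mulVec (center (P v'))] := by
  have hp0 := span_singleton_ne_zero hp
  rw [image_pt_eq ha hz hA hi, eq_comm, span_singleton_eq_iff hp0] at hp
  obtain ⟨t, ht, rfl⟩ := hp
  exact LinearIndependent.smul_left (linearIndependent_mulVec_center hP (hG.pt ⟨i, hA⟩) hv) ht

variable [Finite ι] [Finite κ]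

/-- A line that is not seen by all views, and only by views that see its point, can be forgotten. -/
theorem reducibleTo_line (hD : D.OneInc) {j : κ} {c : Fin 3} (hc : j ∉ D.obsLn c)
    (h : ∀ i, (i, j) ∈ D.inc → ∀ v, j ∈ D.obsLn v → i ∈ D.obsPt v) :
    D.ReducibleTo Set.univ {j}ᶜ := by
  refine reducibleTo_of_genPos (fun i hi => absurd trivial hi) fun X hX P hP a₀ ha₀ hG z hz => ?_
  refine genericOn_fibre (ξ := fun _ _ => Pi.single 0 1) (P := P) hD (fun _ _ _ => by simp)
    (fun v v' hv => hG.mulVec_center_ne hP hv) (fun v i j' hi hj' hij hor => ⟨trivial,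
      hor.resolve_left fun h => h trivial, fun p hp v' hv =>
        linearIndependent_image_pt hP ha₀ hG hz trivial hi hp hv⟩) ?_
  intro y hy hyz a ha hoff _
  -- A line is chosen in a view: the observed one, or an auxiliary one through the image of the
  -- point if the view does not see the line. The sought line is the intersection of two
  -- back-projected planes, for the views other than `c`.
  have hn : ∀ v v', v' ≠ v → ∃ n : Fin 3 → ℂ, n ⬝ᵥ (P v).mulVec (center (P v')) ≠ 0 ∧
      (∀ hj : j ∈ D.obsLn v, (y.ln ⟨(v, j), hj⟩).1 = dualSub n) ∧
      ∀ i, (i, j) ∈ D.inc → n ⬝ᵥ (P v).mulVec (ptv a₀ ⟨i, trivial⟩) = 0 := by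
    intro v v' hv
    by_cases hj : j ∈ D.obsLn v
    · refine ⟨crossProduct (lnv a ⟨(v, j), hj⟩ 0) (lnv a ⟨(v, j), hj⟩ 1),
        hoff ⟨(v, j), hj⟩ (fun h => h rfl) ⟨v', hv⟩, fun _ => ha.ln_eq_dualSub _, fun i hij => ?_⟩
      have hi := h i hij v hj
      have e1 := hy v i j hi hj hij
      have e2 : (y.pt ⟨(v, i), hi⟩).submodule =
          Submodule.span ℂ {(P v).mulVec (ptv a₀ ⟨i, trivial⟩)} := by
        rw [← image_pt_eq ha₀ hz trivial hi, ← hyz]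
        rfl
      rw [OnLine, e2, ha.ln_eq_dualSub, Submodule.span_singleton_le_iff_mem] at e1
      exact e1
    · by_cases hp : ∃ i, (i, j) ∈ D.inc
      · obtain ⟨i, hij⟩ := hp
        obtain ⟨n, hn, hn'⟩ := exists_perp_dot_ne_zero (ι := Unit)
          (c := fun _ => (P v).mulVec (center (P v')))
          (p := (P v).mulVec (ptv a₀ ⟨i, trivial⟩))
          fun _ => linearIndependent_mulVec_center hP (hG.pt ⟨i, trivial⟩) hv
        refine ⟨n, hn' (), fun h => absurd h hj, fun i' hij' => ?_⟩
        obtain rfl := hD j _ _ hij hij'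
        exact hn
      · obtain ⟨n, hn⟩ := exists_dot_ne_zero (ι := Unit)
          (c := fun _ => (P v).mulVec (center (P v'))) fun _ => hG.mulVec_center_ne hP hv
        exact ⟨n, hn (), fun h => absurd h hj, fun i hi => absurd ⟨i, hi⟩ hp⟩
  obtain ⟨a, ha'⟩ := exists_ne_view c
  obtain ⟨b, hca, hcb⟩ := exists_other c a (Ne.symm ha')
  have hviews : ∀ v, j ∈ D.obsLn v → v = a ∨ v = b := by
    intro v hv
    have hvc : v ≠ c := by
      rintro rfl
      exact hc hv
    clear * - hvc ha' hca hcb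
    revert v a b c
    decide
  obtain ⟨n, hn1, hn2, hn3⟩ := hn a b (Ne.symm hcb)
  obtain ⟨m, hm1, hm2, hm3⟩ := hn b a hcb
  obtain ⟨l, hl, hla, hlb⟩ := exists_line_of_images hP hn1 hm1
  refine exists_lift hX hz hyz (fun i => X.pt ⟨i, trivial⟩) (fun _ => l)
    (fun i j' hij hor x l' h1 _ _ h4 => ?_) (fun v i hi hA => absurd trivial hA) fun v j' hj' hB => ?_
  · have hj' : j' ∉ ({j}ᶜ : Set κ) := hor.resolve_left fun h => h trivial
    rw [h1 trivial, h4 hj']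
    obtain rfl : j' = j := by simpa using hj'
    rw [OnLine, (hasCoords_iff.1 ha₀).1, Submodule.span_singleton_le_iff_mem, hl]
    exact ⟨hn3 i hij, hm3 i hij⟩
  · obtain rfl : j' = j := by simpa using hB
    rcases hviews v hj' with rfl | rfl
    · rw [hla, hn2]
    · rw [hlb, hm2]

theorem exists_mem_kernel (n : Fin 3 → Fin 4 → ℂ) : ∃ x : Fin 4 → ℂ, x ≠ 0 ∧ ∀ v, n v ⬝ᵥ x = 0 := by
  have h := LinearMap.ker_ne_bot_of_finrank_lt (f := (Matrix.of n).mulVecLin) (by simp)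
  obtain ⟨x, hx, hx0⟩ := Submodule.exists_mem_ne_zero_of_ne_bot h
  exact ⟨x, hx0, fun v => congrFun hx v⟩

/-- A point that is not seen can be forgotten together with its pins, if every view sees at most
one of them and none of them is seen by all views. -/
theorem reducibleTo_unseen (hD : D.OneInc) {i : ι} (hi : ∀ v, i ∉ D.obsPt v)
    (h1 : ∀ v j k, (i, j) ∈ D.inc → (i, k) ∈ D.inc → j ∈ D.obsLn v → k ∈ D.obsLn v → j = k)
    (h2 : ∀ j, (i, j) ∈ D.inc → ∃ c, j ∉ D.obsLn c) :
    D.ReducibleTo {i}ᶜ {j | (i, j) ∉ D.inc} := by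
  have hpin : ∀ i' j, (i', j) ∈ D.inc → i' ∉ ({i}ᶜ : Set ι) ∨ j ∉ {j | (i, j) ∉ D.inc} → i' = i := by
    rintro i' j hij (h | h)
    · simpa using h
    · exact hD j _ _ hij (not_not.1 h)
  refine reducibleTo_of_genPos (fun i' hi' j hj k hk hij => ?_) fun X hX P hP a₀ ha₀ hG z hz => ?_
  · obtain rfl : i' = i := by simpa using hi'
    exact absurd hij hj
  refine genericOn_fibre (ξ := fun _ _ => Pi.single 0 1) (P := P) hD (fun _ _ _ => by simp)
    (fun v v' hv => hG.mulVec_center_ne hP hv) (fun v i' j' hi' hj' hij hor => ?_) ?_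
  · rw [hpin _ _ hij hor] at hi'
    exact absurd hi' (hi v)
  intro y hy hyz a ha hoff _
  have hn : ∀ v, ∃ n : Fin 3 → ℂ, (∀ v', v' ≠ v → n ⬝ᵥ (P v).mulVec (center (P v')) ≠ 0) ∧
      ∀ j (hj : j ∈ D.obsLn v), (i, j) ∈ D.inc → (y.ln ⟨(v, j), hj⟩).1 = dualSub n := by
    intro v
    by_cases hp : ∃ j, j ∈ D.obsLn v ∧ (i, j) ∈ D.inc
    · obtain ⟨j, hj, hij⟩ := hp
      refine ⟨crossProduct (lnv a ⟨(v, j), hj⟩ 0) (lnv a ⟨(v, j), hj⟩ 1),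
        fun v' hv => hoff ⟨(v, j), hj⟩ (fun h => h hij) ⟨v', hv⟩, fun k hk hik => ?_⟩
      obtain rfl := h1 v j k hij hik hj hk
      exact ha.ln_eq_dualSub _
    · obtain ⟨n, hn⟩ := exists_dot_ne_zero (c := fun v' : {v' // v' ≠ v} =>
        (P v).mulVec (center (P v'))) fun v' => hG.mulVec_center_ne hP v'.2
      exact ⟨n, fun v' hv => hn ⟨v', hv⟩, fun j hj hij => absurd ⟨j, hj, hij⟩ hp⟩
  choose n hn1 hn2 using hn
  -- The three planes back-projected from the pins, or from auxiliary lines, have a common point. It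
  -- serves as the forgotten point, and every pin is the intersection of two of the planes.
  obtain ⟨x, hx0, hx⟩ := exists_mem_kernel fun v => Matrix.vecMul (n v) (P v)
  simp only [← Matrix.dotProduct_mulVec] at hx
  have hlines : ∀ j, ∃ l : ProjLine 4, (i, j) ∈ D.inc → x ∈ l.1 ∧
      ∀ v (hj : j ∈ D.obsLn v), l.1.map (P v).mulVecLin = (y.ln ⟨(v, j), hj⟩).1 := by
    intro j
    by_cases hij : (i, j) ∈ D.inc
    · obtain ⟨c, hc⟩ := h2 j hij
      obtain ⟨a, ha'⟩ := exists_ne_view c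
      obtain ⟨b, hca, hcb⟩ := exists_other c a (Ne.symm ha')
      have hviews : ∀ v, j ∈ D.obsLn v → v = a ∨ v = b := by
        intro v hv
        have hvc : v ≠ c := by
          rintro rfl
          exact hc hv
        clear * - hvc ha' hca hcb
        revert v a b c
        decide
      obtain ⟨l, hl, hla, hlb⟩ := exists_line_of_images hP (hn1 a b (Ne.symm hcb)) (hn1 b a hcb)
      refine ⟨l, fun _ => ⟨(hl x).2 ⟨hx a, hx b⟩, fun v hj => ?_⟩⟩
      rcases hviews v hj with rfl | rfl
      · rw [hla, hn2 _ j hj hij]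
      · rw [hlb, hn2 _ j hj hij]
    · obtain ⟨l, -⟩ := exists_line_of_images hP (hn1 0 1 (by decide)) (hn1 1 0 (by decide))
      exact ⟨l, fun h => absurd h hij⟩
  choose l hl using hlines
  refine exists_lift hX hz hyz (fun _ => Projectivization.mk ℂ x hx0) l
    (fun i' j hij hor x' l' _ h2 _ h4 => ?_) (fun v i' hi' hA => ?_) fun v j hj hB =>
      (hl j (not_not.1 hB)).2 v hj
  · obtain rfl := hpin _ _ hij hor
    rw [h2 (fun h => h rfl), h4 (fun h => h hij)]
    exact (submodule_mk_le hx0).2 (hl j hij).1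
  · obtain rfl : i' = i := by simpa using hA
    exact absurd hi' (hi v)

/-- A point that is seen by one view can be forgotten together with a single pin that is seen by
one other view. -/
theorem reducibleTo_point_pin {i : ι} {j : κ} {a b : Fin 3} (hD : D.OneInc) (hab : b ≠ a)
    (hi : ∀ v, i ∈ D.obsPt v ↔ v = a) (hij : (i, j) ∈ D.inc) (hpin : ∀ k, (i, k) ∈ D.inc → k = j)
    (hj : ∀ v, j ∈ D.obsLn v ↔ v = b) : D.ReducibleTo {i}ᶜ {j}ᶜ := by
  have hinc : ∀ i' j', (i', j') ∈ D.inc → i' ∉ ({i}ᶜ : Set ι) ∨ j' ∉ ({j}ᶜ : Set κ) →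
      i' = i ∧ j' = j := by
    rintro i' j' hij' (h | h)
    · obtain rfl : i' = i := by simpa using h
      exact ⟨rfl, hpin _ hij'⟩
    · obtain rfl : j' = j := by simpa using h
      exact ⟨hD _ _ _ hij' hij, rfl⟩
  refine reducibleTo_of_genPos (fun i' hi' k hk k' hk' hik => ?_) fun X hX P hP a₀ ha₀ hG z hz => ?_
  · obtain rfl : i' = i := by simpa using hi'
    exact absurd (hpin k hik) hk
  -- A line through the image of the other centre; a forgotten point that avoids it differs from
  -- that image.
  have hξ : ∀ v v', ∃ ξ : Fin 3 → ℂ, v' ≠ v → ξ ≠ 0 ∧ ξ ⬝ᵥ (P v).mulVec (center (P v')) = 0 := by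
    intro v v'
    by_cases hv : v' ≠ v
    · have h1 := linearIndependent_mulVec_center hP hG.cam hv
      refine ⟨_, fun _ => ⟨cross_ne_zero h1, ?_⟩⟩
      rw [dotProduct_comm, dot_cross_self]
    · exact ⟨0, fun h => absurd h hv⟩
  choose ξ hξ using hξ
  refine genericOn_fibre (ξ := ξ) (P := P) hD (fun v v' hv => (hξ v v' hv).1)
    (fun v v' hv => hG.mulVec_center_ne hP hv) (fun v i' j' hi' hj' hij hor => ?_) ?_
  · obtain ⟨rfl, rfl⟩ := hinc _ _ hij hor
    rw [hi] at hi'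
    rw [hj] at hj'
    exact absurd (hj'.symm.trans hi') hab
  intro y hy hyz α hα hoff hoff'
  have hia := (hi a).2 rfl
  have hjb := (hj b).2 rfl
  set η := ptv α ⟨(a, i), hia⟩
  have hη : LinearIndependent ℂ ![η, (P a).mulVec (center (P b))] := by
    rw [LinearIndependent.pair_iff]
    intro s t hst
    have h1 := congrArg (fun u => u ⬝ᵥ ξ a b) hst
    simp only [add_dotProduct, smul_dotProduct, zero_dotProduct, smul_eq_mul] at h1
    rw [dotProduct_comm _ (ξ a b), dotProduct_comm _ (ξ a b), (hξ a b hab).2, mul_zero, add_zero,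
      dotProduct_comm] at h1
    have h2 := (mul_eq_zero.1 h1).resolve_right (hoff' ⟨(a, i), hia⟩ (fun h => h rfl) ⟨b, hab⟩)
    rw [h2, zero_smul, zero_add] at hst
    exact ⟨h2, (smul_eq_zero.1 hst).resolve_right (hG.mulVec_center_ne hP hab)⟩
  set m := crossProduct (lnv α ⟨(b, j), hjb⟩ 0) (lnv α ⟨(b, j), hjb⟩ 1)
  have hm : m ⬝ᵥ (P b).mulVec (center (P a)) ≠ 0 :=
    hoff ⟨(b, j), hjb⟩ (fun h => h rfl) ⟨a, Ne.symm hab⟩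
  obtain ⟨n, hn, hn'⟩ := exists_perp_dot_ne_zero (ι := Unit) fun _ => hη
  obtain ⟨l, hl, hla, hlb⟩ := exists_line_of_images hP (hn' ()) hm
  -- The point where the ray of the observed image in `a` meets the plane of the pin from `b`. The
  -- pin lies in that plane and in the plane of an auxiliary line through the image in `a`.
  let x : Fin 4 → ℂ := ray (P a) η -
    (m ⬝ᵥ (P b).mulVec (ray (P a) η) / m ⬝ᵥ (P b).mulVec (center (P a))) • center (P a)
  have hPx : (P a).mulVec x = η := by
    rw [Matrix.mulVec_sub, Matrix.mulVec_smul, mulVec_center (rot_mul_transpose hP a), smul_zero,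
      sub_zero, mulVec_ray (rot_mul_transpose hP a)]
  have hmx : m ⬝ᵥ (P b).mulVec x = 0 := by
    rw [Matrix.mulVec_sub, Matrix.mulVec_smul, dotProduct_sub, dotProduct_smul, smul_eq_mul,
      div_mul_cancel₀ _ hm, sub_self]
  have hx0 : x ≠ 0 := by
    intro h0
    rw [h0, Matrix.mulVec_zero] at hPx
    exact hη.ne_zero 0 hPx.symm
  refine exists_lift hX hz hyz (fun _ => Projectivization.mk ℂ x hx0) (fun _ => l)
    (fun i' j' hij' hor x' l' _ h2 _ h4 => ?_) (fun v i' hi' hA => ?_) fun v j' hj' hB => ?_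
  · obtain ⟨rfl, rfl⟩ := hinc _ _ hij' hor
    rw [h2 (fun h => h rfl), h4 (fun h => h rfl)]
    refine (submodule_mk_le hx0).2 ((hl x).2 ⟨?_, hmx⟩)
    rw [hPx]
    exact hn
  · obtain rfl : i' = i := by simpa using hA
    obtain rfl := (hi v).1 hi'
    rw [Projectivization.submodule_mk, map_span_singleton, hPx]
    exact ((hasCoords_iff.1 hα).1 _).symm
  · obtain rfl : j' = j := by simpa using hB
    obtain rfl := (hj v).1 hj'
    rw [hlb]
    exact (hα.ln_eq_dualSub _).symm

end Reduction

end PointLine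

/-! ### Obstructions to reductions: prescribed images in a fibre -/

namespace PointLine

open MvPolynomial

variable {ι κ : Type}

section Irreducible

variable {D : Problem ι κ} {A : Set ι} {B : Set κ}

theorem nonempty_camVariety : ∃ P, P ∈ camVariety := by
  refine ⟨fun v => mkCam 1 (transFam 0 v), fun v => ?_, ?_, ?_, ?_⟩
  · simp
  · simp
  · simp [transFam]
  · simp [transFam]

theorem nonempty_spaceVariety (D : Problem ι κ) : ∃ X, X ∈ D.spaceVariety := by
  have hli : LinearIndependent ℂ ![(Pi.single 0 1 : Fin 4 → ℂ), Pi.single 1 1] :=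
    linearIndependent_pair_iff_minor.2 ⟨0, 1, by simp⟩
  have h0 : (Pi.single 0 1 : Fin 4 → ℂ) ≠ 0 := hli.ne_zero 0
  refine ⟨⟨fun _ => Projectivization.mk ℂ _ h0, fun _ => mkLine _ _ hli⟩, fun i j _ =>
    (submodule_mk_le h0).2 ?_⟩
  exact Submodule.subset_span (Or.inl rfl)

theorem linearIndependent_of_three {u w c : Fin 3 → ℂ} (h : LinearIndependent ℂ ![u, w, c]) :
    LinearIndependent ℂ ![u, w] := by
  rw [LinearIndependent.pair_iff]
  intro s t hst
  have h1 := Fintype.linearIndependent_iff.1 h ![s, t, 0] (by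
    rw [Fin.sum_univ_three]
    simpa using hst)
  exact ⟨h1 0, h1 1⟩

theorem linearIndependent_of_three' {u w c : Fin 3 → ℂ} (h : LinearIndependent ℂ ![u, w, c]) :
    LinearIndependent ℂ ![u, c] := by
  rw [LinearIndependent.pair_iff]
  intro s t hst
  have h1 := Fintype.linearIndependent_iff.1 h ![s, 0, t] (by
    rw [Fin.sum_univ_three]
    simpa using hst)
  exact ⟨h1 0, h1 2⟩

theorem linearIndependent_mulVec_of_pairs {P : Cameras} (hP : P ∈ camVariety) {x y : Fin 4 → ℂ}
    (h : ∀ v v', v ≠ v' → quad x y (center (P v)) (center (P v')) ≠ 0) {v v' : Fin 3}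
    (hv : v' ≠ v) :
    LinearIndependent ℂ ![(P v).mulVec x, (P v).mulVec y, (P v).mulVec (center (P v'))] :=
  linearIndependent_mulVec_of_quad (rot_mul_transpose hP v) (h v' v hv)

theorem GenPos.linearIndependent_ln {ι' κ' : Type} {P : Cameras} (hP : P ∈ camVariety)
    {x : ArrCoord ι' κ' 4 → ℂ} (hG : GenPos P x) (v : Fin 3) (j : κ') :
    LinearIndependent ℂ ![(P v).mulVec (lnv x j 0), (P v).mulVec (lnv x j 1)] := by
  obtain ⟨v', hv⟩ := exists_ne_view v
  exact linearIndependent_of_three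
    (linearIndependent_mulVec_of_pairs hP (fun v v' h => hG.ln v v' h j) hv)

theorem GenPos.mulVec_pt_ne {ι' κ' : Type} {P : Cameras} (hP : P ∈ camVariety)
    {x : ArrCoord ι' κ' 4 → ℂ} (hG : GenPos P x) (v : Fin 3) (i : ι') :
    (P v).mulVec (ptv x i) ≠ 0 := by
  obtain ⟨v', hv⟩ := exists_ne_view v
  exact (linearIndependent_mulVec_center hP (hG.pt i) hv).ne_zero 0

theorem GenPos.exists_jointImage {P : Cameras} (hP : P ∈ camVariety) {X : Arrangement A B 4}
    {x : ArrCoord A B 4 → ℂ} (hx : X.HasCoords x) (hG : GenPos P x) :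
    ∃ z, (D.restrict A B).IsJointImage X P z := by
  let b : ArrCoord (D.restrict A B).ObsPt (D.restrict A B).ObsLn 3 → ℂ :=
    Sum.elim (fun t => (P t.1.1.1).mulVec (ptv x t.1.1.2) t.2)
      fun t => (P t.1.1.1).mulVec (lnv x t.1.1.2 t.2.1) t.2.2
  obtain ⟨z, hz⟩ := exists_hasCoords (a := b) (fun q => hG.mulVec_pt_ne hP q.1.1 q.1.2)
    fun q => hG.linearIndependent_ln hP q.1.1 q.1.2
  refine ⟨z, fun q => ?_, fun q => ?_⟩
  · rw [(hasCoords_iff.1 hx).1, (hasCoords_iff.1 hz).1, map_span_singleton]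
    rfl
  · rw [(hasCoords_iff.1 hx).2, (hasCoords_iff.1 hz).2, map_span_pair]
    rfl

/-- A solution in general position that lifts for generic input images. -/
theorem exists_of_reducibleTo [Finite ι] [Finite κ] (h : D.ReducibleTo A B) :
    ∃ X ∈ (D.restrict A B).spaceVariety, ∃ P ∈ camVariety, ∃ x, X.HasCoords x ∧ GenPos P x ∧
      ∃ z, (D.restrict A B).IsJointImage X P z ∧
        ∀ G : (ArrCoord D.ObsPt D.ObsLn 3 → ℂ) → ℂ, IsPoly G →
          ∀ y ∈ D.imageVariety, D.forgetImage A B y = z → ∀ a, y.HasCoords a → G a ≠ 0 →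
            ∃ y ∈ D.imageVariety, D.forgetImage A B y = z ∧ ∃ a, y.HasCoords a ∧ G a ≠ 0 ∧
              ∃ X' ∈ D.spaceVariety, D.IsJointImage X' P y ∧ Problem.forgetSpace A B X' = X := by
  obtain ⟨F, hF, hFd, hFQ⟩ := genericOn_iff.1 h.2
  obtain ⟨G, hG, hGG⟩ := opn_genPos (ι := A) (κ := B)
  obtain ⟨P₀, hP₀⟩ := nonempty_camVariety
  obtain ⟨X₀, hX₀⟩ := nonempty_spaceVariety (D.restrict A B)
  obtain ⟨x₀, hx₀⟩ := exists_coords X₀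
  obtain ⟨S₁, hS₁, w₁, hw₁, hG₁, -⟩ := (denseOn_genPos (D.restrict A B) hG hGG).exists_ne
    (G := fun _ => 1) (.const 1) (t := (X₀, P₀)) ⟨hX₀, hP₀⟩
    (a := Sum.elim x₀ fun t => P₀ t.1 t.2.1 t.2.2) ⟨hx₀, fun _ _ _ => rfl⟩ one_ne_zero
  obtain ⟨⟨X, P⟩, ⟨hX, hP⟩, w, hw, hFw, hGw⟩ := hFd.exists_ne hG hS₁ hw₁ hG₁
  have hGP : GenPos (coordCam w) fun k => w (.inl k) := (hGG w).1 hGw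
  rw [coordCam_eq hw] at hGP
  obtain ⟨z, hz⟩ := hGP.exists_jointImage (D := D) hP hw.1
  obtain ⟨F', hF', hFd', hFQ'⟩ := genericOn_iff.1 (hFQ _ ⟨hX, hP⟩ w hw hFw z hz)
  refine ⟨X, hX, P, hP, _, hw.1, hGP, z, hz, fun G hG y hy hyz a ha hGa => ?_⟩
  obtain ⟨y', ⟨hy', hyz'⟩, a', ha', hFa', hGa'⟩ := hFd'.exists_ne hG ⟨hy, hyz⟩ ha hGa
  exact ⟨y', hy', hyz', a', ha', hGa', hFQ' y' ⟨hy', hyz'⟩ a' ha' hFa'⟩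

theorem exists_cross_eq_self {n : Fin 3 → ℂ} (hn : n ≠ 0) :
    ∃ u w : Fin 3 → ℂ, LinearIndependent ℂ ![u, w] ∧ crossProduct u w = n := by
  obtain ⟨u, w, t, ht, h⟩ := exists_cross_eq hn
  have h1 : crossProduct (t⁻¹ • u) w = n := by
    rw [LinearMap.map_smul₂, h, inv_smul_smul₀ ht]
  exact ⟨t⁻¹ • u, w, crossProduct_ne_zero_iff_linearIndependent.1 (h1 ▸ hn), h1⟩

theorem exists_linearIndependent {p : Fin 3 → ℂ} (hp : p ≠ 0) :
    ∃ w : Fin 3 → ℂ, LinearIndependent ℂ ![p, w] := by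
  by_contra! h
  obtain ⟨k, hk⟩ := Function.ne_iff.1 hp
  rw [Pi.zero_apply] at hk
  obtain ⟨l, hl⟩ : ∃ l : Fin 3, l ≠ k := exists_ne_view k
  refine h (Pi.single l 1) (linearIndependent_pair_iff_minor.2 ⟨k, l, ?_⟩)
  simp [hl.symm, hk]

theorem mem_span_pair_of_cross {u w p : Fin 3 → ℂ} (h : LinearIndependent ℂ ![u, w])
    (hp : crossProduct u w ⬝ᵥ p = 0) : p ∈ Submodule.span ℂ {u, w} := by
  rw [span_pair_eq_dualSub_cross h]
  exact hp

/-- Some of the forgotten points and lines of an image can be prescribed. -/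
theorem exists_image (hD : D.OneInc)
    (h1 : ∀ i ∉ A, ∀ j ∈ B, ∀ k ∈ B, (i, j) ∈ D.inc → (i, k) ∈ D.inc → j = k)
    {X : Arrangement A B 4} (hX : X ∈ (D.restrict A B).spaceVariety) {P : Cameras}
    (hP : P ∈ camVariety) {x : ArrCoord A B 4 → ℂ} (hx : X.HasCoords x) (hG : GenPos P x)
    {z : (D.restrict A B).Image} (hz : (D.restrict A B).IsJointImage X P z)
    (s : Fin 3 → ι → Prop) (p : Fin 3 → ι → Fin 3 → ℂ)
    (hp : ∀ v i, s v i → i ∈ D.obsPt v → p v i ≠ 0 ∧ ∀ j (hB : j ∈ B), (i, j) ∈ D.inc →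
      j ∈ D.obsLn v → ∃ w ∈ (X.ln ⟨j, hB⟩).1, (P v).mulVec w = p v i)
    (s' : Fin 3 → κ → Prop) (n : Fin 3 → κ → Fin 3 → ℂ)
    (hn : ∀ v j, s' v j → j ∈ D.obsLn v → n v j ≠ 0 ∧ ∀ i, i ∈ D.obsPt v → (i, j) ∈ D.inc →
      ∃ hA : i ∈ A, n v j ⬝ᵥ (P v).mulVec (ptv x ⟨i, hA⟩) = 0) :
    ∃ y ∈ D.imageVariety, D.forgetImage A B y = z ∧ ∃ a, y.HasCoords a ∧
      (∀ v i (hi : i ∈ D.obsPt v), i ∉ A → s v i → ptv a ⟨(v, i), hi⟩ = p v i) ∧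
      (∀ v j (hj : j ∈ D.obsLn v), j ∉ B → s' v j →
        crossProduct (lnv a ⟨(v, j), hj⟩ 0) (lnv a ⟨(v, j), hj⟩ 1) = n v j) ∧
      ∀ v j (hj : j ∈ D.obsLn v) (hB : j ∈ B), ∀ r,
        lnv a ⟨(v, j), hj⟩ r = (P v).mulVec (lnv x ⟨j, hB⟩ r) := by
  -- Kept points have their true images and selected forgotten points the prescribed ones. Other
  -- forgotten points are placed on the image of their only kept pin, if there is one.
  have hpt : ∀ q : D.ObsPt, ∃ u : Fin 3 → ℂ, u ≠ 0 ∧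
      (∀ hA : q.1.2 ∈ A, u = (P q.1.1).mulVec (ptv x ⟨q.1.2, hA⟩)) ∧
      (q.1.2 ∉ A → s q.1.1 q.1.2 → u = p q.1.1 q.1.2) ∧
      (q.1.2 ∉ A → ∀ j (hB : j ∈ B), (q.1.2, j) ∈ D.inc → j ∈ D.obsLn q.1.1 →
        ∃ w ∈ (X.ln ⟨j, hB⟩).1, (P q.1.1).mulVec w = u) := by
    rintro ⟨⟨v, i⟩, hi⟩
    by_cases hA : i ∈ A
    · exact ⟨_, hG.mulVec_pt_ne hP v ⟨i, hA⟩, fun _ => rfl, fun h => absurd hA h, fun h => absurd hA h⟩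
    by_cases hs : s v i
    · exact ⟨p v i, (hp v i hs hi).1, fun h => absurd h hA, fun _ _ => rfl,
        fun _ j hB hij hj => (hp v i hs hi).2 j hB hij hj⟩
    by_cases hj : ∃ j, j ∈ B ∧ (i, j) ∈ D.inc
    · obtain ⟨j, hB, hij⟩ := hj
      refine ⟨_, (hG.linearIndependent_ln hP v ⟨j, hB⟩).ne_zero 0, fun h => absurd h hA,
        fun _ h => absurd h hs, fun _ k hk hik _ => ?_⟩
      obtain rfl := h1 i hA j hB k hk hij hik
      refine ⟨lnv x ⟨j, hB⟩ 0, ?_, rfl⟩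
      rw [(hasCoords_iff.1 hx).2]
      exact Submodule.subset_span (Or.inl rfl)
    · exact ⟨Pi.single 0 1, by simp, fun h => absurd h hA, fun _ h => absurd h hs,
        fun _ j hB hij _ => absurd ⟨j, hB, hij⟩ hj⟩
  choose u hu0 huA hus huB using hpt
  have hln : ∀ q : D.ObsLn, ∃ l : Fin 2 → Fin 3 → ℂ, LinearIndependent ℂ ![l 0, l 1] ∧
      (∀ hB : q.1.2 ∈ B, ∀ r, l r = (P q.1.1).mulVec (lnv x ⟨q.1.2, hB⟩ r)) ∧
      (q.1.2 ∉ B → s' q.1.1 q.1.2 → crossProduct (l 0) (l 1) = n q.1.1 q.1.2) ∧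
      ∀ i (hi : i ∈ D.obsPt q.1.1), (i, q.1.2) ∈ D.inc →
        u ⟨(q.1.1, i), hi⟩ ∈ Submodule.span ℂ {l 0, l 1} := by
    rintro ⟨⟨v, j⟩, hj⟩
    by_cases hB : j ∈ B
    · refine ⟨fun r => (P v).mulVec (lnv x ⟨j, hB⟩ r), hG.linearIndependent_ln hP v ⟨j, hB⟩,
        fun _ _ => rfl, fun h => absurd hB h, fun i hi hij => ?_⟩
      by_cases hA : i ∈ A
      · rw [huA ⟨(v, i), hi⟩ hA]
        exact mulVec_mem_span_pair _ ((hx.onLine_iff ⟨i, hA⟩ ⟨j, hB⟩).1 (hX ⟨i, hA⟩ ⟨j, hB⟩ hij))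
      · obtain ⟨w, hw, hwu⟩ := huB ⟨(v, i), hi⟩ hA j hB hij hj
        rw [← hwu]
        rw [(hasCoords_iff.1 hx).2] at hw
        exact mulVec_mem_span_pair _ hw
    by_cases hs : s' v j
    · obtain ⟨hn0, hni⟩ := hn v j hs hj
      obtain ⟨l₀, l₁, hl, hln⟩ := exists_cross_eq_self hn0
      refine ⟨![l₀, l₁], hl, fun h => absurd h hB, fun _ _ => hln, fun i hi hij => ?_⟩
      obtain ⟨hA, h0⟩ := hni i hi hij
      rw [huA ⟨(v, i), hi⟩ hA]
      refine mem_span_pair_of_cross hl ?_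
      rw [← hln] at h0
      exact h0
    by_cases hex : ∃ i, i ∈ D.obsPt v ∧ (i, j) ∈ D.inc
    · obtain ⟨i, hi, hij⟩ := hex
      obtain ⟨w, hw⟩ := exists_linearIndependent (hu0 ⟨(v, i), hi⟩)
      refine ⟨![u ⟨(v, i), hi⟩, w], hw, fun h => absurd h hB, fun _ h => absurd h hs,
        fun i' hi' hij' => ?_⟩
      obtain rfl := hD j _ _ hij hij'
      exact Submodule.subset_span (Or.inl rfl)
    · obtain ⟨w, hw⟩ := exists_linearIndependent (p := Pi.single 0 1) (by simp)
      exact ⟨![_, w], hw, fun h => absurd h hB, fun _ h => absurd h hs,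
        fun i hi hij => absurd ⟨i, hi, hij⟩ hex⟩
  choose l hl0 hlB hls hlu using hln
  let a : ArrCoord D.ObsPt D.ObsLn 3 → ℂ :=
    Sum.elim (fun t => u t.1 t.2) fun t => l t.1 t.2.1 t.2.2
  obtain ⟨y, hy⟩ := exists_hasCoords (a := a) hu0 hl0
  refine ⟨y, fun v i j hi hj hij => (hy.onLine_iff _ _).2 (hlu ⟨(v, j), hj⟩ i hi hij), ?_, a, hy,
    fun v i hi => hus ⟨(v, i), hi⟩, fun v j hj => hls ⟨(v, j), hj⟩, fun v j hj => hlB ⟨(v, j), hj⟩⟩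
  refine Arrangement.ext' (fun q => ?_) fun q => ?_
  · rw [← hz.1 q, (hasCoords_iff.1 hx).1, map_span_singleton]
    refine ((hasCoords_iff.1 hy).1 ⟨(q.1.1, (q.1.2 : ι)), q.2⟩).trans ?_
    rw [← huA ⟨(q.1.1, (q.1.2 : ι)), q.2⟩ q.1.2.2]
    rfl
  · rw [← hz.2 q, (hasCoords_iff.1 hx).2, map_span_pair]
    refine ((hasCoords_iff.1 hy).2 ⟨(q.1.1, (q.1.2 : κ)), q.2⟩).trans ?_
    rw [← hlB ⟨(q.1.1, (q.1.2 : κ)), q.2⟩ q.1.2.2, ← hlB ⟨(q.1.1, (q.1.2 : κ)), q.2⟩ q.1.2.2]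
    rfl

end Irreducible

end PointLine

/-! ### Obstructions from rays and from pins of kept points -/

namespace PointLine

open MvPolynomial

variable {ι κ : Type}

section Irreducible

variable {D : Problem ι κ} {A : Set ι} {B : Set κ}

theorem quad_add_add (e a b c : Fin 4 → ℂ) : quad e (a + b + c) a b = quad e c a b := by
  simp [quad, Matrix.det_succ_row_zero, Fin.sum_univ_succ, Fin.succAbove]
  ring

theorem quad_add_smul (x y c d : Fin 4 → ℂ) (γ δ : ℂ) :
    quad (x + γ • c) (y + δ • d) c d = quad x y c d := by
  simp [quad, Matrix.det_succ_row_zero, Fin.sum_univ_succ, Fin.succAbove]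
  ring

/-- A forgotten point has at most one kept pin. Two points on this pin, or two suitable points if
there is none, can be used as contradictory positions of the forgotten point that respect all kept
incidences. -/
theorem exists_pair_on_pins
    (h1 : ∀ i ∉ A, ∀ j ∈ B, ∀ k ∈ B, (i, j) ∈ D.inc → (i, k) ∈ D.inc → j = k)
    {X : Arrangement A B 4} {P : Cameras} {x : ArrCoord A B 4 → ℂ} (hx : X.HasCoords x)
    (hG : GenPos P x) {i : ι} (hi : i ∉ A) :
    ∃ x₁ x₂, (∀ v v', v ≠ v' → quad x₁ x₂ (center (P v)) (center (P v')) ≠ 0) ∧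
      ∀ j (hB : j ∈ B), (i, j) ∈ D.inc → x₁ ∈ (X.ln ⟨j, hB⟩).1 ∧ x₂ ∈ (X.ln ⟨j, hB⟩).1 := by
  by_cases hj : ∃ j, j ∈ B ∧ (i, j) ∈ D.inc
  · obtain ⟨j, hB, hij⟩ := hj
    refine ⟨lnv x ⟨j, hB⟩ 0, lnv x ⟨j, hB⟩ 1, fun v v' hv => hG.ln v v' hv _, fun k hk hik => ?_⟩
    obtain rfl := h1 i hi j hB k hk hij hik
    rw [(hasCoords_iff.1 hx).2]
    exact ⟨Submodule.subset_span (Or.inl rfl), Submodule.subset_span (Or.inr rfl)⟩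
  · refine ⟨Pi.single 0 1, ∑ v, center (P v), fun v v' hv => ?_, fun k hk hik => absurd ⟨k, hk, hik⟩ hj⟩
    obtain ⟨c, hc, hc'⟩ := exists_other v v' hv
    have hu : (Finset.univ : Finset (Fin 3)) = {v, v', c} := by
      clear hj hi hG hx h1
      revert v v' c
      decide
    rw [hu, Finset.sum_insert (by simp [hv, hc]), Finset.sum_insert (by simp [hc']),
      Finset.sum_singleton, ← add_assoc, quad_add_add]
    exact quad_centers hG.cam hc.symm hc'.symm hv

theorem dot_eq_zero_of_jointImage {X : Arrangement ι κ 4} {P : Cameras} {y : D.Image}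
    (hI : D.IsJointImage X P y) {a : ArrCoord D.ObsPt D.ObsLn 3 → ℂ} (ha : y.HasCoords a) (q : D.ObsLn)
    {w : Fin 4 → ℂ} (hw : w ∈ (X.ln q.1.2).1) :
    crossProduct (lnv a q 0) (lnv a q 1) ⬝ᵥ (P q.1.1).mulVec w = 0 := by
  have h1 : (P q.1.1).mulVec w ∈ (y.ln q).1 := by
    rw [← hI.2 q]
    exact ⟨w, hw, rfl⟩
  rw [ha.ln_eq_dualSub q] at h1
  exact h1

theorem exists_eq_smul_ray {X : Arrangement ι κ 4} {P : Cameras} (hP : P ∈ camVariety) {y : D.Image}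
    (hI : D.IsJointImage X P y) {a : ArrCoord D.ObsPt D.ObsLn 3 → ℂ} (ha : y.HasCoords a) (q : D.ObsPt)
    {x : Fin 4 → ℂ} (hx : (X.pt q.1.2).submodule = Submodule.span ℂ {x}) :
    ∃ c γ : ℂ, c ≠ 0 ∧ x = c • ray (P q.1.1) (ptv a q) + γ • center (P q.1.1) := by
  have h1 := hI.1 q
  rw [hx, map_span_singleton, (hasCoords_iff.1 ha).1, eq_comm,
    span_singleton_eq_iff (ha.ptv_ne_zero q)] at h1
  obtain ⟨t, ht, h1⟩ := h1
  have h2 : (P q.1.1).mulVec x = t⁻¹ • (P q.1.1).mulVec (ray (P q.1.1) (ptv a q)) := by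
    rw [mulVec_ray (rot_mul_transpose hP _), h1, inv_smul_smul₀ ht]
  obtain ⟨γ, hγ⟩ := exists_add_smul_center (rot_mul_transpose hP _) h2
  exact ⟨t⁻¹, γ, inv_ne_zero ht, hγ⟩

theorem mem_ln_of_onLine {X : Arrangement ι κ 4} {i : ι} {j : κ} (h : OnLine (X.pt i) (X.ln j))
    {x : Fin 4 → ℂ} (hx : (X.pt i).submodule = Submodule.span ℂ {x}) : x ∈ (X.ln j).1 := by
  refine h ?_
  rw [hx]
  exact Submodule.mem_span_singleton_self x

variable [Finite ι] [Finite κ]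

/-- A point that is seen by two views cannot be forgotten. -/
theorem Problem.ReducibleTo.mem_of_two_views (hD : D.OneInc) (h : D.ReducibleTo A B) {i : ι}
    {v v' : Fin 3} (hv : v ≠ v') (hi : i ∈ D.obsPt v) (hi' : i ∈ D.obsPt v') : i ∈ A := by
  by_contra hA
  obtain ⟨X, hX, P, hP, x, hx, hG, z, hz, key⟩ := exists_of_reducibleTo h
  -- View `v` is shown `x₁` and the other views `x₂`, so that the rays from `v` and `v'` are skew.
  obtain ⟨x₁, x₂, hq, hpin⟩ := exists_pair_on_pins h.1 hx hG hA
  have hpv : ∀ w, ∃ u, (w = v → u = x₁) ∧ (w ≠ v → u = x₂) ∧ (P w).mulVec u ≠ 0 ∧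
      ∀ j (hB : j ∈ B), (i, j) ∈ D.inc → u ∈ (X.ln ⟨j, hB⟩).1 := by
    intro w
    obtain ⟨w', hw⟩ := exists_ne_view w
    have hli := linearIndependent_mulVec_of_pairs hP hq hw
    by_cases h : w = v
    · exact ⟨x₁, fun _ => rfl, fun h' => absurd h h', hli.ne_zero 0, fun j hB hij => (hpin j hB hij).1⟩
    · exact ⟨x₂, fun h' => absurd h' h, fun _ => rfl, hli.ne_zero 1, fun j hB hij => (hpin j hB hij).2⟩
  choose u hu₁ hu₂ hu0 hu using hpv
  obtain ⟨y, hy, hyz, a, ha, hpa, -⟩ := exists_image hD h.1 hX hP hx hG hz (fun _ k => k = i)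
    (fun w _ => (P w).mulVec (u w))
    (by
      rintro w i rfl hi
      exact ⟨hu0 w, fun j hB hij hj => ⟨u w, hu w j hB hij, rfl⟩⟩)
    (fun _ _ => False) (fun _ _ => 0) (fun _ _ h => absurd h not_false)
  -- The determinant of the two rays and centres vanishes whenever the rays meet, hence on every
  -- image that lifts.
  obtain ⟨y', -, -, a', ha', hGa, X', hX', hI, -⟩ := key
    (fun a => quad (ray (P v) (ptv a ⟨(v, i), hi⟩)) (ray (P v') (ptv a ⟨(v', i), hi'⟩))
      (center (P v)) (center (P v')))
    (isPoly_quad (a := fun a : ArrCoord D.ObsPt D.ObsLn 3 → ℂ => ray (P v) (ptv a ⟨(v, i), hi⟩))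
      (b := fun a => ray (P v') (ptv a ⟨(v', i), hi'⟩)) (c := fun _ => center (P v))
      (d := fun _ => center (P v')) (isPoly_ray _ (isPoly_ptv _)) (isPoly_ray _ (isPoly_ptv _))
      (fun _ => .const _) fun _ => .const _) y hy hyz a ha (by
      have hr : ∀ w x, ∃ γ : ℂ, ray (P w) ((P w).mulVec x) = x + γ • center (P w) := fun w x => by
        obtain ⟨γ, hγ⟩ := exists_add_smul_center (rot_mul_transpose hP w) (c := 1)
          (x := x) (z := ray (P w) ((P w).mulVec x))
          (by rw [mulVec_ray (rot_mul_transpose hP _), one_smul])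
        exact ⟨γ, by rwa [one_smul] at hγ⟩
      rw [hpa v i hi hA rfl, hpa v' i hi' hA rfl]
      obtain ⟨γ, hγ⟩ := hr v (u v)
      obtain ⟨δ, hδ⟩ := hr v' (u v')
      rw [hγ, hδ, quad_add_smul, hu₁ v rfl, hu₂ v' hv.symm]
      exact hq v v' hv)
  obtain ⟨x', -, hx'⟩ := (X'.pt i).exists_mk
  obtain ⟨c, γ, hc, e1⟩ := exists_eq_smul_ray hP hI ha' ⟨(v, i), hi⟩ hx'
  obtain ⟨c', γ', -, e2⟩ := exists_eq_smul_ray hP hI ha' ⟨(v', i), hi'⟩ hx'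
  refine hc (coeffs_eq_zero_of_quad hGa (α := c) (β := -c') (γ := γ) (δ := -γ') ?_).1
  have e3 := e1.symm.trans e2
  refine Eq.trans ?_ (sub_eq_zero.2 e3)
  module

/-- A pin of a kept point cannot be forgotten if it is seen by a view that does not see the point. -/
theorem Problem.ReducibleTo.mem_of_pin (hD : D.OneInc) (h : D.ReducibleTo A B) {i : ι} {j : κ}
    (hij : (i, j) ∈ D.inc) (hA : i ∈ A) {v : Fin 3} (hj : j ∈ D.obsLn v) (hi : i ∉ D.obsPt v) :
    j ∈ B := by
  by_contra hB
  obtain ⟨X, hX, P, hP, x, hx, hG, z, hz, key⟩ := exists_of_reducibleTo h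
  -- As `v` does not see the point, the image of the pin is not bound to it and can be prescribed to
  -- miss the image of the kept point.
  obtain ⟨n, hn⟩ := exists_dot_ne_zero fun _ : Unit => hG.mulVec_pt_ne hP v ⟨i, hA⟩
  obtain ⟨y, hy, hyz, a, ha, -, hna, -⟩ := exists_image hD h.1 hX hP hx hG hz (fun _ _ => False)
    (fun _ _ => 0) (fun _ _ h => absurd h not_false) (fun w k => w = v ∧ k = j) (fun _ _ => n)
    (by
      rintro v j ⟨rfl, rfl⟩ -
      refine ⟨fun h0 => hn () (by rw [h0, zero_dotProduct]), fun i' hi' hij' => ?_⟩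
      obtain rfl := hD j _ _ hij hij'
      exact absurd hi' hi)
  obtain ⟨y', -, -, a', ha', hGa, X', hX', hI, hXX⟩ := key
    (fun a => crossProduct (lnv a ⟨(v, j), hj⟩ 0) (lnv a ⟨(v, j), hj⟩ 1) ⬝ᵥ
      (P v).mulVec (ptv x ⟨i, hA⟩))
    (IsPoly.dot (u := fun a : ArrCoord D.ObsPt D.ObsLn 3 → ℂ =>
      crossProduct (lnv a ⟨(v, j), hj⟩ 0) (lnv a ⟨(v, j), hj⟩ 1)) (w := fun _ => _)
      (IsPoly.cross (isPoly_lnv _ 0) (isPoly_lnv _ 1)) fun _ => .const _) y hy hyz a ha (by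
      rw [hna v j hj hB ⟨rfl, rfl⟩]
      exact hn ())
  refine hGa (dot_eq_zero_of_jointImage hI ha' ⟨(v, j), hj⟩ (mem_ln_of_onLine (hX' i j hij) ?_))
  rw [← (hasCoords_iff.1 hx).1, ← hXX]
  rfl

end Irreducible

end PointLine

/-! ### Obstructions from three planes, and sufficiency of the combinatorial conditions -/

namespace PointLine

open MvPolynomial

variable {ι κ : Type}

section Irreducible

variable {D : Problem ι κ} {A : Set ι} {B : Set κ}

/-- Every line meets the plane of the three centres. -/
theorem exists_mem_span_centers {e c₀ c₁ c₂ : Fin 4 → ℂ} (h : quad e c₀ c₁ c₂ ≠ 0) (l : ProjLine 4) :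
    ∃ γ₀ γ₁ γ₂ : ℂ, γ₀ • c₀ + γ₁ • c₁ + γ₂ • c₂ ∈ l.1 ∧ ¬ (γ₀ = 0 ∧ γ₁ = 0 ∧ γ₂ = 0) := by
  obtain ⟨u, w, huw, hl⟩ := l.exists_span
  obtain ⟨α, β, γ, δ, hu⟩ := exists_coeffs_of_quad h u
  obtain ⟨α', β', γ', δ', hw⟩ := exists_coeffs_of_quad h w
  have hul : u ∈ l.1 := by
    rw [hl]
    exact Submodule.subset_span (Or.inl rfl)
  have hwl : w ∈ l.1 := by
    rw [hl]
    exact Submodule.subset_span (Or.inr rfl)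
  by_cases hα : α = 0
  · refine ⟨β, γ, δ, ?_, ?_⟩
    · rw [hα, zero_smul, zero_add] at hu
      rwa [← hu]
    · rintro ⟨rfl, rfl, rfl⟩
      exact huw.ne_zero 0 (by simpa [hα] using hu)
  · have e : (α' * β - α * β') • c₀ + (α' * γ - α * γ') • c₁ + (α' * δ - α * δ') • c₂ =
        α' • u - α • w := by
      rw [hu, hw]
      module
    refine ⟨_, _, _, e ▸ l.1.sub_mem (l.1.smul_mem _ hul) (l.1.smul_mem _ hwl), ?_⟩
    rintro ⟨h0, h1, h2⟩
    rw [h0, h1, h2, zero_smul, zero_smul, zero_smul, add_zero, add_zero, eq_comm, sub_eq_add_neg,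
      ← neg_smul] at e
    exact hα (neg_eq_zero.1 (LinearIndependent.pair_iff.1 huw _ _ e).2)

/-- The position `p` respects the kept pin. The line `n` passes through the image of `p` but not
through that of the centre of `a`, while `m`, which is free because `k` is forgotten, misses the
image of `p`. Then the ray of `p` meets the two planes in different points. -/
theorem exists_forgotten_config
    (h1 : ∀ i ∉ A, ∀ j ∈ B, ∀ k ∈ B, (i, j) ∈ D.inc → (i, k) ∈ D.inc → j = k)
    {X : Arrangement A B 4} {P : Cameras} (hP : P ∈ camVariety) {x : ArrCoord A B 4 → ℂ}
    (hx : X.HasCoords x) (hG : GenPos P x) {i : ι} (hi : i ∉ A) {a b c : Fin 3} (hab : a ≠ b)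
    (hac : a ≠ c) {j k : κ} (hij : (i, j) ∈ D.inc) (hk : k ∉ B) :
    ∃ p n m, (P a).mulVec p ≠ 0 ∧ (∀ l (hB : l ∈ B), (i, l) ∈ D.inc → p ∈ (X.ln ⟨l, hB⟩).1) ∧
      n ≠ 0 ∧ m ≠ 0 ∧
      (∀ hB : j ∈ B, n = crossProduct ((P b).mulVec (lnv x ⟨j, hB⟩ 0)) ((P b).mulVec (lnv x ⟨j, hB⟩ 1))) ∧
      (∀ hB : k ∈ B, m = crossProduct ((P c).mulVec (lnv x ⟨k, hB⟩ 0)) ((P c).mulVec (lnv x ⟨k, hB⟩ 1))) ∧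
      (n ⬝ᵥ (P b).mulVec p) * (m ⬝ᵥ (P c).mulVec (center (P a))) -
        (n ⬝ᵥ (P b).mulVec (center (P a))) * (m ⬝ᵥ (P c).mulVec p) ≠ 0 := by
  obtain ⟨p, q, hq, hpin⟩ := exists_pair_on_pins h1 hx hG hi
  have hli : ∀ {v v'}, v' ≠ v → _ := fun {v v'} hv =>
    linearIndependent_mulVec_of_pairs (v := v) (v' := v') hP hq hv
  have hn : ∃ n : Fin 3 → ℂ, n ⬝ᵥ (P b).mulVec p = 0 ∧ n ⬝ᵥ (P b).mulVec (center (P a)) ≠ 0 ∧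
      ∀ hB : j ∈ B, n = crossProduct ((P b).mulVec (lnv x ⟨j, hB⟩ 0))
        ((P b).mulVec (lnv x ⟨j, hB⟩ 1)) := by
    by_cases hB : j ∈ B
    · refine ⟨_, ?_, cross_dot_ne_zero (rot_mul_transpose hP b) (hG.ln a b hab ⟨j, hB⟩), fun _ => rfl⟩
      have hp := (hpin j hB hij).1
      rw [(hasCoords_iff.1 hx).2] at hp
      have := mulVec_mem_span_pair (P b) hp
      rwa [span_pair_eq_dualSub_cross (hG.linearIndependent_ln hP b ⟨j, hB⟩)] at this
    · obtain ⟨n, hn, hn'⟩ := exists_perp_dot_ne_zero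
        (c := fun _ : Unit => (P b).mulVec (center (P a))) fun _ => linearIndependent_of_three' (hli hab)
      exact ⟨n, hn, hn' (), fun h => absurd h hB⟩
  obtain ⟨n, hn, hna, hnB⟩ := hn
  obtain ⟨m, hm⟩ := exists_dot_ne_zero fun _ : Unit => (hli hac).ne_zero 0
  refine ⟨p, n, m, (hli hab.symm).ne_zero 0, fun l hB hil => (hpin l hB hil).1,
    fun h0 => hna (by rw [h0, zero_dotProduct]), fun h0 => hm () (by rw [h0, zero_dotProduct]),
    hnB, fun h => absurd h hk, ?_⟩
  rw [hn, zero_mul, zero_sub, neg_ne_zero]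
  exact mul_ne_zero hna (hm ())

/-- The ray of the point from `a` must meet the planes of both pins in the same point. Eliminating
the parameter on the ray from the two equations gives the relation. -/
theorem pins_relation {X : Arrangement ι κ 4} (hX : X ∈ D.spaceVariety) {P : Cameras}
    (hP : P ∈ camVariety) {y : D.Image} (hI : D.IsJointImage X P y)
    {α : ArrCoord D.ObsPt D.ObsLn 3 → ℂ} (hα : y.HasCoords α) {i : ι} {a b c : Fin 3} {j k : κ}
    (hij : (i, j) ∈ D.inc) (hj : j ∈ D.obsLn b) (hik : (i, k) ∈ D.inc) (hk : k ∈ D.obsLn c)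
    (hia : i ∈ D.obsPt a) {N M : Fin 3 → ℂ}
    (hN : crossProduct (lnv α ⟨(b, j), hj⟩ 0) (lnv α ⟨(b, j), hj⟩ 1) = N)
    (hM : crossProduct (lnv α ⟨(c, k), hk⟩ 0) (lnv α ⟨(c, k), hk⟩ 1) = M) :
    (N ⬝ᵥ (P b).mulVec (ray (P a) (ptv α ⟨(a, i), hia⟩))) * (M ⬝ᵥ (P c).mulVec (center (P a))) -
      (N ⬝ᵥ (P b).mulVec (center (P a))) *
        (M ⬝ᵥ (P c).mulVec (ray (P a) (ptv α ⟨(a, i), hia⟩))) = 0 := by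
  obtain ⟨x, -, hx⟩ := (X.pt i).exists_mk
  obtain ⟨s, γ, hs, e1⟩ := exists_eq_smul_ray hP hI hα ⟨(a, i), hia⟩ hx
  have e2 := dot_eq_zero_of_jointImage hI hα ⟨(b, j), hj⟩ (mem_ln_of_onLine (hX i j hij) hx)
  have e3 := dot_eq_zero_of_jointImage hI hα ⟨(c, k), hk⟩ (mem_ln_of_onLine (hX i k hik) hx)
  rw [e1, hN] at e2
  rw [e1, hM] at e3
  simp only [Matrix.mulVec_add, Matrix.mulVec_smul, dotProduct_add, dotProduct_smul, smul_eq_mul]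
    at e2 e3
  refine (mul_eq_zero.1 ?_).resolve_left hs
  linear_combination (M ⬝ᵥ (P c).mulVec (center (P a))) * e2 - (N ⬝ᵥ (P b).mulVec (center (P a))) * e3

theorem exists_config
    (h1 : ∀ i ∉ A, ∀ j ∈ B, ∀ k ∈ B, (i, j) ∈ D.inc → (i, k) ∈ D.inc → j = k)
    {X : Arrangement A B 4} {P : Cameras} (hP : P ∈ camVariety) {x : ArrCoord A B 4 → ℂ}
    (hx : X.HasCoords x) (hG : GenPos P x) {i : ι} (hA : i ∉ A)
    {a b c : Fin 3} (hab : a ≠ b) (hac : a ≠ c) (hbc : b ≠ c) {j k : κ} (hij : (i, j) ∈ D.inc)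
    (hj : j ∈ D.obsLn b) (hik : (i, k) ∈ D.inc) (hk : k ∈ D.obsLn c)
    (hV : ∀ j, (i, j) ∈ D.inc → ∃ v, j ∉ D.obsLn v) :
    ∃ p n m, (P a).mulVec p ≠ 0 ∧
      (∀ l (hB : l ∈ B), (i, l) ∈ D.inc → l ∈ D.obsLn a → p ∈ (X.ln ⟨l, hB⟩).1) ∧
      n ≠ 0 ∧ m ≠ 0 ∧
      (∀ hB : j ∈ B, n = crossProduct ((P b).mulVec (lnv x ⟨j, hB⟩ 0)) ((P b).mulVec (lnv x ⟨j, hB⟩ 1))) ∧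
      (∀ hB : k ∈ B, m = crossProduct ((P c).mulVec (lnv x ⟨k, hB⟩ 0)) ((P c).mulVec (lnv x ⟨k, hB⟩ 1))) ∧
      (n ⬝ᵥ (P b).mulVec p) * (m ⬝ᵥ (P c).mulVec (center (P a))) -
        (n ⬝ᵥ (P b).mulVec (center (P a))) * (m ⬝ᵥ (P c).mulVec p) ≠ 0 := by
  by_cases hkB : k ∈ B
  · by_cases hjB : j ∈ B
    · obtain rfl := h1 i hA j hjB k hkB hij hik
      obtain ⟨v, hv⟩ := hV j hij
      have hva : v = a := by
        have h3 : v ≠ b := fun h => hv (h ▸ hj)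
        have h4 : v ≠ c := fun h => hv (h ▸ hk)
        revert hab hac hbc h3 h4
        clear * -
        revert v a b c
        decide
      rw [hva] at hv
      -- Both pins are kept, so they coincide, and `a` does not see the pin. Therefore the image of
      -- the point in `a` is free; taking that of the centre of `c` makes one term of the relation
      -- vanish and the other not.
      refine ⟨center (P c), _, _, hG.mulVec_center_ne hP hac.symm, fun l hB hil hl => ?_,
        cross_ne_zero (hG.linearIndependent_ln hP b ⟨j, hjB⟩),
        cross_ne_zero (hG.linearIndependent_ln hP c ⟨j, hjB⟩), fun _ => rfl, fun _ => rfl, ?_⟩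
      · obtain rfl := h1 i hA j hjB l hB hij hil
        exact absurd hl hv
      · rw [mulVec_center (rot_mul_transpose hP c), dotProduct_zero, mul_zero, sub_zero]
        exact mul_ne_zero
          (cross_dot_ne_zero (rot_mul_transpose hP b) (hG.ln c b hbc.symm ⟨j, hjB⟩))
          (cross_dot_ne_zero (rot_mul_transpose hP c) (hG.ln a c hac ⟨j, hjB⟩))
    · obtain ⟨p, m, n, h2, h3, h4, h5, h6, h7, h8⟩ :=
        exists_forgotten_config h1 hP hx hG hA hac hab hik hjB
      refine ⟨p, n, m, h2, fun l hB hil _ => h3 l hB hil, h5, h4, h7, h6, fun h0 => h8 ?_⟩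
      linear_combination -h0
  · obtain ⟨p, n, m, h2, h3, h4, h5, h6, h7, h8⟩ :=
      exists_forgotten_config h1 hP hx hG hA hab hac hij hkB
    exact ⟨p, n, m, h2, fun l hB hil _ => h3 l hB hil, h4, h5, h6, h7, h8⟩

variable [Finite ι] [Finite κ]

/-- A line that is seen by all views cannot be forgotten if its point is kept. -/
theorem Problem.ReducibleTo.mem_of_seen (hD : D.OneInc) (h : D.ReducibleTo A B) {j : κ}
    (hA : ∀ i, (i, j) ∈ D.inc → i ∈ A) (hj : ∀ v, j ∈ D.obsLn v) : j ∈ B := by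
  by_contra hB
  obtain ⟨X, hX, P, hP, x, hx, hG, z, hz, key⟩ := exists_of_reducibleTo h
  have hξ : ∃ ξ, quad ξ (center (P 0)) (center (P 1)) (center (P 2)) ≠ 0 ∧
      ∀ i (hij : (i, j) ∈ D.inc), ptv x ⟨i, hA i hij⟩ = ξ := by
    by_cases hex : ∃ i, (i, j) ∈ D.inc
    · obtain ⟨i, hij⟩ := hex
      refine ⟨_, hG.pt ⟨i, hA i hij⟩, fun i' hij' => ?_⟩
      obtain rfl := hD j _ _ hij hij'
      rfl
    · exact ⟨_, hG.cam, fun i hij => absurd ⟨i, hij⟩ hex⟩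
  obtain ⟨ξ, hξ, hξx⟩ := hξ
  -- In view `v` the line passes through the image of the centre of `v + 2`, but not of `v + 1`. The
  -- cyclic choice makes exactly one of the two products in the determinant below nonzero.
  let n : Fin 3 → Fin 3 → ℂ := fun v => crossProduct ((P v).mulVec ξ) ((P v).mulVec (center (P (v + 2))))
  have hne : ∀ v : Fin 3, v + 2 ≠ v + 1 ∧ v + 2 ≠ v ∧ v + 1 ≠ v := by decide
  have hn1 : ∀ v, n v ⬝ᵥ (P v).mulVec (center (P (v + 1))) ≠ 0 := fun v =>
    cross_dot_ne_zero (rot_mul_transpose hP v) (quad_centers hξ (hne v).1 (hne v).2.1 (hne v).2.2)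
  have hn2 : ∀ v, n v ⬝ᵥ (P v).mulVec (center (P (v + 2))) = 0 := fun v => by
    rw [dotProduct_comm, dot_cross_self]
  obtain ⟨y, hy, hyz, a, ha, -, hna, -⟩ := exists_image hD h.1 hX hP hx hG hz (fun _ _ => False)
    (fun _ _ => 0) (fun _ _ h => absurd h not_false) (fun _ k => k = j) (fun v _ => n v)
    (by
      rintro v j rfl -
      refine ⟨fun h0 => hn1 v (by rw [h0, zero_dotProduct]), fun i _ hij => ⟨hA i hij, ?_⟩⟩
      rw [hξx i hij, dotProduct_comm, dot_self_cross])
  let p : (ArrCoord D.ObsPt D.ObsLn 3 → ℂ) → Fin 3 → Fin 3 → ℂ := fun a v w =>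
    crossProduct (lnv a ⟨(v, j), hj v⟩ 0) (lnv a ⟨(v, j), hj v⟩ 1) ⬝ᵥ (P v).mulVec (center (P w))
  have hp : ∀ v w, IsPoly fun a => p a v w := fun v w =>
    IsPoly.dot (u := fun a : ArrCoord D.ObsPt D.ObsLn 3 → ℂ =>
      crossProduct (lnv a ⟨(v, j), hj v⟩ 0) (lnv a ⟨(v, j), hj v⟩ 1)) (w := fun _ => _)
      (IsPoly.cross (isPoly_lnv _ 0) (isPoly_lnv _ 1)) fun _ => .const _
  have hpa : ∀ v w, p a v w = n v ⬝ᵥ (P v).mulVec (center (P w)) := fun v w => by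
    show crossProduct _ _ ⬝ᵥ _ = _
    rw [hna v j (hj v) hB rfl]
  -- This is the determinant of the `3 × 3` matrix `p`, whose diagonal is zero. Its rows are the
  -- traces of the three back-projected planes on the plane of the centres. If the image lifts, the
  -- point where the line meets that plane lies in the kernel.
  obtain ⟨y', -, -, a', ha', hGa, X', hX', hI, -⟩ := key
    (fun a => p a 0 1 * p a 1 2 * p a 2 0 + p a 0 2 * p a 1 0 * p a 2 1)
    ((((hp 0 1).mul (hp 1 2)).mul (hp 2 0)).add (((hp 0 2).mul (hp 1 0)).mul (hp 2 1)))
    y hy hyz a ha (by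
      have e0 : p a 0 2 = 0 := by rw [hpa]; exact hn2 0
      rw [e0, zero_mul, zero_mul, add_zero, hpa, hpa, hpa]
      exact mul_ne_zero (mul_ne_zero (hn1 0) (hn1 1)) (hn1 2))
  obtain ⟨γ₀, γ₁, γ₂, hmem, hγ⟩ := exists_mem_span_centers hG.cam (X'.ln j)
  have hc : ∀ v, p a' v v = 0 := fun v => by
    show crossProduct _ _ ⬝ᵥ _ = _
    rw [mulVec_center (rot_mul_transpose hP v), dotProduct_zero]
  have hM : ∀ v, γ₀ * p a' v 0 + γ₁ * p a' v 1 + γ₂ * p a' v 2 = 0 := by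
    intro v
    have h0 := dot_eq_zero_of_jointImage hI ha' ⟨(v, j), hj v⟩ hmem
    simpa only [Matrix.mulVec_add, Matrix.mulVec_smul, dotProduct_add, dotProduct_smul,
      smul_eq_mul] using h0
  have h0 := hM 0
  have h1 := hM 1
  have h2 := hM 2
  rw [hc, mul_zero, zero_add] at h0
  rw [hc, mul_zero, add_zero] at h1
  rw [hc, mul_zero, add_zero] at h2
  refine hγ ⟨(mul_eq_zero.1 ?_).resolve_left hGa, (mul_eq_zero.1 ?_).resolve_left hGa,
    (mul_eq_zero.1 ?_).resolve_left hGa⟩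
  -- The coefficients are cofactors of the matrix.
  · linear_combination -(p a' 1 2 * p a' 2 1) * h0 + p a' 0 2 * p a' 2 1 * h1 + p a' 0 1 * p a' 1 2 * h2
  · linear_combination p a' 1 2 * p a' 2 0 * h0 - p a' 0 2 * p a' 2 0 * h1 + p a' 0 2 * p a' 1 0 * h2
  · linear_combination p a' 1 0 * p a' 2 1 * h0 + p a' 0 1 * p a' 2 0 * h1 - p a' 0 1 * p a' 1 0 * h2

/-- A point that is seen by one view cannot be forgotten if the other views see its pins. -/
theorem Problem.ReducibleTo.mem_of_pins (hD : D.OneInc) (h : D.ReducibleTo A B) {i : ι}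
    {a b c : Fin 3} (hab : a ≠ b) (hac : a ≠ c) (hbc : b ≠ c) (hi : ∀ v, i ∈ D.obsPt v ↔ v = a)
    {j k : κ} (hij : (i, j) ∈ D.inc) (hj : j ∈ D.obsLn b) (hik : (i, k) ∈ D.inc)
    (hk : k ∈ D.obsLn c) (hV : ∀ j, (i, j) ∈ D.inc → ∃ v, j ∉ D.obsLn v) : i ∈ A := by
  by_contra hA
  obtain ⟨X, hX, P, hP, x, hx, hG, z, hz, key⟩ := exists_of_reducibleTo h
  obtain ⟨p, n, m, hpa, hpin, hn0, hm0, hnB, hmB, hne⟩ :=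
    exists_config h.1 hP hx hG hA hab hac hbc hij hj hik hk hV
  have hia : i ∈ D.obsPt a := (hi a).2 rfl
  obtain ⟨y, hy, hyz, α, hα, hpα, hnα, hBα⟩ := exists_image hD h.1 hX hP hx hG hz
    (fun v i' => v = a ∧ i' = i) (fun _ _ => (P a).mulVec p)
    (by
      rintro v i ⟨rfl, rfl⟩ -
      exact ⟨hpa, fun l hB hil hl => ⟨p, hpin l hB hil hl, rfl⟩⟩)
    (fun v l => v = b ∧ l = j ∨ v = c ∧ l = k) (fun v _ => if v = b then n else m)
    (by
      rintro v l (⟨rfl, rfl⟩ | ⟨rfl, rfl⟩) -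
      · refine ⟨by rwa [if_pos rfl], fun i' hi' hil => ?_⟩
        obtain rfl := hD _ _ _ hij hil
        exact absurd ((hi _).1 hi') hab.symm
      · refine ⟨by rwa [if_neg hbc.symm], fun i' hi' hil => ?_⟩
        obtain rfl := hD _ _ _ hik hil
        exact absurd ((hi _).1 hi') hac.symm)
  have hnα' : crossProduct (lnv α ⟨(b, j), hj⟩ 0) (lnv α ⟨(b, j), hj⟩ 1) = n := by
    by_cases hB : j ∈ B
    · rw [hBα b j hj hB, hBα b j hj hB, hnB hB]
    · rw [hnα b j hj hB (Or.inl ⟨rfl, rfl⟩), if_pos rfl]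
  have hmα' : crossProduct (lnv α ⟨(c, k), hk⟩ 0) (lnv α ⟨(c, k), hk⟩ 1) = m := by
    by_cases hB : k ∈ B
    · rw [hBα c k hk hB, hBα c k hk hB, hmB hB]
    · rw [hnα c k hk hB (Or.inr ⟨rfl, rfl⟩), if_neg hbc.symm]
  let N : (ArrCoord D.ObsPt D.ObsLn 3 → ℂ) → Fin 3 → ℂ := fun α =>
    crossProduct (lnv α ⟨(b, j), hj⟩ 0) (lnv α ⟨(b, j), hj⟩ 1)
  let M : (ArrCoord D.ObsPt D.ObsLn 3 → ℂ) → Fin 3 → ℂ := fun α =>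
    crossProduct (lnv α ⟨(c, k), hk⟩ 0) (lnv α ⟨(c, k), hk⟩ 1)
  let r : (ArrCoord D.ObsPt D.ObsLn 3 → ℂ) → Fin 4 → ℂ := fun α => ray (P a) (ptv α ⟨(a, i), hia⟩)
  have hN : ∀ k, IsPoly fun α => N α k := IsPoly.cross (isPoly_lnv _ 0) (isPoly_lnv _ 1)
  have hM : ∀ k, IsPoly fun α => M α k := IsPoly.cross (isPoly_lnv _ 0) (isPoly_lnv _ 1)
  have hr : ∀ k, IsPoly fun α => r α k := isPoly_ray _ (isPoly_ptv _)
  have hPr : ∀ v k, IsPoly fun α => (P v).mulVec (r α) k := fun v =>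
    IsPoly.mulVec (M := fun _ => P v) (w := r) (fun _ _ => .const _) hr
  -- The expression of `pins_relation`, which vanishes on every image that lifts but not at the
  -- prescribed image.
  let G : (ArrCoord D.ObsPt D.ObsLn 3 → ℂ) → ℂ := fun α =>
    (N α ⬝ᵥ (P b).mulVec (r α)) * (M α ⬝ᵥ (P c).mulVec (center (P a))) -
      (N α ⬝ᵥ (P b).mulVec (center (P a))) * (M α ⬝ᵥ (P c).mulVec (r α))
  have hGpoly : IsPoly G := by
    have h1 := IsPoly.dot (u := N) (w := fun α => (P b).mulVec (r α)) hN (hPr b)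
    have h2 := IsPoly.dot (u := M) (w := fun α => (P c).mulVec (r α)) hM (hPr c)
    have h3 := IsPoly.dot (u := N) (w := fun _ => (P b).mulVec (center (P a))) hN fun _ => .const _
    have h4 := IsPoly.dot (u := M) (w := fun _ => (P c).mulVec (center (P a))) hM fun _ => .const _
    exact (h1.mul h4).sub (h3.mul h2)
  have hGα : G α ≠ 0 := by
    obtain ⟨γ, hγ⟩ := exists_add_smul_center (rot_mul_transpose hP a) (c := 1)
      (x := p) (z := r α) (by
        rw [mulVec_ray (rot_mul_transpose hP _), one_smul, hpα a i hia hA ⟨rfl, rfl⟩])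
    rw [one_smul] at hγ
    refine fun h0 => hne ?_
    replace h0 : (n ⬝ᵥ (P b).mulVec (r α)) * (m ⬝ᵥ (P c).mulVec (center (P a))) -
      (n ⬝ᵥ (P b).mulVec (center (P a))) * (m ⬝ᵥ (P c).mulVec (r α)) = 0 := by
      rw [← hnα', ← hmα']
      exact h0
    rw [hγ] at h0
    simp only [Matrix.mulVec_add, Matrix.mulVec_smul, dotProduct_add, dotProduct_smul,
      smul_eq_mul] at h0
    linear_combination h0
  obtain ⟨y', -, -, α', hα', hGa, X', hX', hI, -⟩ := key G hGpoly y hy hyz α hα hGα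
  exact hGa (pins_relation hX' hP hI hα' hij hj hik hk hia rfl rfl)

theorem Comb.isReduced (hD : D.OneInc) (hC : Comb D) : D.IsReduced := by
  intro A B h
  have hA : ∀ i, i ∈ A := by
    intro i
    rcases hC.pt i with ⟨v, v', hv, hi, hi'⟩ | ⟨a, b, c, hab, hac, hbc, hi, ⟨j, hij, hj⟩,
      ⟨k, hik, hk⟩, hV⟩
    · exact h.mem_of_two_views hD hv hi hi'
    · exact h.mem_of_pins hD hab hac hbc hi hij hj hik hk hV
  refine ⟨Set.eq_univ_of_forall hA, Set.eq_univ_of_forall fun j => ?_⟩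
  by_cases hex : ∃ i, (i, j) ∈ D.inc
  · obtain ⟨i, hij⟩ := hex
    by_cases hs : ∀ v, j ∈ D.obsLn v → i ∈ D.obsPt v
    · exact h.mem_of_seen hD (fun i _ => hA i) (hC.pin i j hij hs)
    · push Not at hs
      obtain ⟨v, hv, hv'⟩ := hs
      exact h.mem_of_pin hD hij (hA i) hv hv'
  · exact h.mem_of_seen hD (fun i _ => hA i) (hC.free j hex)

end Irreducible

end PointLine

/-! ### Reduced problems satisfy the combinatorial conditions -/

namespace PointLine

open MvPolynomial

variable {ι κ : Type}

section Reduced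

variable {D : Problem ι κ} [Finite ι] [Finite κ]

theorem view_cases {a b c : Fin 3} (hab : a ≠ b) (hac : a ≠ c) (hbc : b ≠ c) (v : Fin 3) :
    v = a ∨ v = b ∨ v = c := by
  revert v a b c
  decide

/-- All pins are seen by `c`, which does not see the point and hence sees at most one pin. If there
is a pin that `a` does not see, it is forgotten together with the point; otherwise the point alone
is forgotten. -/
theorem exists_reducibleTo_of_one_view (hD : D.OneInc) {i : ι} {a b c : Fin 3} (hab : a ≠ b)
    (hac : a ≠ c) (hbc : b ≠ c) (hi : ∀ v, i ∈ D.obsPt v ↔ v = a)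
    (hp : ∀ j, (i, j) ∈ D.inc → ∃ v, v ≠ a ∧ j ∈ D.obsLn v)
    (hb : ¬ ∃ j, (i, j) ∈ D.inc ∧ j ∈ D.obsLn b) : ∃ B, D.ReducibleTo {i}ᶜ B := by
  have hc : ∀ j, (i, j) ∈ D.inc → j ∈ D.obsLn c := fun j hij => by
    obtain ⟨v, hv, hj⟩ := hp j hij
    rcases view_cases hab hac hbc v with rfl | rfl | rfl
    · exact absurd rfl hv
    · exact absurd ⟨j, hij, hj⟩ hb
    · exact hj
  have hone : ∀ j k, (i, j) ∈ D.inc → (i, k) ∈ D.inc → j = k := fun j k hij hik => by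
    by_contra hjk
    exact hac.symm ((hi c).1 (D.observed c i j k hjk hij hik (hc j hij) (hc k hik)))
  have h1 : ∀ v v', i ∈ D.obsPt v → i ∈ D.obsPt v' → v = v' := fun v v' h h' =>
    ((hi v).1 h).trans ((hi v').1 h').symm
  by_cases hex : ∃ j, (i, j) ∈ D.inc ∧ j ∉ D.obsLn a
  · obtain ⟨j, hij, hj⟩ := hex
    refine ⟨_, reducibleTo_point_pin hD hac.symm hi hij (fun k hk => hone k j hk hij) fun v =>
      ⟨fun hv => ?_, fun hv => hv ▸ hc j hij⟩⟩
    rcases view_cases hab hac hbc v with rfl | rfl | rfl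
    · exact absurd hv hj
    · exact absurd ⟨j, hij, hv⟩ hb
    · rfl
  · push Not at hex
    refine ⟨_, reducibleTo_point h1 hone fun v j hv hij => ?_⟩
    rw [(hi v).1 hv]
    exact hex j hij

theorem Problem.IsReduced.comb (hD : D.OneInc) (h : D.IsReduced) : Comb D := by
  have hln : ∀ j, (∀ i, (i, j) ∈ D.inc → ∀ v, j ∈ D.obsLn v → i ∈ D.obsPt v) →
      ∀ v, j ∈ D.obsLn v := by
    intro j hj v
    by_contra hv
    have h1 := (h _ _ (reducibleTo_line hD hv hj)).2
    have h2 : j ∈ ({j}ᶜ : Set κ) := h1 ▸ trivial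
    exact h2 rfl
  have hpt : ∀ i B, ¬ D.ReducibleTo {i}ᶜ B := by
    intro i B hr
    have h1 := (h _ _ hr).1
    have h2 : i ∈ ({i}ᶜ : Set ι) := h1 ▸ trivial
    exact h2 rfl
  have hpin : ∀ i j, (i, j) ∈ D.inc → (∀ v, j ∈ D.obsLn v → i ∈ D.obsPt v) →
      ∀ v, j ∈ D.obsLn v := by
    refine fun i j hij hs => hln j fun i' hij' => ?_
    obtain rfl := hD j _ _ hij hij'
    exact hs
  refine ⟨fun j hj => hln j fun i hij => absurd ⟨i, hij⟩ hj, hpin, fun i => ?_⟩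
  by_cases htwo : ∃ v v', v ≠ v' ∧ i ∈ D.obsPt v ∧ i ∈ D.obsPt v'
  · exact Or.inl htwo
  refine Or.inr ?_
  have h1 : ∀ v v', i ∈ D.obsPt v → i ∈ D.obsPt v' → v = v' := fun v v' hv hv' => by
    by_contra hne
    exact htwo ⟨v, v', hne, hv, hv'⟩
  by_cases hU : ∃ a, i ∈ D.obsPt a
  · obtain ⟨a, ha⟩ := hU
    have hi : ∀ v, i ∈ D.obsPt v ↔ v = a := fun v => ⟨fun hv => h1 v a hv ha, fun hv => hv ▸ ha⟩
    obtain ⟨b, hb⟩ := exists_ne_view a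
    obtain ⟨c, hac, hbc⟩ := exists_other a b hb.symm
    have hp : ∀ j, (i, j) ∈ D.inc → ∃ v, v ≠ a ∧ j ∈ D.obsLn v := by
      intro j hij
      by_contra! hcon
      have h2 : ∀ v, j ∈ D.obsLn v → v = a := fun v hv => by
        by_contra hne
        exact hcon v hne hv
      exact hb (h2 b (hpin i j hij (fun v hv => (hi v).2 (h2 v hv)) b))
    have hPb : ∃ j, (i, j) ∈ D.inc ∧ j ∈ D.obsLn b := by
      by_contra hcon
      obtain ⟨B, hB⟩ := exists_reducibleTo_of_one_view hD hb.symm hac hbc hi hp hcon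
      exact hpt i B hB
    have hPc : ∃ j, (i, j) ∈ D.inc ∧ j ∈ D.obsLn c := by
      by_contra hcon
      obtain ⟨B, hB⟩ := exists_reducibleTo_of_one_view hD hac hb.symm hbc.symm hi hp hcon
      exact hpt i B hB
    refine ⟨a, b, c, hb.symm, hac, hbc, hi, hPb, hPc, fun j hij => ?_⟩
    -- A pin seen by all views would be the only one, since any other is also seen by a view that
    -- does not see the point. Then the point alone could be forgotten.
    by_contra! hall
    have hone : ∀ k, (i, k) ∈ D.inc → k = j := fun k hik => by
      obtain ⟨v, hv, hk⟩ := hp k hik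
      by_contra hkj
      exact hv ((hi v).1 (D.observed v i k j hkj hik hij hk (hall v)))
    refine hpt i _ (reducibleTo_point h1 (fun k l hk hl => (hone k hk).trans (hone l hl).symm)
      fun v k _ hk => hone k hk ▸ hall v)
  · push Not at hU
    by_cases hone : ∀ j k, (i, j) ∈ D.inc → (i, k) ∈ D.inc → j = k
    · exact absurd (reducibleTo_point h1 hone fun v j hv => absurd hv (hU v)) (hpt i _)
    -- No view sees two pins of an unseen point. A pin seen by all views would therefore be the only
    -- one, since every pin is seen somewhere.
    · have h2 : ∀ v j k, (i, j) ∈ D.inc → (i, k) ∈ D.inc → j ∈ D.obsLn v → k ∈ D.obsLn v →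
          j = k := fun v j k hij hik hj hk => by
        by_contra hjk
        exact hU v (D.observed v i j k hjk hij hik hj hk)
      refine absurd (reducibleTo_unseen hD hU h2 fun j hij => ?_) (hpt i _)
      by_contra! hall
      refine hone fun k l hk hl => ?_
      have h3 : ∀ k, (i, k) ∈ D.inc → k = j := fun k hik => by
        by_cases hv : ∃ v, k ∈ D.obsLn v
        · obtain ⟨v, hv⟩ := hv
          exact h2 v k j hik hij hv (hall v)
        · push Not at hv
          exact absurd (hpin i k hik (fun v h => absurd h (hv v)) 0) (hv 0)
      exact (h3 k hk).trans (h3 l hl).symm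

theorem isReduced_iff_comb (hD : D.OneInc) : D.IsReduced ↔ Comb D :=
  ⟨fun h => h.comb hD, fun h => h.isReduced hD⟩

end Reduced

end PointLine

namespace PointLine

open MvPolynomial

variable {ι κ : Type}

/-! ### Forgetting redundant observations of pins -/

/-- The pin `j` is seen by two views, of which only `v` sees its point. -/
def Problem.Redundant (D : Problem ι κ) (v : Fin 3) (j : κ) : Prop :=
  ∃ i c, (i, j) ∈ D.inc ∧ i ∈ D.obsPt v ∧ i ∉ D.obsPt c ∧ ∀ w, j ∈ D.obsLn w ↔ w = v ∨ w = c

/-- The problem in which redundant observations of pins are forgotten. -/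
def Problem.core (D : Problem ι κ) : Problem ι κ where
  inc := D.inc
  obsPt := D.obsPt
  obsLn v := {j | j ∈ D.obsLn v ∧ ¬ D.Redundant v j}
  realizable := D.realizable
  complete := D.complete
  observed v i j k hjk h1 h2 h3 h4 := D.observed v i j k hjk h1 h2 h3.1 h4.1

section Core

variable {D : Problem ι κ}

/-- The observation in the view that sees the point is dropped; the one in `c`, which does not see
it, is never redundant. -/
theorem core_of_redundant (hD : D.OneInc) {i : ι} {j : κ} {v c : Fin 3} (hij : (i, j) ∈ D.inc)
    (hv : i ∈ D.obsPt v) (hc : i ∉ D.obsPt c) (h : ∀ w, j ∈ D.obsLn w ↔ w = v ∨ w = c) (w : Fin 3) :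
    j ∈ D.core.obsLn w ↔ w = c := by
  constructor
  · rintro ⟨hw, hr⟩
    rcases (h w).1 hw with rfl | rfl
    · exact absurd ⟨i, c, hij, hv, hc, h⟩ hr
    · rfl
  · rintro rfl
    refine ⟨(h w).2 (Or.inr rfl), ?_⟩
    rintro ⟨i', c', hij', hw, -⟩
    obtain rfl := hD j _ _ hij hij'
    exact hc hw

theorem core_of_single {j : κ} {c : Fin 3} (h : ∀ w, j ∈ D.obsLn w ↔ w = c) (w : Fin 3) :
    j ∈ D.core.obsLn w ↔ w = c := by
  refine ⟨fun hw => (h w).1 hw.1, fun hw => ⟨(h w).2 hw, ?_⟩⟩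
  rintro ⟨i, d, -, hv, hd, hj⟩
  have h1 := (h w).1 ((hj w).2 (Or.inl rfl))
  have h2 := (h d).1 ((hj d).2 (Or.inr rfl))
  rw [h1] at hv
  rw [h2] at hd
  exact hd hv

theorem core_of_not_redundant {j : κ} (h : ∀ v, ¬ D.Redundant v j) (w : Fin 3) :
    j ∈ D.core.obsLn w ↔ j ∈ D.obsLn w := and_iff_left (h w)

theorem not_redundant_core (hD : D.OneInc) (v : Fin 3) (j : κ) : ¬ D.core.Redundant v j := by
  by_cases hr : ∃ v, D.Redundant v j
  · obtain ⟨v', i, c, hij, hv, hc, h⟩ := hr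
    rintro ⟨i', c', hij', hv', hc', h'⟩
    have e := core_of_redundant hD hij hv hc h
    have h1 := (e v).1 ((h' v).2 (Or.inl rfl))
    have h2 := (e c').1 ((h' c').2 (Or.inr rfl))
    rw [h2, ← h1] at hc'
    exact hc' hv'
  · push Not at hr
    rintro ⟨i, c, hij, hv, hc, h⟩
    exact hr v ⟨i, c, hij, hv, hc, fun w => (core_of_not_redundant hr w).symm.trans (h w)⟩

theorem core_eq_self (h : ∀ v j, ¬ D.Redundant v j) : ∀ v j, j ∈ D.core.obsLn v ↔ j ∈ D.obsLn v :=
  fun v j => core_of_not_redundant (fun v => h v j) v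

theorem ext_core (hD : D.OneInc) : Ext D.core D := by
  refine ⟨rfl, rfl, fun v j h => h.1, fun v j hj hn => ?_⟩
  obtain ⟨i, c, hij, hv, hc, h⟩ := not_not.1 fun hr => hn ⟨hj, hr⟩
  exact ⟨i, c, hij, hv, fun e => hc (e ▸ hv), core_of_redundant hD hij hv hc h, h⟩

/-- A pin that loses an observation is still seen by a view that does not see its point, so the
condition on pins is not triggered. For a point seen by one view, the observations of pins by the
other two views are not redundant. -/
theorem Comb.core (hD : D.OneInc) (hC : Comb D) : Comb D.core := by
  refine ⟨fun j hj v => ⟨hC.free j hj v, fun ⟨i, _, hij, _⟩ => hj ⟨i, hij⟩⟩, fun i j hij hs => ?_,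
    fun i => ?_⟩
  · by_cases hr : ∃ v, D.Redundant v j
    · obtain ⟨v, i', c, hij', hv, hc, h⟩ := hr
      obtain rfl := hD j _ _ hij hij'
      exact absurd (hs c ((core_of_redundant hD hij hv hc h c).2 rfl)) hc
    · push Not at hr
      have e := core_of_not_redundant hr
      intro v
      rw [e]
      exact hC.pin i j hij (fun v hv => hs v ((e v).2 hv)) v
  · rcases hC.pt i with h | ⟨a, b, c, hab, hac, hbc, hi, ⟨j, hij, hj⟩, ⟨k, hik, hk⟩, hV⟩
    · exact Or.inl h
    · have key : ∀ v j, v ≠ a → (i, j) ∈ D.inc → ¬ D.Redundant v j := by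
        rintro v j hv hij ⟨i', c', hij', hv', -⟩
        obtain rfl := hD j _ _ hij hij'
        exact hv ((hi v).1 hv')
      exact Or.inr ⟨a, b, c, hab, hac, hbc, hi, ⟨j, hij, hj, key b j hab.symm hij⟩,
        ⟨k, hik, hk, key c k hac.symm hik⟩, fun j hij => (hV j hij).imp fun v hv h => hv h.1⟩

theorem exists_ne_ne (a b : Fin 3) : ∃ c, c ≠ a ∧ c ≠ b := by
  revert a b
  decide

theorem Comb.of_ext {T : Problem ι κ} (h : Ext T D) (hC : Comb T) : Comb D := by
  refine ⟨fun j hj v => h.le v j (hC.free j (by rwa [← h.inc]) v), fun i j hij hs v =>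
    h.le v j (hC.pin i j (h.inc ▸ hij) (fun v hv => h.obsPt ▸ hs v (h.le v j hv)) v), fun i => ?_⟩
  rw [h.inc, h.obsPt]
  rcases hC.pt i with h' | ⟨a, b, c, hab, hac, hbc, hi, ⟨j, hij, hj⟩, ⟨k, hik, hk⟩, hV⟩
  · exact Or.inl h'
  · refine Or.inr ⟨a, b, c, hab, hac, hbc, hi, ⟨j, hij, h.le b j hj⟩, ⟨k, hik, h.le c k hk⟩,
      fun j hij => ?_⟩
    by_contra! hall
    obtain ⟨v, hv⟩ := hV j hij
    obtain ⟨_, c', -, -, -, -, h1⟩ := h.new v j (hall v) hv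
    obtain ⟨d, hd, hd'⟩ := exists_ne_ne v c'
    rcases (h1 d).1 (hall d) with e | e
    · exact hd e
    · exact hd' e

theorem Ext.refl (D : Problem ι κ) : Ext D D :=
  ⟨rfl, rfl, fun _ _ => id, fun _ _ h h' => absurd h h'⟩

/-- A pin that is extended has one view before and two afterwards, so no pin is extended twice. -/
theorem Ext.trans {T E : Problem ι κ} (h : Ext T D) (h' : Ext D E) : Ext T E := by
  refine ⟨h'.inc.trans h.inc, h'.obsPt.trans h.obsPt, fun v j hj => h'.le v j (h.le v j hj),
    fun v j hE hT => ?_⟩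
  by_cases hD : j ∈ D.obsLn v
  · obtain ⟨i, c, hij, hi, hvc, h1, h2⟩ := h.new v j hD hT
    refine ⟨i, c, h'.inc ▸ hij, h'.obsPt ▸ hi, hvc, h1, fun w => ⟨fun hw => ?_, fun hw => ?_⟩⟩
    · by_cases hwD : j ∈ D.obsLn w
      · exact (h2 w).1 hwD
      · obtain ⟨_, d, -, -, -, h3, -⟩ := h'.new w j hw hwD
        exact absurd (((h3 v).1 hD).trans ((h3 c).1 ((h2 c).2 (Or.inr rfl))).symm) hvc
    · exact h'.le w j ((h2 w).2 hw)
  · obtain ⟨i, c, hij, hi, hvc, h1, h2⟩ := h'.new v j hE hD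
    refine ⟨i, c, hij, hi, hvc, fun w => ⟨fun hw => (h1 w).1 (h.le w j hw), ?_⟩, h2⟩
    rintro rfl
    by_contra hw
    obtain ⟨_, d, -, -, hwd, -, h3⟩ := h.new w j ((h1 w).2 rfl) hw
    exact hwd ((h1 d).1 ((h3 d).2 (Or.inr rfl))).symm

/-! ### The pins of a point -/

/-- Every pin must be seen by `c`: otherwise it would be seen only by views that see the point,
hence by all. Two pins in `c` would force `c` to see the point. -/
theorem Comb.pin_eq_of_two_views (hC : Comb D) {i : ι} {c : Fin 3} (hc : i ∉ D.obsPt c) {j : κ}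
    (hU : ∀ w, w ≠ c → i ∈ D.obsPt w) (hij : (i, j) ∈ D.inc) {k : κ} (hik : (i, k) ∈ D.inc) :
    k = j := by
  have key : ∀ j, (i, j) ∈ D.inc → j ∈ D.obsLn c := fun j hij => by
    by_contra hj
    exact hj (hC.pin i j hij (fun v hv => hU v fun h => hj (h ▸ hv)) c)
  by_contra hjk
  exact hc (D.observed c i k j hjk hik hij (key k hik) (key j hij))

/-- By `Comb` each of the two views that do not see the point sees a pin, and each sees at most one.
A pin seen by neither would be seen at most by `a`, hence by all views. -/
theorem Comb.exists_other_pin (hC : Comb D) {i : ι} {a b c : Fin 3} (hab : a ≠ b) (hac : a ≠ c)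
    (hbc : b ≠ c) (hi : ∀ v, i ∈ D.obsPt v ↔ v = a) {j : κ} (hij : (i, j) ∈ D.inc)
    (hb : j ∈ D.obsLn b) (hc : j ∉ D.obsLn c) :
    ∃ k, j ≠ k ∧ (∀ m, (i, m) ∈ D.inc ↔ m = j ∨ m = k) ∧ k ∈ D.obsLn c ∧ k ∉ D.obsLn b := by
  have hk : ∃ k, (i, k) ∈ D.inc ∧ k ∈ D.obsLn c := by
    rcases hC.pt i with ⟨v, v', hv, h1, h2⟩ | ⟨a', b', c', hab', hac', hbc', hi', h1, h2, -⟩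
    · exact absurd (((hi v).1 h1).trans ((hi v').1 h2).symm) hv
    · obtain rfl : a' = a := (hi a').1 ((hi' a').2 rfl)
      rcases view_cases hab' hac' hbc' c with rfl | rfl | rfl
      · exact absurd rfl hac
      · exact h1
      · exact h2
  obtain ⟨k, hik, hkc⟩ := hk
  have hjk : j ≠ k := fun h => hc (h ▸ hkc)
  have h1 : ∀ v, v ≠ a → ∀ m n, (i, m) ∈ D.inc → (i, n) ∈ D.inc → m ∈ D.obsLn v →
      n ∈ D.obsLn v → m = n := fun v hv m n hm hn hmv hnv => by
    by_contra hmn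
    exact hv ((hi v).1 (D.observed v i m n hmn hm hn hmv hnv))
  refine ⟨k, hjk, fun m => ⟨fun hm => ?_, ?_⟩, hkc, fun hkb => hjk (h1 b hab.symm j k hij hik hb hkb)⟩
  · by_cases hmb : m ∈ D.obsLn b
    · exact Or.inl (h1 b hab.symm m j hm hij hmb hb)
    by_cases hmc : m ∈ D.obsLn c
    · exact Or.inr (h1 c hac.symm m k hm hik hmc hkc)
    · refine absurd (hC.pin i m hm (fun v hv => (hi v).2 ?_) b) hmb
      rcases view_cases hab hac hbc v with rfl | rfl | rfl
      · rfl
      · exact absurd hv hmb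
      · exact absurd hv hmc
  · rintro (rfl | rfl)
    · exact hij
    · exact hik

end Core

end PointLine

/-! ### Lifting pins that are seen by one view only -/

namespace PointLine

open MvPolynomial

variable {ι κ : Type}

/-- The line `j` is seen by exactly one view. -/
def Problem.Single (D : Problem ι κ) (j : κ) : Prop := ∃ c, ∀ w, j ∈ D.obsLn w ↔ w = c

/-- The view `a`, which sees the point `i`, is made to see those pins of `i` that are seen by one
view only. -/
def Problem.lift (D : Problem ι κ) (hD : D.OneInc) {i : ι} {a : Fin 3} (ha : i ∈ D.obsPt a) :
    Problem ι κ where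
  inc := D.inc
  obsPt := D.obsPt
  obsLn v := {k | k ∈ D.obsLn v ∨ v = a ∧ (i, k) ∈ D.inc ∧ D.Single k}
  realizable := D.realizable
  complete := D.complete
  observed v i' j k hjk h1 h2 h3 h4 := by
    rcases h3 with h3 | ⟨rfl, h3, -⟩
    · rcases h4 with h4 | ⟨rfl, h4, -⟩
      · exact D.observed v i' j k hjk h1 h2 h3 h4
      · rwa [hD k _ _ h2 h4]
    · rwa [hD j _ _ h1 h3]

/-- The views that see a line are changed; this line is the only pin of its point. -/
def Problem.setViews (D : Problem ι κ) (j : κ) (V : Fin 3 → Prop)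
    (h : ∀ i k, (i, j) ∈ D.inc → (i, k) ∈ D.inc → k = j) : Problem ι κ where
  inc := D.inc
  obsPt := D.obsPt
  obsLn v := {k | k = j ∧ V v ∨ k ≠ j ∧ k ∈ D.obsLn v}
  realizable := D.realizable
  complete := D.complete
  observed v i k l hkl h1 h2 h3 h4 := by
    by_cases hk : k = j
    · subst hk
      exact absurd (h i l h1 h2).symm hkl
    by_cases hl : l = j
    · subst hl
      exact absurd (h i k h2 h1) hkl
    exact D.observed v i k l hkl h1 h2 (h3.resolve_left fun h => hk h.1).2
      (h4.resolve_left fun h => hl h.1).2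

section Lift

variable {D : Problem ι κ}

theorem lift_of_not (hD : D.OneInc) {i : ι} {a : Fin 3} (ha : i ∈ D.obsPt a) {k : κ}
    (h : ¬ ((i, k) ∈ D.inc ∧ D.Single k)) (w : Fin 3) :
    k ∈ (D.lift hD ha).obsLn w ↔ k ∈ D.obsLn w :=
  ⟨fun h' => h'.resolve_right fun h' => h h'.2, Or.inl⟩

theorem lift_of_single (hD : D.OneInc) {i : ι} {a : Fin 3} (ha : i ∈ D.obsPt a) {k : κ}
    (hk : (i, k) ∈ D.inc) {c : Fin 3} (h : ∀ w, k ∈ D.obsLn w ↔ w = c) (w : Fin 3) :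
    k ∈ (D.lift hD ha).obsLn w ↔ w = a ∨ w = c := by
  refine ⟨fun h' => h'.elim (fun h' => Or.inr ((h w).1 h')) fun h' => Or.inl h'.1, ?_⟩
  rintro (rfl | rfl)
  · exact Or.inr ⟨rfl, hk, c, h⟩
  · exact Or.inl ((h w).2 rfl)

/-- If the only view of the pin saw the point, the pin would be seen by all views. -/
theorem Comb.not_mem_of_single (hC : Comb D) {i : ι} {j : κ} (hij : (i, j) ∈ D.inc) {c : Fin 3}
    (h : ∀ w, j ∈ D.obsLn w ↔ w = c) : i ∉ D.obsPt c := fun hi => by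
  obtain ⟨v, hv⟩ := exists_ne_view c
  exact hv ((h v).1 (hC.pin i j hij (fun w hw => (h w).1 hw ▸ hi) v))

theorem Comb.ext_lift (hC : Comb D) (hD : D.OneInc) {i : ι} {a : Fin 3} (ha : i ∈ D.obsPt a) :
    Ext D (D.lift hD ha) := by
  refine ⟨rfl, rfl, fun v j => Or.inl, fun v j hj hn => ?_⟩
  obtain ⟨rfl, hij, c, hc⟩ := hj.resolve_left hn
  exact ⟨i, c, hij, ha, fun h => hC.not_mem_of_single hij hc (h ▸ ha), hc,
    lift_of_single hD ha hij hc⟩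

theorem Comb.single_of_lift (hC : Comb D) (hD : D.OneInc) {i : ι} {a : Fin 3} (ha : i ∈ D.obsPt a)
    {k : κ} (h : (D.lift hD ha).Single k) : D.Single k ∧ (i, k) ∉ D.inc := by
  obtain ⟨d, hd⟩ := h
  by_cases hk : (i, k) ∈ D.inc ∧ D.Single k
  · obtain ⟨hik, c, hc⟩ := hk
    have e := lift_of_single hD ha hik hc
    have h1 := (hd a).1 ((e a).2 (Or.inl rfl))
    have h2 := (hd c).1 ((e c).2 (Or.inr rfl))
    exact absurd (h1.trans h2.symm ▸ ha) (hC.not_mem_of_single hik hc)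
  · have hs : D.Single k := ⟨d, fun w => (lift_of_not hD ha hk w).symm.trans (hd w)⟩
    exact ⟨hs, fun h => hk ⟨h, hs⟩⟩

end Lift

namespace PL1P

/-- The matching of two problems on the same points and lines. -/
def idMatching {D : PL1P} {E : Problem (Fin D.p) (Fin D.l)} (hE : E.OneInc)
    (h1 : E.inc = D.prob.inc) (h2 : E.obsPt = D.prob.obsPt) : Matching D ⟨D.p, D.l, E, hE⟩ 1 where
  pt := Equiv.refl _
  ln := Equiv.refl _
  inc_iff i j := by simp [h1]
  obsPt_iff v i := by simp [h2]

/-- If two views see the point, the pin is its only one and the point is of type (A). Otherwise a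
second pin accounts for the remaining view, and the point is of type (C$_0$) or (C$_1$). -/
theorem liftOne_or_liftTwo (D : PL1P) (hC : Comb D.prob) {i : Fin D.p} {j : Fin D.l}
    (hij : (i, j) ∈ D.prob.inc) (hj : D.prob.Single j) :
    ∃ (a : Fin 3) (ha : i ∈ D.prob.obsPt a),
      LiftOne D ⟨D.p, D.l, D.prob.lift D.one ha, D.one⟩ ∨
        LiftTwo D ⟨D.p, D.l, D.prob.lift D.one ha, D.one⟩ := by
  obtain ⟨x, hx⟩ := hj
  have hxi := hC.not_mem_of_single hij hx
  have hU : ∃ a, i ∈ D.prob.obsPt a := by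
    rcases hC.pt i with ⟨v, _, _, h, _⟩ | ⟨a, _, _, _, _, _, h, _⟩
    · exact ⟨v, h⟩
    · exact ⟨a, (h a).2 rfl⟩
  obtain ⟨a, ha⟩ := hU
  have hax : a ≠ x := fun h => hxi (h ▸ ha)
  obtain ⟨b, hab, hxb⟩ := exists_other a x hax
  refine ⟨a, ha, ?_⟩
  have hjE := lift_of_single D.one ha hij hx
  by_cases hb : i ∈ D.prob.obsPt b
  · have hU : ∀ w, i ∈ D.prob.obsPt w ↔ w = a ∨ w = b := by
      intro w
      rcases view_cases hax hab hxb w with rfl | rfl | rfl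
      · simp [ha]
      · simp [hxi, hax.symm, hxb]
      · simp [hb]
    have hpin : D.pins i = {j} := Set.ext fun k => ⟨fun hk => hC.pin_eq_of_two_views hxi (fun w hw => by
      rcases view_cases hax hab hxb w with rfl | rfl | rfl
      exacts [ha, absurd rfl hw, hb]) hij hk, fun hk => by rw [Set.mem_singleton_iff.1 hk]; exact hij⟩
    refine Or.inl ⟨idMatching (E := D.prob.lift D.one ha) D.one rfl rfl, i, j, a, b, x, ⟨hab, hax, hxb.symm⟩,
      ⟨hpin, Set.ext hU, Set.ext hx⟩, ⟨hpin, Set.ext hU, Set.ext hjE⟩, fun k hk => Set.ext fun w => ?_⟩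
    exact lift_of_not D.one ha (fun h => hk (Set.ext_iff.1 hpin k |>.1 h.1)) w
  · have hU : ∀ w, i ∈ D.prob.obsPt w ↔ w = a := by
      intro w
      rcases view_cases hax hab hxb w with rfl | rfl | rfl
      · simp [ha]
      · simp [hxi, hax.symm]
      · simp [hb, hab.symm]
    obtain ⟨k, hjk, hpins, hkb, hkx⟩ := hC.exists_other_pin hax hab hxb hU hij ((hx x).2 rfl)
      fun h => hxb ((hx b).1 h).symm
    -- The pin `k` comes first, because in type (C$_1$) the first pin is the one already seen by
    -- `a`.
    have hpin : D.pins i = {k, j} := Set.ext fun m => (hpins m).trans or_comm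
    have hik : (i, k) ∈ D.prob.inc := (hpins k).2 (Or.inr rfl)
    have hkE : D.TwoPins i k j {a} {b} {x} ∨ D.TwoPins i k j {a} {a, b} {x} := by
      by_cases hka : k ∈ D.prob.obsLn a
      · refine Or.inr ⟨hjk.symm, hpin, Set.ext hU, Set.ext fun w => ?_, Set.ext hx⟩
        show k ∈ D.prob.obsLn w ↔ w = a ∨ w = b
        rcases view_cases hax hab hxb w with rfl | rfl | rfl
        · simp [hka]
        · simp [hkx, hax.symm, hxb]
        · simp [hkb]
      · refine Or.inl ⟨hjk.symm, hpin, Set.ext hU, Set.ext fun w => ?_, Set.ext hx⟩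
        show k ∈ D.prob.obsLn w ↔ w = b
        rcases view_cases hax hab hxb w with rfl | rfl | rfl
        · simp [hka, hab]
        · simp [hkx, hxb]
        · simp [hkb]
    refine Or.inr ⟨idMatching (E := D.prob.lift D.one ha) D.one rfl rfl, i, k, j, a, b, x, ⟨hab, hax, hxb.symm⟩, hkE,
      ⟨hjk.symm, hpin, Set.ext hU, ?_, Set.ext hjE⟩, fun n hn hn' => Set.ext fun w => ?_⟩
    · rcases hkE with h | h
      · exact Set.ext (lift_of_single D.one ha hik (Set.ext_iff.1 h.2.2.2.1))
      · refine Set.ext fun w => (lift_of_not D.one ha (fun hs => ?_) w).trans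
          (Set.ext_iff.1 h.2.2.2.1 w)
        obtain ⟨-, c, hc⟩ := hs
        have e := Set.ext_iff.1 h.2.2.2.1
        exact hab (((hc a).1 ((e a).2 (Or.inl rfl))).trans ((hc b).1 ((e b).2 (Or.inr rfl))).symm)
    · refine lift_of_not D.one ha (fun h => ?_) w
      rcases (hpins n).1 h.1 with h | h
      exacts [hn' h, hn h]

/-- Induction on the number of lines seen by exactly one view; each lift lowers it. Such a line is a
pin, since free lines are seen by all views. -/
theorem exists_liftsTo (D : PL1P) (hC : Comb D.prob) :
    ∃ E : PL1P, D.LiftsTo E ∧ Comb E.prob ∧ (∀ j, ¬ E.prob.Single j) ∧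
      ∃ (E' : Problem (Fin D.p) (Fin D.l)) (hE' : E'.OneInc), E = ⟨D.p, D.l, E', hE'⟩ ∧ Ext D.prob E' := by
  obtain ⟨n, hn⟩ : ∃ n, {j | D.prob.Single j}.ncard = n := ⟨_, rfl⟩
  induction n using Nat.strong_induction_on generalizing D with
  | _ n ih =>
  by_cases hs : ∃ j, D.prob.Single j
  · obtain ⟨j, hj⟩ := hs
    have hp : ∃ i, (i, j) ∈ D.prob.inc := by
      by_contra hf
      obtain ⟨c, hc⟩ := hj
      obtain ⟨v, hv⟩ := exists_ne_view c
      exact hv ((hc v).1 (hC.free j hf v))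
    obtain ⟨i, hij⟩ := hp
    obtain ⟨a, ha, hlift⟩ := D.liftOne_or_liftTwo hC hij hj
    have hext := hC.ext_lift D.one ha
    have hlt : {k | (D.prob.lift D.one ha).Single k}.ncard < n := by
      rw [← hn]
      refine Set.ncard_lt_ncard ⟨fun k hk => (hC.single_of_lift D.one ha hk).1, fun hsub => ?_⟩
      exact (hC.single_of_lift D.one ha (hsub hj)).2 hij
    obtain ⟨E, h1, h2, h3, E', hE', h4, h5⟩ := ih _ hlt ⟨D.p, D.l, D.prob.lift D.one ha, D.one⟩
      (hC.of_ext hext) rfl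
    exact ⟨E, .head hlift h1, h2, h3, E', hE', h4, hext.trans h5⟩
  · exact ⟨D, .refl, hC, fun j hj => hs ⟨j, hj⟩, D.prob, D.one, rfl, .refl _⟩

end PL1P

end PointLine

namespace PointLine

namespace PL1P

/-! ### The core of a problem -/

/-- The problem in which redundant observations of pins are forgotten. -/
def core (D : PL1P) : PL1P := ⟨D.p, D.l, D.prob.core, D.one⟩

theorem Matching.redundant_iff {D E : PL1P} {τ : Equiv.Perm (Fin 3)} (M : Matching D E τ)
    {j : Fin D.l} (h : ∀ v, j ∈ D.prob.obsLn v ↔ M.ln j ∈ E.prob.obsLn (τ v)) (v : Fin 3) :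
    D.prob.Redundant v j ↔ E.prob.Redundant (τ v) (M.ln j) := by
  constructor
  · rintro ⟨i, c, h1, h2, h3, h4⟩
    refine ⟨M.pt i, τ c, (M.inc_iff i j).1 h1, (M.obsPt_iff v i).1 h2,
      fun h => h3 ((M.obsPt_iff c i).2 h), fun w => ?_⟩
    obtain ⟨u, rfl⟩ := τ.surjective w
    rw [← h, h4, τ.injective.eq_iff, τ.injective.eq_iff]
  · rintro ⟨i', c', h1, h2, h3, h4⟩
    obtain ⟨i, rfl⟩ := M.pt.surjective i'
    obtain ⟨c, rfl⟩ := τ.surjective c'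
    refine ⟨i, c, (M.inc_iff i j).2 h1, (M.obsPt_iff v i).2 h2,
      fun h => h3 ((M.obsPt_iff c i).1 h), fun w => ?_⟩
    rw [h, h4, τ.injective.eq_iff, τ.injective.eq_iff]

/-- Forgetting works line by line: a line with corresponding views loses corresponding observations,
and for the remaining lines it suffices that one and the same view is left. -/
theorem Matching.labelEquiv_core {D E : PL1P} {τ : Equiv.Perm (Fin 3)} (M : Matching D E τ)
    (h : ∀ j, (∀ v, j ∈ D.prob.obsLn v ↔ M.ln j ∈ E.prob.obsLn (τ v)) ∨
      ∃ c, (∀ w, j ∈ D.prob.core.obsLn w ↔ w = c) ∧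
        ∀ w, M.ln j ∈ E.prob.core.obsLn w ↔ w = τ c) : LabelEquiv D.core E.core := by
  refine ⟨τ, ⟨M.pt, M.ln, M.inc_iff, M.obsPt_iff⟩, fun v j => ?_⟩
  rcases h j with h | ⟨c, h1, h2⟩
  · exact and_congr (h v) (not_congr (M.redundant_iff h v))
  · exact (h1 v).trans ((h2 (τ v)).trans τ.injective.eq_iff).symm

theorem LabelEquiv.core {D E : PL1P} (h : LabelEquiv D E) : LabelEquiv D.core E.core := by
  obtain ⟨τ, M, hM⟩ := h
  exact M.labelEquiv_core fun j => Or.inl fun v => hM v j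

theorem core_iff_of_pair (D : PL1P) {i : Fin D.p} {j : Fin D.l} {a c : Fin 3} {U : Set (Fin 3)}
    (hij : j ∈ D.pins i) (hU : D.ptViews i = U) (ha : a ∈ U) (hc : c ∉ U)
    (h : D.lnViews j = {a, c}) (w : Fin 3) : j ∈ D.prob.core.obsLn w ↔ w = c :=
  core_of_redundant D.one hij ((Set.ext_iff.1 hU a).2 ha) (fun h => hc ((Set.ext_iff.1 hU c).1 h))
    (Set.ext_iff.1 h) w

theorem core_iff_of_singleton (D : PL1P) {j : Fin D.l} {c : Fin 3} (h : D.lnViews j = {c})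
    (w : Fin 3) : j ∈ D.prob.core.obsLn w ↔ w = c := core_of_single (Set.ext_iff.1 h) w

theorem Swap.labelEquiv_core {D E : PL1P} (h : Swap D E) : LabelEquiv D.core E.core := by
  obtain ⟨M, i, j, a, b, c, ⟨hab, hac, hbc⟩, ⟨h1, h2, h3⟩, ⟨h4, h5, h6⟩, h7⟩ := h
  have hc : c ∉ ({a, b} : Set (Fin 3)) := by simp [hac.symm, hbc.symm]
  refine M.labelEquiv_core fun k => ?_
  by_cases hk : k = j
  · subst hk
    exact Or.inr ⟨c, D.core_iff_of_pair (by rw [h1]; rfl) h2 (Or.inl rfl) hc h3,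
      E.core_iff_of_pair (by rw [h4]; rfl) h5 (Or.inr rfl) hc h6⟩
  · exact Or.inl fun v => (Set.ext_iff.1 (h7 k hk) v).symm

theorem LiftOne.labelEquiv_core {D E : PL1P} (h : LiftOne D E) : LabelEquiv D.core E.core := by
  obtain ⟨M, i, j, a, b, c, ⟨hab, hac, hbc⟩, ⟨h1, h2, h3⟩, ⟨h4, h5, h6⟩, h7⟩ := h
  have hc : c ∉ ({a, b} : Set (Fin 3)) := by simp [hac.symm, hbc.symm]
  refine M.labelEquiv_core fun k => ?_
  by_cases hk : k = j
  · subst hk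
    exact Or.inr ⟨c, D.core_iff_of_singleton h3,
      E.core_iff_of_pair (by rw [h4]; rfl) h5 (Or.inl rfl) hc h6⟩
  · exact Or.inl fun v => (Set.ext_iff.1 (h7 k hk) v).symm

theorem LiftTwo.labelEquiv_core {D E : PL1P} (h : LiftTwo D E) : LabelEquiv D.core E.core := by
  obtain ⟨M, i, j, k, a, b, c, ⟨hab, hac, hbc⟩, hD, ⟨-, h4, h5, h6, h6'⟩, h7⟩ := h
  have hb : b ∉ ({a} : Set (Fin 3)) := hab.symm
  have hc : c ∉ ({a} : Set (Fin 3)) := hac.symm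
  have hDj : ∀ w, j ∈ D.prob.core.obsLn w ↔ w = b := by
    rcases hD with ⟨-, h1, h2, h3, -⟩ | ⟨-, h1, h2, h3, -⟩
    · exact D.core_iff_of_singleton h3
    · exact D.core_iff_of_pair (by rw [h1]; exact Or.inl rfl) h2 (by rfl) hb h3
  have hDk : ∀ w, k ∈ D.prob.core.obsLn w ↔ w = c := by
    rcases hD with ⟨-, -, -, -, h3⟩ | ⟨-, -, -, -, h3⟩ <;> exact D.core_iff_of_singleton h3
  refine M.labelEquiv_core fun n => ?_
  by_cases hn : n = j
  · subst hn
    exact Or.inr ⟨b, hDj, E.core_iff_of_pair (by rw [h4]; exact Or.inl rfl) h5 (by rfl) hb h6⟩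
  by_cases hn' : n = k
  · subst hn'
    exact Or.inr ⟨c, hDk, E.core_iff_of_pair (by rw [h4]; exact Or.inr rfl) h5 (by rfl) hc h6'⟩
  · exact Or.inl fun v => (Set.ext_iff.1 (h7 n hn hn') v).symm

theorem LiftsTo.labelEquiv_core {D E : PL1P} (h : LiftsTo D E) : LabelEquiv D.core E.core := by
  induction h with
  | refl => exact .refl _
  | tail _ h ih => exact ih.trans (h.elim LiftOne.labelEquiv_core LiftTwo.labelEquiv_core)

theorem labelEquiv_core_of_swapLabel {D E : PL1P} (h : swapLabelSetoid D E) :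
    LabelEquiv D.core E.core := by
  replace h : Relation.EqvGen (fun D E => LabelEquiv D E ∨ Swap D E) D E := h
  induction h with
  | rel _ _ h => exact h.elim LabelEquiv.core Swap.labelEquiv_core
  | refl => exact .refl _
  | symm _ _ _ ih => exact ih.symm
  | trans _ _ _ _ _ ih ih' => exact ih.trans ih'

/-! ### Problems with label-equivalent cores -/

/-- The lines whose views do not correspond under a matching. -/
def Matching.discrepancy {D E : PL1P} {τ : Equiv.Perm (Fin 3)} (M : Matching D E τ) :
    Set (Fin D.l) := {j | ¬ ∀ v, j ∈ D.prob.obsLn v ↔ M.ln j ∈ E.prob.obsLn (τ v)}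

/-- Induction on the number of lines whose views disagree; a swap repairs one of them and leaves the
others alone. The swapped line is the only pin of its point, so its views may be changed without
violating the rule on observed intersections. -/
theorem Matching.swapLabel {D E : PL1P} {τ : Equiv.Perm (Fin 3)} (M : Matching D E τ)
    (h : ∀ j, j ∈ M.discrepancy → ∃ i a b c, ViewOrder a b c ∧ D.OnePin i j {a, b} {a, c} ∧
      ∀ v, M.ln j ∈ E.prob.obsLn (τ v) ↔ v = b ∨ v = c) : swapLabelSetoid D E := by
  obtain ⟨n, hn⟩ : ∃ n, M.discrepancy.ncard = n := ⟨_, rfl⟩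
  induction n using Nat.strong_induction_on generalizing D with
  | _ n ih =>
  by_cases hd : ∃ j, j ∈ M.discrepancy
  · obtain ⟨j, hj⟩ := hd
    obtain ⟨i, a, b, c, hv, ⟨hp, hU, hV⟩, hE⟩ := h j hj
    have hone : ∀ i' k, (i', j) ∈ D.prob.inc → (i', k) ∈ D.prob.inc → k = j := by
      intro i' k h1 h2
      obtain rfl := D.one j i' i h1 ((Set.ext_iff.1 hp j).2 rfl)
      exact (Set.ext_iff.1 hp k).1 h2
    let F : PL1P := ⟨D.p, D.l, D.prob.setViews j (fun v => v = b ∨ v = c) hone, D.one⟩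
    let M' : Matching F E τ := ⟨M.pt, M.ln, M.inc_iff, M.obsPt_iff⟩
    have hj' : ∀ v, j ∈ F.prob.obsLn v ↔ v = b ∨ v = c := fun v =>
      ⟨fun h => (h.resolve_right fun h => h.1 rfl).2, fun h => Or.inl ⟨rfl, h⟩⟩
    have hk : ∀ k, k ≠ j → ∀ v, k ∈ F.prob.obsLn v ↔ k ∈ D.prob.obsLn v := fun k hk v =>
      ⟨fun h => (h.resolve_left fun h => hk h.1).2, fun h => Or.inr ⟨hk, h⟩⟩
    have hjM : j ∉ M'.discrepancy := fun h => h fun v => (hj' v).trans (hE v).symm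
    have hsub : ∀ k, k ∈ M'.discrepancy → k ≠ j ∧ k ∈ M.discrepancy := fun k hkM => by
      have hkj : k ≠ j := fun h => hjM (h ▸ hkM)
      exact ⟨hkj, fun h => hkM fun v => (hk k hkj v).trans (h v)⟩
    have hlt : M'.discrepancy.ncard < n := by
      rw [← hn]
      exact Set.ncard_lt_ncard ⟨fun k hkM => (hsub k hkM).2, fun hs => hjM (hs hj)⟩
    have hswap : Swap D F := ⟨idMatching (E := D.prob.setViews j _ hone) D.one rfl rfl, i, j, a, b, c,
      hv, ⟨hp, hU, hV⟩, ⟨hp, hU, Set.ext hj'⟩, fun k hkj => Set.ext (hk k hkj)⟩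
    refine .trans _ _ _ (.rel _ _ (Or.inr hswap)) (ih _ hlt M' (fun k hkM => ?_) rfl)
    obtain ⟨hkj, hkM⟩ := hsub k hkM
    obtain ⟨i', a', b', c', hv', ⟨hp', hU', hV'⟩, hE'⟩ := h k hkM
    exact ⟨i', a', b', c', hv', ⟨hp', hU', (Set.ext (hk k hkj)).trans hV'⟩, hE'⟩
  · push Not at hd
    exact .rel _ _ (Or.inl ⟨τ, M, fun v j => not_not.1 (hd j) v⟩)

/-- A line redundant in just one of the problems would be seen by exactly one view in the other, and
a line redundant in neither has corresponding views. If it is redundant in both, the view `c` left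
in the core corresponds, so a disagreement concerns the view that sees the point. Then two views see
the point and the difference is a swap. -/
theorem swapLabel_of_labelEquiv_core {D E : PL1P} (hC : Comb D.prob)
    (hD : ∀ j, ¬ D.prob.Single j) (hE : ∀ j, ¬ E.prob.Single j) (h : LabelEquiv D.core E.core) :
    swapLabelSetoid D E := by
  obtain ⟨τ, M, hM⟩ := h
  let M' : Matching D E τ := ⟨M.pt, M.ln, M.inc_iff, M.obsPt_iff⟩
  have hM' : ∀ v j, j ∈ D.prob.core.obsLn v ↔ M'.ln j ∈ E.prob.core.obsLn (τ v) := hM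
  refine M'.swapLabel fun j hj => ?_
  by_cases hr : ∃ v, D.prob.Redundant v j
  · obtain ⟨v, i, c, hij, hv, hc, hV⟩ := hr
    have e := core_of_redundant D.one hij hv hc hV
    by_cases hr' : ∃ v, E.prob.Redundant v (M'.ln j)
    · obtain ⟨v', i', c', hij', hv', hc', hV'⟩ := hr'
      have e' := core_of_redundant E.one hij' hv' hc' hV'
      obtain rfl := E.one _ _ _ hij' ((M'.inc_iff i j).1 hij)
      obtain rfl : τ c = c' := (e' _).1 ((hM' c j).1 ((e c).2 rfl))
      obtain ⟨u, rfl⟩ := τ.surjective v'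
      have hu : i ∈ D.prob.obsPt u := (M'.obsPt_iff u i).2 hv'
      have hV'' : ∀ w, M'.ln j ∈ E.prob.obsLn (τ w) ↔ w = u ∨ w = c := fun w => by
        rw [hV', τ.injective.eq_iff, τ.injective.eq_iff]
      have hvu : v ≠ u := by
        rintro rfl
        exact hj fun w => (hV w).trans (hV'' w).symm
      have hvc : v ≠ c := fun h => hc (h ▸ hv)
      have huc : u ≠ c := fun h => hc (h ▸ hu)
      have hU : ∀ w, w ≠ c → i ∈ D.prob.obsPt w := fun w hw => by
        rcases view_cases hvu hvc huc w with rfl | rfl | rfl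
        exacts [hv, hu, absurd rfl hw]
      refine ⟨i, v, u, c, ⟨hvu, hvc, huc⟩, ⟨Set.ext fun k => ⟨hC.pin_eq_of_two_views hc hU hij,
        fun hk => by rw [Set.mem_singleton_iff.1 hk]; exact hij⟩, Set.ext fun w => ?_, Set.ext hV⟩, hV''⟩
      show i ∈ D.prob.obsPt w ↔ w = v ∨ w = u
      rcases view_cases hvu hvc huc w with rfl | rfl | rfl
      · simp [hv]
      · simp [hu]
      · simp [hc, hvc.symm, huc.symm]
    · push Not at hr'
      refine absurd ⟨τ c, fun w => ?_⟩ (hE (M'.ln j))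
      obtain ⟨u, rfl⟩ := τ.surjective w
      rw [← core_of_not_redundant hr', ← hM', e, τ.injective.eq_iff]
  · push Not at hr
    by_cases hr' : ∃ v, E.prob.Redundant v (M'.ln j)
    · obtain ⟨v', i', c', hij', hv', hc', hV'⟩ := hr'
      have e' := core_of_redundant E.one hij' hv' hc' hV'
      obtain ⟨c, rfl⟩ := τ.surjective c'
      refine absurd ⟨c, fun w => ?_⟩ (hD j)
      rw [← core_of_not_redundant hr, hM', e', τ.injective.eq_iff]
    · push Not at hr'
      exact absurd (fun w => by
        rw [← core_of_not_redundant hr, hM', core_of_not_redundant hr']) hj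

/-! ### Terminal problems -/

/-- Under `Comb` a redundant observation occurs in three situations only: type (B) if a second view
sees the point, and otherwise (C$_1$) or (C$_2$), depending on whether `v` sees the other pin. -/
theorem IsTerminal.not_redundant {T : PL1P} (hT : T.IsTerminal) (hC : Comb T.prob) (v : Fin 3)
    (j : Fin T.l) : ¬ T.prob.Redundant v j := by
  rintro ⟨i, c, hij, hv, hc, hV⟩
  have hvc : v ≠ c := fun h => hc (h ▸ hv)
  obtain ⟨d, hd, hd'⟩ := exists_other v c hvc
  by_cases hid : i ∈ T.prob.obsPt d
  · have hU : ∀ w, w ≠ c → i ∈ T.prob.obsPt w := fun w hw => by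
      rcases view_cases hvc hd hd' w with rfl | rfl | rfl
      exacts [hv, absurd rfl hw, hid]
    refine (hT.2.2 v d c ⟨hd, hvc, hd'.symm⟩).2.2 i j ⟨Set.ext fun k =>
      ⟨hC.pin_eq_of_two_views hc hU hij, fun hk => by rw [Set.mem_singleton_iff.1 hk]; exact hij⟩,
      Set.ext fun w => ?_, Set.ext hV⟩
    show i ∈ T.prob.obsPt w ↔ w = v ∨ w = d
    rcases view_cases hvc hd hd' w with rfl | rfl | rfl
    · simp [hv]
    · simp [hc, hvc.symm, hd']
    · simp [hid]
  · have hU : ∀ w, i ∈ T.prob.obsPt w ↔ w = v := fun w => by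
      rcases view_cases hvc hd hd' w with rfl | rfl | rfl
      · simp [hv]
      · simp [hc, hvc.symm]
      · simp [hid, hd.symm]
    obtain ⟨k, hjk, hpins, hkd, hkc⟩ := hC.exists_other_pin hvc hd hd' hU hij
      ((hV c).2 (Or.inr rfl)) fun h => ((hV d).1 h).elim hd.symm hd'.symm
    have ho := hT.2.2 v c d ⟨hvc, hd, hd'⟩
    by_cases hkv : k ∈ T.prob.obsLn v
    · refine ho.2.1 i j k ⟨hjk, Set.ext hpins, Set.ext hU, Set.ext hV, Set.ext fun w => ?_⟩
      show k ∈ T.prob.obsLn w ↔ w = v ∨ w = d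
      rcases view_cases hvc hd hd' w with rfl | rfl | rfl
      · simp [hkv]
      · simp [hkc, hvc.symm, hd']
      · simp [hkd]
    · refine ho.1 i j k ⟨hjk, Set.ext hpins, Set.ext hU, Set.ext hV, Set.ext fun w => ?_⟩
      show k ∈ T.prob.obsLn w ↔ w = d
      rcases view_cases hvc hd hd' w with rfl | rfl | rfl
      · simp [hkv, hd]
      · simp [hkc, hd']
      · simp [hkd]

theorem isTerminal_of_not_redundant {T : PL1P} (h1 : T.prob.IsCameraMinimal) (h2 : T.prob.IsReduced)
    (h : ∀ v j, ¬ T.prob.Redundant v j) : T.IsTerminal := by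
  have key : ∀ {i j a c U}, j ∈ T.pins i → T.ptViews i = U → a ∈ U → c ∉ U →
      T.lnViews j ≠ {a, c} := fun {i j a c U} hij hU ha hc hV =>
    h a j ⟨i, c, hij, (Set.ext_iff.1 hU a).2 ha, fun h => hc ((Set.ext_iff.1 hU c).1 h),
      Set.ext_iff.1 hV⟩
  refine ⟨h1, h2, fun a b c ⟨hab, hac, hbc⟩ => ⟨?_, ?_, ?_⟩⟩
  · rintro i j k ⟨-, hp, hU, hV, -⟩
    exact key (by rw [hp]; exact Or.inl rfl) hU (by rfl) (fun h => hab h.symm) hV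
  · rintro i j k ⟨-, hp, hU, hV, -⟩
    exact key (by rw [hp]; exact Or.inl rfl) hU (by rfl) (fun h => hab h.symm) hV
  · rintro i j ⟨hp, hU, hV⟩
    exact key (by rw [hp]; rfl) hU (Or.inl rfl) (by simp [hac.symm, hbc.symm]) hV

theorem IsTerminal.labelEquiv_core {T : PL1P} (hT : T.IsTerminal) : LabelEquiv T.core T := by
  have e := core_eq_self (hT.not_redundant ((isReduced_iff_comb T.one).1 hT.2.1))
  exact ⟨1, ⟨Equiv.refl _, Equiv.refl _, fun _ _ => Iff.rfl, fun _ _ => Iff.rfl⟩, e⟩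

theorem IsReducedMinimal.core {D : PL1P} (hD : D.IsReducedMinimal) : D.core.IsTerminal ∧
    ∃ d, D.prob.HasCameraDegree d ∧ D.core.prob.HasCameraDegree d := by
  have hC := (isReduced_iff_comb D.one).1 hD.1
  obtain ⟨h1, h2⟩ := isCameraMinimal_of_ext (T := D.prob.core) D.one (ext_core D.one) (hC.core D.one)
    hD.2.isCameraMinimal
  exact ⟨isTerminal_of_not_redundant h1 ((isReduced_iff_comb D.core.one).2 (hC.core D.one))
    (not_redundant_core D.one), h2⟩

theorem IsTerminal.exists_liftsTo {T : PL1P} (hT : T.IsTerminal) :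
    ∃ E : PL1P, T.LiftsTo E ∧ E.IsReducedMinimal := by
  have hC := (isReduced_iff_comb T.one).1 hT.2.1
  obtain ⟨E, h1, h2, h3, E', hE', rfl, h4⟩ := T.exists_liftsTo hC
  exact ⟨_, h1, h2.isReduced hE', isMinimal_of_ext T.one h4 hC h2 h3 hT.1⟩

theorem IsReducedMinimal.swapLabel {D E : PL1P} (hD : D.IsReducedMinimal) (hE : E.IsReducedMinimal)
    (h : LabelEquiv D.core E.core) : swapLabelSetoid D E :=
  swapLabel_of_labelEquiv_core ((isReduced_iff_comb D.one).1 hD.1) (fun j => hD.2.not_single D.one j)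
    (fun j => hE.2.not_single E.one j) h

/-- The degree is unique, because two generic conditions hold at a common image. -/
theorem exists_degree_of_labelEquiv {D E : PL1P} (h : LabelEquiv D E) (hD : D.IsTerminal) {d : ℕ}
    (hd : D.prob.HasCameraDegree d) : E.prob.HasCameraDegree d := by
  obtain ⟨τ, M, hM⟩ := h
  obtain ⟨-, d', h1, h2⟩ := Relabel.isCameraMinimal D.one
    (⟨M.inc_iff, M.obsPt_iff, hM⟩ : Relabel D.prob E.prob τ M.pt M.ln)
    ((isReduced_iff_comb D.one).1 hD.2.1) hD.1
  rw [hasCameraDegree_iff D.one] at hd h1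
  obtain ⟨b, hb, hb'⟩ := (hd.and h1).exists
  obtain rfl : d = d' := by exact_mod_cast hb.symm.trans hb'
  exact h2

end PL1P

end PointLine

/-! ### The bijection of classes and the equality of camera-degrees -/

theorem corollary2 :
    ∃ F : PointLine.PL1P.ReducedMinimalClass ≃ PointLine.PL1P.TerminalClass,
      ∀ (D : {D : PointLine.PL1P // D.IsReducedMinimal})
        (T : {T : PointLine.PL1P // T.IsTerminal}),
        (F (Quotient.mk _ D) = Quotient.mk _ T ↔
          ∃ E : PointLine.PL1P, T.1.LiftsTo E ∧ PointLine.PL1P.swapLabelSetoid E D.1) ∧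
        (F (Quotient.mk _ D) = Quotient.mk _ T →
          ∃ d : ℕ, D.1.prob.HasCameraDegree d ∧ T.1.prob.HasCameraDegree d) := by
  -- The map induced by the core. It is injective because equal cores leave only swaps, and
  -- surjective because a lift of a terminal problem has this problem as its core, up to relabeling.
  let f : PointLine.PL1P.ReducedMinimalClass → PointLine.PL1P.TerminalClass :=
    Quotient.map (fun D => ⟨D.1.core, D.2.core.1⟩) fun D E h => PointLine.PL1P.labelEquiv_core_of_swapLabel h
  have hf : ∀ (D : {D : PointLine.PL1P // D.IsReducedMinimal})
      (T : {T : PointLine.PL1P // T.IsTerminal}),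
      f (Quotient.mk _ D) = Quotient.mk _ T ↔ PointLine.PL1P.LabelEquiv D.1.core T.1 := fun D T => Quotient.eq
  have hbij : Function.Bijective f := by
    constructor
    · intro x y
      induction x using Quotient.inductionOn with | _ D
      induction y using Quotient.inductionOn with | _ E
      intro h
      exact Quotient.sound (D.2.swapLabel E.2 (Quotient.exact h))
    · intro y
      induction y using Quotient.inductionOn with | _ T
      obtain ⟨E, hE, hE'⟩ := T.2.exists_liftsTo
      exact ⟨Quotient.mk _ ⟨E, hE'⟩, (hf _ _).2 (hE.labelEquiv_core.symm.trans T.2.labelEquiv_core)⟩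
  refine ⟨Equiv.ofBijective f hbij, fun D T => ⟨(hf D T).trans ⟨fun h => ?_, ?_⟩, fun h => ?_⟩⟩
  · obtain ⟨E, hE, hE'⟩ := T.2.exists_liftsTo
    exact ⟨E, hE, hE'.swapLabel D.2
      (hE.labelEquiv_core.symm.trans (T.2.labelEquiv_core.trans h.symm))⟩
  · rintro ⟨E, hE, hED⟩
    exact (PointLine.PL1P.labelEquiv_core_of_swapLabel hED).symm.trans
      (hE.labelEquiv_core.symm.trans T.2.labelEquiv_core)
  · obtain ⟨hT, d, h1, h2⟩ := D.2.core
    exact ⟨d, h1, PointLine.PL1P.exists_degree_of_labelEquiv ((hf D T).1 h) hT h2⟩
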